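/- Conventions. $dd^c=\frac{i}{2\pi}\partial\bar\partial$. A $\mathbb{Q}$-Fano variety is a proper normal complex variety $X$ with log terminal singularities such that $-K_X$ is an ample $\mathbb{Q}$-line bundle. Let $X$ be a $\mathbb{Q}$-Fano variety of dimension $n$. A special degeneration $\mathcal{X}$ of $X$ is a flat proper family $\pi:\mathcal{X}\to\mathbb{C}$ of $\mathbb{Q}$-Fano varieties with normal total space and relatively ample $\mathbb{Q}$-line bundle $-K_{\mathcal X}$, whose fibre over some (hence every) $t\neq 0$ is isomorphic to $X$, together with an algebraic $\mathbb{C}^*$-action on $\mathcal{X}$ covering the standard action on $\mathbb{C}$ and the holomorphic vector field $v=\lambda\xi$, where $\xi$ generates the action and $\lambda\in\mathbb{R}\setminus\{0\}$. It is trivial if $\mathcal{X}\cong X\times\mathbb{C}$ over $\mathbb{C}$ in such a way that $v$ is trivial on the factor $X$ (i.e. $\mathbb{C}^*$ acts only on the factor $\mathbb{C}$). Let $\mathcal{X}_0$ be the central fibre. Choose a smooth positive metric $p$ on $-K_{\mathcal{X}_0}$ (locally of the form $e^{-F}|\eta|^{2/m}$, with $\eta$ a local generator of $mK_{\mathcal{X}_0}$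 and $F$ the restriction of a smooth strictly plurisubharmonic function under a local embedding into $\mathbb{C}^N$), with curvature $\omega_0=-dd^c\log p\in c_1(\mathcal{X}_0)$ on the regular part. Put $V=\int_{\mathcal{X}_0}\omega_0^n$, let $h_0=\log(p/\omega_0^n)+C$ be the Ricci potential, normalised by $\int_{\mathcal{X}_0}e^{h_0}\omega_0^n=V$ (so $\mathrm{Ric}\,\omega_0-\omega_0=dd^ch_0$), and let $\theta_0$ be a Hamiltonian of the vector field induced by $v$ on $\mathcal{X}_0$: a continuous real function on $\mathcal{X}_0$, smooth on the regular part, with $\iota_v\omega_0=\frac{i}{2\pi}\bar\partial\theta_0$ there. All integrals are over the regular part. Define $$\mathrm{DF}(\mathcal{X})=\int_{\mathcal{X}_0}\theta_0e^{h_0}\omega_0^n-\int_{\mathcal{X}_0}\theta_0\,\omega_0^n,\qquad H(\mathcal{X})=\int_{\mathcal{X}_0}\theta_0e^{h_0}\omega_0^n-V\log\Big(\frac1V\int_{\mathcal{X}_0}e^{\theta_0}\omega_0^n\Big).$$ Lemma. For every special degeneration $\mathcal{X}$ of $X$ and every such choice of $p$ (hence $\omega_0$, $h_0$) and $\theta_0$,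 one has $0<V<\infty$, the integrals converge, and $$\mathrm{DF}(\mathcal{X})\ge H(\mathcal{X}),$$ with equality if and only if $\mathcal{X}$ is trivial. -/

import Mathlib

open CategoryTheory CategoryTheory.Limits AlgebraicGeometry MeasureTheory
open scoped Topology ContDiff ComplexOrder

noncomputable section

namespace HStability

/-! ## Schemes over the complex numbers -/

/-- `Spec ℂ`. -/
abbrev SpecC : Scheme.{0} := Spec (CommRingCat.of ℂ)

/-- Schemes over `ℂ`. -/
abbrev CScheme : Type 1 := Over SpecC

/-- The affine line `Spec ℂ[t]`. -/
abbrev A1 : Scheme.{0} := Spec (CommRingCat.of (Polynomial ℂ))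

/-- The structure morphism of the affine line. -/
def A1hom : A1 ⟶ SpecC := Spec.map (CommRingCat.ofHom Polynomial.C)

/-- The closed point `a` of the affine line. -/
def A1pt (a : ℂ) : SpecC ⟶ A1 := Spec.map (CommRingCat.ofHom (Polynomial.evalRingHom a))

/-- The constant functions on an open set `U` of a scheme over `ℂ`. -/
def const (X : CScheme) (U : X.left.Opens) : ℂ →+* Γ(X.left, U) :=
  ((Scheme.ΓSpecIso (CommRingCat.of ℂ)).inv ≫ X.hom.appTop ≫
    X.left.presheaf.map (homOfLE le_top).op).hom

/-! ## Complex points and the analytic topology -/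

/-- The set `X(ℂ)` of complex points of a scheme over `ℂ`. -/
@[ext]
structure CPoints (X : CScheme) : Type where
  hom : SpecC ⟶ X.left
  comp_hom : hom ≫ X.hom = 𝟙 SpecC

/-- The point of the underlying topological space of the scheme carrying a complex point. -/
abbrev CPoints.pt {X : CScheme} (p : CPoints X) : X.left :=
  p.hom (IsLocalRing.closedPoint (CommRingCat.of ℂ))

/-- A complex point as a morphism of schemes over `ℂ`. -/
def CPoints.toOver {X : CScheme} (p : CPoints X) : Over.mk (𝟙 SpecC) ⟶ X :=
  Over.homMk p.hom p.comp_hom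

/-- The complex point given by a morphism of schemes over `ℂ`. -/
def CPoints.ofOver {X : CScheme} (u : Over.mk (𝟙 SpecC) ⟶ X) : CPoints X := ⟨u.left, Over.w u⟩

/-- The image of a complex point under a morphism. -/
def CPoints.map {X Y : CScheme} (f : X ⟶ Y) (p : CPoints X) : CPoints Y :=
  CPoints.ofOver (p.toOver ≫ f)

/-- The value of a germ of a regular function at a complex point. -/
def CPoints.evalGerm {X : CScheme} (p : CPoints X) : X.left.presheaf.stalk p.pt →+* ℂ :=
  (Scheme.stalkClosedPointTo (R := CommRingCat.of ℂ) p.hom).hom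

open Classical in
/-- The function `X(ℂ) → ℂ` defined by a regular function on `U` (with the value `0`
outside `U(ℂ)`). -/
def evalAt {X : CScheme} (U : X.left.Opens) (f : Γ(X.left, U)) (p : CPoints X) : ℂ :=
  if h : p.pt ∈ U then p.evalGerm (X.left.presheaf.germ U p.pt h f) else 0

/-- The analytic (classical) topology on `X(ℂ)`: the coarsest one for which Zariski open sets are
open and regular functions on them are continuous. -/
instance (X : CScheme) : TopologicalSpace (CPoints X) :=
  TopologicalSpace.generateFrom
    {S | ∃ (U : X.left.Opens) (f : Γ(X.left, U)) (V : Set ℂ), IsOpen V ∧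
      S = {p | p.pt ∈ U ∧ evalAt U f p ∈ V}}

instance (X : CScheme) : MeasurableSpace (CPoints X) := borel _

instance (X : CScheme) : BorelSpace (CPoints X) := ⟨rfl⟩

/-! ## Pluricanonical forms, `ℚ`-Fano varieties -/

/-- The function field of an integral scheme over `ℂ`. -/
def FunField (X : CScheme) [IsIntegral X.left] : Type := X.left.functionField

instance (X : CScheme) [IsIntegral X.left] : Field (FunField X) :=
  inferInstanceAs (Field X.left.functionField)

/-- The local ring at `x`, mapped to the function field. -/
def stalkToK (X : CScheme) [IsIntegral X.left] (x : X.left) :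
    X.left.presheaf.stalk x →+* FunField X :=
  algebraMap (X.left.presheaf.stalk x) X.left.functionField

instance (X : CScheme) [IsIntegral X.left] : Algebra ℂ (FunField X) :=
  ((stalkToK X (genericPoint X.left)).comp
    ((X.left.presheaf.germ ⊤ (genericPoint X.left) trivial).hom.comp (const X ⊤))).toAlgebra

/-- The local ring at `x` as a subring of the function field. -/
def localRing (X : CScheme) [IsIntegral X.left] (x : X.left) : Subring (FunField X) :=
  (stalkToK X x).range

/-- `⋀ⁿ Ω_{K/ℂ}`, the rational `n`-forms. -/
abbrev RatForm (K : Type) [Field K] [Algebra ℂ K] (n : ℕ) : Type :=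
  ⋀[K]^n (KaehlerDifferential ℂ K)

/-- `(⋀ⁿ Ω_{K/ℂ})^{⊗ m}`, the rational `m`-canonical forms. -/
abbrev PluriForm (K : Type) [Field K] [Algebra ℂ K] (n m : ℕ) : Type :=
  PiTensorProduct K (fun _ : Fin m => RatForm K n)

/-- The `n`-form `df₁ ∧ ⋯ ∧ dfₙ`. -/
def dWedge {K : Type} [Field K] [Algebra ℂ K] {n : ℕ} (f : Fin n → K) : RatForm K n :=
  exteriorPower.ιMulti K n (fun j => KaehlerDifferential.D ℂ K (f j))

/-- For a subring `A` of `K`, the `A`-module of `m`-canonical forms that are regular over `A`, i.e.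
the image of `(⋀ⁿ Ω_{A/ℂ})^{⊗ m}`. -/
def regularForms {K : Type} [Field K] [Algebra ℂ K] (A : Subring K) (n m : ℕ) :
    Submodule A (PluriForm K n m) :=
  Submodule.span A {η | ∃ a : Fin m → Fin n → K, (∀ i j, a i j ∈ A) ∧
    η = PiTensorProduct.tprod K (fun i => dWedge (a i))}

/-- `y` is a point of codimension one of a normal variety (the generic point of a prime divisor). -/
def IsDivisorPoint (X : CScheme) [IsIntegral X.left] (y : X.left) : Prop :=
  IsDiscreteValuationRing (localRing X y)

/-- The nonzero rational `m`-canonical form `η` generates `𝒪(m K_X)` at `x`: it has neither zeros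
nor poles along the prime divisors through `x`. -/
def Generates {X : CScheme} [IsIntegral X.left] {n m : ℕ} (η : PluriForm (FunField X) n m)
    (x : X.left) : Prop :=
  η ≠ 0 ∧ ∀ y : X.left, y ⤳ x → IsDivisorPoint X y →
    Submodule.span (localRing X y) {η} = regularForms (localRing X y) n m

/-- The nonzero rational `m`-canonical form `η` has no zeros on `X`, i.e. `η⁻¹` is a global
section of `𝒪(-m K_X)`. -/
def NoZeros {X : CScheme} [IsIntegral X.left] {n m : ℕ} (η : PluriForm (FunField X) n m) : Prop :=
  η ≠ 0 ∧ ∀ y : X.left, IsDivisorPoint X y →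
    regularForms (localRing X y) n m ≤ Submodule.span (localRing X y) {η}

/-- `-K_X` is an ample `ℚ`-line bundle: around every point there is, for some `m ≥ 1`, a section
`s = η⁻¹` of `-m K_X` whose non-vanishing locus `X_s` contains the point, is affine, and is such
that `s` generates `-m K_X` on it. -/
def AnticanonicallyAmple (X : CScheme) [IsIntegral X.left] (n : ℕ) : Prop :=
  ∀ x : X.left, ∃ (m : ℕ) (η : PluriForm (FunField X) n m) (U : X.left.Opens),
    0 < m ∧ NoZeros η ∧ x ∈ U ∧ IsAffineOpen U ∧ ∀ z : X.left, z ∈ U ↔ Generates η z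

/-- A discrete valuation ring of an `n`-dimensional function field `K` (with `ℂ ⊆ R`) is divisorial:
its residue field has transcendence degree `n - 1` over `ℂ`. -/
def IsDivisorial {K : Type} [Field K] [Algebra ℂ K] (n : ℕ) (R : ValuationSubring K) : Prop :=
  IsDiscreteValuationRing R ∧ ∃ (k : ℕ) (y : Fin k → K), k + 1 = n ∧ (∀ i, y i ∈ R) ∧
    ∀ P : MvPolynomial (Fin k) ℂ, P ≠ 0 →
      MvPolynomial.aeval y P ≠ 0 ∧ (MvPolynomial.aeval y P)⁻¹ ∈ R

/-- Log terminal singularities: for each divisorial valuation `ord_R` over `X` with centre through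
`x`, and each local generator `η` of `m K_X` at `x`, the discrepancy `ord_R(η) / m` is `> -1`. -/
def LogTerminal (X : CScheme) [IsIntegral X.left] (n : ℕ) : Prop :=
  ∀ (x : X.left) (m : ℕ) (η : PluriForm (FunField X) n m), 0 < m → Generates η x →
    ∀ R : ValuationSubring (FunField X), IsDivisorial n R → localRing X x ≤ R.toSubring →
      ∀ a : R.toSubring, ¬ IsUnit a →
        a ^ m • η ∈ Ideal.span {b : R.toSubring | ¬ IsUnit b} • regularForms R.toSubring n m

/-- All local rings are integrally closed. -/
def IsNormal (X : CScheme) : Prop :=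
  ∀ x : X.left, IsIntegrallyClosed (X.left.presheaf.stalk x)

/-- `X` is a `ℚ`-Fano variety of dimension `n`. -/
structure IsQFano (X : CScheme) (n : ℕ) : Prop where
  integral : IsIntegral X.left
  proper : IsProper X.hom
  normal : IsNormal X
  dim : Algebra.trdeg ℂ (FunField X) = n
  ample : AnticanonicallyAmple X n
  logTerminal : LogTerminal X n

/-! ## Special degenerations -/

/-- An algebraic action of the multiplicative group on `X`, in terms of the functor of points:
the groups `𝔾ₘ(T) = Γ(T, 𝒪_T)ˣ` act on the sets `X(T)`, naturally in the `ℂ`-scheme `T`. -/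
structure GmAction (X : CScheme) where
  act : ∀ {T : CScheme}, (Γ(T.left, ⊤))ˣ → (T ⟶ X) → (T ⟶ X)
  one_act : ∀ {T : CScheme} (x : T ⟶ X), act 1 x = x
  mul_act : ∀ {T : CScheme} (a b : (Γ(T.left, ⊤))ˣ) (x : T ⟶ X), act (a * b) x = act a (act b x)
  natural : ∀ {S T : CScheme} (u : S ⟶ T) (a : (Γ(T.left, ⊤))ˣ) (x : T ⟶ X),
    u ≫ act a x = act (Units.map (u.left.appTop).hom.toMonoidHom a) (u ≫ x)

/-- The total space of a family over the affine line, as a scheme over `ℂ`. -/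
abbrev totalSpace {S : Scheme.{0}} (π : S ⟶ A1) : CScheme := Over.mk (π ≫ A1hom)

/-- The scheme-theoretic fibre of a family over the point `a` of the affine line. -/
abbrev fibre {S : Scheme.{0}} (π : S ⟶ A1) (a : ℂ) : CScheme := Over.mk (pullback.snd π (A1pt a))

/-- The coordinate `t ∘ u` of a morphism `u` to the affine line. -/
def coord {T : Scheme.{0}} (u : T ⟶ A1) : Γ(T, ⊤) :=
  u.appTop ((Scheme.ΓSpecIso (CommRingCat.of (Polynomial ℂ))).inv Polynomial.X)

/-- A special degeneration of the `n`-dimensional `ℚ`-Fano variety `X`. The vector field is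
`v = scale · ξ`, where `ξ` is the generator of the `ℂ*`-action. -/
structure SpecialDegeneration (X : CScheme) (n : ℕ) where
  total : Scheme.{0}
  π : total ⟶ A1
  flat : Flat π
  proper : IsProper π
  integral : IsIntegral (totalSpace π).left
  normal : IsNormal (totalSpace π)
  ample : AnticanonicallyAmple (totalSpace π) (n + 1)
  fano : ∀ a : ℂ, IsQFano (fibre π a) n
  fibre_iso : ∃ a : ℂ, a ≠ 0 ∧ Nonempty (fibre π a ≅ X)
  action : GmAction (totalSpace π)
  covers : ∀ {T : CScheme} (a : (Γ(T.left, ⊤))ˣ) (x : T ⟶ totalSpace π),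
    coord ((action.act a x).left ≫ π) = a * coord (x.left ≫ π)
  scale : ℝ
  scale_ne : scale ≠ 0

namespace SpecialDegeneration

variable {X : CScheme} {n : ℕ} (D : SpecialDegeneration X n)

/-- The total space, as a scheme over `ℂ`. -/
abbrev totalC : CScheme := totalSpace D.π

/-- The central fibre. -/
abbrev central : CScheme := fibre D.π 0

instance : IsIntegral D.central.left := (D.fano 0).integral

/-- The inclusion of the central fibre. -/
def inclusion : D.central ⟶ D.totalC :=
  Over.homMk (pullback.fst D.π (A1pt 0)) (by
    have h : A1pt 0 ≫ A1hom = 𝟙 SpecC := by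
      rw [A1pt, A1hom, ← Spec.map_comp, ← CommRingCat.ofHom_comp]
      have : (Polynomial.evalRingHom (0 : ℂ)).comp Polynomial.C = RingHom.id ℂ := by
        ext
        simp
      rw [this]; exact Spec.map_id _
    change pullback.fst D.π (A1pt 0) ≫ D.π ≫ A1hom = pullback.snd D.π (A1pt 0)
    rw [← Category.assoc, pullback.condition, Category.assoc, h, Category.comp_id])

/-- `𝒳 ≅ X × ℂ` over `ℂ`, such that the vector field is trivial on the factor `X`: there is a
`ℂ*`-invariant morphism `q` to `X` that exhibits `𝒳` as the product of `X` and the line. -/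
def IsTrivial : Prop :=
  ∃ q : D.totalC ⟶ X,
    (∀ {T : CScheme} (a : (Γ(T.left, ⊤))ˣ) (x : T ⟶ D.totalC), D.action.act a x ≫ q = x ≫ q) ∧
    IsPullback q.left D.π X.hom A1hom

/-- The element `e^s` of `ℂ* = 𝔾ₘ(ℂ)`. -/
def expUnit (s : ℂ) : (Γ(SpecC, ⊤))ˣ :=
  Units.map (Scheme.ΓSpecIso (CommRingCat.of ℂ)).inv.hom.toMonoidHom
    (Units.mk0 (Complex.exp s) (Complex.exp_ne_zero s))

/-- The flow `s ↦ e^s · p` on the complex points of the total space. -/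
def flow (s : ℂ) (p : CPoints D.totalC) : CPoints D.totalC :=
  CPoints.ofOver (D.action.act (T := Over.mk (𝟙 SpecC)) (expUnit s) p.toOver)

/-- The derivative `(v f)(p)` of a regular function `f` along the holomorphic vector field `v`. -/
def vectorField (U : D.totalC.left.Opens) (f : Γ(D.totalC.left, U)) (p : CPoints D.totalC) : ℂ :=
  D.scale * deriv (fun s : ℂ => evalAt U f (D.flow s p)) 0

end SpecialDegeneration

/-! ## Holomorphic charts and Kähler metrics -/

/-- A holomorphic chart of the `n`-dimensional variety `X`: a homeomorphism from an open subset of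
`X(ℂ)` onto an open subset of `ℂⁿ` whose inverse is holomorphic and immersive. The regular part of
`X` is the union of the domains of the charts. -/
structure HolChart (X : CScheme) (n : ℕ) where
  toHomeo : OpenPartialHomeomorph (CPoints X) (Fin n → ℂ)
  holomorphic : ∀ (U : X.left.Opens) (f : Γ(X.left, U)),
    DifferentiableOn ℂ (fun w => evalAt U f (toHomeo.symm w))
      {w ∈ toHomeo.target | (toHomeo.symm w).pt ∈ U}
  immersion : ∀ w ∈ toHomeo.target, ∀ u : Fin n → ℂ, u ≠ 0 →
    ∃ (U : X.left.Opens) (f : Γ(X.left, U)), (toHomeo.symm w).pt ∈ U ∧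
      fderiv ℂ (fun w' => evalAt U f (toHomeo.symm w')) w u ≠ 0

/-- `∂F/∂z_j`. -/
def dz {N : ℕ} (j : Fin N) (F : (Fin N → ℂ) → ℂ) (w : Fin N → ℂ) : ℂ :=
  (fderiv ℝ F w (Pi.single j 1) - Complex.I * fderiv ℝ F w (Pi.single j Complex.I)) / 2

/-- `∂F/∂z̄_k`. -/
def dzbar {N : ℕ} (k : Fin N) (F : (Fin N → ℂ) → ℂ) (w : Fin N → ℂ) : ℂ :=
  (fderiv ℝ F w (Pi.single k 1) + Complex.I * fderiv ℝ F w (Pi.single k Complex.I)) / 2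

/-- The complex Hessian `(∂²F/∂z_j∂z̄_k)` of a real function. -/
def complexHessian {N : ℕ} (F : (Fin N → ℂ) → ℝ) (w : Fin N → ℂ) : Matrix (Fin N) (Fin N) ℂ :=
  Matrix.of fun j k => dz j (fun w' => dzbar k (fun w'' => (F w'' : ℂ)) w') w

/-- `b = |η|^{2/m}` at the point `w` of the chart `χ`: near that point
`η = g (df₁ ∧ ⋯ ∧ dfₙ)^{⊗ m}` with `g`, `fᵢ` regular, and
`b = |g|^{2/m} |det (∂fᵢ/∂w_j)|²`. -/
def HasDensityAt {X : CScheme} [IsIntegral X.left] {n m : ℕ} (η : PluriForm (FunField X) n m)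
    (χ : HolChart X n) (w : Fin n → ℂ) (b : ℝ) : Prop :=
  ∃ (U : X.left.Opens) (hU : (χ.toHomeo.symm w).pt ∈ U) (g : Γ(X.left, U))
    (f : Fin n → Γ(X.left, U)),
    η = stalkToK X _ (X.left.presheaf.germ U _ hU g) •
      PiTensorProduct.tprod (FunField X)
        (fun _ : Fin m => dWedge fun i => stalkToK X _ (X.left.presheaf.germ U _ hU (f i))) ∧
    b = ‖evalAt U g (χ.toHomeo.symm w)‖ ^ (2 / (m : ℝ)) *
      ‖(Matrix.of fun i j : Fin n =>
        fderiv ℂ (fun w' => evalAt U (f i) (χ.toHomeo.symm w')) w (Pi.single j 1)).det‖ ^ 2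

/-- A smooth positive metric `p` on `-K_X`, given by its densities `dens χ` as a volume form in the
holomorphic charts `χ` of the regular part: around each point of `X(ℂ)`, singular or not, there are
a generator `η` of `m K_X` for some `m ≥ 1`, a closed embedding `f` of an affine open neighbourhood
into `ℂᴺ`, and a smooth strictly plurisubharmonic function `F` on an open subset of `ℂᴺ`, such
that `p = e^{- F ∘ f} |η|^{2/m}`. -/
structure PositiveMetric (X : CScheme) [IsIntegral X.left] (n : ℕ) where
  dens : HolChart X n → (Fin n → ℂ) → ℝ
  locally_smooth : ∀ x : CPoints X,
    ∃ (m : ℕ) (η : PluriForm (FunField X) n m) (U : X.left.Opens) (N : ℕ)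
      (f : Fin N → Γ(X.left, U)) (V : Set (Fin N → ℂ)) (F : (Fin N → ℂ) → ℝ)
      (W : Set (CPoints X)),
      0 < m ∧ Generates η x.pt ∧ IsAffineOpen U ∧
      Function.Surjective (MvPolynomial.eval₂Hom (const X U) f) ∧
      IsOpen V ∧ ContDiffOn ℝ ∞ F V ∧ (∀ z ∈ V, (complexHessian F z).PosDef) ∧
      IsOpen W ∧ x ∈ W ∧ (∀ y ∈ W, y.pt ∈ U ∧ (fun i => evalAt U (f i) y) ∈ V) ∧
      ∀ (χ : HolChart X n), ∀ w ∈ χ.toHomeo.target, χ.toHomeo.symm w ∈ W →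
        ∃ b : ℝ, HasDensityAt η χ w b ∧
          dens χ w = Real.exp (- F (fun i => evalAt U (f i) (χ.toHomeo.symm w))) * b

namespace PositiveMetric

variable {X : CScheme} [IsIntegral X.left] {n : ℕ} (p : PositiveMetric X n)

/-- The curvature `ω = -dd^c log p = (i/2π) ∑ ω_{jk} dw_j ∧ dw̄_k` of `p`, in a chart. -/
def curvature (χ : HolChart X n) (w : Fin n → ℂ) : Matrix (Fin n) (Fin n) ℂ :=
  complexHessian (fun w' => - Real.log (p.dens χ w')) w

/-- The density of `ωⁿ` with respect to Lebesgue measure, in a chart: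
`((i/2π) ∑ ω_{jk} dw_j ∧ dw̄_k)ⁿ = n! π⁻ⁿ det(ω_{jk}) dλ`. -/
def volumeDensity (χ : HolChart X n) (w : Fin n → ℂ) : ℝ :=
  n.factorial / Real.pi ^ n * (p.curvature χ w).det.re

/-- The measure `ωⁿ` on the regular part, extended by zero to `X(ℂ)`. The measures given in the
single charts are the restrictions of one and the same measure to the domains of the charts, so
`ωⁿ` is their supremum. -/
def volume : Measure (CPoints X) :=
  ⨆ χ : HolChart X n,
    (((MeasureTheory.volume : Measure (Fin n → ℂ)).restrict χ.toHomeo.target).withDensity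
      fun w => ENNReal.ofReal (p.volumeDensity χ w)).map χ.toHomeo.symm

/-- The total volume `V = ∫ ωⁿ = ∫ c₁(X)ⁿ`. -/
def V : ℝ := ∫ _ : CPoints X, (1 : ℝ) ∂p.volume

/-- `h` is the Ricci potential of `ω`: `e^h ωⁿ` is a multiple of the volume form `p` (so that
`Ric ω - ω = dd^c h`), and `∫ e^h ωⁿ = V`. -/
def IsRicciPotential (h : CPoints X → ℝ) : Prop :=
  (∃ C : ℝ, ∀ (χ : HolChart X n), ∀ w ∈ χ.toHomeo.target,
    h (χ.toHomeo.symm w) = Real.log (p.dens χ w / p.volumeDensity χ w) + C) ∧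
  ∫ x, Real.exp (h x) ∂p.volume = p.V

end PositiveMetric

namespace SpecialDegeneration

variable {X : CScheme} {n : ℕ} (D : SpecialDegeneration X n)

/-- `ξ` is the vector field induced by `v` on the central fibre, at the point `w` of the chart `χ`
of the central fibre. -/
def IsInducedVector (χ : HolChart D.central n) (w ξ : Fin n → ℂ) : Prop :=
  ∀ (U : D.totalC.left.Opens) (f : Γ(D.totalC.left, U)),
    ((χ.toHomeo.symm w).map D.inclusion).pt ∈ U →
      D.vectorField U f ((χ.toHomeo.symm w).map D.inclusion) =
        fderiv ℂ (fun w' => evalAt U f ((χ.toHomeo.symm w').map D.inclusion)) w ξ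

/-- The real function `θ` on the central fibre is a Hamiltonian of the induced vector field with
respect to the curvature `ω` of `p`: it is continuous, smooth on the regular part, and
`ι_v ω = (i/2π) ∂̄θ` there. -/
structure IsHamiltonian (p : PositiveMetric D.central n) (θ : CPoints D.central → ℝ) : Prop where
  continuous : Continuous θ
  smooth : ∀ χ : HolChart D.central n,
    ContDiffOn ℝ ∞ (fun w => θ (χ.toHomeo.symm w)) χ.toHomeo.target
  eqn : ∀ χ : HolChart D.central n, ∀ w ∈ χ.toHomeo.target, ∃ ξ : Fin n → ℂ,
    D.IsInducedVector χ w ξ ∧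
      ∀ k, dzbar k (fun w' => (θ (χ.toHomeo.symm w') : ℂ)) w = ∑ j, ξ j * p.curvature χ w j k

/-- The choices made in the definitions of the invariants: a smooth positive metric on the
anticanonical bundle of the central fibre, with curvature `ω₀`, the Ricci potential `h₀` of `ω₀`,
and a Hamiltonian `θ₀`. -/
structure Choice where
  p : PositiveMetric D.central n
  h : CPoints D.central → ℝ
  ricci : p.IsRicciPotential h
  θ : CPoints D.central → ℝ
  hamiltonian : D.IsHamiltonian p θ

variable {D}

/-- The Donaldson-Futaki invariant. -/
def Choice.DF (c : D.Choice) : ℝ :=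
  (∫ x, c.θ x * Real.exp (c.h x) ∂c.p.volume) - ∫ x, c.θ x ∂c.p.volume

/-- The H-invariant. -/
def Choice.H (c : D.Choice) : ℝ :=
  (∫ x, c.θ x * Real.exp (c.h x) ∂c.p.volume) -
    c.p.V * Real.log (1 / c.p.V * ∫ x, Real.exp (c.θ x) ∂c.p.volume)

end SpecialDegeneration

end HStability

end

/-! The term containing the Ricci potential cancels in DF - H, and what remains is V log((1/V) ∫ e^θ
ωⁿ) - ∫ θ ωⁿ. So the inequality is Jensen's inequality for the exponential and the finite measure
ωⁿ, and equality holds exactly if θ is constant on the regular part (`integral_le_log_integral_exp`,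
`ae_eq_const_iff`). Two things need work: that ωⁿ is finite and nonzero, and that θ is constant
exactly if the degeneration is trivial.

Finiteness. The complex points of a proper scheme are compact (`compactSpace_of_isProper`), so a
local bound is enough, at singular points too. There ω is the restriction of a form with bounded
coefficients on an open set of ℂᴺ, and by Cauchy–Binet ωⁿ is at most a multiple of the sum of the
pull-backs of Lebesgue measure under all n-tuples of coordinates. Such a projection, unless
degenerate, has fibres of bounded cardinality over almost every point, hence the pull-back has
finite mass (`exists_measure_bound`, `isFiniteMeasure_volume`). On the regular part ω is positive
definite (`curvature_posDef`); normality enters because a generator of m K must not vanish at a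
regular point (`beta_ne_zero`). Regular points exist because X is generically étale over affine
space (`EtaleModel.exists_chart`).

Trivial degenerations have constant θ. The flow fixes the central fibre, so v = 0 there, so dθ = 0
and θ is locally constant on the regular part. The connectedness of the regular part is proved
algebraically: over an affine piece finite over ℂⁿ, the power sums of the roots weighted by a
bounded locally constant function are polynomials after multiplication by ε, and they assemble to a
regular function with the same zeros on the étale locus (`EtaleModel.exists_section`). It vanishes
on an open set, hence everywhere (`exists_eq_const_of_locally_const`).

Constant θ forces triviality. Nondegeneracy of ω gives v = 0 on the regular part, so the
multiplicative group fixes the central fibre as a scheme (`SpecialDegeneration.smul_eq_self`). The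
coordinate t has weight one and the coaction is trivial modulo t, so no negative weights occur
modulo any power of t (`coeff_eq_zero_of_coaction`). With Krull's intersection theorem this shows
that the limits of a·x for a → 0 exist near the central fibre (`ActsTrivially.exists_isLimit`), and
translation by the group carries them to the whole family. The limits glue to an invariant
retraction q onto the central fibre. The morphism (q, π) to the product of the central fibre and the
line is proper and injective over 0, hence finite there; it is an isomorphism modulo t, and flatness
and Nakayama's lemma make it an isomorphism near the fibre over 0. Dilations of the line carry this
everywhere (`IsLimitMap.isIso_toProd`). Finally a fibre over a nonzero point identifies the central
fibre with X. -/

noncomputable section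

namespace HStability

/-! ## Evaluation of regular functions -/

section Eval

variable {X : CScheme}

/-- Evaluation at a complex point of `U`, as a ring homomorphism. -/
def evalHom (p : CPoints X) (U : X.left.Opens) (h : p.pt ∈ U) : Γ(X.left, U) →+* ℂ :=
  p.evalGerm.comp (X.left.presheaf.germ U p.pt h).hom

lemma evalAt_of_mem {U : X.left.Opens} {p : CPoints X} (h : p.pt ∈ U) (f : Γ(X.left, U)) :
    evalAt U f p = evalHom p U h f := by
  simp only [evalAt, h, dif_pos]; rfl

lemma evalAt_of_notMem {U : X.left.Opens} {p : CPoints X} (h : p.pt ∉ U) (f : Γ(X.left, U)) :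
    evalAt U f p = 0 := by
  simp only [evalAt, h, dif_neg, not_false_eq_true]

lemma evalAt_res {U V : X.left.Opens} (i : V ≤ U) (f : Γ(X.left, U)) {p : CPoints X}
    (h : p.pt ∈ V) :
    evalAt V (X.left.presheaf.map (homOfLE i).op f) p = evalAt U f p := by
  rw [evalAt_of_mem h, evalAt_of_mem (i h)]
  simp only [evalHom, RingHom.comp_apply]
  congr 1
  exact TopCat.Presheaf.germ_res_apply _ (homOfLE i) _ h f

lemma evalAt_ne_zero_iff {U : X.left.Opens} {p : CPoints X} (h : p.pt ∈ U) (f : Γ(X.left, U)) :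
    evalAt U f p ≠ 0 ↔ p.pt ∈ X.left.basicOpen f := by
  rw [evalAt_of_mem h, Scheme.mem_basicOpen _ _ _ h]
  simp only [evalHom, RingHom.comp_apply]
  rw [← isUnit_iff_ne_zero]
  constructor
  · intro hu
    have : IsLocalHom p.evalGerm := Scheme.isLocalHom_stalkClosedPointTo' (R := ℂ) p.hom
    exact isUnit_of_map_unit p.evalGerm _ hu
  · intro hu
    exact hu.map p.evalGerm

lemma evalHom_eq_appLE (p : CPoints X) {U : X.left.Opens} (h : p.pt ∈ U)
    (h' : (⊤ : SpecC.Opens) ≤ p.hom ⁻¹ᵁ U) (f : Γ(X.left, U)) :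
    evalHom p U h f = (Scheme.ΓSpecIso (CommRingCat.of ℂ)).hom (p.hom.appLE U ⊤ h' f) := by
  have := Scheme.germ_stalkClosedPointTo (R := CommRingCat.of ℂ) p.hom U h
  have := congr($(this).hom f)
  simp only [evalHom, RingHom.comp_apply, CPoints.evalGerm]
  refine this.trans ?_
  simp [Scheme.Hom.appLE]
  rfl

lemma le_preimage_of_pt_mem {p : CPoints X} {U : X.left.Opens} (h : p.pt ∈ U) :
    (⊤ : SpecC.Opens) ≤ p.hom ⁻¹ᵁ U :=
  (Scheme.preimage_eq_top_of_closedPoint_mem (R := CommRingCat.of ℂ) p.hom h).ge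

lemma fromSpec_comp_hom {U : X.left.Opens} (hU : IsAffineOpen U) :
    hU.fromSpec ≫ X.hom = Spec.map (CommRingCat.ofHom (const X U)) := by
  have h1 : CommRingCat.ofHom (const X U) = (Scheme.ΓSpecIso (CommRingCat.of ℂ)).inv ≫
      X.hom.appLE ⊤ U le_top := by
    ext; rfl
  rw [h1, Spec.map_comp]
  have := IsAffineOpen.SpecMap_appLE_fromSpec X.hom (isAffineOpen_top SpecC) hU le_top
  rw [← this, IsAffineOpen.fromSpec_top]
  rw [Scheme.isoSpec_Spec_inv]

lemma evalHom_const (p : CPoints X) {U : X.left.Opens} (h : p.pt ∈ U) (c : ℂ) :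
    evalHom p U h (const X U c) = c := by
  rw [evalHom_eq_appLE p h (le_preimage_of_pt_mem h)]
  have h1 : const X U c = (X.hom.appLE ⊤ U le_top)
      ((Scheme.ΓSpecIso (CommRingCat.of ℂ)).inv c) := rfl
  have h2 : X.hom.appLE ⊤ U le_top ≫ p.hom.appLE U ⊤ (le_preimage_of_pt_mem h) =
      (𝟙 SpecC : SpecC ⟶ SpecC).appLE ⊤ ⊤ le_top := by
    refine (Scheme.Hom.appLE_comp_appLE _ _ _ _ _ _ _).trans ?_
    congr 1
    exact p.comp_hom
  have h3 := congr($(h2).hom ((Scheme.ΓSpecIso (CommRingCat.of ℂ)).inv c))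
  rw [h1]
  refine (congrArg (Scheme.ΓSpecIso (CommRingCat.of ℂ)).hom h3).trans ?_
  simp [Scheme.Hom.appLE]

lemma evalAt_const {p : CPoints X} {U : X.left.Opens} (h : p.pt ∈ U) (c : ℂ) :
    evalAt U (const X U c) p = c := by
  rw [evalAt_of_mem h, evalHom_const]

lemma CPoints.map_pt {Y : CScheme} (φ : X ⟶ Y) (p : CPoints X) :
    (p.map φ).pt = φ.left p.pt := by
  simp only [CPoints.map, CPoints.ofOver, CPoints.toOver, CPoints.pt, Over.comp_left,
    Over.homMk_left]
  exact Scheme.Hom.comp_apply _ _ _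

lemma evalAt_map {Y : CScheme} (φ : X ⟶ Y) (p : CPoints X) {U : Y.left.Opens}
    (h : (p.map φ).pt ∈ U) (f : Γ(Y.left, U)) :
    evalAt U f (p.map φ) = evalAt (φ.left ⁻¹ᵁ U) (φ.left.app U f) p := by
  have h' : p.pt ∈ φ.left ⁻¹ᵁ U := by
    rw [CPoints.map_pt] at h; exact h
  rw [evalAt_of_mem h, evalAt_of_mem h', evalHom_eq_appLE _ h (le_preimage_of_pt_mem h),
    evalHom_eq_appLE _ h' (le_preimage_of_pt_mem h')]
  have : (p.map φ).hom = p.hom ≫ φ.left := by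
    simp [CPoints.map, CPoints.ofOver, CPoints.toOver]
  have h2 : φ.left.app U ≫ p.hom.appLE (φ.left ⁻¹ᵁ U) ⊤ (le_preimage_of_pt_mem h') =
      (p.map φ).hom.appLE U ⊤ (le_preimage_of_pt_mem h) := by
    rw [Scheme.Hom.app_eq_appLE, Scheme.Hom.appLE_comp_appLE]
    simp only [this]
  exact congrArg (Scheme.ΓSpecIso (CommRingCat.of ℂ)).hom congr($(h2).hom f).symm

lemma CPoints.hom_eq_fromSpec (p : CPoints X) {U : X.left.Opens} (hU : IsAffineOpen U)
    (h : p.pt ∈ U) :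
    p.hom = Spec.map (CommRingCat.ofHom (evalHom p U h)) ≫ hU.fromSpec := by
  have := IsAffineOpen.SpecMap_appLE_fromSpec p.hom hU (isAffineOpen_top SpecC)
    (le_preimage_of_pt_mem h)
  rw [IsAffineOpen.fromSpec_top, Scheme.isoSpec_Spec_inv] at this
  have h2 : CommRingCat.ofHom (evalHom p U h) =
      p.hom.appLE U ⊤ (le_preimage_of_pt_mem h) ≫ (Scheme.ΓSpecIso (CommRingCat.of ℂ)).hom := by
    ext f
    exact evalHom_eq_appLE p h (le_preimage_of_pt_mem h) f
  rw [h2, Spec.map_comp, Category.assoc, this, ← Spec.map_comp_assoc]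
  simp

lemma CPoints.ext_of_evalHom {p q : CPoints X} {U : X.left.Opens} (hU : IsAffineOpen U)
    (hp : p.pt ∈ U) (hq : q.pt ∈ U) (h : ∀ f, evalAt U f p = evalAt U f q) : p = q := by
  apply CPoints.ext
  rw [p.hom_eq_fromSpec hU hp, q.hom_eq_fromSpec hU hq]
  congr 3
  ext f
  rw [← evalAt_of_mem, ← evalAt_of_mem]
  exact h f

/-- The point of an affine open set given by a homomorphism to `ℂ`. -/
def pointOfHom {U : X.left.Opens} (hU : IsAffineOpen U) (ψ : Γ(X.left, U) →+* ℂ)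
    (hψ : ψ.comp (const X U) = RingHom.id ℂ) : CPoints X where
  hom := Spec.map (CommRingCat.ofHom ψ) ≫ hU.fromSpec
  comp_hom := by
    rw [Category.assoc, fromSpec_comp_hom hU, ← Spec.map_comp, ← CommRingCat.ofHom_comp, hψ]
    exact Spec.map_id _

lemma pointOfHom_mem {U : X.left.Opens} (hU : IsAffineOpen U) (ψ : Γ(X.left, U) →+* ℂ)
    (hψ : ψ.comp (const X U) = RingHom.id ℂ) : (pointOfHom hU ψ hψ).pt ∈ U := by
  have : (pointOfHom hU ψ hψ).pt ∈ Set.range hU.fromSpec := by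
    exact ⟨Spec.map (CommRingCat.ofHom ψ) (IsLocalRing.closedPoint (CommRingCat.of ℂ)),
      (Scheme.Hom.comp_apply _ _ _).symm⟩
  rw [hU.range_fromSpec] at this
  exact this

lemma evalAt_pointOfHom {U : X.left.Opens} (hU : IsAffineOpen U) (ψ : Γ(X.left, U) →+* ℂ)
    (hψ : ψ.comp (const X U) = RingHom.id ℂ) (f : Γ(X.left, U)) :
    evalAt U f (pointOfHom hU ψ hψ) = ψ f := by
  have hm := pointOfHom_mem hU ψ hψ
  have h1 := (pointOfHom hU ψ hψ).hom_eq_fromSpec hU hm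
  have h2 : Spec.map (CommRingCat.ofHom ψ) ≫ hU.fromSpec =
    Spec.map (CommRingCat.ofHom (evalHom (pointOfHom hU ψ hψ) U hm)) ≫ hU.fromSpec := h1
  rw [cancel_mono] at h2
  have h3 := Spec.map_injective h2
  rw [evalAt_of_mem hm]
  exact congr($(h3).hom f).symm

/-- Principal open sets of an affine open set form a basis, so every regular function near a point
is a quotient of two functions from one fixed affine algebra. Continuity, holomorphy and immersivity
can thus be tested on generators of that algebra. -/
lemma exists_fraction {U U' : X.left.Opens} (hU : IsAffineOpen U) {p : CPoints X} (hp : p.pt ∈ U)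
    (hp' : p.pt ∈ U') (f : Γ(X.left, U')) : ∃ r s : Γ(X.left, U), evalAt U s p ≠ 0 ∧
      ∀ q : CPoints X, q.pt ∈ U → evalAt U s q ≠ 0 →
        q.pt ∈ U' ∧ evalAt U' f q = evalAt U r q / evalAt U s q := by
  obtain ⟨s, hs, hps⟩ := hU.exists_basicOpen_le (V := U') ⟨p.pt, hp'⟩ hp
  have := hU.isLocalization_basicOpen s
  obtain ⟨⟨r, ⟨_, k, rfl⟩⟩, hr⟩ := IsLocalization.surj (Submonoid.powers s)
    (X.left.presheaf.map (homOfLE hs).op f)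
  have hev : ∀ q : CPoints X, q.pt ∈ U → ∀ a b : Γ(X.left, U),
      evalAt U (a * b) q = evalAt U a q * evalAt U b q := fun q hq a b => by
    simp only [evalAt_of_mem hq, map_mul]
  have hev' : ∀ q : CPoints X, q.pt ∈ U → ∀ (a : Γ(X.left, U)) (k : ℕ),
      evalAt U (a ^ k) q = evalAt U a q ^ k := fun q hq a b => by
    simp only [evalAt_of_mem hq, map_pow]
  -- The additional factor `s` matters for `k = 0`: a nonzero denominator must force the point into
  -- the principal open set of `s`.
  refine ⟨r * s, s ^ (k + 1), ?_, ?_⟩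
  · rw [hev' p hp]
    exact pow_ne_zero _ ((evalAt_ne_zero_iff hp s).2 hps)
  · intro q hq hsq
    rw [hev' q hq] at hsq
    have hs0 : evalAt U s q ≠ 0 := fun h => hsq (by rw [h, zero_pow (Nat.succ_ne_zero _)])
    have hqD : q.pt ∈ X.left.basicOpen s := (evalAt_ne_zero_iff hq s).1 hs0
    refine ⟨hs hqD, ?_⟩
    rw [hev q hq, hev' q hq, eq_div_iff (pow_ne_zero _ hs0), pow_succ, ← mul_assoc]
    congr 1
    have h1 := congrArg (fun a => evalAt (X.left.basicOpen s) a q) hr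
    simp only [evalAt_of_mem hqD, map_mul] at h1
    simp only [← evalAt_of_mem hqD] at h1
    rw [evalAt_res hs f hqD] at h1
    have h2 : ∀ a : Γ(X.left, U), evalAt (X.left.basicOpen s) (algebraMap Γ(X.left, U)
        Γ(X.left, X.left.basicOpen s) a) q = evalAt U a q := fun a =>
      evalAt_res (X.left.basicOpen_le s) a hqD
    rw [h2, h2, hev' q hq] at h1
    exact h1

end Eval

/-! ### Functions pulled back along points with values in a ring -/

section Pull

variable {Y : Scheme.{0}} {R R' : Type} [CommRing R] [CommRing R']

/-- The pull-back of functions along a morphism from an affine scheme. -/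
def pull (g : Spec (CommRingCat.of R) ⟶ Y) (U : Y.Opens) (h : ⊤ ≤ g ⁻¹ᵁ U) : Γ(Y, U) →+* R :=
  (g.appLE U ⊤ h ≫ (Scheme.ΓSpecIso (CommRingCat.of R)).hom).hom

lemma pull_res (g : Spec (CommRingCat.of R) ⟶ Y) {U V : Y.Opens} (i : V ≤ U) (h : ⊤ ≤ g ⁻¹ᵁ V)
    (f : Γ(Y, U)) :
    pull g V h (Y.presheaf.map (homOfLE i).op f) = pull g U (fun _ hx => i (h hx)) f := by
  have : Y.presheaf.map (homOfLE i).op ≫ g.appLE V ⊤ h = g.appLE U ⊤ (fun x hx => i (h hx)) :=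
    Scheme.Hom.map_appLE _ _ _
  exact congrArg (Scheme.ΓSpecIso (CommRingCat.of R)).hom congr($(this).hom f)

lemma pull_congr {g g' : Spec (CommRingCat.of R) ⟶ Y} (e : g = g') {U : Y.Opens}
    (h : ⊤ ≤ g ⁻¹ᵁ U) (h' : ⊤ ≤ g' ⁻¹ᵁ U) (f : Γ(Y, U)) : pull g U h f = pull g' U h' f := by
  subst e; rfl

lemma pull_comp (g : Spec (CommRingCat.of R) ⟶ Y) (φ : R →+* R') {U : Y.Opens}
    (h : ⊤ ≤ g ⁻¹ᵁ U) (h' : ⊤ ≤ (Spec.map (CommRingCat.ofHom φ) ≫ g) ⁻¹ᵁ U) (f : Γ(Y, U)) :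
    pull (Spec.map (CommRingCat.ofHom φ) ≫ g) U h' f = φ (pull g U h f) := by
  have h1 : (Spec.map (CommRingCat.ofHom φ) ≫ g).appLE U ⊤ h' =
      g.appLE U ⊤ h ≫ (Spec.map (CommRingCat.ofHom φ)).appTop := by
    have := Scheme.Hom.appLE_comp_appLE (Spec.map (CommRingCat.ofHom φ)) g U ⊤ ⊤ h le_top
    rw [← this]
    congr 1
  have h2 := Scheme.ΓSpecIso_naturality (CommRingCat.ofHom φ)
  have h3 : (Spec.map (CommRingCat.ofHom φ) ≫ g).appLE U ⊤ h' ≫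
      (Scheme.ΓSpecIso (CommRingCat.of R')).hom = (g.appLE U ⊤ h ≫
      (Scheme.ΓSpecIso (CommRingCat.of R)).hom) ≫ CommRingCat.ofHom φ := by
    rw [h1, Category.assoc, h2, Category.assoc]
  exact congr($(h3).hom f)

lemma eq_fromSpec_of_top_le (g : Spec (CommRingCat.of R) ⟶ Y) {U : Y.Opens} (hU : IsAffineOpen U)
    (h : ⊤ ≤ g ⁻¹ᵁ U) : g = Spec.map (CommRingCat.ofHom (pull g U h)) ≫ hU.fromSpec := by
  have := IsAffineOpen.SpecMap_appLE_fromSpec g hU (isAffineOpen_top _) h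
  rw [IsAffineOpen.fromSpec_top, Scheme.isoSpec_Spec_inv] at this
  have h2 : CommRingCat.ofHom (pull g U h) =
      g.appLE U ⊤ h ≫ (Scheme.ΓSpecIso (CommRingCat.of R)).hom := rfl
  rw [h2, Spec.map_comp, Category.assoc, this, ← Spec.map_comp_assoc]
  simp

lemma top_le_preimage_fromSpec {U : Y.Opens} (hU : IsAffineOpen U) (ψ : Γ(Y, U) →+* R) :
    ⊤ ≤ (Spec.map (CommRingCat.ofHom ψ) ≫ hU.fromSpec) ⁻¹ᵁ U := by
  intro x _
  have : (Spec.map (CommRingCat.ofHom ψ) ≫ hU.fromSpec) x ∈ Set.range hU.fromSpec :=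
    ⟨Spec.map (CommRingCat.ofHom ψ) x, (Scheme.Hom.comp_apply _ _ _).symm⟩
  rw [hU.range_fromSpec] at this
  exact this

lemma pull_fromSpec {U : Y.Opens} (hU : IsAffineOpen U) (ψ : Γ(Y, U) →+* R)
    (h : ⊤ ≤ (Spec.map (CommRingCat.ofHom ψ) ≫ hU.fromSpec) ⁻¹ᵁ U) :
    pull (Spec.map (CommRingCat.ofHom ψ) ≫ hU.fromSpec) U h = ψ := by
  have h2 := eq_fromSpec_of_top_le _ hU h
  rw [cancel_mono] at h2
  exact congr($(Spec.map_injective h2).hom).symm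

lemma isUnit_pull_iff (g : Spec (CommRingCat.of R) ⟶ Y) {U : Y.Opens} (h : ⊤ ≤ g ⁻¹ᵁ U)
    (f : Γ(Y, U)) : IsUnit (pull g U h f) ↔ ⊤ ≤ g ⁻¹ᵁ Y.basicOpen f := by
  have h1 : IsUnit (pull g U h f) ↔ IsUnit (g.appLE U ⊤ h f) :=
    MulEquiv.isUnit_map (Scheme.ΓSpecIso (CommRingCat.of R)).commRingCatIsoToRingEquiv
  have h0 : IsUnit (g.appLE U ⊤ h f) ↔
      (Spec (CommRingCat.of R)).basicOpen (g.appLE U ⊤ h f) = ⊤ := by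
    refine ⟨fun hu => Scheme.basicOpen_of_isUnit _ hu, fun hu => ?_⟩
    refine RingedSpace.isUnit_of_isUnit_germ (Spec (CommRingCat.of R)).toRingedSpace _ _
      fun x hx => ?_
    exact (Scheme.mem_basicOpen (Spec (CommRingCat.of R)) _ x hx).1 (hu.ge hx)
  rw [h1, h0]
  have h2 : (Spec (CommRingCat.of R)).basicOpen (g.appLE U ⊤ h f) = ⊤ ⊓ g ⁻¹ᵁ Y.basicOpen f := by
    rw [Scheme.Hom.appLE, Scheme.preimage_basicOpen]
    exact Scheme.basicOpen_res _ _ _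
  rw [h2, top_inf_eq, ← top_le_iff]

end Pull

lemma evalHom_eq_pull {X : CScheme} (p : CPoints X) {U : X.left.Opens} (h : p.pt ∈ U) :
    evalHom p U h = pull (R := ℂ) p.hom U (le_preimage_of_pt_mem h) := by
  ext f
  exact evalHom_eq_appLE p h (le_preimage_of_pt_mem h) f

/-! ### The analytic topology in affine coordinates -/

section Topology

variable {X : CScheme}

lemma isOpen_setOf_evalAt (U : X.left.Opens) (f : Γ(X.left, U)) {V : Set ℂ} (hV : IsOpen V) :
    IsOpen {p : CPoints X | p.pt ∈ U ∧ evalAt U f p ∈ V} :=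
  TopologicalSpace.isOpen_generateFrom_of_mem ⟨U, f, V, hV, rfl⟩

lemma isOpen_setOf_pt_mem (U : X.left.Opens) : IsOpen {p : CPoints X | p.pt ∈ U} := by
  simpa using isOpen_setOf_evalAt U 0 isOpen_univ

lemma continuousAt_evalAt {U : X.left.Opens} (f : Γ(X.left, U)) {p : CPoints X}
    (hp : p.pt ∈ U) : ContinuousAt (evalAt U f) p := by
  rw [ContinuousAt, tendsto_nhds]
  intro V hV hpV
  filter_upwards [(isOpen_setOf_evalAt U f hV).mem_nhds ⟨hp, hpV⟩] with q hq
  exact hq.2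

/-- The map to `ℂᴺ` given by `N` regular functions. -/
def coordMap {N : ℕ} (U : X.left.Opens) (f : Fin N → Γ(X.left, U)) (p : CPoints X) : Fin N → ℂ :=
  fun i => evalAt U (f i) p

lemma evalAt_eval₂Hom {N : ℕ} {U : X.left.Opens} (f : Fin N → Γ(X.left, U)) {p : CPoints X}
    (hp : p.pt ∈ U) (P : MvPolynomial (Fin N) ℂ) :
    evalAt U (MvPolynomial.eval₂Hom (const X U) f P) p = MvPolynomial.eval (coordMap U f p) P := by
  rw [evalAt_of_mem hp]
  have : (evalHom p U hp).comp (MvPolynomial.eval₂Hom (const X U) f) =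
      MvPolynomial.eval (coordMap U f p) := by
    apply MvPolynomial.ringHom_ext
    · intro c
      simp [evalHom_const]
    · intro i
      simp [coordMap, evalAt_of_mem hp]
  exact congr($this P)

/-- A subbasic neighbourhood of the point is described by a quotient of polynomials in the
generators whose denominator does not vanish there, and such a quotient is continuous in the
coordinates. Hence the analytic topology on an affine piece is induced from ℂᴺ. -/
lemma nhds_eq_comap_coordMap {N : ℕ} {U : X.left.Opens} (hU : IsAffineOpen U)
    {f : Fin N → Γ(X.left, U)}
    (hf : Function.Surjective (MvPolynomial.eval₂Hom (const X U) f)) {p : CPoints X}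
    (hp : p.pt ∈ U) :
    𝓝 p = Filter.comap (coordMap U f) (𝓝 (coordMap U f p)) ⊓ Filter.principal {q | q.pt ∈ U} := by
  apply le_antisymm
  · refine le_inf ?_ ?_
    · rw [← Filter.tendsto_iff_comap]
      exact tendsto_pi_nhds.2 fun i => continuousAt_evalAt (f i) hp
    · rw [Filter.le_principal_iff]
      exact (isOpen_setOf_pt_mem U).mem_nhds hp
  · rw [TopologicalSpace.nhds_generateFrom]
    refine le_iInf₂ fun S hS => ?_
    obtain ⟨hpS, U', g, V, hV, rfl⟩ := hS
    obtain ⟨r, s, hs, h⟩ := exists_fraction hU hp hpS.1 g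
    obtain ⟨R, rfl⟩ := hf r
    obtain ⟨T, rfl⟩ := hf s
    rw [Filter.le_principal_iff]
    rw [evalAt_eval₂Hom f hp] at hs
    have hc : ContinuousAt (fun z => MvPolynomial.eval z R / MvPolynomial.eval z T)
        (coordMap U f p) :=
      (MvPolynomial.continuous_eval R).continuousAt.div
        (MvPolynomial.continuous_eval T).continuousAt hs
    have h1 := (h p hp (by rwa [evalAt_eval₂Hom f hp])).2
    rw [evalAt_eval₂Hom f hp, evalAt_eval₂Hom f hp] at h1
    have hV' : V ∈ 𝓝 (MvPolynomial.eval (coordMap U f p) R / MvPolynomial.eval (coordMap U f p) T) :=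
      hV.mem_nhds (h1 ▸ hpS.2)
    have h2 : ∀ᶠ z in 𝓝 (coordMap U f p), MvPolynomial.eval z T ≠ 0 ∧
        MvPolynomial.eval z R / MvPolynomial.eval z T ∈ V :=
      ((MvPolynomial.continuous_eval T).continuousAt.eventually_ne hs).and (hc hV')
    refine Filter.mem_inf_of_inter (Filter.preimage_mem_comap h2) (Filter.mem_principal_self _) ?_
    rintro q ⟨⟨hq1, hq2⟩, hqU⟩
    have := h q hqU (by rw [evalAt_eval₂Hom f hqU]; exact hq1)
    refine ⟨this.1, ?_⟩
    rw [this.2, evalAt_eval₂Hom f hqU, evalAt_eval₂Hom f hqU]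
    exact hq2

lemma exists_generators [LocallyOfFiniteType X.hom] {U : X.left.Opens} (hU : IsAffineOpen U) :
    ∃ (N : ℕ) (f : Fin N → Γ(X.left, U)),
      Function.Surjective (MvPolynomial.eval₂Hom (const X U) f) := by
  have h := LocallyOfFiniteType.finiteType_appLE X.hom (isAffineOpen_top SpecC) hU le_top
  have h1 : (const X U).FiniteType := by
    have : const X U = (X.hom.appLE ⊤ U le_top).hom.comp
      (Scheme.ΓSpecIso (CommRingCat.of ℂ)).commRingCatIsoToRingEquiv.symm.toRingHom := rfl
    rw [this]
    exact h.comp (RingHom.FiniteType.of_surjective _ (RingEquiv.surjective _))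
  let := (const X U).toAlgebra
  obtain ⟨N, φ, hφ⟩ := Algebra.FiniteType.iff_quotient_mvPolynomial''.1 h1
  refine ⟨N, fun i => φ (MvPolynomial.X i), ?_⟩
  suffices h : MvPolynomial.eval₂Hom (const X U) (fun i => φ (MvPolynomial.X i)) =
      φ.toRingHom by rw [h]; exact hφ
  apply MvPolynomial.ringHom_ext
  · intro c
    simp only [MvPolynomial.coe_eval₂Hom, MvPolynomial.eval₂_C]
    exact (φ.commutes c).symm
  · intro i
    simp

end Topology

/-! ### Compactness: the valuative criterion applied to germs along an ultrafilter -/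

section Compact

variable {X : CScheme}

/-- Germs along an ultrafilter of functions bounded near it. -/
def boundedGerms {α : Type} (𝒰 : Ultrafilter α) :
    ValuationSubring (Filter.Germ (𝒰 : Filter α) ℂ) where
  carrier := {z | ∃ M : ℝ, Filter.Germ.LiftPred (fun c => ‖c‖ ≤ M) z}
  mul_mem' := by
    rintro a b ⟨M, hM⟩ ⟨M', hM'⟩
    induction a using Filter.Germ.inductionOn
    induction b using Filter.Germ.inductionOn
    refine ⟨M * M', ?_⟩
    rw [← Filter.Germ.coe_mul]
    simp only [Filter.Germ.liftPred_coe] at *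
    filter_upwards [hM, hM'] with x h h'
    rw [Pi.mul_apply, norm_mul]
    exact mul_le_mul h h' (norm_nonneg _) ((norm_nonneg _).trans h)
  one_mem' := ⟨1, show ∀ᶠ _ in (𝒰 : Filter α), ‖(1 : ℂ)‖ ≤ 1 by simp⟩
  add_mem' := by
    rintro a b ⟨M, hM⟩ ⟨M', hM'⟩
    induction a using Filter.Germ.inductionOn
    induction b using Filter.Germ.inductionOn
    refine ⟨M + M', ?_⟩
    rw [← Filter.Germ.coe_add]
    simp only [Filter.Germ.liftPred_coe] at *
    filter_upwards [hM, hM'] with x h h'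
    exact (norm_add_le _ _).trans (add_le_add h h')
  zero_mem' := ⟨0, show ∀ᶠ _ in (𝒰 : Filter α), ‖(0 : ℂ)‖ ≤ 0 by simp⟩
  neg_mem' := by
    rintro a ⟨M, hM⟩
    induction a using Filter.Germ.inductionOn
    refine ⟨M, ?_⟩
    rw [← Filter.Germ.coe_neg]
    simp only [Filter.Germ.liftPred_coe] at *
    filter_upwards [hM] with x h
    simpa using h
  mem_or_inv_mem' := by
    intro a
    induction a using Filter.Germ.inductionOn with
    | _ f =>
    by_cases h : ∀ᶠ x in (𝒰 : Filter α), ‖f x‖ ≤ 1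
    · exact Or.inl ⟨1, by simpa [Filter.Germ.liftPred_coe] using h⟩
    · refine Or.inr ⟨1, ?_⟩
      rw [← Filter.Germ.coe_inv]
      simp only [Filter.Germ.liftPred_coe]
      rw [← Ultrafilter.eventually_not] at h
      filter_upwards [h] with x hx
      rw [Pi.inv_apply, norm_inv]
      exact inv_le_one_of_one_le₀ (not_le.1 hx).le

lemma coe_mem_boundedGerms {α : Type} {𝒰 : Ultrafilter α} {f : α → ℂ} :
    (f : Filter.Germ (𝒰 : Filter α) ℂ) ∈ boundedGerms 𝒰 ↔
      ∃ M : ℝ, ∀ᶠ x in (𝒰 : Filter α), ‖f x‖ ≤ M := Iff.rfl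

lemma exists_tendsto_of_mem_boundedGerms {α : Type} {𝒰 : Ultrafilter α} {f : α → ℂ}
    (h : (f : Filter.Germ (𝒰 : Filter α) ℂ) ∈ boundedGerms 𝒰) :
    ∃ c, Filter.Tendsto f 𝒰 (𝓝 c) := by
  obtain ⟨M, hM⟩ := coe_mem_boundedGerms.1 h
  have hc := isCompact_iff_ultrafilter_le_nhds.1 (isCompact_closedBall (0 : ℂ) M) (𝒰.map f) (by
    rw [Filter.le_principal_iff, Ultrafilter.coe_map, Filter.mem_map]
    filter_upwards [hM] with x hx
    simpa using hx)
  obtain ⟨c, -, hc⟩ := hc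
  exact ⟨c, hc⟩

/-- The standard part of a germ. -/
def stdPart {α : Type} (𝒰 : Ultrafilter α) : boundedGerms 𝒰 →+* ℂ where
  toFun z := Filter.Germ.liftOn z.1 (fun f => Filter.limUnder (𝒰 : Filter α) f) (by
    intro f g h
    simp only [Filter.limUnder]
    exact congrArg _ (Filter.map_congr h))
  map_one' := by
    change Filter.limUnder (𝒰 : Filter α) (fun _ => (1 : ℂ)) = 1
    exact tendsto_const_nhds.limUnder_eq
  map_zero' := by
    change Filter.limUnder (𝒰 : Filter α) (fun _ => (0 : ℂ)) = 0
    exact tendsto_const_nhds.limUnder_eq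
  map_mul' := by
    rintro ⟨a, ha⟩ ⟨b, hb⟩
    induction a using Filter.Germ.inductionOn with
    | _ f =>
    induction b using Filter.Germ.inductionOn with
    | _ g =>
    obtain ⟨c, hc⟩ := exists_tendsto_of_mem_boundedGerms ha
    obtain ⟨d, hd⟩ := exists_tendsto_of_mem_boundedGerms hb
    change Filter.limUnder (𝒰 : Filter α) (f * g) = Filter.limUnder (𝒰 : Filter α) f * Filter.limUnder (𝒰 : Filter α) g
    rw [hc.limUnder_eq, hd.limUnder_eq]
    exact (hc.mul hd).limUnder_eq
  map_add' := by
    rintro ⟨a, ha⟩ ⟨b, hb⟩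
    induction a using Filter.Germ.inductionOn with
    | _ f =>
    induction b using Filter.Germ.inductionOn with
    | _ g =>
    obtain ⟨c, hc⟩ := exists_tendsto_of_mem_boundedGerms ha
    obtain ⟨d, hd⟩ := exists_tendsto_of_mem_boundedGerms hb
    change Filter.limUnder (𝒰 : Filter α) (f + g) = Filter.limUnder (𝒰 : Filter α) f + Filter.limUnder (𝒰 : Filter α) g
    rw [hc.limUnder_eq, hd.limUnder_eq]
    exact (hc.add hd).limUnder_eq

lemma tendsto_stdPart {α : Type} {𝒰 : Ultrafilter α} {f : α → ℂ}
    (h : (f : Filter.Germ (𝒰 : Filter α) ℂ) ∈ boundedGerms 𝒰) :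
    Filter.Tendsto f 𝒰 (𝓝 (stdPart 𝒰 ⟨_, h⟩)) := by
  obtain ⟨c, hc⟩ := exists_tendsto_of_mem_boundedGerms h
  have : stdPart 𝒰 ⟨_, h⟩ = c := hc.limUnder_eq
  rwa [this]

/-- The germ of a regular function along an ultrafilter of points of `U`. -/
def germHom {𝒰 : Ultrafilter (CPoints X)} {U : X.left.Opens}
    (hU : ∀ᶠ p in (𝒰 : Filter (CPoints X)), p.pt ∈ U) :
    Γ(X.left, U) →+* Filter.Germ (𝒰 : Filter (CPoints X)) ℂ where
  toFun f := (evalAt U f : CPoints X → ℂ)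
  map_one' := Filter.Germ.coe_eq.2 (by
    filter_upwards [hU] with p hp
    simp [evalAt_of_mem hp])
  map_zero' := Filter.Germ.coe_eq.2 (by
    filter_upwards [hU] with p hp
    simp [evalAt_of_mem hp])
  map_mul' f g := by
    rw [← Filter.Germ.coe_mul]
    refine Filter.Germ.coe_eq.2 ?_
    filter_upwards [hU] with p hp
    simp [evalAt_of_mem hp]
  map_add' f g := by
    rw [← Filter.Germ.coe_add]
    refine Filter.Germ.coe_eq.2 ?_
    filter_upwards [hU] with p hp
    simp [evalAt_of_mem hp]

/-- A germ with nonzero limit has an inverse that is again bounded. -/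
lemma isLocalHom_stdPart {α : Type} (𝒰 : Ultrafilter α) : IsLocalHom (stdPart 𝒰) := by
  refine ⟨?_⟩
  rintro ⟨a, ha⟩ hu
  induction a using Filter.Germ.inductionOn with
  | _ f =>
  have hc := tendsto_stdPart ha
  have h0 : stdPart 𝒰 ⟨_, ha⟩ ≠ 0 := hu.ne_zero
  have hi := hc.inv₀ h0
  have hm : ((f⁻¹ : α → ℂ) : Filter.Germ (𝒰 : Filter α) ℂ) ∈ boundedGerms 𝒰 := by
    refine coe_mem_boundedGerms.2 ⟨‖(stdPart 𝒰 ⟨_, ha⟩)⁻¹‖ + 1, ?_⟩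
    filter_upwards [hi.norm.eventually (eventually_le_nhds (lt_add_one _))] with x hx
    exact hx
  refine IsUnit.of_mul_eq_one ⟨_, hm⟩ ?_
  ext
  change ((f * f⁻¹ : α → ℂ) : Filter.Germ (𝒰 : Filter α) ℂ) = ((1 : α → ℂ) : _)
  refine Filter.Germ.coe_eq.2 ?_
  filter_upwards [hc.eventually_ne h0] with x hx
  exact mul_inv_cancel₀ hx

lemma exists_affine_mem_ultrafilter [CompactSpace X.left] (𝒰 : Ultrafilter (CPoints X)) :
    ∃ U : X.left.Opens, IsAffineOpen U ∧ ∀ᶠ p in (𝒰 : Filter (CPoints X)), p.pt ∈ U := by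
  have hcov : (Set.univ : Set X.left) ⊆ ⋃ U : X.left.affineOpens, (U.1 : Set X.left) := by
    intro x _
    obtain ⟨U, hU, hx, -⟩ := exists_isAffineOpen_mem_and_subset (X := X.left) (x := x) (U := ⊤)
      trivial
    exact Set.mem_iUnion.2 ⟨⟨U, hU⟩, hx⟩
  obtain ⟨s, hs⟩ := isCompact_univ.elim_finite_subcover _ (fun U => U.1.2) hcov
  by_contra! hcon
  have h1 : ∀ U ∈ s, ∀ᶠ p in (𝒰 : Filter (CPoints X)), p.pt ∉ U.1 := fun U _ =>
    hcon U.1 U.2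
  have h2 := (Filter.eventually_all_finset s).2 h1
  obtain ⟨p, hp⟩ := h2.exists
  have := hs (Set.mem_univ p.pt)
  simp only [Set.mem_iUnion] at this
  obtain ⟨U, hU, hpU⟩ := this
  exact hp U hU hpU

/-- The point over the field of germs does not depend on the affine set used to define it. On a
principal open set inside both sets the function is `r / s ^ k`; the germ of `s` is nonzero, and
along an ultrafilter this means that `s` is nonzero on a set of the ultrafilter. -/
lemma pull_eq_germ {𝒰 : Ultrafilter (CPoints X)} {U U' : X.left.Opens} (hU : IsAffineOpen U)
    (hmem : ∀ᶠ p in (𝒰 : Filter (CPoints X)), p.pt ∈ U)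
    (h' : ⊤ ≤ (Spec.map (CommRingCat.ofHom (germHom hmem)) ≫ hU.fromSpec) ⁻¹ᵁ U')
    (f : Γ(X.left, U')) : (∀ᶠ p in (𝒰 : Filter (CPoints X)), p.pt ∈ U') ∧
      pull (Spec.map (CommRingCat.ofHom (germHom hmem)) ≫ hU.fromSpec) U' h' f =
        ((evalAt U' f : CPoints X → ℂ) : Filter.Germ (𝒰 : Filter (CPoints X)) ℂ) := by
  set i := Spec.map (CommRingCat.ofHom (germHom hmem)) ≫ hU.fromSpec with hi
  have hT := top_le_preimage_fromSpec hU (germHom hmem)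
  let x : Spec (CommRingCat.of (Filter.Germ (𝒰 : Filter (CPoints X)) ℂ)) :=
    IsLocalRing.closedPoint (CommRingCat.of (Filter.Germ (𝒰 : Filter (CPoints X)) ℂ))
  obtain ⟨s, hs, hxs⟩ := hU.exists_basicOpen_le (V := U') ⟨i x, h' trivial⟩ (hT trivial)
  have hD : ⊤ ≤ i ⁻¹ᵁ X.left.basicOpen s :=
    (Scheme.preimage_eq_top_of_closedPoint_mem (R := CommRingCat.of
      (Filter.Germ (𝒰 : Filter (CPoints X)) ℂ)) i hxs).ge
  have hpU : ∀ a, pull i U hT a = germHom hmem a := fun a => by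
    rw [pull_fromSpec]
  have hs0 : germHom hmem s ≠ 0 := by
    rw [← hpU]
    exact ((isUnit_pull_iff i hT s).2 hD).ne_zero
  have hs1 : ∀ᶠ p in (𝒰 : Filter (CPoints X)), evalAt U s p ≠ 0 := by
    rw [Ultrafilter.eventually_not]
    intro h
    exact hs0 (Filter.Germ.coe_eq.2 h)
  have hs2 : ∀ᶠ p in (𝒰 : Filter (CPoints X)), p.pt ∈ X.left.basicOpen s := by
    filter_upwards [hs1, hmem] with p hp hpm
    exact (evalAt_ne_zero_iff hpm s).1 hp
  refine ⟨hs2.mono fun p hp => hs hp, ?_⟩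
  have := hU.isLocalization_basicOpen s
  obtain ⟨⟨r, ⟨_, k, rfl⟩⟩, hr⟩ := IsLocalization.surj (Submonoid.powers s)
    (X.left.presheaf.map (homOfLE hs).op f)
  have e1 := congrArg (pull i _ hD) hr
  have e2 : ∀ a : Γ(X.left, U), pull i _ hD (algebraMap Γ(X.left, U)
        Γ(X.left, X.left.basicOpen s) a) = germHom hmem a := fun a =>
      (pull_res i (X.left.basicOpen_le s) hD a).trans (hpU a)
  rw [map_mul, e2, e2, pull_res, map_pow] at e1
  refine mul_right_cancel₀ (pow_ne_zero k hs0) (e1.trans ?_)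
  rw [← map_pow]
  change ((evalAt U r : CPoints X → ℂ) : Filter.Germ (𝒰 : Filter (CPoints X)) ℂ) =
    ((evalAt U' f * evalAt U (s ^ k) : CPoints X → ℂ) : Filter.Germ (𝒰 : Filter (CPoints X)) ℂ)
  refine Filter.Germ.coe_eq.2 ?_
  filter_upwards [hs2] with q hq
  have h1 := congrArg (fun a => evalAt (X.left.basicOpen s) a q) hr
  simp only [evalAt_of_mem hq, map_mul] at h1
  simp only [← evalAt_of_mem hq] at h1
  rw [evalAt_res hs f hq] at h1
  have h2 : ∀ a : Γ(X.left, U), evalAt (X.left.basicOpen s) (algebraMap Γ(X.left, U)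
      Γ(X.left, X.left.basicOpen s) a) q = evalAt U a q := fun a =>
    evalAt_res (X.left.basicOpen_le s) a hq
  rw [h2, h2] at h1
  exact h1.symm

/-- The complex points of a proper scheme form a compact space. -/
theorem compactSpace_of_isProper [IsProper X.hom] : CompactSpace (CPoints X) := by
  have : CompactSpace X.left := by
    have : QuasiCompact X.hom := inferInstance
    exact QuasiCompact.compactSpace_of_compactSpace X.hom
  refine ⟨isCompact_iff_ultrafilter_le_nhds.2 fun 𝒰 _ => ?_⟩
  obtain ⟨U, hU, hmem⟩ := exists_affine_mem_ultrafilter 𝒰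
  let ι : ℂ →+* boundedGerms 𝒰 :=
    { toFun := fun c => ⟨((fun _ => c : CPoints X → ℂ) : Filter.Germ (𝒰 : Filter (CPoints X)) ℂ),
        coe_mem_boundedGerms.2 ⟨‖c‖, by simp⟩⟩
      map_one' := rfl
      map_zero' := rfl
      map_mul' := fun _ _ => rfl
      map_add' := fun _ _ => rfl }
  -- The germs of complex functions along the ultrafilter form a field and the bounded germs a
  -- valuation ring in it. Evaluation of regular functions is a point of `X` over the field, and
  -- properness extends it to the valuation ring.
  have hsq : CommSq (Spec.map (CommRingCat.ofHom (germHom hmem)) ≫ hU.fromSpec)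
      (Spec.map (CommRingCat.ofHom (algebraMap (boundedGerms 𝒰)
        (Filter.Germ (𝒰 : Filter (CPoints X)) ℂ)))) X.hom (Spec.map (CommRingCat.ofHom ι)) := by
    refine ⟨?_⟩
    rw [Category.assoc, fromSpec_comp_hom, ← Spec.map_comp, ← Spec.map_comp,
      ← CommRingCat.ofHom_comp, ← CommRingCat.ofHom_comp]
    congr 2
    ext c
    refine Filter.Germ.coe_eq.2 ?_
    filter_upwards [hmem] with p hp
    exact evalAt_const hp c
  have hex : ValuativeCriterion.Existence X.hom := by
    have h : UniversallyClosed X.hom := inferInstance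
    rw [UniversallyClosed.eq_valuativeCriterion] at h
    exact h.1
  obtain ⟨⟨ℓ, hℓ1, hℓ2⟩⟩ := hex ⟨boundedGerms 𝒰, Filter.Germ (𝒰 : Filter (CPoints X)) ℂ,
    _, _, hsq⟩
  dsimp only at ℓ hℓ1 hℓ2
  have hι : (stdPart 𝒰).comp ι = RingHom.id ℂ := by
    ext c
    exact Filter.Tendsto.limUnder_eq (f := (𝒰 : Filter (CPoints X))) (g := fun _ => c) tendsto_const_nhds
  -- The limit of the ultrafilter: the extended point, specialised by the standard part.
  obtain ⟨p₀, hp₀⟩ : ∃ p₀ : CPoints X, p₀.hom = Spec.map (CommRingCat.ofHom (stdPart 𝒰)) ≫ ℓ :=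
    ⟨⟨Spec.map (CommRingCat.ofHom (stdPart 𝒰)) ≫ ℓ, by
        rw [Category.assoc, hℓ2, ← Spec.map_comp, ← CommRingCat.ofHom_comp, hι]
        exact Spec.map_id _⟩, rfl⟩
  refine ⟨p₀, trivial, ?_⟩
  rw [TopologicalSpace.nhds_generateFrom]
  refine le_iInf₂ fun S hS => ?_
  obtain ⟨hpS, U', f, V, hV, rfl⟩ := hS
  rw [Filter.le_principal_iff]
  -- The standard part is a local homomorphism, so an open set that contains the limit contains the
  -- closed point of the valuation ring, hence the whole of its spectrum.
  have hcl : Spec.map (CommRingCat.ofHom (stdPart 𝒰))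
      (IsLocalRing.closedPoint (CommRingCat.of ℂ)) =
      IsLocalRing.closedPoint (CommRingCat.of (boundedGerms 𝒰)) := by
    have := isLocalHom_stdPart 𝒰
    exact IsLocalRing.comap_closedPoint (stdPart 𝒰)
  have hpt : p₀.pt = ℓ (IsLocalRing.closedPoint (CommRingCat.of (boundedGerms 𝒰))) := by
    rw [← hcl, CPoints.pt, hp₀]
    exact Scheme.Hom.comp_apply _ _ _
  have hT : ⊤ ≤ ℓ ⁻¹ᵁ U' := (Scheme.preimage_eq_top_of_closedPoint_mem
    (R := CommRingCat.of (boundedGerms 𝒰)) ℓ (hpt ▸ hpS.1)).ge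
  have hT2 : ⊤ ≤ (Spec.map (CommRingCat.ofHom (germHom hmem)) ≫ hU.fromSpec) ⁻¹ᵁ U' := by
    rw [← hℓ1]
    intro y _
    exact hT (x := Spec.map (CommRingCat.ofHom (algebraMap (boundedGerms 𝒰)
        (Filter.Germ (𝒰 : Filter (CPoints X)) ℂ))) y) trivial
  obtain ⟨hmem', hev⟩ := pull_eq_germ hU hmem hT2 f
  have hev2 : (algebraMap (boundedGerms 𝒰) (Filter.Germ (𝒰 : Filter (CPoints X)) ℂ))
      (pull ℓ U' hT f) = ((evalAt U' f : CPoints X → ℂ) :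
        Filter.Germ (𝒰 : Filter (CPoints X)) ℂ) := by
    rw [← hev, ← pull_comp ℓ _ hT (by rw [hℓ1]; exact hT2)]
    exact pull_congr hℓ1 _ _ _
  have hb : ((evalAt U' f : CPoints X → ℂ) : Filter.Germ (𝒰 : Filter (CPoints X)) ℂ) ∈
      boundedGerms 𝒰 := hev2 ▸ (pull ℓ U' hT f).2
  have hlim := tendsto_stdPart hb
  have hst : stdPart 𝒰 ⟨_, hb⟩ = evalAt U' f p₀ := by
    have e1 : (⟨_, hb⟩ : boundedGerms 𝒰) = pull ℓ U' hT f := Subtype.ext hev2.symm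
    have hT3 : ⊤ ≤ (Spec.map (CommRingCat.ofHom (stdPart 𝒰)) ≫ ℓ) ⁻¹ᵁ U' :=
      hp₀ ▸ le_preimage_of_pt_mem hpS.1
    rw [evalAt_of_mem hpS.1, evalHom_eq_pull, e1, ← pull_comp ℓ (stdPart 𝒰) hT hT3 f]
    exact (pull_congr (R := ℂ) hp₀ _ _ _).symm
  rw [hst] at hlim
  exact hmem'.and (hlim (hV.mem_nhds hpS.2))

end Compact

/-! ## Holomorphic functions of several variables -/

section Holomorphic

variable {E : Type} [NormedAddCommGroup E] [NormedSpace ℂ E]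
  {F : Type} [NormedAddCommGroup F] [NormedSpace ℂ F]

/-- The Cauchy estimate on balls of half the radius, on which `f` varies by at most 2. -/
lemma exists_fderiv_bound {f : E → F} {Ω : Set E} (hΩ : IsOpen Ω) (hf : DifferentiableOn ℂ f Ω)
    {x₀ : E} (hx₀ : x₀ ∈ Ω) :
    ∃ r > 0, ∃ M, Metric.ball x₀ r ⊆ Ω ∧ ∀ x ∈ Metric.ball x₀ r, ‖fderiv ℂ f x‖ ≤ M := by
  have hc : ContinuousAt f x₀ := (hf.continuousOn.continuousAt (hΩ.mem_nhds hx₀))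
  have h1 : ∀ᶠ x in 𝓝 x₀, x ∈ Ω ∧ f x ∈ Metric.ball (f x₀) 1 :=
    Filter.Eventually.and (hΩ.mem_nhds hx₀) (hc (Metric.ball_mem_nhds _ one_pos))
  obtain ⟨r, hr, h2⟩ := Metric.eventually_nhds_iff_ball.1 h1
  refine ⟨r / 2, by positivity, 2 / (r / 2), fun x hx => (h2 x ?_).1, fun x hx => ?_⟩
  · exact Metric.ball_subset_ball (by linarith) hx
  · have hsub : Metric.ball x (r / 2) ⊆ Metric.ball x₀ r := by
      refine Metric.ball_subset_ball' ?_
      have := Metric.mem_ball.1 hx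
      linarith
    refine Complex.norm_fderiv_le_div_of_mapsTo_ball (R₂ := 2)
      (hf.mono fun y hy => (h2 y (hsub hy)).1) (fun y hy => ?_) (by positivity)
    have a1 := (h2 y (hsub hy)).2
    have a2 := (h2 x (Metric.ball_subset_ball (by linarith) hx)).2
    rw [Metric.mem_ball] at *
    exact ((dist_triangle_right (f y) (f x) (f x₀)).trans_lt (add_lt_add a1 a2)).le.trans
      (by norm_num)

/-- By Cauchy's formula the derivative in the direction `v` is an integral of `f` over a circle in
that direction. Differentiation under this integral needs only the local bound on the derivative of
`f`, not its continuity. -/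
lemma differentiableAt_fderiv_apply [FiniteDimensional ℂ E] [FiniteDimensional ℂ F] {f : E → F} {Ω : Set E} (hΩ : IsOpen Ω)
    (hf : DifferentiableOn ℂ f Ω) {x₀ : E} (hx₀ : x₀ ∈ Ω) (v : E) :
    DifferentiableAt ℂ (fun x => fderiv ℂ f x v) x₀ := by
  obtain ⟨r, hr, M, hrΩ, hM⟩ := exists_fderiv_bound hΩ hf hx₀
  have : CompleteSpace F := FiniteDimensional.complete ℂ F
  have hMM : 0 ≤ M := (norm_nonneg _).trans (hM x₀ (Metric.mem_ball_self hr))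
  -- a radius `ρ` of a circle in direction `v`
  obtain ⟨ρ, hρ, hρv⟩ : ∃ ρ > 0, ρ * ‖v‖ < r / 2 := by
    refine ⟨r / 2 / (‖v‖ + 1), by positivity, ?_⟩
    rw [div_mul_eq_mul_div, div_lt_iff₀ (by positivity)]
    nlinarith [norm_nonneg v]
  have hmem : ∀ x ∈ Metric.ball x₀ (r / 2), ∀ z ∈ Metric.closedBall (0 : ℂ) ρ,
      x + z • v ∈ Metric.ball x₀ r := by
    intro x hx z hz
    rw [Metric.mem_ball, dist_eq_norm] at *
    rw [mem_closedBall_zero_iff] at hz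
    calc ‖x + z • v - x₀‖ = ‖(x - x₀) + z • v‖ := by congr 1; abel
      _ ≤ ‖x - x₀‖ + ‖z‖ * ‖v‖ := (norm_add_le _ _).trans (by rw [norm_smul])
      _ ≤ ‖x - x₀‖ + ρ * ‖v‖ := by gcongr
      _ < r := by linarith
  have hdiff : ∀ x ∈ Metric.ball x₀ r, DifferentiableAt ℂ f x := fun x hx =>
    hf.differentiableAt (hΩ.mem_nhds (hrΩ hx))
  have hCauchy : ∀ x ∈ Metric.ball x₀ (r / 2), fderiv ℂ f x v =
      (2 * Real.pi * Complex.I : ℂ)⁻¹ • ∮ z in C(0, ρ), (z ^ 2)⁻¹ • f (x + z • v) := by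
    intro x hx
    have hd : deriv (fun z : ℂ => f (x + z • v)) 0 = fderiv ℂ f x v := by
      have h0 : HasFDerivAt f (fderiv ℂ f x) (x + (0 : ℂ) • v) := by
        rw [zero_smul, add_zero]
        exact (hdiff x (Metric.ball_subset_ball (by linarith) hx)).hasFDerivAt
      have h1 : HasDerivAt (fun z : ℂ => x + z • v) v 0 := by
        simpa using ((hasDerivAt_id (0 : ℂ)).smul_const v).const_add x
      exact (h0.comp_hasDerivAt 0 h1).deriv
    rw [← hd]
    have hopen : IsOpen {z : ℂ | x + z • v ∈ Metric.ball x₀ r} :=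
      Metric.isOpen_ball.preimage (by fun_prop)
    have := Complex.two_pi_I_inv_smul_circleIntegral_sub_sq_inv_smul_of_differentiable
      (U := {z : ℂ | x + z • v ∈ Metric.ball x₀ r}) (c := 0) (w₀ := 0) (R := ρ)
      (f := fun z : ℂ => f (x + z • v)) hopen (fun z hz => hmem x hx z hz)
      (fun z hz => by
        have := hdiff _ hz
        exact DifferentiableAt.differentiableWithinAt (by fun_prop)) (Metric.mem_ball_self hρ)
    rw [← this]
    simp
  have hintg : ∀ x ∈ Metric.ball x₀ (r / 2), Continuous fun θ : ℝ =>
      deriv (circleMap 0 ρ) θ • (circleMap 0 ρ θ ^ 2)⁻¹ • f (x + circleMap 0 ρ θ • v) := by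
    intro x hx
    have hne : ∀ θ, circleMap 0 ρ θ ^ 2 ≠ 0 := fun θ => pow_ne_zero _ (by simp [hρ.ne'])
    have hc : Continuous fun θ : ℝ => f (x + circleMap 0 ρ θ • v) := by
      rw [continuous_iff_continuousAt]
      intro θ
      refine ContinuousAt.comp (g := f) (f := fun θ : ℝ => x + circleMap 0 ρ θ • v) ?_ ?_
      · exact (hdiff _ (hmem x hx _ (by simp [abs_of_pos hρ]))).continuousAt
      · exact (by fun_prop : Continuous fun θ : ℝ => x + circleMap 0 ρ θ • v).continuousAt
    simp only [deriv_circleMap]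
    exact (by fun_prop : Continuous fun θ : ℝ => circleMap 0 ρ θ * Complex.I).smul
      (((continuous_circleMap 0 ρ).pow 2).inv₀ hne |>.smul hc)
  have hmain : DifferentiableAt ℂ (fun x => ∫ θ in (0)..(2 * Real.pi),
      deriv (circleMap 0 ρ) θ • (circleMap 0 ρ θ ^ 2)⁻¹ • f (x + circleMap 0 ρ θ • v)) x₀ := by
    have hb : x₀ ∈ Metric.ball x₀ (r / 2) := Metric.mem_ball_self (by positivity)
    have : SecondCountableTopology E := by
      have := FiniteDimensional.proper ℂ E
      infer_instance
    let _ : MeasurableSpace E := borel E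
    have : BorelSpace E := ⟨rfl⟩
    refine (intervalIntegral.hasFDerivAt_integral_of_dominated_of_fderiv_le
      (s := Metric.ball x₀ (r / 2)) (bound := fun _ => ρ * (ρ ^ 2)⁻¹ * M)
      (F' := fun x θ => deriv (circleMap 0 ρ) θ • (circleMap 0 ρ θ ^ 2)⁻¹ •
        fderiv ℂ f (x + circleMap 0 ρ θ • v)) (Metric.ball_mem_nhds _ (by positivity))
      ?_ ?_ ?_ ?_ ?_ ?_).differentiableAt
    · filter_upwards [Metric.ball_mem_nhds x₀ (by positivity : 0 < r / 2)] with x hx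
      exact (hintg x hx).aestronglyMeasurable
    · exact (hintg x₀ hb).intervalIntegrable _ _
    · have hx : ∀ θ : ℝ, x₀ + circleMap 0 ρ θ • v ∈ Metric.ball x₀ r := fun θ =>
        hmem x₀ hb _ (by simp [abs_of_pos hρ])
      have hne : ∀ θ, circleMap 0 ρ θ ^ 2 ≠ 0 := fun θ => pow_ne_zero _ (by simp [hρ.ne'])
      have : SecondCountableTopology (E →L[ℂ] F) := by
        have := FiniteDimensional.proper ℂ (E →L[ℂ] F)
        infer_instance
      let _ : MeasurableSpace (E →L[ℂ] F) := borel _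
      have : BorelSpace (E →L[ℂ] F) := ⟨rfl⟩
      have h1 : Measurable fun θ : ℝ => fderiv ℂ f (x₀ + circleMap 0 ρ θ • v) :=
        (measurable_fderiv ℂ f).comp
          (by fun_prop : Continuous fun θ : ℝ => x₀ + circleMap 0 ρ θ • v).measurable
      have h2 : Continuous fun θ : ℝ => deriv (circleMap 0 ρ) θ * (circleMap 0 ρ θ ^ 2)⁻¹ := by
        simp only [deriv_circleMap]
        exact (by fun_prop : Continuous fun θ : ℝ => circleMap 0 ρ θ * Complex.I).mul
          (((continuous_circleMap 0 ρ).pow 2).inv₀ hne)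
      have h3 := h2.aestronglyMeasurable (μ := volume.restrict (Set.uIoc 0 (2 * Real.pi)))
        |>.smul h1.aestronglyMeasurable
      refine h3.congr (Filter.Eventually.of_forall fun θ => ?_)
      simp [mul_smul]
    · refine Filter.Eventually.of_forall fun θ _ x hx => ?_
      rw [norm_smul, norm_smul, deriv_circleMap, norm_inv, norm_pow]
      simp only [norm_mul, norm_circleMap_zero, Complex.norm_I, mul_one, abs_of_pos hρ]
      rw [← mul_assoc]
      gcongr
      exact hM _ (hmem x hx _ (by simp [abs_of_pos hρ]))
    · exact intervalIntegrable_const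
    · refine Filter.Eventually.of_forall fun θ _ x hx => ?_
      have h1 : HasFDerivAt f (fderiv ℂ f (x + circleMap 0 ρ θ • v)) (x + circleMap 0 ρ θ • v) :=
        (hdiff _ (hmem x hx _ (by simp [abs_of_pos hρ]))).hasFDerivAt
      have h2 : HasFDerivAt (fun x => f (x + circleMap 0 ρ θ • v))
          (fderiv ℂ f (x + circleMap 0 ρ θ • v)) x := by
        have := h1.comp x ((hasFDerivAt_id x).add_const (circleMap 0 ρ θ • v))
        rwa [ContinuousLinearMap.comp_id] at this
      exact (h2.const_smul _).const_smul _
  refine (hmain.const_smul (2 * Real.pi * Complex.I : ℂ)⁻¹).congr_of_eventuallyEq ?_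
  filter_upwards [Metric.ball_mem_nhds x₀ (by positivity : 0 < r / 2)] with x hx
  rw [hCauchy x hx]
  rfl

/-- Induction with the target space varying: the derivative is a sum of constant linear maps applied
to directional derivatives, which are holomorphic again. -/
lemma contDiffOn_of_differentiableOn_aux {n : ℕ} (k : ℕ) {F : Type} [NormedAddCommGroup F]
    [NormedSpace ℂ F] [FiniteDimensional ℂ F] {f : (Fin n → ℂ) → F} {Ω : Set (Fin n → ℂ)}
    (hΩ : IsOpen Ω) (hf : DifferentiableOn ℂ f Ω) : ContDiffOn ℂ k f Ω := by
  induction k generalizing F with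
  | zero => simpa using hf.continuousOn
  | succ k ih =>
    rw [Nat.cast_succ, contDiffOn_succ_iff_fderiv_of_isOpen hΩ]
    refine ⟨hf, by simp, ih ?_⟩
    intro x hx
    refine DifferentiableAt.differentiableWithinAt ?_
    have h : fderiv ℂ f = fun x => ∑ j : Fin n,
        ContinuousLinearMap.smulRightL ℂ (Fin n → ℂ) F (ContinuousLinearMap.proj j)
          (fderiv ℂ f x (Pi.single j 1)) := by
      ext x u
      rw [sum_apply]
      change fderiv ℂ f x u = ∑ j, u j • fderiv ℂ f x (Pi.single j 1)
      simp only [← map_smul, ← map_sum]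
      congr 1
      ext i
      simp [Pi.single_apply]
    rw [h]
    refine DifferentiableAt.fun_sum fun j _ => ?_
    exact (ContinuousLinearMap.differentiableAt _).comp x
      (differentiableAt_fderiv_apply hΩ hf hx _)

/-- Holomorphic functions are smooth. -/
theorem contDiffOn_of_differentiableOn {n : ℕ} {F : Type} [NormedAddCommGroup F]
    [NormedSpace ℂ F] [FiniteDimensional ℂ F] {f : (Fin n → ℂ) → F} {Ω : Set (Fin n → ℂ)}
    (hΩ : IsOpen Ω) (hf : DifferentiableOn ℂ f Ω) : ContDiffOn ℂ ∞ f Ω :=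
  contDiffOn_infty.2 fun k => contDiffOn_of_differentiableOn_aux k hΩ hf

end Holomorphic

/-! ## Wirtinger calculus -/

section Wirtinger

variable {n N : ℕ}

/-- `∂φ/∂w_j` for a holomorphic function `φ`. -/
def cpartial (j : Fin n) (φ : (Fin n → ℂ) → ℂ) (w : Fin n → ℂ) : ℂ :=
  fderiv ℂ φ w (Pi.single j 1)

lemma real_linear_apply (L : (Fin N → ℂ) →L[ℝ] ℂ) (v : Fin N → ℂ) :
    L v = ∑ a, ((L (Pi.single a 1) - Complex.I * L (Pi.single a Complex.I)) / 2 * v a +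
      (L (Pi.single a 1) + Complex.I * L (Pi.single a Complex.I)) / 2 *
        (starRingEnd ℂ) (v a)) := by
  have hv : v = ∑ a, ((v a).re • (Pi.single a 1 : Fin N → ℂ) +
      (v a).im • (Pi.single a Complex.I : Fin N → ℂ)) := by
    ext b
    simp only [Finset.sum_apply, Pi.add_apply, Pi.smul_apply, Pi.single_apply]
    rw [Finset.sum_eq_single b]
    · simp
    · intro a _ hab
      simp [hab.symm]
    · simp
  conv_lhs => rw [hv, map_sum]
  refine Finset.sum_congr rfl fun a _ => ?_
  rw [map_add, map_smul, map_smul, Complex.real_smul, Complex.real_smul]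
  have h1 : v a = (v a).re + (v a).im * Complex.I := (Complex.re_add_im (v a)).symm
  have h2 : (starRingEnd ℂ) (v a) = (v a).re - (v a).im * Complex.I := by
    apply Complex.ext <;> simp
  rw [h2]
  conv_rhs => rw [h1]
  have hI : Complex.I ^ 2 = -1 := Complex.I_sq
  simp only [Complex.add_re, Complex.ofReal_re, Complex.mul_re, Complex.I_re, mul_zero,
    Complex.ofReal_im, Complex.I_im, mul_one, sub_self, add_zero, Complex.add_im, Complex.mul_im,
    zero_add]
  ring_nf
  rw [hI]
  ring

lemma fderiv_comp_single {F : (Fin N → ℂ) → ℂ} {φ : (Fin n → ℂ) → (Fin N → ℂ)} {w : Fin n → ℂ}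
    (hF : DifferentiableAt ℝ F (φ w)) (hφ : DifferentiableAt ℂ φ w) (k : Fin n) (c : ℂ) :
    fderiv ℝ (fun w' => F (φ w')) w (Pi.single k c) =
      ∑ a, (dz a F (φ w) * (c * cpartial k (fun w' => φ w' a) w) +
        dzbar a F (φ w) * (starRingEnd ℂ) (c * cpartial k (fun w' => φ w' a) w)) := by
  have h1 : HasFDerivAt (fun w' => F (φ w'))
      ((fderiv ℝ F (φ w)).comp ((fderiv ℂ φ w).restrictScalars ℝ)) w :=
    hF.hasFDerivAt.comp w (hφ.hasFDerivAt.restrictScalars ℝ)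
  rw [h1.fderiv]
  have h2 : ∀ a, fderiv ℂ φ w (Pi.single k c) a = c * cpartial k (fun w' => φ w' a) w := by
    intro a
    have e : (Pi.single k c : Fin n → ℂ) = c • Pi.single k 1 := by
      ext i; simp [Pi.single_apply]
    rw [e, map_smul, Pi.smul_apply, smul_eq_mul, cpartial]
    congr 1
    have := (hasFDerivAt_pi'.1 hφ.hasFDerivAt) a
    rw [this.fderiv]
    rfl
  rw [ContinuousLinearMap.comp_apply, real_linear_apply]
  refine Finset.sum_congr rfl fun a _ => ?_
  rw [ContinuousLinearMap.coe_restrictScalars', h2]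
  rfl

lemma dzbar_comp {F : (Fin N → ℂ) → ℂ} {φ : (Fin n → ℂ) → (Fin N → ℂ)} {w : Fin n → ℂ}
    (hF : DifferentiableAt ℝ F (φ w)) (hφ : DifferentiableAt ℂ φ w) (k : Fin n) :
    dzbar k (fun w' => F (φ w')) w =
      ∑ a, dzbar a F (φ w) * (starRingEnd ℂ) (cpartial k (fun w' => φ w' a) w) := by
  rw [dzbar, fderiv_comp_single hF hφ, fderiv_comp_single hF hφ, Finset.mul_sum,
    ← Finset.sum_add_distrib, Finset.sum_div]
  refine Finset.sum_congr rfl fun a _ => ?_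
  simp only [map_mul, map_one, Complex.conj_I]
  ring_nf
  rw [Complex.I_sq]
  ring

lemma dz_comp {F : (Fin N → ℂ) → ℂ} {φ : (Fin n → ℂ) → (Fin N → ℂ)} {w : Fin n → ℂ}
    (hF : DifferentiableAt ℝ F (φ w)) (hφ : DifferentiableAt ℂ φ w) (k : Fin n) :
    dz k (fun w' => F (φ w')) w =
      ∑ a, dz a F (φ w) * cpartial k (fun w' => φ w' a) w := by
  rw [dz, fderiv_comp_single hF hφ, fderiv_comp_single hF hφ, Finset.mul_sum,
    ← Finset.sum_sub_distrib, Finset.sum_div]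
  refine Finset.sum_congr rfl fun a _ => ?_
  simp only [map_mul, map_one, Complex.conj_I]
  ring_nf
  rw [Complex.I_sq]
  ring

lemma dz_add {F G : (Fin n → ℂ) → ℂ} {w : Fin n → ℂ} (hF : DifferentiableAt ℝ F w)
    (hG : DifferentiableAt ℝ G w) (k : Fin n) :
    dz k (fun w' => F w' + G w') w = dz k F w + dz k G w := by
  simp only [dz]
  rw [fderiv_fun_add hF hG]
  simp only [add_apply]
  ring

lemma dzbar_add {F G : (Fin n → ℂ) → ℂ} {w : Fin n → ℂ} (hF : DifferentiableAt ℝ F w)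
    (hG : DifferentiableAt ℝ G w) (k : Fin n) :
    dzbar k (fun w' => F w' + G w') w = dzbar k F w + dzbar k G w := by
  simp only [dzbar]
  rw [fderiv_fun_add hF hG]
  simp only [add_apply]
  ring

lemma dz_sum {ι : Type} (s : Finset ι) {F : ι → (Fin n → ℂ) → ℂ} {w : Fin n → ℂ}
    (hF : ∀ i ∈ s, DifferentiableAt ℝ (F i) w) (k : Fin n) :
    dz k (fun w' => ∑ i ∈ s, F i w') w = ∑ i ∈ s, dz k (F i) w := by
  simp only [dz]
  rw [fderiv_fun_sum hF]
  simp only [sum_apply]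
  rw [Finset.mul_sum, ← Finset.sum_sub_distrib, Finset.sum_div]

lemma dz_mul {F G : (Fin n → ℂ) → ℂ} {w : Fin n → ℂ} (hF : DifferentiableAt ℝ F w)
    (hG : DifferentiableAt ℝ G w) (k : Fin n) :
    dz k (fun w' => F w' * G w') w = dz k F w * G w + F w * dz k G w := by
  simp only [dz]
  rw [fderiv_fun_mul hF hG]
  simp only [add_apply, smul_apply, smul_eq_mul]
  ring

lemma fderiv_real_of_holomorphic {φ : (Fin n → ℂ) → ℂ} {w : Fin n → ℂ}
    (hφ : DifferentiableAt ℂ φ w) (k : Fin n) (c : ℂ) :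
    fderiv ℝ φ w (Pi.single k c) = c * cpartial k φ w := by
  rw [(hφ.hasFDerivAt.restrictScalars ℝ).fderiv]
  have e : (Pi.single k c : Fin n → ℂ) = c • Pi.single k 1 := by
    ext i; simp [Pi.single_apply]
  rw [ContinuousLinearMap.coe_restrictScalars', e, map_smul, smul_eq_mul]
  rfl

lemma fderiv_real_conj {φ : (Fin n → ℂ) → ℂ} {w : Fin n → ℂ}
    (hφ : DifferentiableAt ℂ φ w) (u : Fin n → ℂ) :
    fderiv ℝ (fun w' => (starRingEnd ℂ) (φ w')) w u = (starRingEnd ℂ) (fderiv ℝ φ w u) := by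
  have h := (Complex.conjCLE.toContinuousLinearMap.hasFDerivAt (x := φ w)).comp w
    (hφ.restrictScalars ℝ).hasFDerivAt
  have h' : HasFDerivAt (fun w' => (starRingEnd ℂ) (φ w'))
    (Complex.conjCLE.toContinuousLinearMap.comp (fderiv ℝ φ w)) w := h
  rw [h'.fderiv]
  rfl

lemma dz_conj {φ : (Fin n → ℂ) → ℂ} {w : Fin n → ℂ} (hφ : DifferentiableAt ℂ φ w) (k : Fin n) :
    dz k (fun w' => (starRingEnd ℂ) (φ w')) w = 0 := by
  rw [dz, fderiv_real_conj hφ, fderiv_real_conj hφ, fderiv_real_of_holomorphic hφ,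
    fderiv_real_of_holomorphic hφ]
  simp only [map_mul, map_one, Complex.conj_I]
  ring_nf
  rw [Complex.I_sq]
  ring

lemma dzbar_holomorphic {φ : (Fin n → ℂ) → ℂ} {w : Fin n → ℂ} (hφ : DifferentiableAt ℂ φ w)
    (k : Fin n) : dzbar k φ w = 0 := by
  rw [dzbar, fderiv_real_of_holomorphic hφ, fderiv_real_of_holomorphic hφ]
  ring_nf
  rw [Complex.I_sq]
  ring

lemma dzbar_conj {φ : (Fin n → ℂ) → ℂ} {w : Fin n → ℂ} (hφ : DifferentiableAt ℂ φ w)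
    (k : Fin n) : dzbar k (fun w' => (starRingEnd ℂ) (φ w')) w =
      (starRingEnd ℂ) (cpartial k φ w) := by
  rw [dzbar, fderiv_real_conj hφ, fderiv_real_conj hφ, fderiv_real_of_holomorphic hφ,
    fderiv_real_of_holomorphic hφ]
  simp only [map_mul, map_one, Complex.conj_I]
  ring_nf
  rw [Complex.I_sq]
  ring

lemma dzbar_congr {F G : (Fin n → ℂ) → ℂ} {w : Fin n → ℂ} (h : F =ᶠ[𝓝 w] G) (k : Fin n) :
    dzbar k F w = dzbar k G w := by
  rw [dzbar, dzbar, h.fderiv_eq]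

lemma dz_congr {F G : (Fin n → ℂ) → ℂ} {w : Fin n → ℂ} (h : F =ᶠ[𝓝 w] G) (k : Fin n) :
    dz k F w = dz k G w := by
  rw [dz, dz, h.fderiv_eq]

lemma differentiableAt_dzbar {F : (Fin N → ℂ) → ℂ} {V : Set (Fin N → ℂ)} (hV : IsOpen V)
    (hF : ContDiffOn ℝ ∞ F V) {z : Fin N → ℂ} (hz : z ∈ V) (a : Fin N) :
    DifferentiableAt ℝ (dzbar a F) z := by
  have h1 : ContDiffAt ℝ ∞ F z := hF.contDiffAt (hV.mem_nhds hz)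
  have h2 : DifferentiableAt ℝ (fderiv ℝ F) z :=
    (h1.fderiv_right (m := 1) (by norm_cast)).differentiableAt (by simp)
  unfold dzbar
  fun_prop

lemma differentiableAt_cpartial {φ : (Fin n → ℂ) → ℂ} {Ω : Set (Fin n → ℂ)} (hΩ : IsOpen Ω)
    (hφ : DifferentiableOn ℂ φ Ω) {w : Fin n → ℂ} (hw : w ∈ Ω) (k : Fin n) :
    DifferentiableAt ℂ (cpartial k φ) w :=
  differentiableAt_fderiv_apply hΩ hφ hw _

lemma dzbar_re {g : (Fin n → ℂ) → ℂ} {w : Fin n → ℂ} (hg : DifferentiableAt ℂ g w) (k : Fin n) :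
    dzbar k (fun w' => ((g w').re : ℂ)) w = (starRingEnd ℂ) (cpartial k g w / 2) := by
  have h0 : (fun w' => ((g w').re : ℂ)) =
      fun w' => g w' / 2 + (starRingEnd ℂ) (g w' / 2) := by
    ext w'
    rw [Complex.re_eq_add_conj, map_div₀, add_div, map_ofNat]
  have hg2 : DifferentiableAt ℂ (fun w' => g w' / 2) w := by
    simp only [div_eq_mul_inv]
    exact hg.mul_const _
  have hc : DifferentiableAt ℝ (fun w' => (starRingEnd ℂ) (g w' / 2)) w :=
    (Complex.conjCLE.toContinuousLinearMap.differentiableAt).comp w (hg2.restrictScalars ℝ)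
  rw [h0, dzbar_add (hg2.restrictScalars ℝ) hc, dzbar_holomorphic hg2, dzbar_conj hg2, zero_add]
  congr 1
  simp only [cpartial, div_eq_mul_inv]
  rw [fderiv_mul_const hg]
  simp [mul_comm]

/-- The Jacobian matrix of a holomorphic map. -/
def cjacobian (φ : (Fin n → ℂ) → (Fin N → ℂ)) (w : Fin n → ℂ) : Matrix (Fin N) (Fin n) ℂ :=
  Matrix.of fun a j => cpartial j (fun w' => φ w' a) w

/-- For holomorphic `φ` the conjugated Jacobian is annihilated by `∂`, so no second derivatives of
`φ` occur; the real part of a holomorphic function is pluriharmonic and drops out. -/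
theorem complexHessian_comp_add_re {u : (Fin n → ℂ) → ℝ} {F : (Fin N → ℂ) → ℝ}
    {φ : (Fin n → ℂ) → (Fin N → ℂ)} {g : (Fin n → ℂ) → ℂ} {Ω : Set (Fin n → ℂ)}
    {V : Set (Fin N → ℂ)} (hΩ : IsOpen Ω) (hV : IsOpen V) (hF : ContDiffOn ℝ ∞ F V)
    (hφ : DifferentiableOn ℂ φ Ω) (hφV : ∀ w ∈ Ω, φ w ∈ V) (hg : DifferentiableOn ℂ g Ω)
    (hu : ∀ w ∈ Ω, u w = F (φ w) + (g w).re) {w : Fin n → ℂ} (hw : w ∈ Ω) :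
    complexHessian u w = (cjacobian φ w).transpose * complexHessian F (φ w) *
      (cjacobian φ w).map (starRingEnd ℂ) := by
  have hFc : ContDiffOn ℝ ∞ (fun z => (F z : ℂ)) V :=
    Complex.ofRealCLM.contDiff.comp_contDiffOn hF
  have hFd : ∀ z ∈ V, DifferentiableAt ℝ (fun z => (F z : ℂ)) z := fun z hz =>
    (hFc.contDiffAt (hV.mem_nhds hz)).differentiableAt (by simp)
  have hφd : ∀ w ∈ Ω, DifferentiableAt ℂ φ w := fun w hw => hφ.differentiableAt (hΩ.mem_nhds hw)
  have hφa : ∀ a, DifferentiableOn ℂ (fun w => φ w a) Ω := fun a =>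
    differentiableOn_pi.1 hφ a
  have hgd : ∀ w ∈ Ω, DifferentiableAt ℂ g w := fun w hw => hg.differentiableAt (hΩ.mem_nhds hw)
  have hconj : ∀ {ψ : (Fin n → ℂ) → ℂ} {w : Fin n → ℂ}, DifferentiableAt ℂ ψ w →
      DifferentiableAt ℝ (fun w' => (starRingEnd ℂ) (ψ w')) w := fun h =>
    (Complex.conjCLE.toContinuousLinearMap.differentiableAt).comp _ (h.restrictScalars ℝ)
  have h1 : ∀ k, ∀ w' ∈ Ω, dzbar k (fun w'' => (u w'' : ℂ)) w' =
      ∑ a, dzbar a (fun z => (F z : ℂ)) (φ w') *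
        (starRingEnd ℂ) (cpartial k (fun w'' => φ w'' a) w') +
        (starRingEnd ℂ) (cpartial k g w' / 2) := by
    intro k w' hw'
    have e : (fun w'' => (u w'' : ℂ)) =ᶠ[𝓝 w'] fun w'' => (F (φ w'') : ℂ) + ((g w'').re : ℂ) := by
      filter_upwards [hΩ.mem_nhds hw'] with w'' hw''
      rw [hu w'' hw'']
      push_cast
      rfl
    rw [dzbar_congr e, dzbar_add, dzbar_comp (hFd _ (hφV _ hw')) (hφd _ hw'), dzbar_re (hgd _ hw')]
    · exact (hFd _ (hφV _ hw')).comp w' ((hφd _ hw').restrictScalars ℝ)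
    · exact Complex.ofRealCLM.differentiableAt.comp w'
        (Complex.reCLM.differentiableAt.comp w' ((hgd _ hw').restrictScalars ℝ))
  ext j k
  have e2 : (fun w' => dzbar k (fun w'' => (u w'' : ℂ)) w') =ᶠ[𝓝 w] fun w' =>
      ∑ a, dzbar a (fun z => (F z : ℂ)) (φ w') *
        (starRingEnd ℂ) (cpartial k (fun w'' => φ w'' a) w') +
        (starRingEnd ℂ) (cpartial k g w' / 2) := by
    filter_upwards [hΩ.mem_nhds hw] with w' hw' using h1 k w' hw'
  have hcp : ∀ a, DifferentiableAt ℂ (cpartial k (fun w'' => φ w'' a)) w := fun a =>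
    differentiableAt_cpartial hΩ (hφa a) hw k
  have hdz : ∀ a, DifferentiableAt ℝ (fun w' => dzbar a (fun z => (F z : ℂ)) (φ w')) w := fun a =>
    (differentiableAt_dzbar hV hFc (hφV _ hw) a).comp w ((hφd _ hw).restrictScalars ℝ)
  have hcg : DifferentiableAt ℂ (fun w' => cpartial k g w' / 2) w := by
    simp only [div_eq_mul_inv]
    exact (differentiableAt_cpartial hΩ hg hw k).mul_const _
  have hL : complexHessian u w j k = dz j (fun w' => dzbar k (fun w'' => (u w'' : ℂ)) w') w := rfl
  rw [hL, dz_congr e2, dz_add (DifferentiableAt.fun_sum fun a _ => (hdz a).fun_mul (hconj (hcp a)))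
    (hconj hcg), dz_conj hcg, add_zero, dz_sum _ (fun a _ => (hdz a).fun_mul (hconj (hcp a)))]
  simp only [Matrix.mul_apply, Matrix.map_apply, Matrix.transpose_apply]
  refine Finset.sum_congr rfl fun a _ => ?_
  rw [dz_mul (hdz a) (hconj (hcp a)), dz_conj (hcp a), mul_zero, add_zero,
    dz_comp (differentiableAt_dzbar hV hFc (hφV _ hw) a) (hφd _ hw)]
  congr 1
  refine Finset.sum_congr rfl fun b _ => ?_
  rw [mul_comm]
  rfl

end Wirtinger

/-! ## Linear algebra and polynomials -/

section CauchyBinet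

lemma det_mul_eq_sum {R : Type} [CommRing R] {n N : ℕ} (A : Matrix (Fin n) (Fin N) R)
    (B : Matrix (Fin N) (Fin n) R) :
    (A * B).det = ∑ κ : Fin n → Fin N, (∏ i, A i (κ i)) * (B.submatrix κ id).det := by
  have h : A * B = fun i => ∑ k, A i k • B k := by
    ext i j
    simp [Matrix.mul_apply]
  rw [h]
  have := (Matrix.detRowAlternating (R := R) (n := Fin n)).toMultilinearMap.map_sum
    (fun i k => A i k • B k)
  refine this.trans (Finset.sum_congr rfl fun κ _ => ?_)
  have h2 := (Matrix.detRowAlternating (R := R) (n := Fin n)).toMultilinearMap.map_smul_univ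
    (fun i => A i (κ i)) (fun i => B (κ i))
  exact h2

/-- The Cauchy–Binet formula. -/
theorem factorial_mul_det_mul {R : Type} [CommRing R] {n N : ℕ} (A : Matrix (Fin n) (Fin N) R)
    (B : Matrix (Fin N) (Fin n) R) :
    (n.factorial : R) * (A * B).det =
      ∑ κ : Fin n → Fin N, (A.submatrix id κ).det * (B.submatrix κ id).det := by
  -- Reindexing by `σ` leaves the sum unchanged and moves the sign from the minor of `B` to the
  -- product. Summation over all `σ` then assembles the minors of `A`; the factorial appears because
  -- the sum runs over maps and not over subsets.
  have h1 : ∀ σ : Equiv.Perm (Fin n), (A * B).det =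
      ∑ κ : Fin n → Fin N, (Equiv.Perm.sign σ : ℤ) • (∏ i, A i (κ (σ i))) *
        (B.submatrix κ id).det := by
    intro σ
    rw [det_mul_eq_sum, ← (Equiv.arrowCongr σ (Equiv.refl (Fin N))).symm.sum_comp]
    refine Finset.sum_congr rfl fun κ _ => ?_
    have : ((Equiv.arrowCongr σ (Equiv.refl (Fin N))).symm κ) = κ ∘ σ := by
      ext i; simp [Equiv.arrowCongr]
    rw [this]
    have h3 : (B.submatrix (κ ∘ σ) id).det = (Equiv.Perm.sign σ : ℤ) •
        (B.submatrix κ id).det := by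
      have := Matrix.det_permute σ (B.submatrix κ id)
      rw [Matrix.submatrix_submatrix, Function.comp_id] at this
      rw [this, zsmul_eq_mul]
    rw [h3]
    simp only [Function.comp_apply, zsmul_eq_mul]
    ring
  have h2 : (n.factorial : R) * (A * B).det = ∑ _σ : Equiv.Perm (Fin n), (A * B).det := by
    rw [Finset.sum_const, Finset.card_univ, Fintype.card_perm, Fintype.card_fin, nsmul_eq_mul]
  rw [h2]
  calc ∑ _σ : Equiv.Perm (Fin n), (A * B).det
      = ∑ σ : Equiv.Perm (Fin n), ∑ κ : Fin n → Fin N, (Equiv.Perm.sign σ : ℤ) •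
        (∏ i, A i (κ (σ i))) * (B.submatrix κ id).det := Finset.sum_congr rfl fun σ _ => h1 σ
    _ = _ := by
      rw [Finset.sum_comm]
      refine Finset.sum_congr rfl fun κ _ => ?_
      rw [← Finset.sum_mul]
      congr 1
      rw [← Matrix.det_transpose, Matrix.det_apply]
      rfl

/-- If all maximal minors vanish, then by Cauchy–Binet the Gram matrix is singular, and a kernel
vector of the Gram matrix is a kernel vector of `J`. -/
lemma exists_minor_ne_zero {n N : ℕ} (J : Matrix (Fin N) (Fin n) ℂ)
    (h : ∀ u : Fin n → ℂ, J.mulVec u = 0 → u = 0) :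
    ∃ κ : Fin n → Fin N, (J.submatrix κ id).det ≠ 0 := by
  by_contra! hcon
  have h1 := factorial_mul_det_mul J.conjTranspose J
  simp only [hcon, mul_zero, Finset.sum_const_zero, mul_eq_zero, Nat.cast_eq_zero,
    Nat.factorial_ne_zero, false_or] at h1
  obtain ⟨v, hv, hv2⟩ := Matrix.exists_mulVec_eq_zero_iff.2 h1
  rw [Matrix.conjTranspose_mul_self_mulVec_eq_zero] at hv2
  exact hv (h v hv2)

/-- Cauchy–Binet applied twice. It bounds the density of `ωⁿ` by the squared minors of the Jacobian,
which are the densities of Lebesgue measure pulled back by n-tuples of coordinates. -/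
lemma norm_det_sandwich_le {n N : ℕ} (J : Matrix (Fin N) (Fin n) ℂ) (H : Matrix (Fin N) (Fin N) ℂ)
    {C : ℝ} (hC : ∀ κ ν : Fin n → Fin N, ‖(H.submatrix κ ν).det‖ ≤ C) :
    ‖(J.transpose * H * J.map (starRingEnd ℂ)).det‖ ≤
      C * (Fintype.card (Fin n → Fin N)) * ∑ κ : Fin n → Fin N, ‖(J.submatrix κ id).det‖ ^ 2 := by
  have hJ : ∀ κ : Fin n → Fin N, ((J.map (starRingEnd ℂ)).submatrix κ id).det =
      (starRingEnd ℂ) (J.submatrix κ id).det := by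
    intro κ
    rw [RingHom.map_det]
    rfl
  -- The bound `C` is known to be nonnegative only if there is an index map; otherwise the
  -- Cauchy–Binet sum is empty and the determinant is zero.
  have hC0 : 0 ≤ C ∨ IsEmpty (Fin n → Fin N) := by
    by_cases hne : Nonempty (Fin n → Fin N)
    · obtain ⟨κ⟩ := hne
      exact Or.inl ((norm_nonneg _).trans (hC κ κ))
    · exact Or.inr (not_nonempty_iff.1 hne)
  have hf1 : (1 : ℝ) ≤ n.factorial := by exact_mod_cast Nat.factorial_pos n
  have h2 : ∀ κ : Fin n → Fin N, ((n.factorial : ℂ)) *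
      ((H * J.map (starRingEnd ℂ)).submatrix κ id).det =
      ∑ ν : Fin n → Fin N, (H.submatrix κ ν).det * (starRingEnd ℂ) (J.submatrix ν id).det := by
    intro κ
    have : (H * J.map (starRingEnd ℂ)).submatrix κ id =
        H.submatrix κ id * J.map (starRingEnd ℂ) := by
      ext; simp [Matrix.mul_apply]
    rw [this, factorial_mul_det_mul]
    refine Finset.sum_congr rfl fun ν _ => ?_
    rw [hJ, Matrix.submatrix_submatrix]
    rfl
  have h1 := factorial_mul_det_mul J.transpose (H * J.map (starRingEnd ℂ))
  rw [← Matrix.mul_assoc] at h1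
  have h3 : ∀ κ : Fin n → Fin N, ‖((H * J.map (starRingEnd ℂ)).submatrix κ id).det‖ ≤
      C * ∑ ν : Fin n → Fin N, ‖(J.submatrix ν id).det‖ := by
    intro κ
    have e := congrArg norm (h2 κ)
    rw [norm_mul, Complex.norm_natCast] at e
    calc ‖((H * J.map (starRingEnd ℂ)).submatrix κ id).det‖
        ≤ n.factorial * ‖((H * J.map (starRingEnd ℂ)).submatrix κ id).det‖ :=
          le_mul_of_one_le_left (norm_nonneg _) hf1
      _ ≤ ∑ ν : Fin n → Fin N, ‖(H.submatrix κ ν).det *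
          (starRingEnd ℂ) (J.submatrix ν id).det‖ := e ▸ norm_sum_le _ _
      _ ≤ ∑ ν : Fin n → Fin N, C * ‖(J.submatrix ν id).det‖ := by
          refine Finset.sum_le_sum fun ν _ => ?_
          rw [norm_mul, RCLike.norm_conj]
          exact mul_le_mul_of_nonneg_right (hC κ ν) (norm_nonneg _)
      _ = _ := by rw [Finset.mul_sum]
  have e := congrArg norm h1
  rw [norm_mul, Complex.norm_natCast] at e
  rcases hC0 with hC0 | hemp
  · calc ‖(J.transpose * H * J.map (starRingEnd ℂ)).det‖
        ≤ n.factorial * ‖(J.transpose * H * J.map (starRingEnd ℂ)).det‖ :=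
          le_mul_of_one_le_left (norm_nonneg _) hf1
      _ ≤ ∑ κ : Fin n → Fin N, ‖(J.transpose.submatrix id κ).det *
          ((H * J.map (starRingEnd ℂ)).submatrix κ id).det‖ := e ▸ norm_sum_le _ _
      _ ≤ ∑ κ : Fin n → Fin N, ‖(J.submatrix κ id).det‖ *
          (C * ∑ ν : Fin n → Fin N, ‖(J.submatrix ν id).det‖) := by
          refine Finset.sum_le_sum fun κ _ => ?_
          rw [norm_mul]
          have : (J.transpose.submatrix id κ).det = (J.submatrix κ id).det := by
            rw [← Matrix.det_transpose]; rfl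
          rw [this]
          exact mul_le_mul_of_nonneg_left (h3 κ) (norm_nonneg _)
      _ = C * (∑ κ : Fin n → Fin N, ‖(J.submatrix κ id).det‖) ^ 2 := by
          rw [← Finset.sum_mul]; ring
      _ ≤ C * ((Fintype.card (Fin n → Fin N)) *
          ∑ κ : Fin n → Fin N, ‖(J.submatrix κ id).det‖ ^ 2) := by
          refine mul_le_mul_of_nonneg_left ?_ hC0
          exact sq_sum_le_card_mul_sum_sq
      _ = _ := by ring
  · have : ‖(J.transpose * H * J.map (starRingEnd ℂ)).det‖ ≤ 0 := by
      have : (n.factorial : ℝ) * ‖(J.transpose * H * J.map (starRingEnd ℂ)).det‖ = 0 := by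
        rw [e]; simp
      have h0 := (mul_eq_zero.1 this).resolve_left (by positivity)
      exact h0.le
    simpa using this

end CauchyBinet

section Poly

lemma mvPolynomial_eq_zero_of_eventually {n : ℕ} {P : MvPolynomial (Fin n) ℂ} {z : Fin n → ℂ}
    (h : ∀ᶠ y in 𝓝 z, MvPolynomial.eval y P = 0) : P = 0 := by
  obtain ⟨r, hr, hb⟩ := Metric.eventually_nhds_iff_ball.1 h
  refine (MvPolynomial.funext_set_iff (fun i => Metric.ball (z i) r) fun i =>
    infinite_of_mem_nhds (z i) (Metric.ball_mem_nhds _ hr)).2 fun y hy => ?_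
  rw [map_zero]
  refine hb y ?_
  rw [ball_pi _ hr]
  exact hy

/-- The specialization of a polynomial over `ℂ[y]` at a point. -/
def spec {n : ℕ} (P : Polynomial (MvPolynomial (Fin n) ℂ)) (z : Fin n → ℂ) : Polynomial ℂ :=
  P.map (MvPolynomial.eval z)

lemma map_eval₂_eq {n : ℕ} {B : Type} [CommRing B] (Y : MvPolynomial (Fin n) ℂ →+* B)
    (ψ : B →+* ℂ) (hψ : ∀ c, ψ (Y (MvPolynomial.C c)) = c) (P : Polynomial (MvPolynomial (Fin n) ℂ))
    (f : B) : ψ (P.eval₂ Y f) = (spec P fun i => ψ (Y (MvPolynomial.X i))).eval (ψ f) := by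
  rw [Polynomial.hom_eval₂, spec, Polynomial.eval_map]
  congr 1
  apply MvPolynomial.ringHom_ext
  · intro c
    simp [hψ]
  · intro i
    simp

end Poly

/-! ### Algebraic relations over a polynomial ring -/

section Relations

variable {n : ℕ}

lemma exists_minimal_relation {B : Type} [CommRing B] {R : Type} [CommRing R] (Y : R →+* B) {f : B}
    (hf : ∃ P : Polynomial R, P ≠ 0 ∧ P.eval₂ Y f = 0) :
    ∃ P : Polynomial R, P ≠ 0 ∧ P.eval₂ Y f = 0 ∧
      ∀ Q : Polynomial R, Q ≠ 0 → Q.eval₂ Y f = 0 → P.natDegree ≤ Q.natDegree := by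
  classical
  have hex : ∃ d, ∃ P : Polynomial R, P ≠ 0 ∧ P.eval₂ Y f = 0 ∧ P.natDegree = d := by
    obtain ⟨P, h1, h2⟩ := hf
    exact ⟨_, P, h1, h2, rfl⟩
  obtain ⟨P, h1, h2, h3⟩ := Nat.find_spec hex
  exact ⟨P, h1, h2, fun Q hQ hQ2 => h3 ▸ Nat.find_min' hex ⟨Q, hQ, hQ2, rfl⟩⟩

variable {B : Type} [CommRing B] [IsDomain B]

/-- In a relation of minimal degree the derivative cannot vanish at `f`: it has smaller degree, and
in characteristic zero it is nonzero because a constant relation would contradict injectivity. -/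
lemma exists_separable_relation {B R : Type} [CommRing B] [CommRing R] [IsDomain R] [CharZero R]
    (Y : R →+* B)
    (hY : Function.Injective Y) {f : B} (hf : ∃ P : Polynomial R, P ≠ 0 ∧ P.eval₂ Y f = 0) :
    ∃ P : Polynomial R, P.eval₂ Y f = 0 ∧ P.derivative.eval₂ Y f ≠ 0 := by
  obtain ⟨P, h1, h2, h3⟩ := exists_minimal_relation Y hf
  refine ⟨P, h2, fun h => ?_⟩
  by_cases hd : P.derivative = 0
  · have hC := Polynomial.eq_C_of_derivative_eq_zero hd
    rw [hC, Polynomial.eval₂_C] at h2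
    have := (map_eq_zero_iff Y hY).1 h2
    rw [this, Polynomial.C_0] at hC
    exact h1 hC
  · have h4 := h3 _ hd h
    have h5 : P.natDegree ≠ 0 := fun h0 => hd (Polynomial.derivative_of_natDegree_zero h0)
    have := Polynomial.natDegree_derivative_lt h5
    omega

/-- A relation of minimal degree with vanishing constant coefficient could be divided by the
variable, since `f` is not a zero divisor. -/
lemma exists_relation_coeff_zero_ne {R : Type} [CommRing R] (Y : R →+* B) {f : B} (hf0 : f ≠ 0)
    (hf : ∃ P : Polynomial R, P ≠ 0 ∧ P.eval₂ Y f = 0) :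
    ∃ P : Polynomial R, P.eval₂ Y f = 0 ∧ P.coeff 0 ≠ 0 := by
  obtain ⟨P, h1, h2, h3⟩ := exists_minimal_relation Y hf
  refine ⟨P, h2, fun h => ?_⟩
  have e : P = Polynomial.X * P.divX := by
    conv_lhs => rw [← Polynomial.divX_mul_X_add P, h, Polynomial.C_0, add_zero]
    rw [mul_comm]
  have hd : P.divX ≠ 0 := fun h0 => h1 (by rw [e, h0, mul_zero])
  have h4 : P.divX.eval₂ Y f = 0 := by
    rw [e, Polynomial.eval₂_mul, Polynomial.eval₂_X] at h2
    exact (mul_eq_zero.1 h2).resolve_left hf0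
  have h5 := h3 _ hd h4
  rw [Polynomial.natDegree_divX_eq_natDegree_tsub_one] at h5
  have h6 : P.natDegree = 0 := by omega
  have h7 := Polynomial.eq_C_of_natDegree_eq_zero h6
  rw [h, Polynomial.C_0] at h7
  exact h1 h7

/-- An element transcendental over the subalgebra would extend the `n` independent elements to `n +
1`. -/
lemma exists_relation_of_trdeg {K : Type} [Field K] [Algebra ℂ K] (h : Algebra.trdeg ℂ K = n)
    {y : Fin n → K} (hy : AlgebraicIndependent ℂ y) (f : K) :
    ∃ P : Polynomial (MvPolynomial (Fin n) ℂ), P ≠ 0 ∧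
      P.eval₂ (MvPolynomial.aeval y : MvPolynomial (Fin n) ℂ →ₐ[ℂ] K).toRingHom f = 0 := by
  have halg : IsAlgebraic (Algebra.adjoin ℂ (Set.range y)) f := by
    by_contra hcon
    have := (hy.option_iff_transcendental f).2 hcon
    have hc := this.lift_cardinalMk_le_trdeg
    rw [h] at hc
    simp at hc
  obtain ⟨P, hP, hP2⟩ := halg
  refine ⟨P.map hy.aevalEquiv.symm.toRingEquiv.toRingHom, ?_, ?_⟩
  · rw [Polynomial.map_ne_zero_iff]
    · exact hP
    · exact hy.aevalEquiv.symm.injective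
  · rw [Polynomial.eval₂_map, ← hP2, Polynomial.aeval_def]
    congr 1
    ext a
    have := hy.aevalEquiv.apply_symm_apply a
    have h2 := congrArg (Subtype.val) this
    rw [hy.aevalEquiv_apply_coe] at h2
    exact h2

end Relations

section InverseFunction

/-- The inverse function theorem for holomorphic maps. -/
theorem exists_localHomeo {n : ℕ} {φ : (Fin n → ℂ) → (Fin n → ℂ)} {Ω : Set (Fin n → ℂ)}
    (hΩ : IsOpen Ω) (hφ : DifferentiableOn ℂ φ Ω) {w : Fin n → ℂ} (hw : w ∈ Ω)
    (hdet : (cjacobian φ w).det ≠ 0) :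
    ∃ e : OpenPartialHomeomorph (Fin n → ℂ) (Fin n → ℂ), w ∈ e.source ∧ e.source ⊆ Ω ∧
      ∀ w' ∈ e.source, e w' = φ w' := by
  have hc : ContDiffAt ℂ 1 φ w :=
    ((contDiffOn_of_differentiableOn hΩ hφ).contDiffAt (hΩ.mem_nhds hw)).of_le (by simp)
  have hd : DifferentiableAt ℂ φ w := hφ.differentiableAt (hΩ.mem_nhds hw)
  have hL : LinearMap.toMatrix' (fderiv ℂ φ w).toLinearMap = cjacobian φ w := by
    ext a j
    rw [LinearMap.toMatrix'_apply, cjacobian, Matrix.of_apply, cpartial]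
    have := (hasFDerivAt_pi'.1 hd.hasFDerivAt) a
    rw [this.fderiv]
    simp
  have hu : IsUnit (LinearMap.det (fderiv ℂ φ w).toLinearMap) := by
    rw [← LinearMap.det_toMatrix', hL]
    exact hdet.isUnit
  let L : (Fin n → ℂ) ≃L[ℂ] (Fin n → ℂ) :=
    (LinearEquiv.ofIsUnitDet (f := (fderiv ℂ φ w).toLinearMap) (v := Pi.basisFun ℂ (Fin n))
      (v' := Pi.basisFun ℂ (Fin n)) (by
        rw [LinearMap.toMatrix_eq_toMatrix', hL]
        exact hdet.isUnit)).toContinuousLinearEquiv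
  have hs : HasStrictFDerivAt φ (L : (Fin n → ℂ) →L[ℂ] (Fin n → ℂ)) w := by
    have hLeq : (L : (Fin n → ℂ) →L[ℂ] (Fin n → ℂ)) = fderiv ℂ φ w := by
      ext u a
      rfl
    rw [hLeq]
    exact hc.hasStrictFDerivAt (by simp)
  let e := hs.toOpenPartialHomeomorph φ
  refine ⟨e.restrOpen Ω hΩ, ?_, ?_, ?_⟩
  · exact ⟨hs.mem_toOpenPartialHomeomorph_source, hw⟩
  · exact fun x hx => hx.2
  · intro w' _
    rfl

end InverseFunction

/-! ## Regular functions in charts -/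

/-- The homomorphism from a polynomial ring given by `n` regular functions. -/
def polyHom {X : CScheme} {n : ℕ} (U : X.left.Opens) (y : Fin n → Γ(X.left, U)) :
    MvPolynomial (Fin n) ℂ →+* Γ(X.left, U) :=
  MvPolynomial.eval₂Hom (const X U) y

/-! ### Sections as rational functions -/

section FunctionField

variable {X : CScheme} [IsIntegral X.left]

/-- Regular functions as rational functions. -/
def toK (U : X.left.Opens) [Nonempty U] : Γ(X.left, U) →+* FunField X :=
  (X.left.germToFunctionField U).hom

lemma toK_injective (U : X.left.Opens) [Nonempty U] : Function.Injective (toK (X := X) U) :=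
  Scheme.germToFunctionField_injective X.left U

lemma stalkToK_germ (U : X.left.Opens) [Nonempty U] {x : X.left} (hx : x ∈ U) (f : Γ(X.left, U)) :
    stalkToK X x (X.left.presheaf.germ U x hx f) = toK U f :=
  Scheme.algebraMap_germ_eq_germToFunctionField X.left hx f

lemma toK_res {U V : X.left.Opens} [Nonempty U] [Nonempty V] (i : V ≤ U) (f : Γ(X.left, U)) :
    toK V (X.left.presheaf.map (homOfLE i).op f) = toK U f := by
  obtain ⟨x⟩ := ‹Nonempty V›
  rw [← stalkToK_germ V x.2, ← stalkToK_germ U (i x.2)]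
  congr 1
  exact TopCat.Presheaf.germ_res_apply _ (homOfLE i) _ x.2 f

lemma algebraMap_eq_toK (U : X.left.Opens) [Nonempty U] (c : ℂ) :
    algebraMap ℂ (FunField X) c = toK U (const X U c) := by
  have : Nonempty (⊤ : X.left.Opens) := ⟨⟨genericPoint X.left, trivial⟩⟩
  have h1 : algebraMap ℂ (FunField X) c = toK (X := X) ⊤ (const X ⊤ c) := by
    rw [← stalkToK_germ ⊤ (x := genericPoint X.left) trivial]
    rfl
  rw [h1, ← toK_res (le_top : U ≤ ⊤)]
  congr 1
  simp only [const, CommRingCat.hom_comp, RingHom.comp_apply]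
  have := X.left.presheaf.map_comp (homOfLE (le_refl (⊤ : X.left.Opens))).op
    (homOfLE (le_top : U ≤ ⊤)).op
  exact congr($(this).hom (X.hom.appTop.hom ((Scheme.ΓSpecIso (CommRingCat.of ℂ)).inv.hom c))).symm

instance isDomain_section (U : X.left.Opens) [Nonempty U] : IsDomain Γ(X.left, U) :=
  inferInstance

lemma toK_polyHom {n : ℕ} (U : X.left.Opens) [Nonempty U] (y : Fin n → Γ(X.left, U)) :
    (toK U).comp (polyHom U y) =
      (MvPolynomial.aeval (fun i => toK U (y i)) : _ →ₐ[ℂ] FunField X).toRingHom := by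
  apply MvPolynomial.ringHom_ext
  · intro c
    simp [polyHom, algebraMap_eq_toK U c]
  · intro i
    simp [polyHom]

lemma exists_relation {n : ℕ} (hdim : Algebra.trdeg ℂ (FunField X) = n) {U : X.left.Opens}
    [Nonempty U] {y : Fin n → Γ(X.left, U)} (hy : Function.Injective (polyHom U y))
    (f : Γ(X.left, U)) :
    ∃ P : Polynomial (MvPolynomial (Fin n) ℂ), P ≠ 0 ∧ P.eval₂ (polyHom U y) f = 0 := by
  have hind : AlgebraicIndependent ℂ fun i => toK U (y i) := by
    have : Function.Injective ((toK U).comp (polyHom U y)) := by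
      rw [RingHom.coe_comp]
      exact (toK_injective U).comp hy
    rw [toK_polyHom] at this
    exact this
  obtain ⟨P, hP, h⟩ := exists_relation_of_trdeg hdim hind (toK U f)
  refine ⟨P, hP, ?_⟩
  rw [← toK_polyHom, ← Polynomial.hom_eval₂] at h
  exact (map_eq_zero_iff _ (toK_injective U)).1 h

end FunctionField

section Chart

variable {X : CScheme} {n : ℕ} (χ : HolChart X n)

/-- A regular function, in a chart. -/
def cfun (U : X.left.Opens) (f : Γ(X.left, U)) (w : Fin n → ℂ) : ℂ :=
  evalAt U f (χ.toHomeo.symm w)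

/-- The part of the target of a chart that lies over `U`. -/
def cdom (U : X.left.Opens) : Set (Fin n → ℂ) :=
  {w ∈ χ.toHomeo.target | (χ.toHomeo.symm w).pt ∈ U}

lemma isOpen_cdom (U : X.left.Opens) : IsOpen (cdom χ U) :=
  χ.toHomeo.isOpen_inter_preimage_symm (isOpen_setOf_pt_mem U)

lemma differentiableOn_cfun (U : X.left.Opens) (f : Γ(X.left, U)) :
    DifferentiableOn ℂ (cfun χ U f) (cdom χ U) := χ.holomorphic U f

/-- Several regular functions, in a chart. -/
def cmap {N : ℕ} (U : X.left.Opens) (f : Fin N → Γ(X.left, U)) (w : Fin n → ℂ) : Fin N → ℂ :=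
  fun i => cfun χ U (f i) w

lemma differentiableOn_cmap {N : ℕ} (U : X.left.Opens) (f : Fin N → Γ(X.left, U)) :
    DifferentiableOn ℂ (cmap χ U f) (cdom χ U) :=
  differentiableOn_pi.2 fun i => differentiableOn_cfun χ U (f i)

lemma differentiableAt_cmap {N : ℕ} {U : X.left.Opens} (f : Fin N → Γ(X.left, U))
    {w : Fin n → ℂ} (hw : w ∈ cdom χ U) : DifferentiableAt ℂ (cmap χ U f) w :=
  (differentiableOn_cmap χ U f).differentiableAt ((isOpen_cdom χ U).mem_nhds hw)

lemma cfun_eval₂Hom {N : ℕ} {U : X.left.Opens} (f : Fin N → Γ(X.left, U)) {w : Fin n → ℂ}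
    (hw : w ∈ cdom χ U) (P : MvPolynomial (Fin N) ℂ) :
    cfun χ U (MvPolynomial.eval₂Hom (const X U) f P) w = MvPolynomial.eval (cmap χ U f w) P :=
  evalAt_eval₂Hom f hw.2 P

lemma fderiv_pi_apply {N : ℕ} {φ : (Fin n → ℂ) → (Fin N → ℂ)} {w : Fin n → ℂ}
    (h : DifferentiableAt ℂ φ w) (u : Fin n → ℂ) : fderiv ℂ φ w u = (cjacobian φ w).mulVec u := by
  ext a
  have h1 := (hasFDerivAt_pi'.1 h.hasFDerivAt) a
  have h2 : fderiv ℂ φ w u a = fderiv ℂ (fun w' => φ w' a) w u := by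
    rw [h1.fderiv]; rfl
  rw [h2, Matrix.mulVec, dotProduct]
  have hu : u = ∑ j, u j • (Pi.single j 1 : Fin n → ℂ) := by
    ext i
    simp [Pi.single_apply]
  conv_lhs => rw [hu, map_sum]
  refine Finset.sum_congr rfl fun j _ => ?_
  rw [map_smul, smul_eq_mul, mul_comm]
  rfl

/-- The immersion property provides some function with nonzero derivative along `u`. It is a
quotient of polynomials in the generators, so its derivative factors through the Jacobian of the
generators. -/
lemma jacobian_mulVec_injective {N : ℕ} {U : X.left.Opens} (hU : IsAffineOpen U)
    {f : Fin N → Γ(X.left, U)}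
    (hf : Function.Surjective (MvPolynomial.eval₂Hom (const X U) f)) {w : Fin n → ℂ}
    (hw : w ∈ cdom χ U) (u : Fin n → ℂ) (hu : (cjacobian (cmap χ U f) w).mulVec u = 0) :
    u = 0 := by
  by_contra hne
  obtain ⟨U', g, hU', hg⟩ := χ.immersion w hw.1 u hne
  apply hg
  obtain ⟨r, s, hs, h⟩ := exists_fraction hU hw.2 hU' g
  obtain ⟨R, rfl⟩ := hf r
  obtain ⟨S, rfl⟩ := hf s
  have hd := differentiableAt_cmap χ f hw
  have hs' : MvPolynomial.eval (cmap χ U f w) S ≠ 0 := by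
    rw [← cfun_eval₂Hom χ f hw]; exact hs
  have hcont : ContinuousAt (fun w' => MvPolynomial.eval (cmap χ U f w') S) w :=
    (MvPolynomial.continuous_eval S).continuousAt.comp hd.continuousAt
  have hev : (fun w' => evalAt U' g (χ.toHomeo.symm w')) =ᶠ[𝓝 w] fun w' =>
      MvPolynomial.eval (cmap χ U f w') R / MvPolynomial.eval (cmap χ U f w') S := by
    filter_upwards [(isOpen_cdom χ U).mem_nhds hw, hcont.eventually_ne hs'] with w' hw' hs2
    have := (h (χ.toHomeo.symm w') hw'.2 (by
      rw [evalAt_eval₂Hom f hw'.2]; exact hs2)).2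
    rw [this, evalAt_eval₂Hom f hw'.2, evalAt_eval₂Hom f hw'.2]
    rfl
  rw [hev.fderiv_eq]
  have hpoly : ∀ Q : MvPolynomial (Fin N) ℂ, Differentiable ℂ fun z => MvPolynomial.eval z Q :=
    fun Q => by
      induction Q using MvPolynomial.induction_on with
      | C a => simp
      | add p q hp hq => simp only [map_add]; exact hp.add hq
      | mul_X p i hp =>
        simp only [map_mul, MvPolynomial.eval_X]
        exact hp.mul (differentiable_apply i)
  have hq : DifferentiableAt ℂ (fun z => MvPolynomial.eval z R / MvPolynomial.eval z S)
      (cmap χ U f w) := by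
    simp only [div_eq_mul_inv]
    exact (hpoly R _).fun_mul ((hpoly S _).fun_inv hs')
  have hcomp := hq.hasFDerivAt.comp w hd.hasFDerivAt
  have hcomp' : HasFDerivAt (fun w' => MvPolynomial.eval (cmap χ U f w') R /
      MvPolynomial.eval (cmap χ U f w') S) _ w := hcomp
  rw [hcomp'.fderiv, ContinuousLinearMap.comp_apply, fderiv_pi_apply hd, hu, map_zero]

lemma exists_coords {N : ℕ} {U : X.left.Opens} (hU : IsAffineOpen U)
    {f : Fin N → Γ(X.left, U)}
    (hf : Function.Surjective (MvPolynomial.eval₂Hom (const X U) f)) {w : Fin n → ℂ}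
    (hw : w ∈ cdom χ U) :
    ∃ κ : Fin n → Fin N, (cjacobian (cmap χ U (f ∘ κ)) w).det ≠ 0 :=
  exists_minor_ne_zero _ (jacobian_mulVec_injective χ hU hf hw)

lemma eventually_of_comp {φ : (Fin n → ℂ) → (Fin n → ℂ)} {Ω : Set (Fin n → ℂ)}
    (hΩ : IsOpen Ω) (hφ : DifferentiableOn ℂ φ Ω) {w : Fin n → ℂ} (hw : w ∈ Ω)
    (hdet : (cjacobian φ w).det ≠ 0) {Q : (Fin n → ℂ) → Prop} (h : ∀ᶠ w' in 𝓝 w, Q (φ w')) :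
    ∀ᶠ z in 𝓝 (φ w), Q z := by
  obtain ⟨e, hwe, -, he⟩ := exists_localHomeo hΩ hφ hw hdet
  rw [← he w hwe, ← e.map_nhds_eq hwe, Filter.eventually_map]
  filter_upwards [h, e.open_source.mem_nhds hwe] with w' h1 h2
  rwa [he w' h2]

/-- By the inverse function theorem the values of `y` fill an open set, on which a nonzero
polynomial cannot vanish. -/
lemma polyHom_injective {U : X.left.Opens} {y : Fin n → Γ(X.left, U)} {w : Fin n → ℂ}
    (hw : w ∈ cdom χ U) (hdet : (cjacobian (cmap χ U y) w).det ≠ 0) :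
    Function.Injective (polyHom U y) := by
  rw [injective_iff_map_eq_zero]
  intro P hP
  refine mvPolynomial_eq_zero_of_eventually (z := cmap χ U y w)
    (eventually_of_comp (isOpen_cdom χ U) (differentiableOn_cmap χ U y) hw hdet ?_)
  filter_upwards [(isOpen_cdom χ U).mem_nhds hw] with w' hw'
  rw [← cfun_eval₂Hom χ y hw']
  change cfun χ U (polyHom U y P) w' = 0
  rw [hP, cfun, evalAt_of_mem hw'.2, map_zero]

lemma cfun_eval₂ {U : X.left.Opens} (y : Fin n → Γ(X.left, U)) {w : Fin n → ℂ}
    (hw : w ∈ cdom χ U) (P : Polynomial (MvPolynomial (Fin n) ℂ)) (f : Γ(X.left, U)) :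
    cfun χ U (P.eval₂ (polyHom U y) f) w = (spec P (cmap χ U y w)).eval (cfun χ U f w) := by
  rw [cfun, evalAt_of_mem hw.2, map_eval₂_eq]
  · have h : cmap χ U y w = fun i => evalHom _ U hw.2 (y i) :=
      funext fun i => evalAt_of_mem hw.2 _
    rw [h, cfun, evalAt_of_mem hw.2]
    simp [polyHom]
  · intro c
    simp [polyHom, evalHom_const]

/-- A regular function that vanishes on a nonempty open subset of a chart is zero. -/
theorem eq_zero_of_eventually_cfun [IsIntegral X.left] [LocallyOfFiniteType X.hom]
    (hdim : Algebra.trdeg ℂ (FunField X) = n) {U : X.left.Opens} {f : Γ(X.left, U)}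
    {w : Fin n → ℂ} (hw : w ∈ cdom χ U) (h : ∀ᶠ w' in 𝓝 w, cfun χ U f w' = 0) : f = 0 := by
  obtain ⟨U', hU', hwU', hle⟩ := exists_isAffineOpen_mem_and_subset (X := X.left) (U := U) hw.2
  replace hle : U' ≤ U := hle
  have : Nonempty U := ⟨⟨_, hw.2⟩⟩
  have : Nonempty U' := ⟨⟨_, hwU'⟩⟩
  have hw' : w ∈ cdom χ U' := ⟨hw.1, hwU'⟩
  obtain ⟨N, g, hg⟩ := exists_generators hU'
  obtain ⟨κ, hκ⟩ := exists_coords χ hU' hg hw'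
  have hinj := polyHom_injective χ hw' hκ
  set f' := X.left.presheaf.map (homOfLE hle).op f with hf'
  suffices h0 : f' = 0 by
    rw [← map_eq_zero_iff _ (toK_injective U), ← toK_res hle, ← hf', h0, map_zero]
  by_contra hne
  -- Where `f` vanishes, its relation says that the constant coefficient of `P` vanishes at the
  -- coordinates. These fill an open set, so the constant coefficient would be zero.
  obtain ⟨P, hP1, hP2⟩ := exists_relation_coeff_zero_ne (polyHom U' (g ∘ κ)) hne
    (exists_relation hdim hinj f')
  apply hP2
  refine mvPolynomial_eq_zero_of_eventually (z := cmap χ U' (g ∘ κ) w)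
    (eventually_of_comp (isOpen_cdom χ U') (differentiableOn_cmap χ U' _) hw' hκ ?_)
  filter_upwards [(isOpen_cdom χ U').mem_nhds hw', h] with w1 h1 h2
  have h3 := cfun_eval₂ χ (g ∘ κ) h1 P f'
  have h4 : cfun χ U' f' w1 = 0 := by
    rw [← h2]
    exact evalAt_res hle f h1.2
  rw [hP1, h4, cfun, evalAt_of_mem h1.2, map_zero, ← Polynomial.coeff_zero_eq_eval_zero, spec,
    Polynomial.coeff_map] at h3
  exact h3.symm

end Chart

/-! ## Jacobians and rational differential forms -/

lemma alternatingMap_sum_smul {K M N : Type} [Field K] [AddCommGroup M] [Module K M]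
    [AddCommGroup N] [Module K N] {n : ℕ} (g : M [⋀^Fin n]→ₗ[K] N) (A : Matrix (Fin n) (Fin n) K)
    (v : Fin n → M) : g (fun i => ∑ j, A i j • v j) = A.det • g v := by
  have h : g.compLinearMap (Fintype.linearCombination K v) =
      (LinearMap.toSpanSingleton K N (g v)).compAlternatingMap Matrix.detRowAlternating := by
    refine Module.Basis.ext_alternating (Pi.basisFun K (Fin n)) fun r hr => ?_
    obtain ⟨σ, rfl⟩ : ∃ σ : Equiv.Perm (Fin n), r = σ :=
      ⟨Equiv.ofBijective r (Finite.injective_iff_bijective.1 hr), rfl⟩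
    have h1 := g.map_perm v σ
    have h2 := (Matrix.detRowAlternating (R := K) (n := Fin n)).map_perm (1 : Matrix _ _ K) σ
    have h3 : (Matrix.detRowAlternating fun i => (Pi.basisFun K (Fin n)) (σ i)) =
        ((Equiv.Perm.sign σ : ℤ) : K) := by
      have : (fun i => (Pi.basisFun K (Fin n)) (σ i)) = (1 : Matrix _ _ K) ∘ σ := by
        ext i j
        change Pi.basisFun K (Fin n) (σ i) j = (1 : Matrix _ _ K) (σ i) j
        rw [Matrix.one_apply, Pi.basisFun_apply, Pi.single_apply]
        exact if_congr eq_comm rfl rfl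
      rw [this, h2]
      change Equiv.Perm.sign σ • (1 : Matrix (Fin n) (Fin n) K).det = _
      rw [Matrix.det_one, Units.smul_def, zsmul_one]
    simp only [AlternatingMap.compLinearMap_apply, LinearMap.compAlternatingMap_apply, h3,
      LinearMap.toSpanSingleton_apply]
    rw [Int.cast_smul_eq_zsmul, ← Units.smul_def, ← h1]
    congr 1
    ext i
    simp [Fintype.linearCombination_apply, Pi.single_apply]
  exact congr($h A)

/-! ### The chain rule for derivations along a relation -/

section Leibniz

variable {B K M : Type} [CommRing B] [CommRing K] [AddCommGroup M] [Module K M] {n : ℕ}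

/-- The partial derivative of `P(y, f)` with respect to `y_j`. -/
def coeffPderiv (Y : MvPolynomial (Fin n) ℂ →+* B) (f : B) (j : Fin n)
    (P : Polynomial (MvPolynomial (Fin n) ℂ)) : B :=
  P.sum fun i c => Y (MvPolynomial.pderiv j c) * f ^ i

/-- The chain rule for a derivation `δ` along a ring homomorphism `ψ`. -/
lemma leibniz_eval₂ (ψ : B →+* K) (δ : B →+ M)
    (hδ : ∀ a b, δ (a * b) = ψ a • δ b + ψ b • δ a)
    (Y : MvPolynomial (Fin n) ℂ →+* B) (hc : ∀ c, δ (Y (MvPolynomial.C c)) = 0)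
    (P : Polynomial (MvPolynomial (Fin n) ℂ)) (f : B) :
    δ (P.eval₂ Y f) = ψ (P.derivative.eval₂ Y f) • δ f +
      ∑ j, ψ (coeffPderiv Y f j P) • δ (Y (MvPolynomial.X j)) := by
  have hpoly : ∀ c : MvPolynomial (Fin n) ℂ, δ (Y c) =
      ∑ j, ψ (Y (MvPolynomial.pderiv j c)) • δ (Y (MvPolynomial.X j)) := by
    intro c
    induction c using MvPolynomial.induction_on with
    | C a => simp [hc]
    | add p q hp hq => simp [hp, hq, add_smul, Finset.sum_add_distrib]
    | mul_X p i hp =>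
      rw [map_mul, hδ, hp]
      simp only [Derivation.leibniz, smul_eq_mul, map_add, map_mul, add_smul,
        Finset.sum_add_distrib, MvPolynomial.pderiv_X, Finset.smul_sum, mul_smul]
      congr 1
      rw [Finset.sum_eq_single i]
      · simp
      · intro b _ hb
        rw [Pi.single_eq_of_ne' hb]; simp
      · simp
  have hone : δ 1 = 0 := by simpa using hc 1
  have hpow : ∀ i : ℕ, δ (f ^ i) = ψ ((i : B) * f ^ (i - 1)) • δ f := by
    intro i
    induction i with
    | zero => simp [hone]
    | succ i ih =>
      rw [pow_succ, hδ, ih, smul_smul, ← add_smul, ← map_mul, ← map_add]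
      congr 2
      rcases i with _ | i
      · simp
      · simp only [Nat.add_sub_cancel]; push_cast; ring
  induction P using Polynomial.induction_on' with
  | add p q hp hq =>
    have h : ∀ j, coeffPderiv Y f j (p + q) = coeffPderiv Y f j p + coeffPderiv Y f j q :=
      fun j => Polynomial.sum_add_index _ _ _ (by simp) (by intros; simp [add_mul])
    simp only [Polynomial.eval₂_add, map_add, hp, hq, h, add_smul, Finset.sum_add_distrib]
    abel
  | monomial i c =>
    have h : ∀ j, coeffPderiv Y f j (Polynomial.monomial i c) =
        Y (MvPolynomial.pderiv j c) * f ^ i :=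
      fun j => Polynomial.sum_monomial_index _ _ (by simp)
    rw [Polynomial.derivative_monomial]
    simp only [Polynomial.eval₂_monomial, h, hδ, hpow, hpoly c, Finset.smul_sum, smul_smul,
      map_mul, map_natCast]
    congr 1
    · congr 1; ring
    · refine Finset.sum_congr rfl fun j _ => ?_
      rw [mul_comm]

end Leibniz

section Chart

variable {X : CScheme} {n : ℕ}

lemma polyHom_C {U : X.left.Opens} (y : Fin n → Γ(X.left, U)) (c : ℂ) :
    polyHom U y (MvPolynomial.C c) = const X U c := by simp [polyHom]

lemma polyHom_X {U : X.left.Opens} (y : Fin n → Γ(X.left, U)) (j : Fin n) :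
    polyHom U y (MvPolynomial.X j) = y j := by simp [polyHom]

lemma differentiableAt_cfun (χ : HolChart X n) {U : X.left.Opens} (f : Γ(X.left, U))
    {w : Fin n → ℂ} (hw : w ∈ cdom χ U) : DifferentiableAt ℂ (cfun χ U f) w :=
  (differentiableOn_cfun χ U f).differentiableAt ((isOpen_cdom χ U).mem_nhds hw)

lemma cfun_add (χ : HolChart X n) {U : X.left.Opens} (f g : Γ(X.left, U)) {w : Fin n → ℂ}
    (hw : w ∈ cdom χ U) : cfun χ U (f + g) w = cfun χ U f w + cfun χ U g w := by
  simp only [cfun, evalAt_of_mem hw.2, map_add]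

lemma cfun_mul (χ : HolChart X n) {U : X.left.Opens} (f g : Γ(X.left, U)) {w : Fin n → ℂ}
    (hw : w ∈ cdom χ U) : cfun χ U (f * g) w = cfun χ U f w * cfun χ U g w := by
  simp only [cfun, evalAt_of_mem hw.2, map_mul]

lemma cfun_pow (χ : HolChart X n) {U : X.left.Opens} (f : Γ(X.left, U)) (m : ℕ) {w : Fin n → ℂ}
    (hw : w ∈ cdom χ U) : cfun χ U (f ^ m) w = cfun χ U f w ^ m := by
  simp only [cfun, evalAt_of_mem hw.2, map_pow]

lemma cfun_const (χ : HolChart X n) {U : X.left.Opens} (c : ℂ) {w : Fin n → ℂ}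
    (hw : w ∈ cdom χ U) : cfun χ U (const X U c) w = c := by
  simp only [cfun, evalAt_of_mem hw.2, evalHom_const]

/-- The derivation given by a coordinate vector at a point of a chart. -/
def cderiv (χ : HolChart X n) (U : X.left.Opens) (k : Fin n) {w : Fin n → ℂ}
    (hw : w ∈ cdom χ U) : Γ(X.left, U) →+ ℂ where
  toFun f := cpartial k (cfun χ U f) w
  map_zero' := by
    have h : cfun χ U 0 = fun _ => 0 := by
      ext w'
      by_cases h' : (χ.toHomeo.symm w').pt ∈ U
      · rw [cfun, evalAt_of_mem h', map_zero]
      · rw [cfun, evalAt_of_notMem h']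
    simp [h, cpartial]
  map_add' f g := by
    have h : cfun χ U (f + g) =ᶠ[𝓝 w] fun w' => cfun χ U f w' + cfun χ U g w' := by
      filter_upwards [(isOpen_cdom χ U).mem_nhds hw] with w' hw'
      exact cfun_add χ f g hw'
    rw [cpartial, h.fderiv_eq, fderiv_fun_add (differentiableAt_cfun χ f hw)
      (differentiableAt_cfun χ g hw)]
    rfl

lemma cderiv_mul (χ : HolChart X n) (U : X.left.Opens) (k : Fin n) {w : Fin n → ℂ}
    (hw : w ∈ cdom χ U) (f g : Γ(X.left, U)) : cderiv χ U k hw (f * g) =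
      evalHom _ U hw.2 f • cderiv χ U k hw g + evalHom _ U hw.2 g • cderiv χ U k hw f := by
  have h : cfun χ U (f * g) =ᶠ[𝓝 w] fun w' => cfun χ U f w' * cfun χ U g w' := by
    filter_upwards [(isOpen_cdom χ U).mem_nhds hw] with w' hw'
    exact cfun_mul χ f g hw'
  change cpartial k _ w = _ • cpartial k _ w + _ • cpartial k _ w
  rw [cpartial, h.fderiv_eq, fderiv_fun_mul (differentiableAt_cfun χ f hw)
      (differentiableAt_cfun χ g hw), ← evalAt_of_mem hw.2, ← evalAt_of_mem hw.2]
  rfl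

lemma cderiv_const (χ : HolChart X n) (U : X.left.Opens) (k : Fin n) {w : Fin n → ℂ}
    (hw : w ∈ cdom χ U) (c : ℂ) : cderiv χ U k hw (const X U c) = 0 := by
  have h : cfun χ U (const X U c) =ᶠ[𝓝 w] fun _ => c := by
    filter_upwards [(isOpen_cdom χ U).mem_nhds hw] with w' hw'
    exact cfun_const χ c hw'
  change cpartial k _ w = 0
  rw [cpartial, h.fderiv_eq]
  simp

variable [IsIntegral X.left]

/-- The comparison of two `n`-forms, both rationally and in all charts. -/
theorem exists_comparison (hdim : Algebra.trdeg ℂ (FunField X) = n) {U : X.left.Opens}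
    [Nonempty U] {y : Fin n → Γ(X.left, U)} (hy : Function.Injective (polyHom U y))
    (f : Fin n → Γ(X.left, U)) :
    ∃ den num : Γ(X.left, U), den ≠ 0 ∧
      toK U den • dWedge (fun i => toK U (f i)) = toK U num • dWedge (fun i => toK U (y i)) ∧
      ∀ (χ : HolChart X n), ∀ w ∈ cdom χ U,
        cfun χ U den w * (cjacobian (cmap χ U f) w).det =
          cfun χ U num w * (cjacobian (cmap χ U y) w).det := by
  choose P hP1 hP2 using fun i =>
    exists_separable_relation (polyHom U y) hy (exists_relation hdim hy (f i))
  -- Differentiating `P i (y, f i) = 0` expresses the derivative of `P i` times `d(f i)` through the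
  -- `dy_j`. The same identity holds for Kähler differentials and for derivatives in a chart, so
  -- both comparisons have the same coefficients: the product of the `d i` and the determinant of
  -- `E`.
  let d : Fin n → Γ(X.left, U) := fun i => (P i).derivative.eval₂ (polyHom U y) (f i)
  let E : Matrix (Fin n) (Fin n) Γ(X.left, U) :=
    Matrix.of fun i j => - coeffPderiv (polyHom U y) (f i) j (P i)
  refine ⟨∏ i, d i, E.det, Finset.prod_ne_zero_iff.2 fun i _ => hP2 i, ?_, ?_⟩
  · let δ : Γ(X.left, U) →+ KaehlerDifferential ℂ (FunField X) :=
      (KaehlerDifferential.D ℂ (FunField X)).toLinearMap.toAddMonoidHom.comp (toK U).toAddMonoidHom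
    have key : ∀ i, toK U (d i) • KaehlerDifferential.D ℂ (FunField X) (toK U (f i)) =
        ∑ j, toK U (E i j) • KaehlerDifferential.D ℂ (FunField X) (toK U (y j)) := by
      intro i
      have h := leibniz_eval₂ (toK U) δ (fun a b => by simp [δ]) (polyHom U y) (fun c => by
        rw [polyHom_C]
        change KaehlerDifferential.D ℂ (FunField X) (toK U (const X U c)) = 0
        rw [← algebraMap_eq_toK, Derivation.map_algebraMap]) (P i) (f i)
      rw [hP1, map_zero] at h
      simp only [polyHom_X] at h
      rw [eq_comm, add_eq_zero_iff_eq_neg] at h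
      refine h.trans ?_
      simp only [E, Matrix.of_apply, map_neg, neg_smul, Finset.sum_neg_distrib]
      rfl
    have h1 := MultilinearMap.map_smul_univ
      (exteriorPower.ιMulti (FunField X) n (M := KaehlerDifferential ℂ (FunField X))).toMultilinearMap
      (fun i => toK U (d i)) (fun i => KaehlerDifferential.D ℂ (FunField X) (toK U (f i)))
    rw [map_prod]
    refine h1.symm.trans ?_
    simp only [key]
    refine (alternatingMap_sum_smul _ (E.map (toK U)) _).trans ?_
    congr 1
    exact ((toK U).map_det E).symm
  · intro χ w hw
    have key : ∀ i k, cfun χ U (d i) w * cpartial k (cfun χ U (f i)) w =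
        ∑ j, cfun χ U (E i j) w * cpartial k (cfun χ U (y j)) w := by
      intro i k
      have h := leibniz_eval₂ (evalHom _ U hw.2) (cderiv χ U k hw) (cderiv_mul χ U k hw)
        (polyHom U y) (fun c => by rw [polyHom_C, cderiv_const]) (P i) (f i)
      rw [hP1, map_zero] at h
      simp only [polyHom_X] at h
      rw [eq_comm, add_eq_zero_iff_eq_neg] at h
      simp only [cfun, evalAt_of_mem hw.2]
      refine h.trans ?_
      simp only [E, Matrix.of_apply, map_neg, neg_mul, Finset.sum_neg_distrib]
      rfl
    have h1 : (Matrix.of fun i k => cfun χ U (d i) w * cjacobian (cmap χ U f) w i k) =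
        (Matrix.of fun i j => cfun χ U (E i j) w) * cjacobian (cmap χ U y) w := by
      ext i k
      exact key i k
    have h2 := congr_arg Matrix.det h1
    rw [Matrix.det_mul] at h2
    have h3 : cfun χ U E.det w = (Matrix.of fun i j => cfun χ U (E i j) w).det := by
      simp only [cfun, evalAt_of_mem hw.2]
      exact RingHom.map_det _ E
    have h4 : cfun χ U (∏ i, d i) w = ∏ i, cfun χ U (d i) w := by
      simp only [cfun, evalAt_of_mem hw.2, map_prod]
    rw [h3, h4, ← h2]
    exact (Matrix.det_mul_column _ _).symm

end Chart

/-! ## Densities of pluricanonical forms in charts -/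

section Chart

variable {X : CScheme} {n : ℕ}

lemma cfun_res (χ : HolChart X n) {U V : X.left.Opens} (i : V ≤ U) (f : Γ(X.left, U))
    {w : Fin n → ℂ} (hw : w ∈ cdom χ V) :
    cfun χ V (X.left.presheaf.map (homOfLE i).op f) w = cfun χ U f w :=
  evalAt_res i f hw.2

lemma cmap_res (χ : HolChart X n) {N : ℕ} {U V : X.left.Opens} (i : V ≤ U)
    (f : Fin N → Γ(X.left, U)) {w : Fin n → ℂ} (hw : w ∈ cdom χ V) :
    cmap χ V (fun j => X.left.presheaf.map (homOfLE i).op (f j)) w = cmap χ U f w :=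
  funext fun j => cfun_res χ i (f j) hw

lemma cjacobian_congr {N : ℕ} {φ ψ : (Fin n → ℂ) → (Fin N → ℂ)} {w : Fin n → ℂ}
    (h : φ =ᶠ[𝓝 w] ψ) : cjacobian φ w = cjacobian ψ w := by
  ext a j
  have : (fun w' => φ w' a) =ᶠ[𝓝 w] fun w' => ψ w' a := h.mono fun w' h' => by simp only [h']
  simp only [cjacobian, Matrix.of_apply, cpartial, this.fderiv_eq]

lemma cjacobian_res (χ : HolChart X n) {N : ℕ} {U V : X.left.Opens} (i : V ≤ U)
    (f : Fin N → Γ(X.left, U)) {w : Fin n → ℂ} (hw : w ∈ cdom χ V) :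
    cjacobian (cmap χ V fun j => X.left.presheaf.map (homOfLE i).op (f j)) w =
      cjacobian (cmap χ U f) w := by
  apply cjacobian_congr
  filter_upwards [(isOpen_cdom χ V).mem_nhds hw] with w' hw'
  exact cmap_res χ i f hw'

/-- The coefficient of `g (df₁ ∧ ⋯ ∧ dfₙ)^{⊗ m}` in a chart. -/
def beta (χ : HolChart X n) (m : ℕ) {U : X.left.Opens} (g : Γ(X.left, U))
    (f : Fin n → Γ(X.left, U)) (w : Fin n → ℂ) : ℂ :=
  cfun χ U g w * (cjacobian (cmap χ U f) w).det ^ m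

lemma beta_res (χ : HolChart X n) (m : ℕ) {U V : X.left.Opens} (i : V ≤ U) (g : Γ(X.left, U))
    (f : Fin n → Γ(X.left, U)) {w : Fin n → ℂ} (hw : w ∈ cdom χ V) :
    beta χ m (X.left.presheaf.map (homOfLE i).op g)
      (fun j => X.left.presheaf.map (homOfLE i).op (f j)) w = beta χ m g f w := by
  rw [beta, beta, cjacobian_res χ i f hw, cfun_res χ i g hw]

lemma differentiableAt_finset_prod {E ι : Type} [NormedAddCommGroup E] [NormedSpace ℂ E]
    (s : Finset ι) {f : ι → E → ℂ} {x : E} (h : ∀ i ∈ s, DifferentiableAt ℂ (f i) x) :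
    DifferentiableAt ℂ (fun z => ∏ i ∈ s, f i z) x := by
  classical
  induction s using Finset.induction_on with
  | empty => simp
  | insert i s hi ih =>
    simp only [Finset.prod_insert hi]
    exact (h i (Finset.mem_insert_self i s)).fun_mul
      (ih fun j hj => h j (Finset.mem_insert_of_mem hj))

lemma differentiableOn_det_cjacobian (χ : HolChart X n) {U : X.left.Opens}
    (f : Fin n → Γ(X.left, U)) :
    DifferentiableOn ℂ (fun w => (cjacobian (cmap χ U f) w).det) (cdom χ U) := by
  intro w hw
  apply DifferentiableAt.differentiableWithinAt
  simp only [Matrix.det_apply]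
  refine DifferentiableAt.fun_sum fun σ _ => DifferentiableAt.const_smul ?_ _
  refine differentiableAt_finset_prod _ fun i _ => ?_
  exact differentiableAt_cpartial (isOpen_cdom χ U) (differentiableOn_cfun χ U (f (σ i))) hw i

lemma differentiableOn_beta (χ : HolChart X n) (m : ℕ) {U : X.left.Opens} (g : Γ(X.left, U))
    (f : Fin n → Γ(X.left, U)) : DifferentiableOn ℂ (beta χ m g f) (cdom χ U) :=
  (differentiableOn_cfun χ U g).fun_mul ((differentiableOn_det_cjacobian χ f).fun_pow m)

lemma exists_affine_coords [LocallyOfFiniteType X.hom] (χ : HolChart X n) {U : X.left.Opens}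
    {w : Fin n → ℂ} (hw : w ∈ cdom χ U) :
    ∃ (V : X.left.Opens) (y : Fin n → Γ(X.left, V)), V ≤ U ∧ IsAffineOpen V ∧ w ∈ cdom χ V ∧
      (cjacobian (cmap χ V y) w).det ≠ 0 := by
  obtain ⟨V, hV, hwV, hle⟩ := exists_isAffineOpen_mem_and_subset (X := X.left) (U := U) hw.2
  obtain ⟨N, g, hg⟩ := exists_generators hV
  obtain ⟨κ, hκ⟩ := exists_coords χ hV hg ⟨hw.1, hwV⟩
  exact ⟨V, g ∘ κ, hle, hV, ⟨hw.1, hwV⟩, hκ⟩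

variable [IsIntegral X.left]

/-- The zeros of a nonzero regular function contain no open piece of a chart, so by continuity it
can be cancelled. -/
lemma eq_of_cfun_mul_eq [LocallyOfFiniteType X.hom] (hdim : Algebra.trdeg ℂ (FunField X) = n)
    (χ : HolChart X n) {U : X.left.Opens} {d : Γ(X.left, U)} (hd : d ≠ 0)
    {F G : (Fin n → ℂ) → ℂ} (hF : ContinuousOn F (cdom χ U)) (hG : ContinuousOn G (cdom χ U))
    (h : ∀ w ∈ cdom χ U, cfun χ U d w * F w = cfun χ U d w * G w) {w : Fin n → ℂ}
    (hw : w ∈ cdom χ U) : F w = G w := by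
  by_contra hne
  apply hd
  refine eq_zero_of_eventually_cfun χ hdim hw ?_
  have hnhds := (isOpen_cdom χ U).mem_nhds hw
  filter_upwards [((hF.continuousAt hnhds).sub (hG.continuousAt hnhds)).eventually_ne
    (sub_ne_zero.2 hne), hnhds] with w' h1 h2
  by_contra h3
  exact h1 (sub_eq_zero.2 (mul_left_cancel₀ h3 (h w' h2)))

/-- `η = g (df₁ ∧ ⋯ ∧ dfₙ)^{⊗ m}`. -/
def IsRep {m : ℕ} (η : PluriForm (FunField X) n m) (U : X.left.Opens) [Nonempty U]
    (g : Γ(X.left, U)) (f : Fin n → Γ(X.left, U)) : Prop :=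
  η = toK U g • PiTensorProduct.tprod (FunField X)
    (fun _ : Fin m => dWedge fun i => toK U (f i))

lemma IsRep.res {m : ℕ} {η : PluriForm (FunField X) n m} {U V : X.left.Opens} [Nonempty U]
    [Nonempty V] (i : V ≤ U) {g : Γ(X.left, U)} {f : Fin n → Γ(X.left, U)} (h : IsRep η U g f) :
    IsRep η V (X.left.presheaf.map (homOfLE i).op g)
      (fun j => X.left.presheaf.map (homOfLE i).op (f j)) := by
  simp only [IsRep, toK_res i]
  exact h

lemma tprod_smul {K M : Type} [Field K] [AddCommGroup M] [Module K M] (m : ℕ) (a : K) (v : M) :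
    PiTensorProduct.tprod K (fun _ : Fin m => a • v) =
      a ^ m • PiTensorProduct.tprod K (fun _ : Fin m => v) := by
  have := (PiTensorProduct.tprod K (s := fun _ : Fin m => M)).map_smul_univ
    (fun _ => a) (fun _ => v)
  simpa using this

lemma IsRep.comparison {m : ℕ} {η : PluriForm (FunField X) n m}
    (hdim : Algebra.trdeg ℂ (FunField X) = n) {U : X.left.Opens} [Nonempty U]
    {g : Γ(X.left, U)} {f : Fin n → Γ(X.left, U)} (h : IsRep η U g f)
    {y : Fin n → Γ(X.left, U)} (hy : Function.Injective (polyHom U y)) :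
    ∃ den num : Γ(X.left, U), den ≠ 0 ∧
      toK U den • η = toK U num • PiTensorProduct.tprod (FunField X)
        (fun _ : Fin m => dWedge fun i => toK U (y i)) ∧
      ∀ (χ : HolChart X n), ∀ w ∈ cdom χ U,
        cfun χ U den w * beta χ m g f w =
          cfun χ U num w * (cjacobian (cmap χ U y) w).det ^ m := by
  obtain ⟨den, num, h1, h2, h3⟩ := exists_comparison hdim hy f
  refine ⟨den ^ m, g * num ^ m, pow_ne_zero m h1, ?_, fun χ w hw => ?_⟩
  · rw [h, smul_comm, map_pow, ← tprod_smul, h2, tprod_smul, smul_smul, map_mul, map_pow]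
  · rw [cfun_pow χ _ _ hw, cfun_mul χ _ _ hw, cfun_pow χ _ _ hw, beta]
    have := congr_arg (· ^ m) (h3 χ w hw)
    simp only [mul_pow] at this
    linear_combination cfun χ U g w * this

/-- The coefficient in a chart depends on the rational form only. Both representations are compared
with the form given by local coordinates `y`; that form is nonzero because `η` is, so the two
rational comparison factors agree, and the denominators can be cancelled in the chart. -/
lemma beta_eq [LocallyOfFiniteType X.hom] (hdim : Algebra.trdeg ℂ (FunField X) = n)
    {m : ℕ} {η : PluriForm (FunField X) n m} (hη : η ≠ 0) {U U' : X.left.Opens} [Nonempty U]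
    [Nonempty U'] {g : Γ(X.left, U)} {f : Fin n → Γ(X.left, U)} (h : IsRep η U g f)
    {g' : Γ(X.left, U')} {f' : Fin n → Γ(X.left, U')} (h' : IsRep η U' g' f')
    (χ : HolChart X n) {w : Fin n → ℂ} (hw : w ∈ cdom χ U) (hw' : w ∈ cdom χ U') :
    beta χ m g f w = beta χ m g' f' w := by
  obtain ⟨V, y, hle, -, hwV, hy⟩ := exists_affine_coords χ (U := U ⊓ U') (w := w)
    ⟨hw.1, hw.2, hw'.2⟩
  have : Nonempty V := ⟨⟨_, hwV.2⟩⟩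
  have i : V ≤ U := hle.trans inf_le_left
  have i' : V ≤ U' := hle.trans inf_le_right
  obtain ⟨d, e, hd, h1, h2⟩ := (h.res i).comparison hdim (polyHom_injective χ hwV hy)
  obtain ⟨d', e', hd', h1', h2'⟩ := (h'.res i').comparison hdim (polyHom_injective χ hwV hy)
  have hne : PiTensorProduct.tprod (FunField X)
      (fun _ : Fin m => dWedge fun i => toK V (y i)) ≠ 0 := by
    intro h0
    rw [h0, smul_zero, smul_eq_zero] at h1
    exact h1.elim (fun h3 => hd ((map_eq_zero_iff _ (toK_injective V)).1 h3)) hη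
  have h3 : e * d' = e' * d := by
    apply toK_injective V
    apply smul_left_injective _ hne
    simp only [map_mul]
    rw [mul_comm, mul_smul, ← h1, mul_comm, mul_smul, ← h1', smul_comm]
  rw [← beta_res χ m i g f hwV, ← beta_res χ m i' g' f' hwV]
  refine eq_of_cfun_mul_eq hdim χ (mul_ne_zero hd hd')
    (differentiableOn_beta χ m _ _).continuousOn (differentiableOn_beta χ m _ _).continuousOn
    (fun w1 hw1 => ?_) hwV
  have h4 : cfun χ V e w1 * cfun χ V d' w1 = cfun χ V e' w1 * cfun χ V d w1 := by
    rw [← cfun_mul χ _ _ hw1, h3, cfun_mul χ _ _ hw1]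
  rw [cfun_mul χ _ _ hw1]
  linear_combination cfun χ V d' w1 * h2 χ w1 hw1 - cfun χ V d w1 * h2' χ w1 hw1 +
    (cjacobian (cmap χ V y) w1).det ^ m * h4

/-- The squared Jacobian in the density is the power `2 / m` of its m-th power, so the density
becomes a power of the absolute value of one holomorphic function. -/
lemma HasDensityAt.exists_isRep {m : ℕ} (hm : 0 < m) {η : PluriForm (FunField X) n m}
    {χ : HolChart X n} {w : Fin n → ℂ} {b : ℝ} (h : HasDensityAt η χ w b) :
    ∃ (U : X.left.Opens) (_ : Nonempty U) (g : Γ(X.left, U)) (f : Fin n → Γ(X.left, U)),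
      (χ.toHomeo.symm w).pt ∈ U ∧ IsRep η U g f ∧ b = ‖beta χ m g f w‖ ^ (2 / (m : ℝ)) := by
  obtain ⟨U, hU, g, f, h1, h2⟩ := h
  have : Nonempty U := ⟨⟨_, hU⟩⟩
  refine ⟨U, this, g, f, hU, ?_, ?_⟩
  · simp only [stalkToK_germ] at h1
    exact h1
  · rw [h2, beta, norm_mul, Real.mul_rpow (norm_nonneg _) (norm_nonneg _), norm_pow]
    congr 1
    rw [← Real.rpow_natCast _ m, ← Real.rpow_mul (norm_nonneg _), mul_div_cancel₀ _ (by positivity)]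
    exact (Real.rpow_natCast _ 2).symm

end Chart

/-! ## Rational functions without poles along divisors -/

/-- A rational function on a Noetherian normal domain that is not regular has a pole along some
prime divisor. -/
theorem exists_prime_isDiscreteValuationRing {R K : Type} [CommRing R] [IsDomain R]
    [IsNoetherianRing R] [IsIntegrallyClosed R] [Field K] [Algebra R K] [IsFractionRing R K]
    {z : K} (hz : z ∉ (algebraMap R K).range) :
    ∃ (P : Ideal R) (_ : P.IsPrime), IsDiscreteValuationRing (Localization.AtPrime P) ∧
      ∀ s : R, s ∉ P → algebraMap R K s * z ∉ (algebraMap R K).range := by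
  let L : Submodule R K := LinearMap.range (Algebra.linearMap R K)
  have hL : ∀ u : K, u ∈ L ↔ u ∈ (algebraMap R K).range := fun u => by
    simp [L, LinearMap.mem_range, RingHom.mem_range]
  have hz' : L.mkQ z ≠ 0 := by
    rw [Submodule.mkQ_apply, Ne, Submodule.Quotient.mk_eq_zero, hL]
    exact hz
  -- The denominators of `z` form the annihilator of its class in `K / R`. This ideal lies in an
  -- associated prime `P`, the annihilator of the class of some `w`.
  obtain ⟨P, hP, hle⟩ := exists_le_isAssociatedPrime_of_isNoetherianRing R (L.mkQ z) hz'
  rw [isAssociatedPrime_iff] at hP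
  obtain ⟨hprime, x, hx⟩ := hP
  obtain ⟨w, rfl⟩ := L.mkQ_surjective x
  have hmem : ∀ u (r : R), r ∈ (⊥ : Submodule R (K ⧸ L)).colon {L.mkQ u} ↔
      algebraMap R K r * u ∈ (algebraMap R K).range := by
    intro u r
    rw [Submodule.mem_colon_singleton, Submodule.mem_bot, ← map_smul, Submodule.mkQ_apply,
      Submodule.Quotient.mk_eq_zero, hL, Algebra.smul_def]
  have hPw : ∀ r, r ∈ P ↔ algebraMap R K r * w ∈ (algebraMap R K).range := fun r => by
    rw [hx, hmem]
  have hinj := IsFractionRing.injective R K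
  have hw : w ∉ (algebraMap R K).range := fun h =>
    hprime.ne_top ((Ideal.eq_top_iff_one P).2 ((hPw 1).2 (by simpa using h)))
  refine ⟨P, hprime, ?_, fun s hs h => hs (hle ((hmem z s).2 h))⟩
  -- Multiplication by `w` maps `P` into `R`. If some `b ∈ P` goes to an element outside `P`, then
  -- `b` generates the maximal ideal of the localization, which is therefore a discrete valuation
  -- ring. Otherwise `w` stabilises the finitely generated module `P`, so it is integral, contrary
  -- to normality.
  by_cases hA : ∃ b ∈ P, ∃ a, a ∉ P ∧ algebraMap R K b * w = algebraMap R K a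
  · obtain ⟨b, hb, a, ha, hab⟩ := hA
    have ha0 : a ≠ 0 := fun h => ha (h ▸ P.zero_mem)
    have hb0 : b ≠ 0 := by
      rintro rfl
      rw [map_zero, zero_mul, eq_comm, map_eq_zero_iff _ hinj] at hab
      exact ha0 hab
    have hmax : IsLocalRing.maximalIdeal (Localization.AtPrime P) =
        Ideal.span {algebraMap R _ b} := by
      rw [← IsLocalization.AtPrime.map_eq_maximalIdeal P, Ideal.map]
      refine le_antisymm (Ideal.span_le.2 ?_) (Ideal.span_mono ?_)
      · rintro _ ⟨b', hb', rfl⟩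
        obtain ⟨a', ha'⟩ := (hPw b').1 hb'
        have h1 : b' * a = b * a' := by
          apply hinj
          rw [map_mul, map_mul, ← hab, ha']
          ring
        have hu : IsUnit (algebraMap R (Localization.AtPrime P) a) :=
          IsLocalization.map_units (Localization.AtPrime P) (⟨a, ha⟩ : P.primeCompl)
        rw [SetLike.mem_coe, ← Ideal.mul_unit_mem_iff_mem _ hu, ← map_mul, h1, map_mul]
        exact Ideal.mul_mem_right _ _ (Ideal.mem_span_singleton_self _)
      · rintro _ rfl
        exact ⟨b, hb, rfl⟩
    have hnf : ¬ IsField (Localization.AtPrime P) := by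
      rw [IsLocalRing.isField_iff_maximalIdeal_eq, hmax, Ideal.span_singleton_eq_bot,
        map_eq_zero_iff _ (IsLocalization.injective (Localization.AtPrime P)
          P.primeCompl_le_nonZeroDivisors)]
      exact hb0
    have := IsLocalization.isNoetherianRing P.primeCompl (Localization.AtPrime P) inferInstance
    have h4 : (IsLocalRing.maximalIdeal (Localization.AtPrime P)).IsPrincipal := ⟨_, hmax⟩
    exact ((IsDiscreteValuationRing.TFAE (Localization.AtPrime P) hnf).out 0 4).2 h4
  · push Not at hA
    refine absurd ?_ hw
    have hintg : IsIntegral R w := by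
      refine isIntegral_of_smul_mem_submodule (Submodule.map (Algebra.linearMap R K) P) ?_
        ((IsNoetherian.noetherian P).map _) w ?_
      · obtain ⟨⟨a, s⟩, has⟩ := IsLocalization.surj (nonZeroDivisors R) w
        rw [Submodule.ne_bot_iff]
        refine ⟨algebraMap R K s, ⟨s, (hPw _).2 ⟨a, ?_⟩, rfl⟩, ?_⟩
        · rw [← has, mul_comm]
        · rw [Ne, map_eq_zero_iff _ hinj]
          exact nonZeroDivisors.coe_ne_zero s
      · rintro _ ⟨b, hb, rfl⟩
        obtain ⟨a, ha⟩ := (hPw b).1 hb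
        refine ⟨a, ?_, ?_⟩
        · by_contra h
          exact hA b hb a h ha.symm
        · rw [smul_eq_mul, mul_comm]
          exact ha
    obtain ⟨a, ha⟩ := IsIntegrallyClosed.algebraMap_eq_of_integral hintg
    exact ⟨a, ha⟩

section

variable {X : CScheme} [IsIntegral X.left]

instance isLocallyNoetherian_specC : IsLocallyNoetherian SpecC := inferInstance

/-- A rational function on a normal variety that is not regular at `x` has a pole along some
prime divisor through `x`. -/
theorem exists_isDivisorPoint [LocallyOfFiniteType X.hom] (hX : IsNormal X) {x : X.left}
    {z : FunField X} (hz : z ∉ localRing X x) :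
    ∃ y : X.left, y ⤳ x ∧ IsDivisorPoint X y ∧ z ∉ localRing X y := by
  have := LocallyOfFiniteType.isLocallyNoetherian X.hom
  have := hX x
  obtain ⟨P, hP, hdvr, hz'⟩ := exists_prime_isDiscreteValuationRing
    (R := X.left.presheaf.stalk x) (K := X.left.functionField) hz
  obtain ⟨U, hU, hxU, -⟩ := exists_isAffineOpen_mem_and_subset (X := X.left) (U := ⊤) (x := x)
    trivial
  have : Nonempty U := ⟨⟨x, hxU⟩⟩
  let a1 : Algebra Γ(X.left, U) (X.left.presheaf.stalk x) :=
    (X.left.presheaf.germ U x hxU).hom.toAlgebra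
  have hloc : IsLocalization.AtPrime (X.left.presheaf.stalk x)
    (hU.primeIdealOf ⟨x, hxU⟩).asIdeal := hU.isLocalization_stalk ⟨x, hxU⟩
  let p : PrimeSpectrum Γ(X.left, U) := ⟨P.comap (algebraMap _ _), inferInstance⟩
  have hy : hU.fromSpec p ∈ U := by
    have h : hU.fromSpec p ∈ Set.range hU.fromSpec := Set.mem_range_self p
    rwa [hU.range_fromSpec] at h
  let a2 : Algebra Γ(X.left, U) (X.left.presheaf.stalk (hU.fromSpec p)) :=
    (X.left.presheaf.germ U _ hy).hom.toAlgebra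
  have hloc' : IsLocalization.AtPrime (X.left.presheaf.stalk (hU.fromSpec p)) p.asIdeal :=
    hU.isLocalization_stalk' p hy
  have hloc2 : IsLocalization.AtPrime (Localization.AtPrime P) p.asIdeal :=
    IsLocalization.isLocalization_isLocalization_atPrime_isLocalization
      (hU.primeIdealOf ⟨x, hxU⟩).asIdeal.primeCompl _ P
  refine ⟨hU.fromSpec p, ?_, ?_, ?_⟩
  · have h : p ≤ hU.primeIdealOf ⟨x, hxU⟩ := by
      intro b hb
      by_contra hb'
      have hu : IsUnit (algebraMap Γ(X.left, U) (X.left.presheaf.stalk x) b) :=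
        IsLocalization.map_units _
          (⟨b, hb'⟩ : (hU.primeIdealOf ⟨x, hxU⟩).asIdeal.primeCompl)
      exact hP.ne_top (P.eq_top_of_isUnit_mem hb hu)
    have h2 := ((PrimeSpectrum.le_iff_specializes _ _).1 h).map hU.fromSpec.continuous
    rwa [hU.fromSpec_primeIdealOf] at h2
  -- The localization of the stalk at `P` and the stalk at the new point are the localization of the
  -- same algebra of sections at the same prime.
  · let e := IsLocalization.algEquiv p.asIdeal.primeCompl (Localization.AtPrime P)
      (X.left.presheaf.stalk (hU.fromSpec p))
    have h1 : IsDiscreteValuationRing (X.left.presheaf.stalk (hU.fromSpec p)) :=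
      IsDiscreteValuationRing.RingEquivClass.isDiscreteValuationRing e
    have hinj : Function.Injective (stalkToK X (hU.fromSpec p)) :=
      IsFractionRing.injective _ X.left.functionField
    let e2 : X.left.presheaf.stalk (hU.fromSpec p) ≃+* localRing X (hU.fromSpec p) :=
      RingEquiv.ofBijective (stalkToK X (hU.fromSpec p)).rangeRestrict
        ⟨(stalkToK X (hU.fromSpec p)).injective_codRestrict.2 hinj,
          (stalkToK X (hU.fromSpec p)).rangeRestrict_surjective⟩
    exact IsDiscreteValuationRing.RingEquivClass.isDiscreteValuationRing e2
  · rintro ⟨u, rfl⟩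
    obtain ⟨⟨a, s⟩, has⟩ := IsLocalization.surj p.asIdeal.primeCompl u
    refine hz' (algebraMap _ _ s.1) s.2 ⟨algebraMap _ _ a, ?_⟩
    have h1 := congr_arg (stalkToK X (hU.fromSpec p)) has
    rw [map_mul] at h1
    have h2 : stalkToK X _ (algebraMap Γ(X.left, U) _ s.1) = toK U s.1 :=
      stalkToK_germ U hy s.1
    have h3 : stalkToK X _ (algebraMap Γ(X.left, U) _ a) = toK U a := stalkToK_germ U hy a
    have h4 : algebraMap (X.left.presheaf.stalk x) X.left.functionField
      (algebraMap Γ(X.left, U) _ s.1) = toK U s.1 := stalkToK_germ U hxU s.1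
    have h5 : algebraMap (X.left.presheaf.stalk x) X.left.functionField
      (algebraMap Γ(X.left, U) _ a) = toK U a := stalkToK_germ U hxU a
    rw [h4, h5, ← h3, ← h2]
    exact h1.symm.trans (mul_comm _ _)

lemma exists_fraction_of_mem_localRing {U : X.left.Opens} [Nonempty U] (hU : IsAffineOpen U)
    {x : X.left} (hx : x ∈ U) {z : FunField X} (hz : z ∈ localRing X x) :
    ∃ a s : Γ(X.left, U), x ∈ X.left.basicOpen s ∧ toK U s * z = toK U a := by
  obtain ⟨u, rfl⟩ := hz
  let a1 : Algebra Γ(X.left, U) (X.left.presheaf.stalk x) :=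
    (X.left.presheaf.germ U x hx).hom.toAlgebra
  have hloc : IsLocalization.AtPrime (X.left.presheaf.stalk x)
    (hU.primeIdealOf ⟨x, hx⟩).asIdeal := hU.isLocalization_stalk ⟨x, hx⟩
  obtain ⟨⟨a, s⟩, has⟩ := IsLocalization.surj (hU.primeIdealOf ⟨x, hx⟩).asIdeal.primeCompl u
  refine ⟨a, s, ?_, ?_⟩
  · rw [Scheme.mem_basicOpen _ _ _ hx]
    exact IsLocalization.map_units _ s
  · have h1 := congr_arg (stalkToK X x) has
    rw [map_mul] at h1
    have h4 : stalkToK X x (algebraMap Γ(X.left, U) _ s.1) = toK U s.1 := stalkToK_germ U hx s.1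
    have h5 : stalkToK X x (algebraMap Γ(X.left, U) _ a) = toK U a := stalkToK_germ U hx a
    rw [← h4, ← h5]
    exact (mul_comm _ _).trans h1

lemma toK_mem_localRing {U : X.left.Opens} [Nonempty U] {x : X.left} (hx : x ∈ U)
    (f : Γ(X.left, U)) : toK U f ∈ localRing X x :=
  ⟨X.left.presheaf.germ U x hx f, stalkToK_germ U hx f⟩

/-- A generator of `m K_X` does not vanish at the regular points. -/
theorem beta_ne_zero {n m : ℕ} [LocallyOfFiniteType X.hom] (hX : IsNormal X)
    (hdim : Algebra.trdeg ℂ (FunField X) = n) {η : PluriForm (FunField X) n m} {U : X.left.Opens}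
    [Nonempty U] {g : Γ(X.left, U)} {f : Fin n → Γ(X.left, U)} (h : IsRep η U g f)
    (χ : HolChart X n) {w : Fin n → ℂ} (hw : w ∈ cdom χ U)
    (hgen : Generates η (χ.toHomeo.symm w).pt) : beta χ m g f w ≠ 0 := by
  obtain ⟨V, y, i, hV, hwV, hy⟩ := exists_affine_coords χ hw
  have : Nonempty V := ⟨⟨_, hwV.2⟩⟩
  obtain ⟨d, e, hd, h1, h2⟩ := (h.res i).comparison hdim (polyHom_injective χ hwV hy)
  have hd' : toK V d ≠ 0 := fun h3 => hd ((map_eq_zero_iff _ (toK_injective V)).1 h3)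
  have he : toK V e ≠ 0 := by
    intro h0
    rw [h0, zero_smul, smul_eq_zero] at h1
    exact h1.elim hd' hgen.1
  -- Along each prime divisor through the point the coordinate form is regular, hence a multiple of
  -- the generator `η`, and the factor is `d / e`. A rational function without poles along divisors
  -- is regular by normality.
  have hz : toK V d / toK V e ∈ localRing X (χ.toHomeo.symm w).pt := by
    by_contra hz
    obtain ⟨x', hx', hdiv, hz'⟩ := exists_isDivisorPoint hX hz
    have hx'V : x' ∈ V := hx'.mem_open V.2 hwV.2
    have hmem : PiTensorProduct.tprod (FunField X)
        (fun _ : Fin m => dWedge fun i => toK V (y i)) ∈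
          Submodule.span (localRing X x') {η} := by
      rw [hgen.2 x' hx' hdiv]
      exact Submodule.subset_span
        ⟨fun _ j => toK V (y j), fun _ j => toK_mem_localRing hx'V _, rfl⟩
    obtain ⟨u, hu⟩ := Submodule.mem_span_singleton.1 hmem
    apply hz'
    have h3 : toK V d = toK V e * u := by
      apply smul_left_injective _ hgen.1
      simp only
      rw [h1, mul_smul, ← hu]
      rfl
    rw [h3, mul_div_cancel_left₀ _ he]
    exact u.2
  obtain ⟨a, s, hs, has⟩ := exists_fraction_of_mem_localRing hV hwV.2 hz
  have h3 : s * d = a * e := by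
    apply toK_injective V
    rw [map_mul, map_mul, ← has, mul_assoc, div_mul_cancel₀ _ he]
  rw [← beta_res χ m i g f hwV]
  intro h0
  -- With `d / e = a / s` the comparison becomes `a β = s det ^ m`. The right-hand side is nonzero
  -- at the point, since `y` are coordinates and `s` is invertible there.
  have h4 := eq_of_cfun_mul_eq hdim χ hd
    (F := fun w' => cfun χ V a w' * beta χ m (X.left.presheaf.map (homOfLE i).op g)
      (fun j => X.left.presheaf.map (homOfLE i).op (f j)) w')
    (G := fun w' => cfun χ V s w' * (cjacobian (cmap χ V y) w').det ^ m)
    ((differentiableOn_cfun χ V a).continuousOn.mul (differentiableOn_beta χ m _ _).continuousOn)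
    ((differentiableOn_cfun χ V s).continuousOn.mul
      ((differentiableOn_det_cjacobian χ y).continuousOn.pow m))
    (fun w' hw' => by
      have h5 : cfun χ V s w' * cfun χ V d w' = cfun χ V a w' * cfun χ V e w' := by
        rw [← cfun_mul χ _ _ hw', h3, cfun_mul χ _ _ hw']
      linear_combination cfun χ V a w' * h2 χ w' hw' -
        (cjacobian (cmap χ V y) w').det ^ m * h5) hwV
  simp only [h0, mul_zero] at h4
  exact mul_ne_zero ((evalAt_ne_zero_iff hwV.2 s).2 hs) (pow_ne_zero m hy) h4.symm

end

/-! ## The curvature of a positive metric -/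

section Smooth

variable {N : ℕ} {F : (Fin N → ℂ) → ℂ} {z : Fin N → ℂ}

lemma contDiffAt_fderiv_apply (hF : ContDiffAt ℝ ∞ F z) (v : Fin N → ℂ) :
    ContDiffAt ℝ ∞ (fun z' => fderiv ℝ F z' v) z :=
  (hF.fderiv_right (m := ∞) (by norm_cast)).clm_apply contDiffAt_const

lemma contDiffAt_dz (hF : ContDiffAt ℝ ∞ F z) (j : Fin N) : ContDiffAt ℝ ∞ (dz j F) z := by
  unfold dz
  simp only [div_eq_mul_inv]
  exact ((contDiffAt_fderiv_apply hF _).sub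
    (contDiffAt_const.mul (contDiffAt_fderiv_apply hF _))).mul contDiffAt_const

lemma contDiffAt_dzbar (hF : ContDiffAt ℝ ∞ F z) (j : Fin N) :
    ContDiffAt ℝ ∞ (dzbar j F) z := by
  unfold dzbar
  simp only [div_eq_mul_inv]
  exact ((contDiffAt_fderiv_apply hF _).add
    (contDiffAt_const.mul (contDiffAt_fderiv_apply hF _))).mul contDiffAt_const

lemma continuousAt_complexHessian {F : (Fin N → ℂ) → ℝ} (hF : ContDiffAt ℝ ∞ F z) :
    ContinuousAt (complexHessian F) z := by
  have h : ContDiffAt ℝ ∞ (fun z => (F z : ℂ)) z :=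
    Complex.ofRealCLM.contDiff.contDiffAt.comp z hF
  refine continuousAt_pi.2 fun j => continuousAt_pi.2 fun k => ?_
  exact (contDiffAt_dz (contDiffAt_dzbar h k) j).continuousAt

end Smooth

/-! ### Local potentials and positivity -/

section Metric

variable {X : CScheme} [IsIntegral X.left] {n : ℕ}

/-- A local description of a positive metric. -/
structure LocalPotential (p : PositiveMetric X n) where
  m : ℕ
  η : PluriForm (FunField X) n m
  U : X.left.Opens
  N : ℕ
  f : Fin N → Γ(X.left, U)
  V : Set (Fin N → ℂ)
  F : (Fin N → ℂ) → ℝ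
  W : Set (CPoints X)
  m_pos : 0 < m
  ne_zero : η ≠ 0
  affine : IsAffineOpen U
  surjective : Function.Surjective (MvPolynomial.eval₂Hom (const X U) f)
  isOpen_V : IsOpen V
  smooth : ContDiffOn ℝ ∞ F V
  posDef : ∀ z ∈ V, (complexHessian F z).PosDef
  isOpen_W : IsOpen W
  mem : ∀ y ∈ W, y.pt ∈ U ∧ coordMap U f y ∈ V
  dens_eq : ∀ (χ : HolChart X n), ∀ w ∈ χ.toHomeo.target, χ.toHomeo.symm w ∈ W →
    ∃ b : ℝ, HasDensityAt η χ w b ∧ p.dens χ w = Real.exp (- F (cmap χ U f w)) * b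

lemma exists_localPotential (p : PositiveMetric X n) (x : CPoints X) :
    ∃ L : LocalPotential p, x ∈ L.W ∧ Generates L.η x.pt := by
  obtain ⟨m, η, U, N, f, V, F, W, h1, h2, h3, h4, h5, h6, h7, h8, h9, h10, h11⟩ :=
    p.locally_smooth x
  exact ⟨⟨m, η, U, N, f, V, F, W, h1, h2.1, h3, h4, h5, h6, h7, h8, h10, h11⟩, h9, h2⟩

namespace LocalPotential

variable {p : PositiveMetric X n} (L : LocalPotential p)

/-- The part of a chart that lies over the domain of a local potential. -/
def dom (χ : HolChart X n) : Set (Fin n → ℂ) :=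
  {w ∈ χ.toHomeo.target | χ.toHomeo.symm w ∈ L.W}

lemma isOpen_dom (χ : HolChart X n) : IsOpen (L.dom χ) :=
  χ.toHomeo.isOpen_inter_preimage_symm L.isOpen_W

lemma dom_subset_cdom (χ : HolChart X n) : L.dom χ ⊆ cdom χ L.U :=
  fun _ hw => ⟨hw.1, (L.mem _ hw.2).1⟩

end LocalPotential

variable [LocallyOfFiniteType X.hom]

theorem dens_pos (hX : IsNormal X) (hdim : Algebra.trdeg ℂ (FunField X) = n)
    (p : PositiveMetric X n) (χ : HolChart X n) {w : Fin n → ℂ} (hw : w ∈ χ.toHomeo.target) :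
    0 < p.dens χ w := by
  obtain ⟨L, hL, hgen⟩ := exists_localPotential p (χ.toHomeo.symm w)
  obtain ⟨b, hb, h⟩ := L.dens_eq χ w hw hL
  obtain ⟨U, _, g, f, hU, hrep, rfl⟩ := hb.exists_isRep L.m_pos
  rw [h]
  have := beta_ne_zero hX hdim hrep χ ⟨hw, hU⟩ hgen
  positivity

namespace LocalPotential

variable {p : PositiveMetric X n} (L : LocalPotential p)

/-- Up to sign and the factor `2 / m`, the logarithm of the density of `η` is `log ‖β‖`, the real
part of a holomorphic logarithm of the nonvanishing coefficient. The potential `F` is therefore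
determined up to a pluriharmonic term. -/
lemma exists_neg_log_dens (hX : IsNormal X) (hdim : Algebra.trdeg ℂ (FunField X) = n)
    (χ : HolChart X n) {w : Fin n → ℂ} (hw : w ∈ L.dom χ) :
    ∃ (Ω : Set (Fin n → ℂ)) (g : (Fin n → ℂ) → ℂ), IsOpen Ω ∧ w ∈ Ω ∧ Ω ⊆ L.dom χ ∧
      DifferentiableOn ℂ g Ω ∧
      ∀ w' ∈ Ω, - Real.log (p.dens χ w') = L.F (cmap χ L.U L.f w') + (g w').re := by
  obtain ⟨b, hb, h⟩ := L.dens_eq χ w hw.1 hw.2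
  obtain ⟨U, _, g, f, hU, hrep, hb'⟩ := hb.exists_isRep L.m_pos
  have hm : (L.m : ℝ) ≠ 0 := by exact_mod_cast L.m_pos.ne'
  have hne : beta χ L.m g f w ≠ 0 := by
    intro h0
    have := dens_pos hX hdim p χ hw.1
    rw [h, hb', h0, norm_zero, Real.zero_rpow (by positivity), mul_zero] at this
    exact lt_irrefl _ this
  set β := beta χ L.m g f with hβ
  have hd := differentiableOn_beta χ L.m g f
  have hcont : ContinuousOn (fun w' => β w' / β w) (cdom χ U) := hd.continuousOn.div_const _
  -- Dividing by the value at `w` brings the coefficient near 1, where the principal branch of the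
  -- logarithm is holomorphic; the added real constant restores the absolute value.
  refine ⟨L.dom χ ∩ (cdom χ U ∩ (fun w' => β w' / β w) ⁻¹' Complex.slitPlane),
    fun w' => -(2 / L.m : ℝ) * (Complex.log (β w' / β w) + (Real.log ‖β w‖ : ℝ)),
    (L.isOpen_dom χ).inter (hcont.isOpen_inter_preimage (isOpen_cdom χ U)
      Complex.isOpen_slitPlane), ⟨hw, ⟨hw.1, hU⟩, ?_⟩, Set.inter_subset_left, ?_, ?_⟩
  · simp [div_self hne]
  · intro w' hw'
    refine DifferentiableWithinAt.const_mul (DifferentiableWithinAt.add_const _ ?_) _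
    refine DifferentiableWithinAt.clog ?_ hw'.2.2
    simp only [div_eq_mul_inv]
    exact ((hd w' hw'.2.1).mono fun _ h => h.2.1).mul_const _
  · intro w' hw'
    obtain ⟨b', hb1, hb2⟩ := L.dens_eq χ w' hw'.1.1 hw'.1.2
    obtain ⟨U', _, g', f', hU', hrep', hb1'⟩ := hb1.exists_isRep L.m_pos
    rw [← beta_eq hdim L.ne_zero hrep hrep' χ hw'.2.1 ⟨hw'.1.1, hU'⟩, ← hβ] at hb1'
    have hne' : β w' ≠ 0 := by
      intro h0
      have := Complex.slitPlane_ne_zero hw'.2.2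
      simp [h0] at this
    have hn : 0 < ‖β w'‖ := norm_pos_iff.2 hne'
    rw [hb2, hb1', Real.log_mul (Real.exp_ne_zero _) (Real.rpow_pos_of_pos hn _).ne',
      Real.log_exp, Real.log_rpow hn]
    have h1 : (Complex.log (β w' / β w)).re = Real.log ‖β w'‖ - Real.log ‖β w‖ := by
      rw [Complex.log_re, norm_div, Real.log_div hn.ne' (norm_ne_zero_iff.2 hne)]
    have h2 : (-(2 / L.m : ℝ) * (Complex.log (β w' / β w) + (Real.log ‖β w‖ : ℝ)) : ℂ).re =
        -(2 / L.m : ℝ) * ((Complex.log (β w' / β w)).re + Real.log ‖β w‖) := by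
      rw [← Complex.ofReal_neg, Complex.re_ofReal_mul, Complex.add_re, Complex.ofReal_re]
    rw [h2, h1]
    ring

/-- The curvature is the pullback of the complex Hessian of the local potential. -/
theorem curvature_eq (hX : IsNormal X) (hdim : Algebra.trdeg ℂ (FunField X) = n)
    (χ : HolChart X n) {w : Fin n → ℂ} (hw : w ∈ L.dom χ) :
    p.curvature χ w = (cjacobian (cmap χ L.U L.f) w).transpose *
      complexHessian L.F (cmap χ L.U L.f w) *
      (cjacobian (cmap χ L.U L.f) w).map (starRingEnd ℂ) := by
  obtain ⟨Ω, g, hΩ, hwΩ, hsub, hg, h⟩ := L.exists_neg_log_dens hX hdim χ hw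
  exact complexHessian_comp_add_re hΩ L.isOpen_V L.smooth
    ((differentiableOn_cmap χ L.U L.f).mono (hsub.trans (L.dom_subset_cdom χ)))
    (fun w' hw' => (L.mem _ (hsub hw').2).2) hg h hwΩ

end LocalPotential

/-- The curvature is the pull-back of a positive definite Hessian by a Jacobian with trivial kernel.
The pull-back formula uses conjugate coordinates, so the kernel is tested on conjugate vectors. -/
theorem curvature_posDef (hX : IsNormal X) (hdim : Algebra.trdeg ℂ (FunField X) = n)
    (p : PositiveMetric X n) (χ : HolChart X n) {w : Fin n → ℂ} (hw : w ∈ χ.toHomeo.target) :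
    (p.curvature χ w).PosDef := by
  obtain ⟨L, hL, -⟩ := exists_localPotential p (χ.toHomeo.symm w)
  have hwL : w ∈ L.dom χ := ⟨hw, hL⟩
  rw [L.curvature_eq hX hdim χ hwL]
  set J := cjacobian (cmap χ L.U L.f) w
  have h1 : J.transpose = (J.map (starRingEnd ℂ)).conjTranspose := by
    ext i j
    simp
  rw [h1]
  refine (L.posDef _ (L.mem _ hL).2).conjTranspose_mul_mul_same ?_
  intro u v huv
  have h2 : (J.map (starRingEnd ℂ)).mulVec (u - v) = 0 := by
    rw [Matrix.mulVec_sub, sub_eq_zero]; exact huv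
  have h3 : J.mulVec (star (u - v)) = 0 := by
    ext i
    have := congr_arg (starRingEnd ℂ) (congr_fun h2 i)
    simp only [Matrix.mulVec, dotProduct, map_sum, map_mul, Matrix.map_apply, Pi.zero_apply,
      map_zero, Complex.conj_conj] at this
    exact this
  have h4 := jacobian_mulVec_injective χ L.affine L.surjective (L.dom_subset_cdom χ hwL) _ h3
  exact sub_eq_zero.1 (star_eq_zero.1 h4)

theorem volumeDensity_pos (hX : IsNormal X) (hdim : Algebra.trdeg ℂ (FunField X) = n)
    (p : PositiveMetric X n) (χ : HolChart X n) {w : Fin n → ℂ} (hw : w ∈ χ.toHomeo.target) :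
    0 < p.volumeDensity χ w := by
  have h := (curvature_posDef hX hdim p χ hw).det_pos
  have h1 : 0 < (p.curvature χ w).det.re := (Complex.lt_def.1 h).1
  unfold PositiveMetric.volumeDensity
  positivity

theorem continuousOn_volumeDensity (hX : IsNormal X) (hdim : Algebra.trdeg ℂ (FunField X) = n)
    (p : PositiveMetric X n) (χ : HolChart X n) :
    ContinuousOn (p.volumeDensity χ) χ.toHomeo.target := by
  intro w hw
  apply ContinuousAt.continuousWithinAt
  obtain ⟨L, hL, -⟩ := exists_localPotential p (χ.toHomeo.symm w)
  have hwL : w ∈ L.dom χ := ⟨hw, hL⟩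
  have hJ : ContinuousAt (cjacobian (cmap χ L.U L.f)) w := by
    refine continuousAt_pi.2 fun a => continuousAt_pi.2 fun j => ?_
    exact (differentiableAt_cpartial (isOpen_cdom χ L.U) (differentiableOn_cfun χ L.U (L.f a))
      (L.dom_subset_cdom χ hwL) j).continuousAt
  have hH : ContinuousAt (fun w' => complexHessian L.F (cmap χ L.U L.f w')) w :=
    ContinuousAt.comp (g := complexHessian L.F)
      (continuousAt_complexHessian (L.smooth.contDiffAt (L.isOpen_V.mem_nhds (L.mem _ hL).2)))
      (differentiableAt_cmap χ L.f (L.dom_subset_cdom χ hwL)).continuousAt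
  have h1 : ContinuousAt (fun w' => (cjacobian (cmap χ L.U L.f) w').transpose *
      complexHessian L.F (cmap χ L.U L.f w') *
      (cjacobian (cmap χ L.U L.f) w').map (starRingEnd ℂ)) w := by
    have hc : Continuous fun q : Matrix (Fin L.N) (Fin n) ℂ × Matrix (Fin L.N) (Fin L.N) ℂ =>
        q.1.transpose * q.2 * q.1.map (starRingEnd ℂ) :=
      (continuous_fst.matrix_transpose.matrix_mul continuous_snd).matrix_mul
        (continuous_fst.matrix_map Complex.continuous_conj)
    exact ContinuousAt.comp (f := fun w' => (cjacobian (cmap χ L.U L.f) w',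
      complexHessian L.F (cmap χ L.U L.f w'))) hc.continuousAt (hJ.prodMk hH)
  have h2 : ContinuousAt (p.curvature χ) w := by
    refine h1.congr ?_
    filter_upwards [(L.isOpen_dom χ).mem_nhds hwL] with w' hw'
    exact (L.curvature_eq hX hdim χ hw').symm
  exact continuousAt_const.mul (Complex.continuous_re.continuousAt.comp
    ((Continuous.matrix_det continuous_id).continuousAt.comp h2))

end Metric

/-! ## A generically étale presentation of a finite extension -/

section Algebra

open Polynomial

lemma exists_clear_denominators {A K : Type} [CommRing A] [IsDomain A] [Field K] [Algebra A K]
    [IsFractionRing A K] (q : K[X]) :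
    ∃ (s : A) (Q : A[X]), s ≠ 0 ∧ Q.map (algebraMap A K) = C (algebraMap A K s) * q := by
  obtain ⟨s, hs, h⟩ := IsLocalization.integerNormalization_spec (nonZeroDivisors A) q
  refine ⟨s, _, nonZeroDivisors.ne_zero hs, h.trans ?_⟩
  rw [← Polynomial.smul_eq_C_mul, algebraMap_smul]

attribute [local instance] FractionRing.liftAlgebra FractionRing.isScalarTower_liftAlgebra

/-- A finite extension of domains is, over a nonempty open set, given by one separable monic
equation. -/
theorem exists_monic_presentation {A B : Type} [CommRing A] [IsDomain A] [IsIntegrallyClosed A]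
    [CharZero A] [CommRing B] [IsDomain B] [Algebra A B] [FaithfulSMul A B] [Module.Finite A B] :
    ∃ (a : B) (P : A[X]) (ε : A), P.Monic ∧ ε ≠ 0 ∧ aeval a P = 0 ∧
      (∃ S T : A[X], S * P + T * derivative P = C ε) ∧
      (∀ Q : A[X], aeval a Q = 0 → P ∣ Q) ∧
      ∀ b : B, ∃ Q : A[X], algebraMap A B ε * b = aeval a Q := by
  let K := FractionRing A
  let L := FractionRing B
  have hintg : Algebra.IsIntegral A B := inferInstance
  have hloc : IsLocalization (Algebra.algebraMapSubmonoid B (nonZeroDivisors A)) L := inferInstance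
  have hfin : FiniteDimensional K L := .of_isLocalization A B (nonZeroDivisors A)
  have : CharZero K := charZero_of_injective_algebraMap (IsFractionRing.injective A K)
  obtain ⟨α, hα⟩ := Field.exists_primitive_element K L
  have hAL : Function.Injective (algebraMap A L) := by
    rw [IsScalarTower.algebraMap_eq A B L]
    exact (IsFractionRing.injective B L).comp (FaithfulSMul.algebraMap_injective A B)
  have hAK := IsFractionRing.injective A K
  -- A primitive element may be multiplied by a denominator to lie in `B`; it generates the same
  -- field.
  obtain ⟨a, s, hs, has⟩ : ∃ (a : B) (s : A), s ≠ 0 ∧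
      algebraMap B L a = algebraMap A L s * α := by
    obtain ⟨⟨a, ⟨_, s, hs, rfl⟩⟩, h⟩ :=
      IsLocalization.surj (Algebra.algebraMapSubmonoid B (nonZeroDivisors A)) α
    refine ⟨a, s, nonZeroDivisors.ne_zero hs, ?_⟩
    rw [← h, IsScalarTower.algebraMap_apply A B L, mul_comm]
  have hprim : Algebra.adjoin K {algebraMap B L a} = ⊤ := by
    have h1 : IntermediateField.adjoin K {algebraMap B L a} = ⊤ := by
      rw [eq_top_iff, ← hα, IntermediateField.adjoin_simple_le_iff]
      have h2 : α = (algebraMap K L (algebraMap A K s))⁻¹ * algebraMap B L a := by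
        rw [← IsScalarTower.algebraMap_apply A K L, has, inv_mul_cancel_left₀]
        exact (map_ne_zero_iff _ hAL).2 hs
      rw [h2]
      exact mul_mem (inv_mem (IntermediateField.algebraMap_mem _ _))
        (IntermediateField.mem_adjoin_simple_self K _)
    have h3 := IntermediateField.adjoin_simple_toSubalgebra_of_isAlgebraic
      (Algebra.IsAlgebraic.isAlgebraic (R := K) (algebraMap B L a))
    rw [← h3, h1]
    rfl
  have ha : IsIntegral A a := hintg.isIntegral a
  -- Since `A` is integrally closed, the minimal polynomial over the fraction field has coefficients
  -- in `A`, and over `A` it divides every relation.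
  have hP : (minpoly A a).map (algebraMap A K) = minpoly K (algebraMap B L a) :=
    (minpoly.isIntegrallyClosed_eq_field_fractions K L ha).symm
  have hsep : (minpoly K (algebraMap B L a)).Separable :=
    (minpoly.irreducible (Algebra.IsIntegral.isIntegral _)).separable
  obtain ⟨u, v, huv⟩ := hsep
  obtain ⟨s₁, u', hs₁, hu'⟩ := exists_clear_denominators (A := A) u
  obtain ⟨s₂, v', hs₂, hv'⟩ := exists_clear_denominators (A := A) v
  have hrep : ∀ b : B, ∃ (t : A) (Q : A[X]), t ≠ 0 ∧ algebraMap A B t * b = aeval a Q := by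
    intro b
    have hb : algebraMap B L b ∈ Algebra.adjoin K {algebraMap B L a} := by rw [hprim]; trivial
    rw [Algebra.adjoin_singleton_eq_range_aeval] at hb
    obtain ⟨q, hq⟩ := hb
    obtain ⟨t, Q, ht, hQ⟩ := exists_clear_denominators (A := A) q
    refine ⟨t, Q, ht, IsFractionRing.injective B L ?_⟩
    rw [← aeval_algebraMap_apply, ← aeval_map_algebraMap K, hQ, map_mul, map_mul, aeval_C]
    congr 1
    · rw [← IsScalarTower.algebraMap_apply, ← IsScalarTower.algebraMap_apply]
    · exact hq.symm
  choose t Q ht hQ using hrep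
  obtain ⟨G, hG⟩ := (Module.Finite.fg_top : (⊤ : Submodule A B).FG)
  -- One denominator serves all of `B`, because `B` is generated over `A` by finitely many elements.
  have hprod : ∀ b : B, ∃ R : A[X], algebraMap A B (∏ g ∈ G, t g) * b = aeval a R := by
    intro b
    have hb : b ∈ Submodule.span A (G : Set B) := by rw [hG]; trivial
    induction hb using Submodule.span_induction with
    | mem g hg =>
      classical
      refine ⟨C (∏ g' ∈ G.erase g, t g') * Q g, ?_⟩
      rw [map_mul, aeval_C, ← hQ, ← Finset.prod_erase_mul G t hg, map_mul]
      ring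
    | zero => exact ⟨0, by simp⟩
    | add x y _ _ hx hy =>
      obtain ⟨R, hR⟩ := hx
      obtain ⟨R', hR'⟩ := hy
      exact ⟨R + R', by rw [mul_add, hR, hR', map_add]⟩
    | smul c x _ hx =>
      obtain ⟨R, hR⟩ := hx
      exact ⟨C c * R, by rw [map_mul, aeval_C, ← hR, Algebra.smul_def]; ring⟩
  -- `s₁` and `s₂` clear the denominators in the Bézout identity of separability, and the product of
  -- the `t g` clears those in the expressions of the module generators.
  refine ⟨a, minpoly A a, s₁ * s₂ * ∏ g ∈ G, t g, minpoly.monic ha,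
    mul_ne_zero (mul_ne_zero hs₁ hs₂) (Finset.prod_ne_zero_iff.2 fun g _ => ht g),
    minpoly.aeval A a, ⟨C (s₂ * ∏ g ∈ G, t g) * u', C (s₁ * ∏ g ∈ G, t g) * v', ?_⟩,
    fun R hR => minpoly.isIntegrallyClosed_dvd ha hR, fun b => ?_⟩
  · apply Polynomial.map_injective _ hAK
    simp only [Polynomial.map_add, Polynomial.map_mul, hu', hv', hP, ← Polynomial.derivative_map,
      Polynomial.map_C, map_mul]
    linear_combination C (algebraMap A K s₁) * C (algebraMap A K s₂) *
      C (algebraMap A K (∏ g ∈ G, t g)) * huv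
  · obtain ⟨R, hR⟩ := hprod b
    refine ⟨C (s₁ * s₂) * R, ?_⟩
    rw [map_mul, map_mul (aeval a), aeval_C, ← hR]
    ring

end Algebra

/-! ## Finite coverings of affine space and charts -/

/-- The function field is algebraic over the polynomial ring of a Noether normalization, so the
number of variables equals the transcendence degree. -/
lemma exists_noether_normalization {n : ℕ} {B K : Type} [CommRing B] [IsDomain B] [Algebra ℂ B]
    [Algebra.FiniteType ℂ B] [Field K] [Algebra ℂ K] [Algebra B K] [IsFractionRing B K]
    [IsScalarTower ℂ B K] (h : Algebra.trdeg ℂ K = n) :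
    ∃ g : MvPolynomial (Fin n) ℂ →ₐ[ℂ] B, Function.Injective g ∧ g.Finite := by
  obtain ⟨s, g, hg, hfin⟩ := exists_finite_inj_algHom_of_fg ℂ B
  suffices hs : s = n by
    subst hs
    exact ⟨g, hg, hfin⟩
  let A := MvPolynomial (Fin s) ℂ
  let : Algebra A B := g.toRingHom.toAlgebra
  have : Module.Finite A B := hfin
  let : Algebra A K := ((algebraMap B K).comp g.toRingHom).toAlgebra
  have : IsScalarTower A B K := IsScalarTower.of_algebraMap_eq fun _ => rfl
  have : IsScalarTower ℂ A K := IsScalarTower.of_algebraMap_eq fun c => by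
    rw [IsScalarTower.algebraMap_apply ℂ B K]
    change _ = algebraMap B K (g (algebraMap ℂ A c))
    rw [g.commutes]
  have h1 : FaithfulSMul A K := (faithfulSMul_iff_algebraMap_injective A K).2
    ((IsFractionRing.injective B K).comp hg)
  have h2 : Algebra.IsAlgebraic B K := IsLocalization.isAlgebraic K (nonZeroDivisors B)
  have h3 : Algebra.IsAlgebraic A B := inferInstance
  have : FaithfulSMul A B := (faithfulSMul_iff_algebraMap_injective A B).2 hg
  have h4 : Algebra.IsAlgebraic A K := Algebra.IsAlgebraic.trans A B K
  have h5 := trdeg_add_eq ℂ A (A := K)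
  rw [trdeg_eq_zero (R := A) (A := K), add_zero, h, MvPolynomial.trdeg_of_isDomain] at h5
  simpa using h5

/-- A finite map from an affine open set to `ℂⁿ`, given over the locus `ε ≠ 0` by one separable
monic equation `P(y, a) = 0`. -/
structure EtaleModel (X : CScheme) (n : ℕ) where
  U : X.left.Opens
  affine : IsAffineOpen U
  y : Fin n → Γ(X.left, U)
  a : Γ(X.left, U)
  P : Polynomial (MvPolynomial (Fin n) ℂ)
  ε : MvPolynomial (Fin n) ℂ
  monic : P.Monic
  natDegree_pos : 0 < P.natDegree
  ε_ne : ε ≠ 0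
  root : P.eval₂ (polyHom U y) a = 0
  simple : ∀ z τ, MvPolynomial.eval z ε ≠ 0 → (spec P z).eval τ = 0 →
    (spec P z).derivative.eval τ ≠ 0
  exists_point : ∀ z τ, MvPolynomial.eval z ε ≠ 0 → (spec P z).eval τ = 0 →
    ∃ p : CPoints X, p.pt ∈ U ∧ coordMap U y p = z ∧ evalAt U a p = τ
  exists_fraction : ∀ b, ∃ Q : Polynomial (MvPolynomial (Fin n) ℂ),
    polyHom U y ε * b = Q.eval₂ (polyHom U y) a

/-- Every element is `Q(a) / ε` and every relation of `a` is divisible by `P`, so evaluation at a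
root of `P` over `z` is well defined as soon as `ε` is nonzero at `z`. The points over `z` are thus
the roots. -/
lemma exists_ringHom_of_presentation {n : ℕ} {B : Type} [CommRing B]
    (Y : MvPolynomial (Fin n) ℂ →+* B) {a : B} {P : Polynomial (MvPolynomial (Fin n) ℂ)}
    {ε : MvPolynomial (Fin n) ℂ}
    (hdvd : ∀ Q : Polynomial (MvPolynomial (Fin n) ℂ), Q.eval₂ Y a = 0 → P ∣ Q)
    (hfrac : ∀ b, ∃ Q : Polynomial (MvPolynomial (Fin n) ℂ), Y ε * b = Q.eval₂ Y a)
    {z : Fin n → ℂ} {τ : ℂ} (hε : MvPolynomial.eval z ε ≠ 0) (hτ : (spec P z).eval τ = 0) :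
    ∃ ψ : B →+* ℂ, ∀ Q : Polynomial (MvPolynomial (Fin n) ℂ),
      ψ (Q.eval₂ Y a) = (spec Q z).eval τ := by
  choose Q hQ using hfrac
  let ev : Polynomial (MvPolynomial (Fin n) ℂ) →+* ℂ :=
    Polynomial.eval₂RingHom (MvPolynomial.eval z) τ
  let ea : Polynomial (MvPolynomial (Fin n) ℂ) →+* B := Polynomial.eval₂RingHom Y a
  have hev : ∀ Q, ev Q = (spec Q z).eval τ := fun Q => (Polynomial.eval_map _ _).symm
  have hP : ev P = 0 := (hev P).trans hτ
  have key : ∀ R R', ea R = ea R' → ev R = ev R' := fun R R' h => by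
    obtain ⟨S, hS⟩ := hdvd (R - R') (by
      change ea (R - R') = 0
      rw [map_sub, h, sub_self])
    rw [← sub_eq_zero, ← map_sub, hS, map_mul, hP, zero_mul]
  have hQ' : ∀ b, ea (Polynomial.C ε) * b = ea (Q b) := fun b => by
    rw [← show _ = ea (Q b) from hQ b]
    congr 1
    exact Polynomial.eval₂_C _ _
  have hC : ev (Polynomial.C ε) = MvPolynomial.eval z ε := Polynomial.eval₂_C _ _
  have hval : ∀ R, ev (Q (ea R)) = ev (Polynomial.C ε) * ev R := fun R => by
    rw [← map_mul]
    apply key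
    rw [map_mul, hQ']
  have hne : ev (Polynomial.C ε) ≠ 0 := by rwa [hC]
  refine ⟨RingHom.mk' ⟨⟨fun b => ev (Q b) / ev (Polynomial.C ε), ?_⟩, ?_⟩ ?_, fun R => ?_⟩
  · rw [← map_one ea, hval, map_one, mul_one, div_self hne]
  · intro b b'
    have h1 : ev (Q (b * b')) * ev (Polynomial.C ε) = ev (Q b) * ev (Q b') := by
      rw [← map_mul, ← map_mul]
      apply key
      rw [map_mul, map_mul, ← hQ', ← hQ', ← hQ']
      ring
    simp only
    rw [div_mul_div_comm, ← h1, mul_div_mul_right _ _ hne]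
  · intro b b'
    have h1 : ev (Q (b + b')) = ev (Q b) + ev (Q b') := by
      rw [← map_add]
      apply key
      rw [map_add, ← hQ', ← hQ', ← hQ', mul_add]
    exact (congr_arg (· / ev (Polynomial.C ε)) h1).trans (add_div _ _ _)
  · change ev (Q (ea R)) / ev (Polynomial.C ε) = _
    rw [hval, mul_div_cancel_left₀ _ hne, hev]

theorem exists_etaleModel {X : CScheme} {n : ℕ} [IsIntegral X.left] [LocallyOfFiniteType X.hom]
    (hdim : Algebra.trdeg ℂ (FunField X) = n) {U : X.left.Opens} (hU : IsAffineOpen U)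
    [Nonempty U] : ∃ M : EtaleModel X n, M.U = U := by
  let B := Γ(X.left, U)
  let : Algebra ℂ B := (const X U).toAlgebra
  let : Algebra B (FunField X) := (toK U).toAlgebra
  have : IsFractionRing B (FunField X) := functionField_isFractionRing_of_isAffineOpen X.left U hU
  have : IsScalarTower ℂ B (FunField X) :=
    IsScalarTower.of_algebraMap_eq fun c => algebraMap_eq_toK U c
  have : Algebra.FiniteType ℂ B := by
    obtain ⟨N, f, hf⟩ := exists_generators hU
    exact Algebra.FiniteType.iff_quotient_mvPolynomial''.2 ⟨N, MvPolynomial.aeval f, hf⟩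
  obtain ⟨g, hg, hfin⟩ := exists_noether_normalization (B := B) hdim
  let : Algebra (MvPolynomial (Fin n) ℂ) B := g.toRingHom.toAlgebra
  have : Module.Finite (MvPolynomial (Fin n) ℂ) B := hfin
  have : FaithfulSMul (MvPolynomial (Fin n) ℂ) B :=
    (faithfulSMul_iff_algebraMap_injective _ B).2 hg
  obtain ⟨a, P, ε, hmon, hε, hroot, ⟨S, T, hST⟩, hdvd, hfrac⟩ :=
    exists_monic_presentation (A := MvPolynomial (Fin n) ℂ) (B := B)
  let y : Fin n → B := fun i => g (MvPolynomial.X i)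
  have hY : polyHom U y = g.toRingHom := by
    apply MvPolynomial.ringHom_ext
    · intro c
      rw [polyHom_C]
      exact (g.commutes c).symm
    · intro i
      rw [polyHom_X]
      rfl
  have hae : ∀ Q, Q.eval₂ (polyHom U y) a = Polynomial.aeval a Q := fun Q => by
    rw [hY]
    rfl
  refine ⟨⟨U, hU, y, a, P, ε, hmon, ?_, hε, (hae P).trans hroot, ?_, ?_, ?_⟩, rfl⟩
  · by_contra h0
    rw [(Polynomial.Monic.natDegree_eq_zero hmon).1 (by omega), map_one] at hroot
    exact one_ne_zero hroot
  -- A double root would make the Bézout combination vanish at `z`, but its value there is that of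
  -- `ε`.
  · intro z τ hz hτ h'
    have h1 := congr_arg (fun Q => (spec Q z).eval τ) hST
    simp only [spec, Polynomial.map_add, Polynomial.map_mul, Polynomial.eval_add,
      Polynomial.eval_mul, ← Polynomial.derivative_map, Polynomial.map_C, Polynomial.eval_C] at h1
    simp only [spec] at hτ h'
    rw [hτ, h', mul_zero, mul_zero, add_zero] at h1
    exact hz h1.symm
  · intro z τ hz hτ
    obtain ⟨ψ, hψ⟩ := exists_ringHom_of_presentation (polyHom U y) (a := a)
      (fun Q hQ => hdvd Q ((hae Q).symm.trans hQ))
      (fun b => by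
        obtain ⟨Q, hQ⟩ := hfrac b
        refine ⟨Q, ?_⟩
        rw [hae, ← hQ, hY]
        rfl) hz hτ
    have hψ1 : ∀ R, ψ (polyHom U y R) = MvPolynomial.eval z R := fun R => by
      have := hψ (Polynomial.C R)
      simpa [spec] using this
    have hψc : ψ.comp (const X U) = RingHom.id ℂ := by
      ext c
      have := hψ1 (MvPolynomial.C c)
      rw [polyHom_C] at this
      simpa using this
    refine ⟨pointOfHom hU ψ hψc, pointOfHom_mem hU ψ hψc, ?_, ?_⟩
    · ext i
      rw [coordMap, evalAt_pointOfHom]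
      have := hψ1 (MvPolynomial.X i)
      rwa [polyHom_X, MvPolynomial.eval_X] at this
    · rw [evalAt_pointOfHom]
      have := hψ Polynomial.X
      simpa [spec] using this
  · intro b
    obtain ⟨Q, hQ⟩ := hfrac b
    refine ⟨Q, ?_⟩
    rw [hae, ← hQ, hY]
    rfl

lemma spec_eval_eq_sum {n : ℕ} (Q : Polynomial (MvPolynomial (Fin n) ℂ)) (z : Fin n → ℂ) (τ : ℂ) :
    (spec Q z).eval τ = ∑ i ∈ Finset.range (Q.natDegree + 1),
      MvPolynomial.eval z (Q.coeff i) * τ ^ i := by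
  rw [spec, Polynomial.eval_map, Polynomial.eval₂_eq_sum_range]

lemma contDiff_spec_eval {n : ℕ} (Q : Polynomial (MvPolynomial (Fin n) ℂ)) :
    ContDiff ℂ 1 fun u : (Fin n → ℂ) × ℂ => (spec Q u.1).eval u.2 := by
  simp only [spec_eval_eq_sum]
  refine ContDiff.sum fun i _ => ?_
  have h : ContDiff ℂ 1 fun z : Fin n → ℂ => MvPolynomial.eval z (Q.coeff i) :=
    contDiff_iff_contDiffAt.2 fun z =>
      (AnalyticOnNhd.eval_mvPolynomial (Q.coeff i) z trivial).contDiffAt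
  exact (h.comp contDiff_fst).mul (contDiff_snd.pow i)

/-- The implicit function theorem for a simple root of a polynomial with parameters. -/
theorem exists_root_function {n : ℕ} (P : Polynomial (MvPolynomial (Fin n) ℂ)) {z₀ : Fin n → ℂ}
    {τ₀ : ℂ} (h0 : (spec P z₀).eval τ₀ = 0) (h1 : (spec P z₀).derivative.eval τ₀ ≠ 0)
    {Ω : Set (Fin n → ℂ)} (hΩ : IsOpen Ω) (hz : z₀ ∈ Ω) :
    ∃ (D : Set (Fin n → ℂ)) (T : Set ℂ) (ψ : (Fin n → ℂ) → ℂ), IsOpen D ∧ IsOpen T ∧ z₀ ∈ D ∧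
      τ₀ ∈ T ∧ D ⊆ Ω ∧ DifferentiableOn ℂ ψ D ∧ (∀ z ∈ D, ψ z ∈ T) ∧
      ∀ z ∈ D, ∀ τ ∈ T, (spec P z).eval τ = 0 ↔ ψ z = τ := by
  have hcd : ContDiffAt ℂ 1 (fun u : (Fin n → ℂ) × ℂ => (spec P u.1).eval u.2) (z₀, τ₀) :=
    (contDiff_spec_eval P).contDiffAt
  have hinv : (fderiv ℂ (fun u : (Fin n → ℂ) × ℂ => (spec P u.1).eval u.2) (z₀, τ₀) ∘L
      .inr ℂ (Fin n → ℂ) ℂ).IsInvertible := by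
    refine ⟨ContinuousLinearEquiv.unitsEquivAut ℂ (Units.mk0 _ h1), ?_⟩
    have h2 := (hcd.differentiableAt one_ne_zero).hasFDerivAt.comp τ₀
      (hasFDerivAt_prodMk_right (𝕜 := ℂ) z₀ τ₀)
    have h3 : HasDerivAt (fun τ => (spec P z₀).eval τ) ((spec P z₀).derivative.eval τ₀) τ₀ :=
      (spec P z₀).hasDerivAt τ₀
    have h4 := h2.unique h3.hasFDerivAt
    rw [h4]
    ext
    simp
  set ψ := hcd.implicitFunction one_ne_zero hinv
  have hψ0 : ψ z₀ = τ₀ := hcd.implicitFunction_apply_self one_ne_zero hinv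
  have hψc : ContDiffAt ℂ 1 ψ z₀ := hcd.contDiffAt_implicitFunction one_ne_zero hinv
  have hev := hcd.eventually_apply_eq_iff_implicitFunction one_ne_zero hinv
  rw [nhds_prod_eq, Filter.eventually_prod_iff] at hev
  obtain ⟨pa, hpa, pb, hpb, hab⟩ := hev
  obtain ⟨T, hT, hTo, hτT⟩ := eventually_nhds_iff.1 hpb
  have hd : ∀ᶠ z in 𝓝 z₀, DifferentiableAt ℂ ψ z :=
    (hψc.eventually (by simp)).mono fun z hz => hz.differentiableAt one_ne_zero
  have hT' : ∀ᶠ z in 𝓝 z₀, ψ z ∈ T :=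
    hψc.continuousAt.eventually_mem (by rw [hψ0]; exact hTo.mem_nhds hτT)
  obtain ⟨D, hD, hDo, hzD⟩ := eventually_nhds_iff.1
    (hpa.and (hd.and (hT'.and (hΩ.eventually_mem hz))))
  refine ⟨D, T, ψ, hDo, hTo, hzD, hτT, fun z hz => (hD z hz).2.2.2,
    fun z hz => (hD z hz).2.1.differentiableWithinAt, fun z hz => (hD z hz).2.2.1, ?_⟩
  intro z hz τ hτ
  have := hab (hD z hz).1 (hT τ hτ)
  simp only [h0] at this
  exact this

namespace EtaleModel

variable {X : CScheme} {n : ℕ} (M : EtaleModel X n)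

lemma evalAt_polyHom {p : CPoints X} (hp : p.pt ∈ M.U) (R : MvPolynomial (Fin n) ℂ) :
    evalAt M.U (polyHom M.U M.y R) p = MvPolynomial.eval (coordMap M.U M.y p) R :=
  evalAt_eval₂Hom M.y hp R

lemma evalAt_eval₂ {p : CPoints X} (hp : p.pt ∈ M.U)
    (Q : Polynomial (MvPolynomial (Fin n) ℂ)) : evalAt M.U (Q.eval₂ (polyHom M.U M.y) M.a) p =
      (spec Q (coordMap M.U M.y p)).eval (evalAt M.U M.a p) := by
  have h : coordMap M.U M.y p = fun i => evalHom _ M.U hp (M.y i) :=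
    funext fun i => evalAt_of_mem hp _
  rw [h, evalAt_of_mem hp, evalAt_of_mem hp, map_eval₂_eq]
  · simp [polyHom]
  · intro c
    simp [polyHom, evalHom_const]

lemma spec_eval_eq_zero {p : CPoints X} (hp : p.pt ∈ M.U) :
    (spec M.P (coordMap M.U M.y p)).eval (evalAt M.U M.a p) = 0 := by
  rw [← M.evalAt_eval₂ hp, M.root, evalAt_of_mem hp, map_zero]

lemma evalAt_eq_div {p : CPoints X} (hp : p.pt ∈ M.U)
    (hε : MvPolynomial.eval (coordMap M.U M.y p) M.ε ≠ 0) {b : Γ(X.left, M.U)}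
    {Q : Polynomial (MvPolynomial (Fin n) ℂ)}
    (hQ : polyHom M.U M.y M.ε * b = Q.eval₂ (polyHom M.U M.y) M.a) :
    evalAt M.U b p = (spec Q (coordMap M.U M.y p)).eval (evalAt M.U M.a p) /
      MvPolynomial.eval (coordMap M.U M.y p) M.ε := by
  rw [eq_div_iff hε, ← M.evalAt_eval₂ hp, ← hQ, ← M.evalAt_polyHom hp, evalAt_of_mem hp,
    evalAt_of_mem hp, evalAt_of_mem hp, map_mul, mul_comm]

lemma point_ext {p q : CPoints X} (hp : p.pt ∈ M.U) (hq : q.pt ∈ M.U)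
    (hε : MvPolynomial.eval (coordMap M.U M.y p) M.ε ≠ 0)
    (hy : coordMap M.U M.y p = coordMap M.U M.y q) (ha : evalAt M.U M.a p = evalAt M.U M.a q) :
    p = q := by
  refine CPoints.ext_of_evalHom M.affine hp hq fun b => ?_
  obtain ⟨Q, hQ⟩ := M.exists_fraction b
  rw [M.evalAt_eq_div hp hε hQ, M.evalAt_eq_div hq (hy ▸ hε) hQ, hy, ha]

open Classical in
/-- The point with coordinates `(z, τ)` (and a junk value if there is none). -/
def point (p₀ : CPoints X) (z : Fin n → ℂ) (τ : ℂ) : CPoints X :=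
  if h : MvPolynomial.eval z M.ε ≠ 0 ∧ (spec M.P z).eval τ = 0 then
    (M.exists_point z τ h.1 h.2).choose else p₀

lemma point_spec (p₀ : CPoints X) {z : Fin n → ℂ} {τ : ℂ} (hε : MvPolynomial.eval z M.ε ≠ 0)
    (hτ : (spec M.P z).eval τ = 0) : (M.point p₀ z τ).pt ∈ M.U ∧
      coordMap M.U M.y (M.point p₀ z τ) = z ∧ evalAt M.U M.a (M.point p₀ z τ) = τ := by
  rw [point, dif_pos ⟨hε, hτ⟩]
  exact (M.exists_point z τ hε hτ).choose_spec

/-- The points with `ε ≠ 0` are regular, with the coordinates `y`. -/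
theorem exists_chart [LocallyOfFiniteType X.hom] {p₀ : CPoints X} (hp₀ : p₀.pt ∈ M.U)
    (hε₀ : MvPolynomial.eval (coordMap M.U M.y p₀) M.ε ≠ 0) :
    ∃ (χ : HolChart X n) (ψ : (Fin n → ℂ) → ℂ), p₀ ∈ χ.toHomeo.source ∧
      (∀ p ∈ χ.toHomeo.source, p.pt ∈ M.U ∧ χ.toHomeo p = coordMap M.U M.y p) ∧
      DifferentiableOn ℂ ψ χ.toHomeo.target ∧
      ∀ z ∈ χ.toHomeo.target, MvPolynomial.eval z M.ε ≠ 0 ∧ (spec M.P z).eval (ψ z) = 0 ∧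
        χ.toHomeo.symm z = M.point p₀ z (ψ z) := by
  have hroot := M.spec_eval_eq_zero hp₀
  -- The implicit function theorem describes one sheet of the covering near `p₀` by a holomorphic
  -- root `ψ`; the inverse of the chart sends `z` to the point `(z, ψ z)`.
  obtain ⟨D, T, ψ, hD, hT, hzD, hτT, hDε, hψ, hψT, hiff⟩ := exists_root_function M.P hroot
    (M.simple _ _ hε₀ hroot)
    (isOpen_ne_fun (MvPolynomial.continuous_eval M.ε) continuous_const) hε₀
  have hψ0 : ∀ z ∈ D, (spec M.P z).eval (ψ z) = 0 := fun z hz =>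
    (hiff z hz _ (hψT z hz)).2 rfl
  let inv : (Fin n → ℂ) → CPoints X := fun z => M.point p₀ z (ψ z)
  have hinv : ∀ z ∈ D, (inv z).pt ∈ M.U ∧ coordMap M.U M.y (inv z) = z ∧
      evalAt M.U M.a (inv z) = ψ z := fun z hz => M.point_spec p₀ (hDε hz) (hψ0 z hz)
  have hval : ∀ b : Γ(X.left, M.U), DifferentiableOn ℂ (fun z => evalAt M.U b (inv z)) D := by
    intro b
    obtain ⟨Q, hQ⟩ := M.exists_fraction b
    have h1 : DifferentiableOn ℂ (fun z => (spec Q z).eval (ψ z) * (MvPolynomial.eval z M.ε)⁻¹)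
        D := by
      intro z hz
      refine DifferentiableWithinAt.mul ?_ (DifferentiableWithinAt.inv ?_ (hDε hz))
      · exact (((contDiff_spec_eval Q).differentiable one_ne_zero) (z, ψ z)).comp_differentiableWithinAt z
          (differentiableWithinAt_id.prodMk (hψ z hz))
      · exact ((AnalyticOnNhd.eval_mvPolynomial M.ε z trivial).differentiableAt
          ).differentiableWithinAt
    refine h1.congr fun z hz => ?_
    obtain ⟨ha, hb, hc⟩ := hinv z hz
    rw [M.evalAt_eq_div ha (by rw [hb]; exact hDε hz) hQ, hb, hc, div_eq_mul_inv]
  let e : OpenPartialHomeomorph (CPoints X) (Fin n → ℂ) :=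
    { toFun := coordMap M.U M.y
      invFun := inv
      -- The condition on the value of `a` separates this sheet from the other roots over `D`.
      source := {p | p.pt ∈ M.U ∧ coordMap M.U M.y p ∈ D ∧ evalAt M.U M.a p ∈ T}
      target := D
      map_source' := fun p hp => hp.2.1
      map_target' := fun z hz => by
        obtain ⟨ha, hb, hc⟩ := hinv z hz
        refine ⟨ha, ?_, ?_⟩
        · rw [hb]; exact hz
        · rw [hc]; exact hψT z hz
      left_inv' := fun p hp => by
        obtain ⟨ha, hb, hc⟩ := hinv _ hp.2.1
        refine (M.point_ext hp.1 ha (hDε hp.2.1) hb.symm ?_).symm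
        rw [hc]
        exact ((hiff _ hp.2.1 _ hp.2.2).1 (M.spec_eval_eq_zero hp.1)).symm
      right_inv' := fun z hz => (hinv z hz).2.1
      open_source := by
        rw [isOpen_iff_mem_nhds]
        rintro p ⟨h1, h2, h3⟩
        have hc : ContinuousAt (coordMap M.U M.y) p :=
          continuousAt_pi.2 fun i => continuousAt_evalAt (M.y i) h1
        filter_upwards [(isOpen_setOf_pt_mem M.U).mem_nhds h1,
          hc.eventually_mem (hD.mem_nhds h2),
          (continuousAt_evalAt M.a h1).eventually_mem (hT.mem_nhds h3)] with q h4 h5 h6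
        exact ⟨h4, h5, h6⟩
      open_target := hD
      continuousOn_toFun := fun p hp => ContinuousAt.continuousWithinAt
        (continuousAt_pi.2 fun i => continuousAt_evalAt (M.y i) hp.1)
      continuousOn_invFun := by
        intro z hz
        apply ContinuousAt.continuousWithinAt
        obtain ⟨N, f, hf⟩ := exists_generators M.affine
        rw [ContinuousAt, nhds_eq_comap_coordMap M.affine hf (hinv z hz).1, Filter.tendsto_inf,
          Filter.tendsto_comap_iff, Filter.tendsto_principal]
        refine ⟨tendsto_pi_nhds.2 fun i => ?_, ?_⟩
        · exact ((hval (f i)).differentiableAt (hD.mem_nhds hz)).continuousAt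
        · filter_upwards [hD.mem_nhds hz] with z' hz'
          exact (hinv z' hz').1 }
  refine ⟨⟨e, ?_, ?_⟩, ψ, ⟨hp₀, hzD, hτT⟩, fun p hp => ⟨hp.1, rfl⟩, hψ,
    fun z hz => ⟨hDε hz, hψ0 z hz, rfl⟩⟩
  · rintro U' f z ⟨hz, hzU'⟩
    apply DifferentiableAt.differentiableWithinAt
    change D z at hz
    obtain ⟨r, s, hs, h⟩ := HStability.exists_fraction M.affine (hinv z hz).1 hzU' f
    have hds := (hval s).differentiableAt (hD.mem_nhds hz)
    have hdr := (hval r).differentiableAt (hD.mem_nhds hz)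
    refine (hdr.fun_mul (hds.fun_inv hs)).congr_of_eventuallyEq ?_
    filter_upwards [hD.mem_nhds hz, hds.continuousAt.eventually_ne hs] with z' hz' hs'
    exact (h _ (hinv z' hz').1 hs').2.trans (div_eq_mul_inv _ _)
  · intro z hz u hu
    obtain ⟨i, hi⟩ := Function.ne_iff.1 hu
    refine ⟨M.U, M.y i, (hinv z hz).1, ?_⟩
    have hev : (fun w' => evalAt M.U (M.y i) (e.symm w')) =ᶠ[𝓝 z] fun w' => w' i := by
      filter_upwards [hD.mem_nhds hz] with z' hz'
      exact congr_fun (hinv z' hz').2.1 i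
    rw [hev.fderiv_eq, (hasFDerivAt_apply i z).fderiv]
    exact hi

lemma exists_point_ne : ∃ p : CPoints X, p.pt ∈ M.U ∧
    MvPolynomial.eval (coordMap M.U M.y p) M.ε ≠ 0 := by
  obtain ⟨z, hz⟩ : ∃ z, MvPolynomial.eval z M.ε ≠ 0 := by
    by_contra! h
    exact M.ε_ne (MvPolynomial.funext fun z => by rw [h z, map_zero])
  have hdeg : (spec M.P z).degree ≠ 0 := by
    have h1 : (spec M.P z).natDegree = M.P.natDegree := M.monic.natDegree_map _
    have := M.natDegree_pos
    intro h0
    have := Polynomial.natDegree_eq_zero_iff_degree_le_zero.2 h0.le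
    omega
  obtain ⟨τ, hτ⟩ := IsAlgClosed.exists_root (spec M.P z) hdeg
  obtain ⟨p, h1, h2, -⟩ := M.exists_point z τ hz hτ
  exact ⟨p, h1, h2 ▸ hz⟩

end EtaleModel

/-! ## The volume is finite -/

/-- The zero set of a nonzero polynomial is a null set. -/
theorem volume_setOf_eval_eq_zero {n : ℕ} {q : MvPolynomial (Fin n) ℂ} (hq : q ≠ 0) :
    volume {z : Fin n → ℂ | MvPolynomial.eval z q = 0} = 0 := by
  induction n with
  | zero =>
    convert measure_empty (μ := (volume : Measure (Fin 0 → ℂ)))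
    rw [Set.eq_empty_iff_forall_notMem]
    intro z hz
    refine hq (MvPolynomial.funext fun z' => ?_)
    rw [Subsingleton.elim z' z, map_zero]
    exact hz
  | succ n ih =>
    have hmp := volume_preserving_piFinSuccAbove (fun _ : Fin (n + 1) => ℂ) 0
    have hclosed : IsClosed {z : Fin (n + 1) → ℂ | MvPolynomial.eval z q = 0} :=
      isClosed_eq (MvPolynomial.continuous_eval q) continuous_const
    rw [← hmp.symm.measure_preimage_equiv, Measure.volume_eq_prod, Measure.prod_apply_symm
      ((MeasurableEquiv.measurable _) hclosed.measurableSet)]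
    -- Fubini in the first variable: where the leading coefficient does not vanish, the slice is a
    -- set of roots of a nonzero polynomial, hence finite. The zeros of the leading coefficient are
    -- null by induction.
    set Q := MvPolynomial.finSuccEquiv ℂ n q with hQ
    have hQ0 : Q ≠ 0 := by
      rw [hQ, Ne, EmbeddingLike.map_eq_zero_iff]
      exact hq
    have hlc := ih (Polynomial.leadingCoeff_ne_zero.2 hQ0)
    rw [lintegral_eq_zero_iff'
      (measurable_measure_prodMk_right ((MeasurableEquiv.measurable _)
        hclosed.measurableSet)).aemeasurable]
    have hae : ∀ᵐ z' : Fin n → ℂ, MvPolynomial.eval z' Q.leadingCoeff ≠ 0 := by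
      rw [ae_iff]
      simpa using hlc
    filter_upwards [hae] with z' hz'
    have hne : Q.map (MvPolynomial.eval z') ≠ 0 := by
      intro h0
      have := congr_arg (fun R => Polynomial.coeff R Q.natDegree) h0
      simp only [Polynomial.coeff_map, Polynomial.coeff_zero] at this
      exact hz' this
    refine (Set.Finite.subset (Multiset.finite_toSet (Q.map (MvPolynomial.eval z')).roots)
      ?_).measure_zero _
    intro t ht
    have h1 : MvPolynomial.eval ((MeasurableEquiv.piFinSuccAbove (fun _ => ℂ) 0).symm (t, z')) q
      = 0 := ht
    have h2 : (MeasurableEquiv.piFinSuccAbove (fun _ : Fin (n + 1) => ℂ) 0).symm (t, z') =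
      Fin.cons t z' := by
      ext i
      refine Fin.cases ?_ (fun j => ?_) i <;> simp [MeasurableEquiv.piFinSuccAbove]
    rw [h2, MvPolynomial.eval_eq_eval_mv_eval'] at h1
    exact (Polynomial.mem_roots hne).2 h1

/-! ### Fibres of projections and measurability -/

section Fibres

variable {X : CScheme} {n N : ℕ}

/-- The number of points in a general fibre of a generically finite map is bounded. -/
theorem exists_card_fibre_le [IsIntegral X.left] (hdim : Algebra.trdeg ℂ (FunField X) = n)
    {U : X.left.Opens} [Nonempty U] (hU : IsAffineOpen U) {f : Fin N → Γ(X.left, U)}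
    (hf : Function.Surjective (MvPolynomial.eval₂Hom (const X U) f))
    {y : Fin n → Γ(X.left, U)} (hy : Function.Injective (polyHom U y)) :
    ∃ (q : MvPolynomial (Fin n) ℂ) (d : ℕ), q ≠ 0 ∧ ∀ z, MvPolynomial.eval z q ≠ 0 →
      ∀ s : Finset (CPoints X), (∀ p ∈ s, p.pt ∈ U ∧ coordMap U y p = z) → s.card ≤ d := by
  -- At a point over `z` each generator takes a value that is a root of its relation specialised at
  -- `z`. The relations stay nonzero if no leading coefficient vanishes at `z`, and a point is
  -- determined by the values of the generators.
  choose P hP1 hP2 using fun i => exists_relation hdim hy (f i)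
  refine ⟨∏ i, (P i).leadingCoeff, ∏ i, (P i).natDegree,
    Finset.prod_ne_zero_iff.2 fun i _ => Polynomial.leadingCoeff_ne_zero.2 (hP1 i), ?_⟩
  intro z hz s hs
  rw [map_prod, Finset.prod_ne_zero_iff] at hz
  have hne : ∀ i, spec (P i) z ≠ 0 := by
    intro i h0
    have := congr_arg (fun R => Polynomial.coeff R (P i).natDegree) h0
    simp only [spec, Polynomial.coeff_map, Polynomial.coeff_zero] at this
    exact hz i (Finset.mem_univ i) this
  have hcard : s.card ≤ (Fintype.piFinset fun i => (spec (P i) z).roots.toFinset).card := by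
    refine Finset.card_le_card_of_injOn (coordMap U f) (fun p hp => ?_) fun p hp p' hp' h => ?_
    · rw [Finset.mem_coe, Fintype.mem_piFinset]
      intro i
      rw [Multiset.mem_toFinset, Polynomial.mem_roots (hne i), Polynomial.IsRoot]
      obtain ⟨hpU, hpz⟩ := hs p hp
      have h1 := map_eval₂_eq (polyHom U y) (evalHom p U hpU)
        (fun c => by rw [polyHom_C, evalHom_const]) (P i) (f i)
      rw [hP2, map_zero] at h1
      simp only [polyHom_X, ← evalAt_of_mem hpU] at h1
      rw [← hpz]
      exact h1.symm
    · refine CPoints.ext_of_evalHom hU (hs p hp).1 (hs p' hp').1 fun g => ?_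
      obtain ⟨G, rfl⟩ := hf g
      rw [evalAt_eval₂Hom f (hs p hp).1, evalAt_eval₂Hom f (hs p' hp').1, h]
  refine hcard.trans ?_
  rw [Fintype.card_piFinset]
  refine Finset.prod_le_prod' fun i _ => ?_
  exact (Multiset.toFinset_card_le _).trans ((Polynomial.card_roots' _).trans
    (Polynomial.natDegree_map_le))

/-- The analytic topology of a proper variety is second countable. -/
theorem secondCountableTopology_cpoints [LocallyOfFiniteType X.hom] [CompactSpace (CPoints X)] :
    SecondCountableTopology (CPoints X) := by
  have hex : ∀ p : CPoints X, ∃ U : X.left.Opens, IsAffineOpen U ∧ p.pt ∈ U := fun p => by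
    obtain ⟨U, hU, hp, -⟩ := exists_isAffineOpen_mem_and_subset (X := X.left) (U := ⊤)
      (x := p.pt) trivial
    exact ⟨U, hU, hp⟩
  choose U hU hpU using hex
  obtain ⟨t, ht⟩ := isCompact_univ.elim_finite_subcover (fun p => {q : CPoints X | q.pt ∈ U p})
    (fun p => isOpen_setOf_pt_mem (U p)) fun p _ => Set.mem_iUnion.2 ⟨p, hpU p⟩
  have hsc : ∀ p : t, SecondCountableTopology {q : CPoints X | q.pt ∈ U p} := by
    intro p
    obtain ⟨N, f, hf⟩ := exists_generators (hU p)
    have hind : Topology.IsInducing fun q : {q : CPoints X | q.pt ∈ U p} =>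
        coordMap (U p) f q.1 := by
      rw [Topology.isInducing_iff_nhds]
      intro q
      rw [nhds_subtype_eq_comap, nhds_eq_comap_coordMap (hU p) hf q.2, Filter.comap_inf,
        Filter.comap_comap, Filter.comap_principal, Subtype.coe_preimage_self,
        Filter.principal_univ, inf_top_eq]
      rfl
    exact hind.secondCountableTopology
  refine TopologicalSpace.secondCountableTopology_of_countable_cover (ι := t)
    (fun p => isOpen_setOf_pt_mem (U p)) ?_
  rw [Set.eq_univ_iff_forall]
  intro q
  obtain ⟨p, hp, hq⟩ := Set.mem_iUnion₂.1 (ht (Set.mem_univ q))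
  exact Set.mem_iUnion.2 ⟨⟨p, hp⟩, hq⟩

lemma measurableSet_target_inter_symm {E F : Type} [TopologicalSpace E] [MeasurableSpace E]
    [BorelSpace E] [TopologicalSpace F] [MeasurableSpace F] [BorelSpace F]
    (e : OpenPartialHomeomorph E F) {A : Set E} (hA : MeasurableSet A) :
    MeasurableSet (e.target ∩ e.symm ⁻¹' A) := by
  classical
  rcases e.target.eq_empty_or_nonempty with h | ⟨z, hz⟩
  · rw [h, Set.empty_inter]; exact MeasurableSet.empty
  have hm : Measurable (e.target.piecewise e.symm fun _ => e.symm z) :=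
    e.continuousOn_symm.measurable_piecewise continuousOn_const e.open_target.measurableSet
  convert e.open_target.measurableSet.inter (hm hA) using 1
  ext w
  simp only [Set.mem_inter_iff, Set.mem_preimage, and_congr_right_iff]
  intro hw
  rw [Set.piecewise_eq_of_mem _ _ _ hw]

/-- The inverse of a local homeomorphism has arbitrary values off its target. It is almost
everywhere measurable for a measure that does not charge the complement of the target, and this is
what a push-forward needs. -/
lemma restrict_map_symm_apply {E F : Type} [TopologicalSpace E] [MeasurableSpace E]
    [BorelSpace E] [TopologicalSpace F] [MeasurableSpace F] [BorelSpace F]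
    (e : OpenPartialHomeomorph E F) (μ : Measure F) (hμ : μ e.targetᶜ = 0)
    {A : Set E} (hA : MeasurableSet A) :
    μ.map e.symm A = μ (e.target ∩ e.symm ⁻¹' A) := by
  have h1 : μ.restrict e.target = μ := Measure.restrict_eq_self_of_ae_mem (by
    rw [ae_iff]; exact hμ)
  have h2 : AEMeasurable e.symm μ := by
    rw [← h1]
    exact e.continuousOn_symm.aemeasurable e.open_target.measurableSet
  rw [Measure.map_apply_of_aemeasurable h2 hA]
  conv_lhs => rw [← h1]
  rw [Measure.restrict_apply' e.open_target.measurableSet, Set.inter_comm]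

end Fibres

/-! ### Pull-backs of Lebesgue measure under finite-to-one projections -/

section Bound

variable {X : CScheme} {n N : ℕ}

/-- The local homeomorphisms given by the functions `y`. -/
def etaleHomeos (U : X.left.Opens) (y : Fin n → Γ(X.left, U)) :
    Set (OpenPartialHomeomorph (CPoints X) (Fin n → ℂ)) :=
  {e | ∀ p ∈ e.source, p.pt ∈ U ∧ e p = coordMap U y p}

lemma exists_etaleHomeo (χ : HolChart X n) {U : X.left.Opens} {y : Fin n → Γ(X.left, U)}
    {w : Fin n → ℂ} (hw : w ∈ cdom χ U) (hdet : (cjacobian (cmap χ U y) w).det ≠ 0) :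
    ∃ e ∈ etaleHomeos U y, χ.toHomeo.symm w ∈ e.source := by
  obtain ⟨e, hwe, hsub, he⟩ := exists_localHomeo (isOpen_cdom χ U)
    (differentiableOn_cmap χ U y) hw hdet
  refine ⟨χ.toHomeo.trans e, fun p hp => ?_, ?_⟩
  · rw [OpenPartialHomeomorph.trans_source] at hp
    have h1 := hsub hp.2
    have h2 : χ.toHomeo.symm (χ.toHomeo p) = p := χ.toHomeo.left_inv hp.1
    refine ⟨?_, ?_⟩
    · have := h1.2
      rwa [h2] at this
    · rw [OpenPartialHomeomorph.coe_trans, Function.comp_apply, he _ hp.2]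
      ext i
      rw [cmap, cfun, h2, coordMap]
  · rw [OpenPartialHomeomorph.trans_source]
    refine ⟨χ.toHomeo.map_target hw.1, ?_⟩
    rw [Set.mem_preimage, χ.toHomeo.right_inv hw.1]
    exact hwe

/-- The Lindelöf property. The element `e₀` is inserted so that the countable family is nonempty and
can be indexed by `ℕ`. -/
lemma exists_countable_etaleHomeos [SecondCountableTopology (CPoints X)] (U : X.left.Opens)
    (y : Fin n → Γ(X.left, U)) (h : (etaleHomeos U y).Nonempty) :
    ∃ e : ℕ → OpenPartialHomeomorph (CPoints X) (Fin n → ℂ), (∀ j, e j ∈ etaleHomeos U y) ∧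
      ∀ e' ∈ etaleHomeos U y, e'.source ⊆ ⋃ j, (e j).source := by
  obtain ⟨T, hTsub, hT, hTU⟩ := TopologicalSpace.isOpen_biUnion_countable (etaleHomeos U y)
    (fun e => e.source) fun e _ => e.open_source
  obtain ⟨e₀, he₀⟩ := h
  obtain ⟨e, he⟩ := (hT.insert e₀).exists_eq_range (Set.insert_nonempty _ _)
  refine ⟨e, fun j => ?_, fun e' he' p hp => ?_⟩
  · have : e j ∈ insert e₀ T := he ▸ Set.mem_range_self j
    rcases this with h1 | h1
    · rwa [h1]
    · exact hTsub h1
  · have : p ∈ ⋃ e ∈ T, e.source := by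
      rw [hTU]
      exact Set.mem_biUnion he' hp
    obtain ⟨e1, he1, hp1⟩ := Set.mem_iUnion₂.1 this
    obtain ⟨j, rfl⟩ : e1 ∈ Set.range e := he ▸ Set.mem_insert_of_mem _ he1
    exact Set.mem_iUnion.2 ⟨j, hp1⟩

/-- The absolute value of the real Jacobian of a holomorphic map. -/
lemma abs_det_fderiv_restrictScalars {φ : (Fin n → ℂ) → (Fin n → ℂ)} {w : Fin n → ℂ}
    (h : DifferentiableAt ℂ φ w) :
    |((fderiv ℂ φ w).restrictScalars ℝ).det| = ‖(cjacobian φ w).det‖ ^ 2 := by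
  have hL : LinearMap.toMatrix' (fderiv ℂ φ w).toLinearMap = cjacobian φ w := by
    ext a j
    rw [LinearMap.toMatrix'_apply, cjacobian, Matrix.of_apply, cpartial]
    have := (hasFDerivAt_pi'.1 h.hasFDerivAt) a
    rw [this.fderiv]
    simp
  have h1 : ((fderiv ℂ φ w).restrictScalars ℝ).det =
      LinearMap.det ((fderiv ℂ φ w).toLinearMap.restrictScalars ℝ) := rfl
  rw [h1, LinearMap.det_restrictScalars, ← LinearMap.det_toMatrix', hL,
    Algebra.norm_complex_apply, Complex.normSq_eq_norm_sq, abs_of_nonneg (by positivity)]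

/-- Cut the étale locus of `y` into countably many disjoint pieces on which `y` is injective, and
let `ν` measure a set by the total volume of the images of its pieces. The change of variables
formula bounds the integral in every chart by the same `ν`. Its mass is at most `d` times the volume
of `Ω`, as almost every fibre has at most `d` points. -/
theorem exists_measure_bound [IsIntegral X.left] [SecondCountableTopology (CPoints X)]
    (hdim : Algebra.trdeg ℂ (FunField X) = n)
    {U : X.left.Opens} [Nonempty U] (hU : IsAffineOpen U) {f : Fin N → Γ(X.left, U)}
    (hf : Function.Surjective (MvPolynomial.eval₂Hom (const X U) f))
    (y : Fin n → Γ(X.left, U)) {W : Set (CPoints X)} (hWU : ∀ p ∈ W, p.pt ∈ U)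
    {Ω : Set (Fin n → ℂ)} (hΩ : IsOpen Ω) (hΩ' : volume Ω < ⊤)
    (hWΩ : ∀ p ∈ W, coordMap U y p ∈ Ω) :
    ∃ ν : Measure (CPoints X), IsFiniteMeasure ν ∧ ∀ (χ : HolChart X n) (A : Set (CPoints X)),
      MeasurableSet A → A ⊆ W →
      ∫⁻ w in χ.toHomeo.target ∩ χ.toHomeo.symm ⁻¹' A,
        ENNReal.ofReal (‖(cjacobian (cmap χ U y) w).det‖ ^ 2) ≤ ν A := by
  have hmeas : ∀ (χ : HolChart X n) (A : Set (CPoints X)), MeasurableSet A →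
      MeasurableSet (χ.toHomeo.target ∩ χ.toHomeo.symm ⁻¹' A) := fun χ A hA =>
    measurableSet_target_inter_symm χ.toHomeo hA
  -- If the Jacobian of `y` vanishes in all charts, the integrals are zero and so may be the
  -- measure. Otherwise the functions `y` are algebraically independent, and the bound on the fibres
  -- applies.
  by_cases hex : ∃ (χ : HolChart X n), ∃ w ∈ cdom χ U, (cjacobian (cmap χ U y) w).det ≠ 0
  swap
  · push Not at hex
    refine ⟨0, inferInstance, fun χ A hA hAW => ?_⟩
    rw [setLIntegral_congr_fun (hmeas χ A hA) (g := fun _ => 0) fun w hw => by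
      simp only [hex χ w ⟨hw.1, hWU _ (hAW hw.2)⟩, norm_zero, ne_eq, OfNat.ofNat_ne_zero,
        not_false_eq_true, zero_pow, ENNReal.ofReal_zero]]
    simp
  obtain ⟨χ₀, w₀, hw₀, hdet₀⟩ := hex
  have hy := polyHom_injective χ₀ hw₀ hdet₀
  obtain ⟨e₀, he₀, -⟩ := exists_etaleHomeo χ₀ hw₀ hdet₀
  obtain ⟨e, he, hcov⟩ := exists_countable_etaleHomeos U y ⟨e₀, he₀⟩
  let E : ℕ → Set (CPoints X) := disjointed fun j => (e j).source
  have hE : ∀ j, MeasurableSet (E j) :=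
    MeasurableSet.disjointed fun j => (e j).open_source.measurableSet
  have hEsub : ∀ j, E j ⊆ (e j).source := fun j => disjointed_subset _ j
  have hEdisj : Pairwise (Function.onFun Disjoint E) := disjoint_disjointed _
  have hEU : ⋃ j, E j = ⋃ j, (e j).source := iUnion_disjointed
  let Z : ℕ → Set (CPoints X) → Set (Fin n → ℂ) := fun j A =>
    (e j).target ∩ (e j).symm ⁻¹' (A ∩ E j) ∩ Ω
  have hZ : ∀ j A, MeasurableSet A → MeasurableSet (Z j A) := fun j A hA =>
    (measurableSet_target_inter_symm (e j) (hA.inter (hE j))).inter hΩ.measurableSet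
  let ν : Measure (CPoints X) := Measure.sum fun j =>
    (((volume.restrict Ω).restrict (e j).target).map (e j).symm).restrict (E j)
  have hν : ∀ A, MeasurableSet A → ν A = ∑' j, volume (Z j A) := by
    intro A hA
    rw [Measure.sum_apply _ hA]
    congr 1
    ext j
    rw [Measure.restrict_apply hA, restrict_map_symm_apply (e j) _ ?_ (hA.inter (hE j)),
      Measure.restrict_apply' (e j).open_target.measurableSet,
      Measure.restrict_apply' hΩ.measurableSet]
    · congr 1
      ext z
      simp only [Z, Set.mem_inter_iff]
      tauto
    · rw [Measure.restrict_apply' (e j).open_target.measurableSet, Set.compl_inter_self,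
        measure_empty]
  have hZpt : ∀ j A, ∀ z ∈ Z j A, (e j).symm z ∈ E j ∧ ((e j).symm z).pt ∈ U ∧
      coordMap U y ((e j).symm z) = z := by
    intro j A z hz
    have hs := (e j).map_target hz.1.1
    obtain ⟨h1, h2⟩ := he j _ hs
    exact ⟨hz.1.2.2, h1, by rw [← h2, (e j).right_inv hz.1.1]⟩
  refine ⟨ν, ⟨?_⟩, fun χ A hA hAW => ?_⟩
  · obtain ⟨q, d, hq, hd⟩ := exists_card_fibre_le hdim hU hf hy
    rw [hν _ MeasurableSet.univ]
    calc ∑' j, volume (Z j Set.univ)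
        = ∑' j, ∫⁻ z, (Z j Set.univ).indicator 1 z := by
          congr 1
          ext j
          rw [lintegral_indicator_one (hZ j _ MeasurableSet.univ)]
      _ = ∫⁻ z, ∑' j, (Z j Set.univ).indicator 1 z :=
          (lintegral_tsum fun j =>
            (measurable_one.indicator (hZ j _ MeasurableSet.univ)).aemeasurable).symm
      _ ≤ ∫⁻ z, Ω.indicator (fun _ => (d : ENNReal)) z := by
          refine lintegral_mono_ae ?_
          have hae : ∀ᵐ z : Fin n → ℂ, MvPolynomial.eval z q ≠ 0 := by
            rw [ae_iff]
            simpa using volume_setOf_eval_eq_zero hq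
          filter_upwards [hae] with z hz
          by_cases hzΩ : z ∈ Ω
          swap
          · have : ∀ j, (Z j Set.univ).indicator (1 : (Fin n → ℂ) → ENNReal) z = 0 := fun j =>
              Set.indicator_of_notMem (fun h => hzΩ h.2) _
            simp [this]
          rw [Set.indicator_of_mem hzΩ, ENNReal.tsum_eq_iSup_sum]
          refine iSup_le fun s => ?_
          classical
          have h1 : ∑ j ∈ s, (Z j Set.univ).indicator (1 : (Fin n → ℂ) → ENNReal) z =
              ((s.filter fun j => z ∈ Z j Set.univ).card : ENNReal) := by
            rw [Finset.card_filter]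
            push_cast
            refine Finset.sum_congr rfl fun j _ => ?_
            by_cases h : z ∈ Z j Set.univ <;> simp [h]
          rw [h1]
          -- The pieces are disjoint, so different branches over `z` give different points of the
          -- fibre.
          have hinj : Set.InjOn (fun j => (e j).symm z) (s.filter fun j => z ∈ Z j Set.univ) := by
            intro j hj k hk hjk
            by_contra hne
            have h2 := (hZpt j _ z (Finset.mem_filter.1 hj).2).1
            have h3 := (hZpt k _ z (Finset.mem_filter.1 hk).2).1
            simp only at hjk
            rw [← hjk] at h3
            exact Set.disjoint_left.1 (hEdisj hne) h2 h3
          rw [← Finset.card_image_of_injOn hinj]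
          norm_cast
          refine hd z hz _ fun p hp => ?_
          obtain ⟨j, hj, rfl⟩ := Finset.mem_image.1 hp
          exact (hZpt j _ z (Finset.mem_filter.1 hj).2).2
      _ = d * volume Ω := lintegral_indicator_const hΩ.measurableSet _
      _ < ⊤ := ENNReal.mul_lt_top (ENNReal.natCast_lt_top d) hΩ'
  · rw [hν A hA]
    let φ := cmap χ U y
    let S : ℕ → Set (Fin n → ℂ) := fun j => χ.toHomeo.target ∩ χ.toHomeo.symm ⁻¹' (A ∩ E j)
    have hSdom : ∀ j, ∀ w ∈ S j, w ∈ cdom χ U := fun j w hw => ⟨hw.1, hWU _ (hAW hw.2.1)⟩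
    have hφe : ∀ j, ∀ w ∈ S j, e j (χ.toHomeo.symm w) = φ w := fun j w hw =>
      (he j _ (hEsub j hw.2.2)).2
    have hSj : ∀ j, ∫⁻ w in S j, ENNReal.ofReal (‖(cjacobian φ w).det‖ ^ 2) ≤
        volume (Z j A) := by
      intro j
      have hdiff : ∀ w ∈ S j, DifferentiableAt ℂ φ w := fun w hw =>
        differentiableAt_cmap χ y (hSdom j w hw)
      rw [setLIntegral_congr_fun (hmeas χ _ (hA.inter (hE j)))
        (g := fun w => ENNReal.ofReal |((fderiv ℂ φ w).restrictScalars ℝ).det|)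
        fun w hw => by simp only [abs_det_fderiv_restrictScalars (hdiff w hw)]]
      rw [lintegral_abs_det_fderiv_eq_addHaar_image volume (hmeas χ _ (hA.inter (hE j)))
        (fun w hw => ((hdiff w hw).hasFDerivAt.restrictScalars ℝ).hasFDerivWithinAt)]
      · refine measure_mono ?_
        rintro _ ⟨w, hw, rfl⟩
        have h1 := hEsub j hw.2.2
        rw [← hφe j w hw]
        refine ⟨⟨(e j).map_source h1, ?_⟩, ?_⟩
        · rw [Set.mem_preimage, (e j).left_inv h1]
          exact hw.2
        · rw [hφe j w hw]
          exact hWΩ _ (hAW hw.2.1)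
      · intro w hw w' hw' h
        rw [← hφe j w hw, ← hφe j w' hw'] at h
        have h2 := (e j).injOn (hEsub j hw.2.2) (hEsub j hw'.2.2) h
        exact χ.toHomeo.symm.injOn hw.1 hw'.1 h2
    set B := χ.toHomeo.target ∩ χ.toHomeo.symm ⁻¹' A with hB
    have hBm := hmeas χ A hA
    -- Where the Jacobian is nonzero some branch passes through the point, so the pieces miss only
    -- points with integrand zero.
    have hle : ∀ w ∈ B, ENNReal.ofReal (‖(cjacobian φ w).det‖ ^ 2) ≤
        (⋃ j, S j).indicator (fun w => ENNReal.ofReal (‖(cjacobian φ w).det‖ ^ 2)) w := by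
      intro w hw
      by_cases h : w ∈ ⋃ j, S j
      · rw [Set.indicator_of_mem h]
      · rw [Set.indicator_of_notMem h, nonpos_iff_eq_zero]
        have h0 : (cjacobian φ w).det = 0 := by
          by_contra hne
          obtain ⟨e', he', hs⟩ := exists_etaleHomeo χ (y := y) ⟨hw.1, hWU _ (hAW hw.2)⟩ hne
          have h1 := hcov e' he' hs
          rw [← hEU] at h1
          obtain ⟨j, hj⟩ := Set.mem_iUnion.1 h1
          exact h (Set.mem_iUnion.2 ⟨j, hw.1, hw.2, hj⟩)
        simp [h0]
    calc ∫⁻ w in B, ENNReal.ofReal (‖(cjacobian φ w).det‖ ^ 2)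
        ≤ ∫⁻ w in B, (⋃ j, S j).indicator
            (fun w => ENNReal.ofReal (‖(cjacobian φ w).det‖ ^ 2)) w :=
          setLIntegral_mono' hBm hle
      _ ≤ ∫⁻ w, (⋃ j, S j).indicator
            (fun w => ENNReal.ofReal (‖(cjacobian φ w).det‖ ^ 2)) w := setLIntegral_le_lintegral _ _
      _ = ∫⁻ w in ⋃ j, S j, ENNReal.ofReal (‖(cjacobian φ w).det‖ ^ 2) :=
          lintegral_indicator (MeasurableSet.iUnion fun j => hmeas χ _ (hA.inter (hE j))) _
      _ ≤ ∑' j, ∫⁻ w in S j, ENNReal.ofReal (‖(cjacobian φ w).det‖ ^ 2) :=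
          lintegral_iUnion_le _ _
      _ ≤ ∑' j, volume (Z j A) := ENNReal.tsum_le_tsum hSj

end Bound

/-! ### Finiteness and positivity of the volume -/

section Volume

variable {X : CScheme} [IsIntegral X.left] {n : ℕ}

/-- The measure `ωⁿ` in one chart. -/
def chartVolume (p : PositiveMetric X n) (χ : HolChart X n) : Measure (CPoints X) :=
  (((MeasureTheory.volume : Measure (Fin n → ℂ)).restrict χ.toHomeo.target).withDensity
    fun w => ENNReal.ofReal (p.volumeDensity χ w)).map χ.toHomeo.symm

lemma chartVolume_apply (p : PositiveMetric X n) (χ : HolChart X n) {A : Set (CPoints X)}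
    (hA : MeasurableSet A) : chartVolume p χ A =
      ∫⁻ w in χ.toHomeo.target ∩ χ.toHomeo.symm ⁻¹' A, ENNReal.ofReal (p.volumeDensity χ w) := by
  have hm := measurableSet_target_inter_symm χ.toHomeo hA
  rw [chartVolume, restrict_map_symm_apply _ _ ?_ hA, withDensity_apply _ hm,
    Measure.restrict_restrict hm, Set.inter_right_comm, Set.inter_self]
  apply withDensity_absolutelyContinuous
  rw [Measure.restrict_apply' χ.toHomeo.open_target.measurableSet, Set.compl_inter_self,
    measure_empty]

variable [LocallyOfFiniteType X.hom]

/-- Near `x` the minors of the Hessian of the potential are bounded by `C`, so the density of `ωⁿ`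
is at most a multiple of the sum over `κ` of the squared Jacobians of the n-tuples `f ∘ κ`. This
works at singular points, and uniformly in the chart. -/
lemma exists_local_bound [SecondCountableTopology (CPoints X)] (hX : IsNormal X)
    (hdim : Algebra.trdeg ℂ (FunField X) = n) (p : PositiveMetric X n) (x : CPoints X) :
    ∃ (W : Set (CPoints X)) (ν : Measure (CPoints X)), IsOpen W ∧ x ∈ W ∧ IsFiniteMeasure ν ∧
      ∀ (χ : HolChart X n) (A : Set (CPoints X)), MeasurableSet A → A ⊆ W →
        chartVolume p χ A ≤ ν A := by
  obtain ⟨L, hxL, -⟩ := exists_localPotential p x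
  have : Nonempty L.U := ⟨⟨_, (L.mem x hxL).1⟩⟩
  set z₀ := coordMap L.U L.f x with hz₀
  let G : (Fin n → Fin L.N) × (Fin n → Fin L.N) → (Fin L.N → ℂ) → ℝ := fun κ z =>
    ‖((complexHessian L.F z).submatrix κ.1 κ.2).det‖
  have hG : ∀ κ, ContinuousAt (G κ) z₀ := by
    intro κ
    have h1 := continuousAt_complexHessian
      (L.smooth.contDiffAt (L.isOpen_V.mem_nhds (L.mem x hxL).2))
    have h2 : Continuous fun H : Matrix (Fin L.N) (Fin L.N) ℂ => ‖(H.submatrix κ.1 κ.2).det‖ :=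
      ((continuous_id.matrix_submatrix κ.1 κ.2).matrix_det).norm
    exact h2.continuousAt.comp h1
  -- Adding 1 to each term makes `C` strictly larger than every minor at `z₀`, so it remains a bound
  -- nearby.
  set C := ∑ κ, (G κ z₀ + 1) with hC
  have hCκ : ∀ κ, G κ z₀ < C := fun κ =>
    (lt_add_one _).trans_le (Finset.single_le_sum
      (f := fun κ => G κ z₀ + 1) (fun κ _ => by positivity) (Finset.mem_univ κ))
  have hev : ∀ᶠ z in 𝓝 z₀, ∀ κ, G κ z ≤ C :=
    Filter.eventually_all.2 fun κ => ((hG κ).eventually_lt continuousAt_const (hCκ κ)).mono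
      fun z hz => hz.le
  obtain ⟨r, hr, hball⟩ := Metric.eventually_nhds_iff_ball.1 hev
  let W : Set (CPoints X) := {q | q ∈ L.W ∧ coordMap L.U L.f q ∈ Metric.ball z₀ r}
  have hW : IsOpen W := by
    rw [isOpen_iff_mem_nhds]
    rintro q ⟨h1, h2⟩
    have hc : ContinuousAt (coordMap L.U L.f) q :=
      continuousAt_pi.2 fun i => continuousAt_evalAt (L.f i) (L.mem q h1).1
    filter_upwards [L.isOpen_W.mem_nhds h1, hc.eventually_mem (Metric.isOpen_ball.mem_nhds h2)]
      with q' h3 h4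
    exact ⟨h3, h4⟩
  choose ν hν hνle using fun κ : Fin n → Fin L.N => exists_measure_bound hdim L.affine
    L.surjective (L.f ∘ κ) (W := W) (fun q hq => (L.mem q hq.1).1)
    (Ω := Metric.ball (z₀ ∘ κ) r) Metric.isOpen_ball measure_ball_lt_top
    (fun q hq => by
      rw [Metric.mem_ball, dist_pi_lt_iff hr]
      intro i
      exact (dist_pi_lt_iff hr).1 hq.2 (κ i))
  -- The normalisation of `ωⁿ` times the constant of `norm_det_sandwich_le`.
  set c : ℝ := n.factorial / Real.pi ^ n * (C * Fintype.card (Fin n → Fin L.N)) with hc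
  have hC0 : 0 ≤ C := Finset.sum_nonneg fun κ _ => by positivity
  have hc0 : 0 ≤ c := by positivity
  refine ⟨W, ENNReal.ofReal c • ∑ κ, ν κ, hW, ⟨hxL, Metric.mem_ball_self hr⟩, ?_, ?_⟩
  · have : IsFiniteMeasure (∑ κ, ν κ) := inferInstance
    exact Measure.smul_finite _ ENNReal.ofReal_ne_top
  · intro χ A hA hAW
    have hm := measurableSet_target_inter_symm χ.toHomeo hA
    have hpt : ∀ w ∈ χ.toHomeo.target ∩ χ.toHomeo.symm ⁻¹' A,
        ENNReal.ofReal (p.volumeDensity χ w) ≤ ENNReal.ofReal c *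
          ∑ κ : Fin n → Fin L.N,
            ENNReal.ofReal (‖(cjacobian (cmap χ L.U (L.f ∘ κ)) w).det‖ ^ 2) := by
      intro w hw
      have hwL : w ∈ L.dom χ := ⟨hw.1, (hAW hw.2).1⟩
      rw [← ENNReal.ofReal_sum_of_nonneg (fun _ _ => by positivity), ← ENNReal.ofReal_mul hc0]
      apply ENNReal.ofReal_le_ofReal
      have h1 := norm_det_sandwich_le (cjacobian (cmap χ L.U L.f) w)
        (complexHessian L.F (cmap χ L.U L.f w)) (C := C)
        (fun κ κ' => hball _ (hAW hw.2).2 (κ, κ'))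
      rw [← L.curvature_eq hX hdim χ hwL] at h1
      rw [PositiveMetric.volumeDensity, hc, mul_assoc]
      refine mul_le_mul_of_nonneg_left ?_ (by positivity)
      exact ((Complex.re_le_norm _).trans h1)
    rw [chartVolume_apply p χ hA, Measure.smul_apply, Measure.finsetSum_apply, smul_eq_mul]
    refine (setLIntegral_mono' hm hpt).trans ?_
    rw [lintegral_const_mul' _ _ ENNReal.ofReal_ne_top]
    gcongr
    rw [lintegral_finsetSum']
    · exact Finset.sum_le_sum fun κ _ => hνle κ χ A hA hAW
    · intro κ _
      have hcont : ContinuousOn (fun w => ‖(cjacobian (cmap χ L.U (L.f ∘ κ)) w).det‖ ^ 2)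
          (cdom χ L.U) :=
        (differentiableOn_det_cjacobian χ (L.f ∘ κ)).continuousOn.norm.pow 2
      have hsub : χ.toHomeo.target ∩ χ.toHomeo.symm ⁻¹' A ⊆ cdom χ L.U :=
        fun w hw => ⟨hw.1, (L.mem _ (hAW hw.2).1).1⟩
      exact ((hcont.mono hsub).aemeasurable hm).ennreal_ofReal

/-- A supremum of measures is bounded by any common upper bound. Finitely many of the local bounds
cover the compact space, and their sum dominates the measure of every chart. -/
theorem isFiniteMeasure_volume [CompactSpace (CPoints X)] (hX : IsNormal X)
    (hdim : Algebra.trdeg ℂ (FunField X) = n) (p : PositiveMetric X n) :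
    IsFiniteMeasure p.volume := by
  have := secondCountableTopology_cpoints (X := X)
  choose W ν hW hxW hν hle using exists_local_bound hX hdim p
  obtain ⟨t, ht⟩ := isCompact_univ.elim_finite_subcover W hW fun x _ =>
    Set.mem_iUnion.2 ⟨x, hxW x⟩
  have hfin : IsFiniteMeasure (∑ x ∈ t, ν x) := inferInstance
  refine isFiniteMeasure_of_le (∑ x ∈ t, ν x) (iSup_le fun χ => Measure.le_iff.2 fun A hA => ?_)
  rw [Measure.finsetSum_apply]
  calc chartVolume p χ A ≤ chartVolume p χ (⋃ x ∈ t, A ∩ W x) := by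
        refine measure_mono fun q hq => ?_
        obtain ⟨x, hx, hqx⟩ := Set.mem_iUnion₂.1 (ht (Set.mem_univ q))
        exact Set.mem_iUnion₂.2 ⟨x, hx, hq, hqx⟩
    _ ≤ ∑ x ∈ t, chartVolume p χ (A ∩ W x) := measure_biUnion_finset_le _ _
    _ ≤ ∑ x ∈ t, ν x A := Finset.sum_le_sum fun x _ =>
        (hle x χ _ (hA.inter (hW x).measurableSet) Set.inter_subset_right).trans
          (measure_mono Set.inter_subset_left)

/-- A measurable set that contains an open piece of a chart has positive volume. -/
theorem volume_pos (hX : IsNormal X) (hdim : Algebra.trdeg ℂ (FunField X) = n)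
    (p : PositiveMetric X n) (χ : HolChart X n) {O : Set (Fin n → ℂ)} (hO : IsOpen O)
    {w : Fin n → ℂ} (hwO : w ∈ O) (hw : w ∈ χ.toHomeo.target) {A : Set (CPoints X)}
    (hA : MeasurableSet A) (hOA : ∀ w ∈ O, w ∈ χ.toHomeo.target → χ.toHomeo.symm w ∈ A) :
    0 < p.volume A := by
  have h1 : chartVolume p χ A ≤ p.volume A := (le_iSup (chartVolume p) χ) A
  refine lt_of_lt_of_le ?_ h1
  rw [chartVolume_apply p χ hA]
  have hpos := volumeDensity_pos hX hdim p χ hw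
  have hcont := (continuousOn_volumeDensity hX hdim p χ).continuousAt
    (χ.toHomeo.open_target.mem_nhds hw)
  have hev : ∀ᶠ w' in 𝓝 w, p.volumeDensity χ w / 2 < p.volumeDensity χ w' ∧ w' ∈ O ∧
      w' ∈ χ.toHomeo.target :=
    (continuousAt_const.eventually_lt hcont (half_lt_self hpos)).and
      ((hO.eventually_mem hwO).and (χ.toHomeo.open_target.eventually_mem hw))
  obtain ⟨O', hO', hO'o, hwO'⟩ := eventually_nhds_iff.1 hev
  calc 0 < ENNReal.ofReal (p.volumeDensity χ w / 2) * volume O' :=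
        ENNReal.mul_pos (ENNReal.ofReal_pos.2 (half_pos hpos)).ne'
          (hO'o.measure_pos volume ⟨w, hwO'⟩).ne'
    _ = ∫⁻ _ in O', ENNReal.ofReal (p.volumeDensity χ w / 2) := (setLIntegral_const _ _).symm
    _ ≤ ∫⁻ w' in O', ENNReal.ofReal (p.volumeDensity χ w') :=
        setLIntegral_mono' hO'o.measurableSet fun w' hw' =>
          ENNReal.ofReal_le_ofReal (hO' w' hw').1.le
    _ ≤ ∫⁻ w' in χ.toHomeo.target ∩ χ.toHomeo.symm ⁻¹' A,
          ENNReal.ofReal (p.volumeDensity χ w') := lintegral_mono_set fun w' hw' =>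
        ⟨(hO' w' hw').2.2, hOA w' (hO' w' hw').2.1 (hO' w' hw').2.2⟩

/-- A regular point is provided by a generically étale presentation; the density is positive there.
-/
theorem V_pos [CompactSpace (CPoints X)] (hX : IsNormal X)
    (hdim : Algebra.trdeg ℂ (FunField X) = n) (p : PositiveMetric X n) : 0 < p.V := by
  have := isFiniteMeasure_volume hX hdim p
  obtain ⟨U, hU, hgen, -⟩ := exists_isAffineOpen_mem_and_subset (X := X.left) (U := ⊤)
    (x := genericPoint X.left) trivial
  have : Nonempty U := ⟨⟨_, hgen⟩⟩
  obtain ⟨M, -⟩ := exists_etaleModel hdim hU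
  obtain ⟨q, hq, hε⟩ := M.exists_point_ne
  obtain ⟨χ, -, hqχ, -⟩ := M.exists_chart hq hε
  have hpos := volume_pos hX hdim p χ isOpen_univ (Set.mem_univ _) (χ.toHomeo.map_source hqχ)
    MeasurableSet.univ fun _ _ _ => Set.mem_univ _
  rw [PositiveMetric.V, integral_const, smul_eq_mul, mul_one]
  exact ENNReal.toReal_pos hpos.ne' (measure_ne_top _ _)

/-- A continuous function is constant almost everywhere if and only if it is constant on the
regular part. -/
theorem ae_eq_const_iff (hX : IsNormal X) (hdim : Algebra.trdeg ℂ (FunField X) = n)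
    (p : PositiveMetric X n) {θ : CPoints X → ℝ} (hθ : Continuous θ) (a : ℝ) :
    (∀ᵐ x ∂p.volume, θ x = a) ↔
      ∀ χ : HolChart X n, ∀ w ∈ χ.toHomeo.target, θ (χ.toHomeo.symm w) = a := by
  have hclosed : IsClosed {x | θ x = a} := isClosed_eq hθ continuous_const
  constructor
  · intro h χ w hw
    by_contra hne
    have hc : ContinuousAt (fun w' => θ (χ.toHomeo.symm w')) w :=
      hθ.continuousAt.comp (χ.toHomeo.continuousAt_symm hw)
    obtain ⟨O, hO, hOo, hwO⟩ := eventually_nhds_iff.1 (hc.eventually_ne hne)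
    have := volume_pos hX hdim p χ hOo hwO hw hclosed.isOpen_compl.measurableSet
      fun w' hw' _ => hO w' hw'
    exact this.ne' (ae_iff.1 h)
  · intro h
    -- The measure of each chart is concentrated on the set where `θ = a`, so the supremum is
    -- bounded by its own restriction to this set.
    have hle : p.volume ≤ p.volume.restrict {x | θ x = a} := by
      refine iSup_le fun χ => Measure.le_iff.2 fun A hA => ?_
      rw [Measure.restrict_apply hA]
      refine le_trans ?_ ((le_iSup (chartVolume p) χ) _)
      change chartVolume p χ A ≤ _
      rw [chartVolume_apply p χ hA, chartVolume_apply p χ (hA.inter hclosed.measurableSet)]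
      exact lintegral_mono_set fun w hw => ⟨hw.1, hw.2, h χ w hw.1⟩
    rw [ae_iff]
    refine le_antisymm ((hle _).trans_eq ?_) zero_le
    rw [Measure.restrict_apply' hclosed.measurableSet]
    convert measure_empty (μ := p.volume)
    ext x
    simp

end Volume

/-! ## Jensen's inequality -/

section Jensen

variable {α : Type} [MeasurableSpace α] {μ : Measure α} [IsFiniteMeasure μ] {θ : α → ℝ}

/-- Integrate `exp t ≥ 1 + t` at `t = θ - m`, where `m` is the mean of `θ`. Equality holds only at
`t = 0`, which gives the equality case. -/
theorem integral_le_log_integral_exp (hV : 0 < μ.real Set.univ) (h1 : Integrable θ μ)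
    (h2 : Integrable (fun x => Real.exp (θ x)) μ) :
    ∫ x, θ x ∂μ ≤
        μ.real Set.univ * Real.log (1 / μ.real Set.univ * ∫ x, Real.exp (θ x) ∂μ) ∧
      (∫ x, θ x ∂μ =
        μ.real Set.univ * Real.log (1 / μ.real Set.univ * ∫ x, Real.exp (θ x) ∂μ) ↔
        ∃ a, ∀ᵐ x ∂μ, θ x = a) := by
  set V := μ.real Set.univ with hVdef
  set m := 1 / V * ∫ x, θ x ∂μ with hm
  set I := 1 / V * ∫ x, Real.exp (θ x) ∂μ with hI
  have hθ : ∫ x, θ x ∂μ = V * m := by rw [hm]; field_simp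
  have hE : ∫ x, Real.exp (θ x) ∂μ = V * I := by rw [hI]; field_simp
  let g : α → ℝ := fun x => Real.exp (θ x - m) - (θ x - m) - 1
  have hg0 : ∀ x, 0 ≤ g x := fun x => by
    have := Real.add_one_le_exp (θ x - m)
    simp only [g]
    linarith
  have hgeq : ∀ x, g x = Real.exp (-m) * Real.exp (θ x) - (θ x + (1 - m)) := fun x => by
    simp only [g]
    rw [sub_eq_add_neg (θ x) m, Real.exp_add]
    ring
  have hgint : Integrable g μ := by
    simp only [funext hgeq]
    exact (h2.const_mul _).sub (h1.add (integrable_const _))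
  have hgval : ∫ x, g x ∂μ = V * (Real.exp (-m) * I - 1) := by
    simp only [funext hgeq]
    have h3 : Integrable (fun x => θ x + (1 - m)) μ := h1.add (integrable_const _)
    rw [integral_sub (h2.const_mul _) h3, integral_const_mul,
      integral_add h1 (integrable_const _), integral_const, hE, hθ, smul_eq_mul]
    ring
  have hpos : 0 ≤ V * (Real.exp (-m) * I - 1) := hgval ▸ integral_nonneg hg0
  have hI1 : Real.exp m ≤ I := by
    have h3 : 0 ≤ Real.exp (-m) * I - 1 := by
      by_contra h
      push Not at h
      nlinarith
    have h4 : Real.exp m * Real.exp (-m) = 1 := by rw [← Real.exp_add]; simp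
    have := mul_le_mul_of_nonneg_left (sub_nonneg.1 h3) (Real.exp_pos m).le
    rw [← mul_assoc, h4] at this
    linarith
  have hlog : m ≤ Real.log I := by
    have := Real.log_le_log (Real.exp_pos m) hI1
    rwa [Real.log_exp] at this
  rw [hθ]
  refine ⟨mul_le_mul_of_nonneg_left hlog hV.le, ?_, ?_⟩
  · intro h
    have h3 : m = Real.log I := mul_left_cancel₀ hV.ne' h
    have h4 : I = Real.exp m := by
      rw [h3, Real.exp_log ((Real.exp_pos m).trans_le hI1)]
    rw [h4, ← Real.exp_add, neg_add_cancel, Real.exp_zero, sub_self, mul_zero] at hgval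
    refine ⟨m, ?_⟩
    filter_upwards [(integral_eq_zero_iff_of_nonneg hg0 hgint).1 hgval] with x hx
    by_contra hne
    have := Real.add_one_lt_exp (sub_ne_zero.2 hne)
    have hx' : g x = 0 := hx
    simp only [g] at hx'
    linarith
  · rintro ⟨a, ha⟩
    have h3 : ∫ x, θ x ∂μ = V * a := by
      rw [integral_congr_ae (ha.mono fun x hx => hx), integral_const, smul_eq_mul]
    have h4 : ∫ x, Real.exp (θ x) ∂μ = V * Real.exp a := by
      rw [integral_congr_ae (g := fun _ => Real.exp a) (ha.mono fun x hx => by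
        simp only [hx]), integral_const, smul_eq_mul]
    have h5 : m = a := by rw [hm, h3]; field_simp
    have h6 : I = Real.exp a := by rw [hI, h4]; field_simp
    rw [h5, h6, Real.log_exp]

end Jensen

namespace SpecialDegeneration

variable {X : CScheme} {n : ℕ} {D : SpecialDegeneration X n}

instance : IsProper D.central.hom := (D.fano 0).proper

instance : CompactSpace (CPoints D.central) := compactSpace_of_isProper

/-- The convergence of the integrals, and the comparison of the two invariants. -/
theorem Choice.comparison (c : D.Choice) :
    (0 < c.p.V ∧ IsFiniteMeasure c.p.volume ∧
      Integrable (fun x => c.θ x * Real.exp (c.h x)) c.p.volume ∧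
      Integrable c.θ c.p.volume ∧
      Integrable (fun x => Real.exp (c.θ x)) c.p.volume) ∧
    c.DF ≥ c.H ∧ (c.DF = c.H ↔ ∃ a, ∀ χ : HolChart D.central n, ∀ w ∈ χ.toHomeo.target,
      c.θ (χ.toHomeo.symm w) = a) := by
  have hnorm := (D.fano 0).normal
  have hdim := (D.fano 0).dim
  have hfin := isFiniteMeasure_volume hnorm hdim c.p
  have hV := V_pos hnorm hdim c.p
  have hcont := c.hamiltonian.continuous
  have hbdd : ∀ g : CPoints D.central → ℝ, Continuous g → Integrable g c.p.volume := by
    intro g hg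
    obtain ⟨C, hC⟩ := isCompact_univ.exists_bound_of_continuousOn hg.continuousOn
    exact Integrable.of_bound hg.aestronglyMeasurable C (Filter.Eventually.of_forall fun x =>
      hC x (Set.mem_univ x))
  have h1 : Integrable c.θ c.p.volume := hbdd _ hcont
  have h2 : Integrable (fun x => Real.exp (c.θ x)) c.p.volume :=
    hbdd _ (Real.continuous_exp.comp hcont)
  -- The integral of a function that is not integrable is zero by convention, so the normalisation
  -- `∫ exp h = V > 0` contains the integrability.
  have h3 : Integrable (fun x => Real.exp (c.h x)) c.p.volume := by
    by_contra h
    have := c.ricci.2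
    rw [integral_undef h] at this
    exact hV.ne this
  have h4 : Integrable (fun x => c.θ x * Real.exp (c.h x)) c.p.volume := by
    obtain ⟨C, hC⟩ := isCompact_univ.exists_bound_of_continuousOn hcont.continuousOn
    exact h3.bdd_mul hcont.aestronglyMeasurable (Filter.Eventually.of_forall fun x =>
      hC x (Set.mem_univ x))
  have hVeq : c.p.V = c.p.volume.real Set.univ := by
    rw [PositiveMetric.V, integral_const, smul_eq_mul, mul_one]
  obtain ⟨h5, h6⟩ := integral_le_log_integral_exp (hVeq ▸ hV) h1 h2
  rw [← hVeq] at h5 h6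
  refine ⟨⟨hV, hfin, h4, h1, h2⟩, ?_, ?_⟩
  · unfold Choice.DF Choice.H
    linarith
  · rw [← exists_congr fun a => ae_eq_const_iff hnorm hdim c.p hcont a, ← h6]
    unfold Choice.DF Choice.H
    constructor
    · intro h
      linarith
    · intro h
      rw [← h]

end SpecialDegeneration

/-! ## Functions of polynomial growth -/

/-- A continuous function on the plane that is holomorphic off a finite set and has polynomial
growth is a polynomial. -/
theorem exists_polynomial_of_growth {g : ℂ → ℂ} (hg : Continuous g) {S : Set ℂ} (hS : S.Finite)
    (hd : ∀ s ∉ S, DifferentiableAt ℂ g s) {C : ℝ} {m : ℕ}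
    (hC : ∀ s, ‖g s‖ ≤ C * (1 + ‖s‖) ^ m) :
    ∃ p : Polynomial ℂ, p.natDegree ≤ m ∧ ∀ s, g s = p.eval s := by
  -- Cauchy's formula on discs tolerates a countable exceptional set for continuous functions, so
  -- the singularities are removable.
  have hdiff : Differentiable ℂ g := by
    intro s
    have h := Complex.hasFPowerSeriesOnBall_of_differentiable_off_countable (R := 1) (c := s)
      hS.countable hg.continuousOn (fun z hz => hd z hz.2) one_pos
    exact h.analyticAt.differentiableAt
  -- The Cauchy estimates on circles of radius `R → ∞` remove all Taylor coefficients beyond the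
  -- growth exponent.
  have hzero : ∀ k, m < k → iteratedDeriv k g 0 = 0 := by
    intro k hk
    rw [← norm_le_zero_iff]
    have hlim : Filter.Tendsto (fun R : ℝ => (k.factorial * C * 2 ^ m) * R⁻¹) Filter.atTop
        (𝓝 ((k.factorial * C * 2 ^ m) * 0)) := tendsto_inv_atTop_zero.const_mul _
    rw [mul_zero] at hlim
    refine ge_of_tendsto hlim ?_
    filter_upwards [Filter.eventually_ge_atTop 1] with R hR
    have hR0 : 0 < R := by linarith
    have hC0 : 0 ≤ C := by simpa using (norm_nonneg _).trans (hC 0)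
    refine (Complex.norm_iteratedDeriv_le_of_forall_mem_sphere_norm_le k hR0
      hdiff.diffContOnCl (C := C * (2 * R) ^ m) fun z hz => (hC z).trans ?_).trans ?_
    · have : ‖z‖ = R := by simpa using hz
      rw [this]
      gcongr
      linarith
    · rw [div_le_iff₀ (by positivity), mul_pow]
      have h1 : R ^ (m + 1) ≤ R ^ k := pow_le_pow_right₀ hR hk
      have h2 : R ^ m ≤ R⁻¹ * R ^ k := by
        rw [← div_eq_inv_mul, le_div_iff₀ hR0, ← pow_succ]
        exact h1
      calc (k.factorial : ℝ) * (C * (2 ^ m * R ^ m)) = (k.factorial * C * 2 ^ m) * R ^ m := by ring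
        _ ≤ (k.factorial * C * 2 ^ m) * (R⁻¹ * R ^ k) := by gcongr
        _ = _ := by ring
  refine ⟨∑ k ∈ Finset.range (m + 1),
    Polynomial.monomial k ((k.factorial : ℂ)⁻¹ * iteratedDeriv k g 0), ?_, fun s => ?_⟩
  · refine Polynomial.natDegree_sum_le_of_forall_le _ _ fun k hk => ?_
    exact (Polynomial.natDegree_monomial_le _).trans (by simp at hk; omega)
  · have h := Complex.taylorSeries_eq_of_entire' 0 s hdiff
    rw [← h, tsum_eq_sum (s := Finset.range (m + 1)), Polynomial.eval_finsetSum]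
    · simp
    · intro k hk
      rw [hzero k (by simpa using hk)]
      simp

/-- A function that is polynomial of bounded degree in each variable is a polynomial. -/
theorem exists_mvPolynomial_of_separately (m : ℕ) : ∀ {n : ℕ} (f : (Fin n → ℂ) → ℂ),
    (∀ z i, ∃ p : Polynomial ℂ, p.natDegree ≤ m ∧ ∀ s, f (Function.update z i s) = p.eval s) →
    ∃ q : MvPolynomial (Fin n) ℂ, ∀ z, f z = MvPolynomial.eval z q
  | 0, f, _ => ⟨MvPolynomial.C (f 0), fun z => by
      rw [MvPolynomial.eval_C]
      exact congrArg f (Subsingleton.elim _ _)⟩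
  | n + 1, f, h => by
    -- A polynomial of degree at most `m` is determined by its values at the nodes `0, …, m`. So `f`
    -- is interpolated in the first variable from its restrictions to these values, which are
    -- polynomials by induction.
    let v : Fin (m + 1) → ℂ := fun k => (k : ℂ)
    have hv : Function.Injective v := fun a b hab => Fin.ext (by simpa [v] using hab)
    have hq : ∀ k : Fin (m + 1), ∃ q : MvPolynomial (Fin n) ℂ,
        ∀ z, f (Fin.cons (v k) z) = MvPolynomial.eval z q := fun k =>
      exists_mvPolynomial_of_separately m (fun z => f (Fin.cons (v k) z)) fun z i => by
        obtain ⟨p, hp, hp'⟩ := h (Fin.cons (v k) z) i.succ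
        exact ⟨p, hp, fun s => by rw [Fin.cons_update]; exact hp' s⟩
    choose q hq using hq
    refine ⟨∑ k, Polynomial.aeval (MvPolynomial.X 0) (Lagrange.basis Finset.univ v k) *
      MvPolynomial.rename Fin.succ (q k), fun z => ?_⟩
    obtain ⟨p, hp, hp'⟩ := h z 0
    have hz : f z = p.eval (z 0) := by rw [← hp' (z 0), Function.update_eq_self]
    have hpv : ∀ k, p.eval (v k) = f (Fin.cons (v k) (Fin.tail z)) := fun k => by
      rw [← hp' (v k)]
      congr 1
      conv_lhs => rw [← Fin.cons_self_tail z]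
      rw [Fin.update_cons_zero]
    have hintg := Lagrange.eq_interpolate (s := Finset.univ) (f := p) hv.injOn (by
      rw [Finset.card_univ, Fintype.card_fin]
      exact Polynomial.degree_le_natDegree.trans_lt (by exact_mod_cast Nat.lt_succ_of_le hp))
    rw [hz, hintg, Lagrange.interpolate_apply, Polynomial.eval_finsetSum, map_sum]
    refine Finset.sum_congr rfl fun k _ => ?_
    rw [Polynomial.eval_mul, Polynomial.eval_C, hpv, hq, map_mul, MvPolynomial.eval_rename,
      mul_comm]
    congr 1
    rw [Polynomial.aeval_def, Polynomial.hom_eval₂]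
    simp [Polynomial.eval₂_eq_eval_map, MvPolynomial.algebraMap_eq]
    congr 1
    ext i
    simp

lemma exists_norm_eval_le {n : ℕ} (q : MvPolynomial (Fin n) ℂ) :
    ∃ (C : ℝ) (m : ℕ), 0 ≤ C ∧ ∀ z, ‖MvPolynomial.eval z q‖ ≤ C * (1 + ‖z‖) ^ m := by
  induction q using MvPolynomial.induction_on with
  | C c => exact ⟨‖c‖, 0, norm_nonneg _, fun z => by simp⟩
  | add p q hp hq =>
    obtain ⟨C, m, hC, hp⟩ := hp
    obtain ⟨C', m', hC', hq⟩ := hq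
    refine ⟨C + C', m + m', by positivity, fun z => ?_⟩
    have h1 : (1 : ℝ) ≤ 1 + ‖z‖ := by linarith [norm_nonneg z]
    rw [map_add, add_mul]
    refine (norm_add_le _ _).trans (add_le_add ((hp z).trans ?_) ((hq z).trans ?_))
    · gcongr
      exact Nat.le_add_right m m'
    · gcongr
      exact Nat.le_add_left m' m
  | mul_X p i hp =>
    obtain ⟨C, m, hC, hp⟩ := hp
    refine ⟨C, m + 1, hC, fun z => ?_⟩
    rw [map_mul, MvPolynomial.eval_X, norm_mul, pow_succ, ← mul_assoc]
    have : ‖z i‖ ≤ 1 + ‖z‖ := (norm_le_pi_norm z i).trans (by linarith)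
    gcongr
    exact hp z

lemma norm_update_le {n : ℕ} (z : Fin n → ℂ) (i : Fin n) (s : ℂ) :
    1 + ‖Function.update z i s‖ ≤ (1 + ‖z‖) * (1 + ‖s‖) := by
  have : ‖Function.update z i s‖ ≤ ‖z‖ + ‖s‖ := by
    refine (pi_norm_le_iff_of_nonneg (by positivity)).2 fun j => ?_
    by_cases hj : j = i
    · subst hj
      simp
    · rw [Function.update_of_ne hj]
      linarith [norm_le_pi_norm z j, norm_nonneg s]
  nlinarith [norm_nonneg z, norm_nonneg s]

/-- A function holomorphic on `ε ≠ 0` and bounded by the product of `ε` and a power of the norm is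
a polynomial. -/
theorem exists_mvPolynomial_of_growth {n : ℕ} (ε : MvPolynomial (Fin n) ℂ)
    {f : (Fin n → ℂ) → ℂ} (hd : ∀ z, MvPolynomial.eval z ε ≠ 0 → DifferentiableAt ℂ f z)
    {C : ℝ} {m : ℕ} (hC0 : 0 ≤ C)
    (hC : ∀ z, ‖f z‖ ≤ ‖MvPolynomial.eval z ε‖ * (C * (1 + ‖z‖) ^ m)) :
    ∃ q : MvPolynomial (Fin n) ℂ, ∀ z, f z = MvPolynomial.eval z q := by
  -- At the zeros of `ε` the bound forces `f = 0` and makes `f` tend to zero.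
  have hcont : Continuous f := by
    refine continuous_iff_continuousAt.2 fun z => ?_
    by_cases hz : MvPolynomial.eval z ε = 0
    · have hfz : f z = 0 := by simpa [hz] using hC z
      rw [ContinuousAt, hfz]
      refine squeeze_zero_norm hC ?_
      have : Continuous fun z => ‖MvPolynomial.eval z ε‖ * (C * (1 + ‖z‖) ^ m) := by
        have := MvPolynomial.continuous_eval ε
        fun_prop
      simpa [hz] using this.tendsto z
    · exact (hd z hz).continuousAt
  obtain ⟨C', m', hC', hε⟩ := exists_norm_eval_le ε
  refine exists_mvPolynomial_of_separately (m' + m) f fun z i => ?_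
  have hup : Differentiable ℂ fun s : ℂ => Function.update z i s := by
    refine differentiable_pi.2 fun j => ?_
    by_cases hj : j = i
    · subst hj
      simp
    · simp [Function.update_of_ne hj]
  let e : Polynomial ℂ := MvPolynomial.eval₂ Polynomial.C
    (fun j => if j = i then Polynomial.X else Polynomial.C (z j)) ε
  have he : ∀ s, e.eval s = MvPolynomial.eval (Function.update z i s) ε := fun s => by
    have : e.eval s = Polynomial.evalRingHom s e := rfl
    rw [this, MvPolynomial.eval₂_comp_left, MvPolynomial.eval, MvPolynomial.coe_eval₂Hom]
    congr 1
    · ext; simp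
    · ext j
      by_cases hj : j = i
      · subst hj; simp
      · simp [hj]
  -- The line may lie in the zero set of `ε`; then `f` vanishes on it. Otherwise only finitely many
  -- points of the line are exceptional.
  by_cases he0 : e = 0
  · refine ⟨0, by simp, fun s => ?_⟩
    have h := hC (Function.update z i s)
    rw [← he s, he0] at h
    simpa using h
  · refine exists_polynomial_of_growth (hcont.comp hup.continuous) (S := {s | e.IsRoot s})
      (Polynomial.finite_setOfPred_isRoot he0) (fun s hs => ?_)
      (C := C' * C * (1 + ‖z‖) ^ (m' + m)) fun s => ?_
    · exact (hd _ (by rw [← he]; exact hs)).comp s (hup s)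
    · have h1 := norm_update_le z i s
      refine (hC _).trans ?_
      calc _ ≤ (C' * ((1 + ‖z‖) * (1 + ‖s‖)) ^ m') * (C * ((1 + ‖z‖) * (1 + ‖s‖)) ^ m) := by
            gcongr
            refine (hε _).trans ?_
            gcongr
        _ = _ := by rw [mul_pow, mul_pow, pow_add, pow_add]; ring

/-! ## Locally constant functions on the regular part -/

/-- Cauchy's bound for the roots of a monic polynomial, whose coefficients have polynomial growth.
-/
lemma exists_norm_root_le {n : ℕ} {P : Polynomial (MvPolynomial (Fin n) ℂ)} (hP : P.Monic) :
    ∃ (C : ℝ) (m : ℕ), 1 ≤ C ∧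
      ∀ z τ, (spec P z).eval τ = 0 → ‖τ‖ ≤ C * (1 + ‖z‖) ^ m := by
  have h : ∀ i, ∃ (C : ℝ) (m : ℕ), 0 ≤ C ∧
    ∀ z, ‖MvPolynomial.eval z (P.coeff i)‖ ≤ C * (1 + ‖z‖) ^ m := fun i => exists_norm_eval_le _
  choose C m hC h using h
  refine ⟨∑ i ∈ Finset.range P.natDegree, C i + 1, ∑ i ∈ Finset.range P.natDegree, m i,
    by linarith [Finset.sum_nonneg fun i (_ : i ∈ Finset.range P.natDegree) => hC i],
    fun z τ hτ => ?_⟩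
  have hmon : (spec P z).Monic := hP.map _
  have hb := Polynomial.IsRoot.norm_lt_cauchyBound hmon.ne_zero hτ
  have h1 : (1 : ℝ) ≤ 1 + ‖z‖ := by linarith [norm_nonneg z]
  have hpow : ∀ {k}, (1 : ℝ) ≤ (1 + ‖z‖) ^ k := one_le_pow₀ h1
  refine (le_of_lt (show ‖τ‖ < (spec P z).cauchyBound from hb)).trans ?_
  rw [Polynomial.cauchyBound, hmon.leadingCoeff, nnnorm_one, div_one, NNReal.coe_add,
    NNReal.coe_one, add_mul, one_mul]
  refine add_le_add ?_ hpow
  have hnd : (spec P z).natDegree = P.natDegree := hP.natDegree_map _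
  rw [hnd, Finset.sum_mul]
  have hsup : ((Finset.range P.natDegree).sup fun i => ‖(spec P z).coeff i‖₊) ≤
      ∑ i ∈ Finset.range P.natDegree, ‖(spec P z).coeff i‖₊ :=
    Finset.sup_le fun i hi => Finset.single_le_sum (f := fun i => ‖(spec P z).coeff i‖₊)
      (fun _ _ => zero_le) hi
  refine (NNReal.coe_le_coe.2 hsup).trans ?_
  rw [NNReal.coe_sum]
  refine Finset.sum_le_sum fun i hi => ?_
  have : (spec P z).coeff i = MvPolynomial.eval z (P.coeff i) := Polynomial.coeff_map _ _
  rw [coe_nnnorm, this]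
  refine (h i z).trans ?_
  have := hC i
  gcongr
  exact Finset.single_le_sum (f := m) (fun _ _ => Nat.zero_le _) hi

/-- Division by `T - τ`: the polynomial `(P(σ) - P(τ)) / (σ - τ)` in `σ` and `τ` vanishes at two
different roots of `P`, and is the derivative on the diagonal. -/
lemma sum_coeff_mul_geom {P : Polynomial ℂ} {N : ℕ} (hN : P.natDegree ≤ N) {σ τ : ℂ}
    (hσ : P.eval σ = 0) (hτ : P.eval τ = 0) :
    ∑ i ∈ Finset.range (N + 1), P.coeff i * ∑ k ∈ Finset.range i, σ ^ k * τ ^ (i - 1 - k) =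
      if σ = τ then P.derivative.eval σ else 0 := by
  have hev : ∀ s, P.eval s = ∑ i ∈ Finset.range (N + 1), P.coeff i * s ^ i := fun s =>
    Polynomial.eval_eq_sum_range' (Nat.lt_succ_of_le hN) s
  split_ifs with h
  · subst h
    have hd : P.derivative.eval σ =
        ∑ i ∈ Finset.range (N + 1), P.coeff i * (i * σ ^ (i - 1)) := by
      conv_lhs => rw [Polynomial.as_sum_range' P (N + 1) (Nat.lt_succ_of_le hN)]
      rw [Polynomial.derivative_sum, Polynomial.eval_finsetSum]
      refine Finset.sum_congr rfl fun i _ => ?_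
      rw [Polynomial.derivative_monomial, Polynomial.eval_monomial]
      ring
    rw [hd]
    refine Finset.sum_congr rfl fun i _ => ?_
    congr 1
    rw [Finset.sum_congr rfl fun k hk => ?_, Finset.sum_const, Finset.card_range, nsmul_eq_mul]
    rw [← pow_add]
    congr 1
    have := Finset.mem_range.1 hk
    omega
  · refine mul_right_cancel₀ (sub_ne_zero.2 h) ?_
    rw [zero_mul, Finset.sum_mul]
    simp_rw [mul_assoc, geom_sum₂_mul, mul_sub]
    rw [Finset.sum_sub_distrib, ← hev, ← hev, hσ, hτ, sub_zero]

namespace EtaleModel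

variable {X : CScheme} {n : ℕ} (M : EtaleModel X n)

lemma card_roots {z : Fin n → ℂ} (hz : MvPolynomial.eval z M.ε ≠ 0) :
    (spec M.P z).roots.toFinset.card = M.P.natDegree := by
  have hmon : (spec M.P z).Monic := M.monic.map _
  rw [Multiset.toFinset_card_of_nodup, IsAlgClosed.card_roots_eq_natDegree]
  · exact M.monic.natDegree_map _
  · rw [Multiset.nodup_iff_count_le_one]
    intro τ
    rw [Polynomial.count_roots]
    by_contra hlt
    push Not at hlt
    have h := (Polynomial.one_lt_rootMultiplicity_iff_isRoot hmon.ne_zero).1 hlt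
    exact M.simple z τ hz h.1 h.2

/-- The power sums of the roots over `z`, weighted by the values of `g`. -/
def weightedSum (p₀ : CPoints X) (g : CPoints X → ℂ) (j : ℕ) (z : Fin n → ℂ) : ℂ :=
  MvPolynomial.eval z M.ε *
    ∑ τ ∈ (spec M.P z).roots.toFinset, g (M.point p₀ z τ) * τ ^ j

lemma mem_roots {z : Fin n → ℂ} {τ : ℂ} :
    τ ∈ (spec M.P z).roots.toFinset ↔ (spec M.P z).eval τ = 0 := by
  have hmon : (spec M.P z).Monic := M.monic.map _
  rw [Multiset.mem_toFinset, Polynomial.mem_roots hmon.ne_zero]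
  rfl

lemma point_congr (p₀ p₁ : CPoints X) {z : Fin n → ℂ} {τ : ℂ}
    (hε : MvPolynomial.eval z M.ε ≠ 0) (hτ : (spec M.P z).eval τ = 0) :
    M.point p₀ z τ = M.point p₁ z τ := by
  rw [point, point, dif_pos ⟨hε, hτ⟩, dif_pos ⟨hε, hτ⟩]

/-- Where `ε ≠ 0` the roots are locally given by holomorphic functions, and `g` is constant along
each of the sheets. The weighted sum is then a finite sum of holomorphic functions with constant
weights. -/
lemma differentiableAt_weightedSum [LocallyOfFiniteType X.hom] (p₀ : CPoints X)
    {g : CPoints X → ℂ} (hg : ∀ χ : HolChart X n, ∀ w ∈ χ.toHomeo.target,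
      ∀ᶠ w' in 𝓝 w, g (χ.toHomeo.symm w') = g (χ.toHomeo.symm w)) (j : ℕ)
    {z : Fin n → ℂ} (hz : MvPolynomial.eval z M.ε ≠ 0) :
    DifferentiableAt ℂ (M.weightedSum p₀ g j) z := by
  classical
  have key : ∀ τ : ℂ, ∃ ψ : (Fin n → ℂ) → ℂ, (spec M.P z).eval τ = 0 →
      DifferentiableAt ℂ ψ z ∧ ψ z = τ ∧ ∀ᶠ z' in 𝓝 z, (spec M.P z').eval (ψ z') = 0 ∧
        g (M.point p₀ z' (ψ z')) = g (M.point p₀ z τ) := by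
    intro τ
    by_cases hτ : (spec M.P z).eval τ = 0
    swap
    · exact ⟨0, fun h => absurd h hτ⟩
    obtain ⟨h1, h2, h3⟩ := M.point_spec p₀ hz hτ
    obtain ⟨χ, ψ, hs, hsrc, hψ, ht⟩ := M.exists_chart h1 (by rwa [h2])
    have hχ : χ.toHomeo (M.point p₀ z τ) = z := by rw [(hsrc _ hs).2, h2]
    have hzt : z ∈ χ.toHomeo.target := hχ ▸ χ.toHomeo.map_source hs
    have hzs : χ.toHomeo.symm z = M.point p₀ z τ := by
      rw [← hχ, χ.toHomeo.left_inv hs, hχ]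
    have hψz : ψ z = τ := by
      obtain ⟨e1, e2, e3⟩ := ht z hzt
      have := (M.point_spec (M.point p₀ z τ) e1 e2).2.2
      rw [← e3, hzs, h3] at this
      exact this.symm
    refine ⟨ψ, fun _ => ⟨hψ.differentiableAt (χ.toHomeo.open_target.mem_nhds hzt), hψz, ?_⟩⟩
    filter_upwards [hg χ z hzt, χ.toHomeo.open_target.mem_nhds hzt] with z' hz' hz't
    obtain ⟨e1, e2, e3⟩ := ht z' hz't
    rw [hzs, e3, M.point_congr _ p₀ e1 e2] at hz'
    exact ⟨e2, hz'⟩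
  choose ψ hψ using key
  have hev : ∀ᶠ z' in 𝓝 z, M.weightedSum p₀ g j z' = MvPolynomial.eval z' M.ε *
      ∑ τ ∈ (spec M.P z).roots.toFinset, g (M.point p₀ z τ) * ψ τ z' ^ j := by
    have hε : ∀ᶠ z' in 𝓝 z, MvPolynomial.eval z' M.ε ≠ 0 :=
      (MvPolynomial.continuous_eval M.ε).continuousAt.eventually_ne hz
    have h1 : ∀ᶠ z' in 𝓝 z, ∀ τ ∈ (spec M.P z).roots.toFinset,
        (spec M.P z').eval (ψ τ z') = 0 ∧ g (M.point p₀ z' (ψ τ z')) = g (M.point p₀ z τ) :=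
      (Filter.eventually_all_finset _).2 fun τ hτ => (hψ τ (M.mem_roots.1 hτ)).2.2
    have h2 : ∀ᶠ z' in 𝓝 z, ∀ τ ∈ (spec M.P z).roots.toFinset,
        ∀ σ ∈ (spec M.P z).roots.toFinset, τ ≠ σ → ψ τ z' ≠ ψ σ z' := by
      refine (Filter.eventually_all_finset _).2 fun τ hτ =>
        (Filter.eventually_all_finset _).2 fun σ hσ => ?_
      by_cases hne : τ = σ
      · exact Filter.Eventually.of_forall fun _ h => absurd hne h
      · obtain ⟨a1, a2, -⟩ := hψ τ (M.mem_roots.1 hτ)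
        obtain ⟨b1, b2, -⟩ := hψ σ (M.mem_roots.1 hσ)
        have := (a1.continuousAt.sub b1.continuousAt).eventually_ne
          (y := 0) (by simpa [a2, b2, sub_eq_zero] using hne)
        filter_upwards [this] with z' hz' _ h
        exact hz' (by simp [h])
    filter_upwards [hε, h1, h2] with z' hε h1 h2
    have hinj : Set.InjOn (fun τ => ψ τ z') ((spec M.P z).roots.toFinset : Set ℂ) :=
      fun τ hτ σ hσ h => by_contra fun hne => h2 τ hτ σ hσ hne h
    -- The branches remain different near `z`, and the number of roots does not depend on the point,
    -- so the branches give all the roots.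
    have himg : (spec M.P z').roots.toFinset =
        (spec M.P z).roots.toFinset.image fun τ => ψ τ z' := by
      refine (Finset.eq_of_subset_of_card_le (fun σ hσ => ?_) ?_).symm
      · obtain ⟨τ, hτ, rfl⟩ := Finset.mem_image.1 hσ
        exact M.mem_roots.2 (h1 τ hτ).1
      · rw [Finset.card_image_of_injOn hinj, M.card_roots hz, M.card_roots hε]
    rw [weightedSum, himg, Finset.sum_image hinj]
    congr 1
    exact Finset.sum_congr rfl fun τ hτ => by rw [(h1 τ hτ).2]
  refine DifferentiableAt.congr_of_eventuallyEq ?_ hev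
  refine DifferentiableAt.fun_mul ?_ (DifferentiableAt.fun_sum fun τ hτ => ?_)
  · exact (AnalyticOnNhd.eval_mvPolynomial M.ε z trivial).differentiableAt
  · exact ((hψ τ (M.mem_roots.1 hτ)).1.pow j).const_mul _

/-- The factor `ε` lets the sum tend to zero at the branch locus, and its growth is polynomial
because `g` is bounded and the roots grow polynomially. -/
lemma exists_mvPolynomial_weightedSum [LocallyOfFiniteType X.hom] (p₀ : CPoints X)
    {g : CPoints X → ℂ} (hg : ∀ χ : HolChart X n, ∀ w ∈ χ.toHomeo.target,
      ∀ᶠ w' in 𝓝 w, g (χ.toHomeo.symm w') = g (χ.toHomeo.symm w))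
    {B : ℝ} (hB : ∀ p, ‖g p‖ ≤ B) (j : ℕ) :
    ∃ q : MvPolynomial (Fin n) ℂ, ∀ z, M.weightedSum p₀ g j z = MvPolynomial.eval z q := by
  obtain ⟨C, m, hC, hroot⟩ := exists_norm_root_le M.monic
  have hB0 : 0 ≤ B := (norm_nonneg _).trans (hB p₀)
  refine exists_mvPolynomial_of_growth M.ε (fun z hz => M.differentiableAt_weightedSum p₀ hg j hz)
    (C := M.P.natDegree * (B * C ^ j)) (m := m * j) (by positivity) fun z => ?_
  rw [weightedSum, norm_mul]
  refine mul_le_mul_of_nonneg_left ?_ (norm_nonneg _)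
  refine (norm_sum_le _ _).trans ?_
  have hcard : ((spec M.P z).roots.toFinset.card : ℝ) ≤ M.P.natDegree := by
    have h1 : (spec M.P z).natDegree = M.P.natDegree := M.monic.natDegree_map _
    exact_mod_cast ((Multiset.toFinset_card_le _).trans (Polynomial.card_roots' _)).trans_eq h1
  refine (Finset.sum_le_card_nsmul _ _ (B * (C * (1 + ‖z‖) ^ m) ^ j) fun τ hτ => ?_).trans ?_
  · rw [norm_mul, norm_pow]
    have := hroot z τ (M.mem_roots.1 hτ)
    have := hB (M.point p₀ z τ)
    gcongr
  · rw [nsmul_eq_mul, mul_pow, ← pow_mul]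
    calc _ ≤ (M.P.natDegree : ℝ) * (B * (C ^ j * (1 + ‖z‖) ^ (m * j))) := by gcongr
      _ = _ := by ring

/-- The section whose value at the points with `ε ≠ 0` is `g` times a function without zeros. -/
lemma exists_section [LocallyOfFiniteType X.hom] {g : CPoints X → ℂ}
    (hg : ∀ χ : HolChart X n, ∀ w ∈ χ.toHomeo.target,
      ∀ᶠ w' in 𝓝 w, g (χ.toHomeo.symm w') = g (χ.toHomeo.symm w))
    {B : ℝ} (hB : ∀ p, ‖g p‖ ≤ B) :
    ∃ N : Γ(X.left, M.U), ∀ p : CPoints X, p.pt ∈ M.U →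
      MvPolynomial.eval (coordMap M.U M.y p) M.ε ≠ 0 → (evalAt M.U N p = 0 ↔ g p = 0) := by
  obtain ⟨p₀, -, -⟩ := M.exists_point_ne
  choose q hq using M.exists_mvPolynomial_weightedSum p₀ hg hB
  -- The interpolation polynomial `∑ ε g(τ) (P(T) - P(τ)) / (T - τ)` over the roots `τ`, expanded in
  -- powers of `T`; its coefficients involve `g` only through the weighted power sums. At a root `σ`
  -- all terms but one vanish, which leaves `ε g(σ) P'(σ)`.
  let Q : Polynomial (MvPolynomial (Fin n) ℂ) := ∑ i ∈ Finset.range (M.P.natDegree + 1),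
    ∑ k ∈ Finset.range i, Polynomial.monomial k (M.P.coeff i * q (i - 1 - k))
  refine ⟨Q.eval₂ (polyHom M.U M.y) M.a, fun p hp hε => ?_⟩
  set z := coordMap M.U M.y p with hz
  set σ := evalAt M.U M.a p with hσ
  have hσ0 : (spec M.P z).eval σ = 0 := M.spec_eval_eq_zero hp
  have hpt : M.point p₀ z σ = p := by
    obtain ⟨h1, h2, h3⟩ := M.point_spec p₀ hε hσ0
    exact M.point_ext h1 hp (by rwa [h2]) (by rw [h2]) (by rw [h3])
  have hval : evalAt M.U (Q.eval₂ (polyHom M.U M.y) M.a) p =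
      MvPolynomial.eval z M.ε * (g p * (spec M.P z).derivative.eval σ) := by
    have hnd : (spec M.P z).natDegree = M.P.natDegree := M.monic.natDegree_map _
    have hc : ∀ i, (spec M.P z).coeff i = MvPolynomial.eval z (M.P.coeff i) := fun i =>
      Polynomial.coeff_map _ _
    rw [M.evalAt_eval₂ hp]
    have h1 : (spec Q z).eval σ = ∑ i ∈ Finset.range (M.P.natDegree + 1),
        ∑ k ∈ Finset.range i, (spec M.P z).coeff i * M.weightedSum p₀ g (i - 1 - k) z * σ ^ k := by
      rw [spec, Polynomial.map_sum, Polynomial.eval_finsetSum]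
      refine Finset.sum_congr rfl fun i _ => ?_
      rw [Polynomial.map_sum, Polynomial.eval_finsetSum]
      refine Finset.sum_congr rfl fun k _ => ?_
      rw [Polynomial.map_monomial, Polynomial.eval_monomial, hc, hq]
      simp
    rw [← hz, ← hσ, h1]
    have h2 : ∀ τ ∈ (spec M.P z).roots.toFinset, g (M.point p₀ z τ) *
        (∑ i ∈ Finset.range (M.P.natDegree + 1), (spec M.P z).coeff i *
          ∑ k ∈ Finset.range i, σ ^ k * τ ^ (i - 1 - k)) =
        if σ = τ then g p * (spec M.P z).derivative.eval σ else 0 := fun τ hτ => by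
      rw [sum_coeff_mul_geom hnd.le hσ0 (M.mem_roots.1 hτ)]
      split_ifs with h
      · rw [← h, hpt]
      · rw [mul_zero]
    have h3 := Finset.sum_congr (rfl : (spec M.P z).roots.toFinset = _) h2
    rw [Finset.sum_ite_eq, if_pos (M.mem_roots.2 hσ0)] at h3
    rw [← h3, Finset.mul_sum]
    simp_rw [weightedSum, Finset.mul_sum, Finset.sum_mul]
    rw [Finset.sum_congr rfl fun i _ => Finset.sum_comm, Finset.sum_comm]
    refine Finset.sum_congr rfl fun τ _ => Finset.sum_congr rfl fun i _ =>
      Finset.sum_congr rfl fun k _ => ?_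
    ring
  rw [hval]
  simp [hε, M.simple z σ hε hσ0]

end EtaleModel

/-- The regular part of an irreducible complete variety is connected: a continuous function that is
locally constant on it is constant. -/
theorem exists_eq_const_of_locally_const {X : CScheme} {n : ℕ} [IsIntegral X.left]
    [LocallyOfFiniteType X.hom] [CompactSpace (CPoints X)]
    (hdim : Algebra.trdeg ℂ (FunField X) = n) {θ : CPoints X → ℝ} (hθ : Continuous θ)
    (hloc : ∀ χ : HolChart X n, ∀ w ∈ χ.toHomeo.target,
      ∀ᶠ w' in 𝓝 w, θ (χ.toHomeo.symm w') = θ (χ.toHomeo.symm w)) :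
    ∃ a, ∀ χ : HolChart X n, ∀ w ∈ χ.toHomeo.target, θ (χ.toHomeo.symm w) = a := by
  obtain ⟨U, hU, hxU, -⟩ := exists_isAffineOpen_mem_and_subset
    (U := (⊤ : X.left.Opens)) (x := genericPoint X.left) trivial
  have : Nonempty U := ⟨⟨_, hxU⟩⟩
  obtain ⟨M, rfl⟩ := exists_etaleModel hdim hU
  obtain ⟨p₀, hp₀, hε₀⟩ := M.exists_point_ne
  obtain ⟨B, hB⟩ := (isCompact_range hθ).isBounded.exists_norm_le
  obtain ⟨N, hN⟩ := M.exists_section (g := fun p => ((θ p - θ p₀ : ℝ) : ℂ))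
    (fun χ w hw => (hloc χ w hw).mono fun w' h => by rw [h]) (B := B + B) fun p => by
      rw [Complex.norm_real]
      exact (norm_sub_le _ _).trans (add_le_add (hB _ ⟨p, rfl⟩) (hB _ ⟨p₀, rfl⟩))
  simp only [Complex.ofReal_eq_zero, sub_eq_zero] at hN
  -- `θ` equals `θ p₀` near `p₀`, so the section vanishes on an open piece of a chart.
  have hN0 : N = 0 := by
    obtain ⟨χ, ψ, hs, hsrc, -, ht⟩ := M.exists_chart hp₀ hε₀
    have ht₀ := χ.toHomeo.map_source hs
    have hw : χ.toHomeo p₀ ∈ cdom χ M.U := ⟨ht₀, by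
      rw [χ.toHomeo.left_inv hs]; exact hp₀⟩
    refine eq_zero_of_eventually_cfun χ hdim hw ?_
    filter_upwards [hloc χ _ ht₀, (χ.toHomeo.open_target).mem_nhds ht₀] with w h hwt
    rw [χ.toHomeo.left_inv hs] at h
    obtain ⟨h1, h2⟩ := hsrc _ (χ.toHomeo.map_target hwt)
    refine (hN _ h1 ?_).2 h
    rw [← h2, χ.toHomeo.right_inv hwt]
    exact (ht w hwt).1
  have hM : ∀ p : CPoints X, p.pt ∈ X.left.basicOpen (polyHom M.U M.y M.ε) → θ p = θ p₀ := by
    intro p hp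
    have hpU : p.pt ∈ M.U := X.left.basicOpen_le _ hp
    have hε := (evalAt_ne_zero_iff hpU _).2 hp
    rw [M.evalAt_polyHom hpU] at hε
    refine (hN p hpU hε).1 ?_
    rw [hN0, evalAt_of_mem hpU, map_zero]
  refine ⟨θ p₀, fun χ w hw => ?_⟩
  obtain ⟨V, hV, hwV, -⟩ := exists_isAffineOpen_mem_and_subset
    (U := (⊤ : X.left.Opens)) (x := (χ.toHomeo.symm w).pt) trivial
  have hne : (X.left.basicOpen (polyHom M.U M.y M.ε) ⊓ V : X.left.Opens) ≠ ⊥ := by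
    have hg : ∀ W : X.left.Opens, (W : Set X.left).Nonempty → genericPoint X.left ∈ W :=
      fun W hW => (genericPoint_spec X.left).mem_open_set_iff W.2 |>.2 (by simpa using hW)
    intro h
    have : genericPoint X.left ∈ (X.left.basicOpen (polyHom M.U M.y M.ε) ⊓ V : X.left.Opens) :=
      ⟨hg _ ⟨p₀.pt, (evalAt_ne_zero_iff hp₀ _).1 (by rwa [M.evalAt_polyHom hp₀])⟩,
        hg V ⟨_, hwV⟩⟩
    rw [h] at this
    exact this
  obtain ⟨x, hx⟩ := (TopologicalSpace.Opens.ne_bot_iff_nonempty _).1 hne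
  obtain ⟨d, hd, hxd⟩ := hV.exists_basicOpen_le (V := X.left.basicOpen (polyHom M.U M.y M.ε))
    ⟨x, hx.1⟩ hx.2
  have hd0 : d ≠ 0 := by
    rintro rfl
    rw [Scheme.basicOpen_zero] at hxd
    exact hxd
  have hwd : w ∈ cdom χ V := ⟨hw, hwV⟩
  -- Every chart meets the étale locus arbitrarily close to `w`, because the nonzero function `d`
  -- does not vanish on an open set; local constancy then passes the value on to `w`.
  have hfr : ∃ᶠ w' in 𝓝 w, cfun χ V d w' ≠ 0 := fun h =>
    hd0 (eq_zero_of_eventually_cfun χ hdim hwd (h.mono fun _ h => not_not.1 h))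
  obtain ⟨w', h1, h2, h3⟩ := (hfr.and_eventually ((hloc χ w hw).and
    ((isOpen_cdom χ V).mem_nhds hwd))).exists
  rw [← h2]
  exact hM _ (hd ((evalAt_ne_zero_iff h3.2 _).1 h1))

/-! ## Morphisms to the affine line -/

lemma coord_comp {S T : Scheme.{0}} (g : S ⟶ T) (u : T ⟶ A1) :
    coord (g ≫ u) = g.appTop (coord u) := by
  rw [coord, coord, Scheme.Hom.comp_appTop]
  rfl

lemma coord_A1pt (a : ℂ) :
    coord (A1pt a) = (Scheme.ΓSpecIso (CommRingCat.of ℂ)).inv a := by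
  have h := ConcreteCategory.congr_hom (Scheme.ΓSpecIso_inv_naturality
    (CommRingCat.ofHom (Polynomial.evalRingHom a))) (Polynomial.X : Polynomial ℂ)
  exact h.symm.trans (congrArg (Scheme.ΓSpecIso (CommRingCat.of ℂ)).inv
    (Polynomial.eval_X (x := a)))

lemma A1_hom_ext {T : Scheme.{0}} {u v : T ⟶ A1} (h : u ≫ A1hom = v ≫ A1hom)
    (hc : coord u = coord v) : u = v := by
  refine ext_of_isAffine ?_
  rw [← cancel_epi (Scheme.ΓSpecIso (CommRingCat.of (Polynomial ℂ))).inv]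
  apply CommRingCat.hom_ext
  refine Polynomial.ringHom_ext' ?_ hc
  have e := congrArg (fun f => f.appTop) h
  simp only [Scheme.Hom.comp_appTop] at e
  have e' := congrArg (fun f => (Scheme.ΓSpecIso (CommRingCat.of ℂ)).inv ≫ f) e
  simp only [A1hom, ← Category.assoc, ← Scheme.ΓSpecIso_inv_naturality] at e'
  simp only [Category.assoc] at e'
  exact congrArg (fun f => f.hom) e'

namespace SpecialDegeneration

variable {X : CScheme} {n : ℕ} (D : SpecialDegeneration X n)

lemma coord_inclusion (p : CPoints D.central) :
    coord ((p.map D.inclusion).hom ≫ D.π) = 0 := by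
  have h : (p.map D.inclusion).hom ≫ D.π = p.hom ≫ pullback.snd D.π (A1pt 0) ≫ A1pt 0 := by
    change (p.hom ≫ pullback.fst D.π (A1pt 0)) ≫ D.π = _
    rw [Category.assoc, pullback.condition]
  rw [h, coord_comp, coord_comp, coord_A1pt]
  simp

variable {D} in
-- In a product a point is determined by its two projections. The first is invariant by assumption,
-- and the second is multiplied by the group element but is zero on the central fibre.
lemma flow_eq_of_isTrivial (h : D.IsTrivial) (s : ℂ) (p : CPoints D.central) :
    D.flow s (p.map D.inclusion) = p.map D.inclusion := by
  obtain ⟨q, hq, hpb⟩ := h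
  refine CPoints.ext (hpb.hom_ext ?_ ?_)
  · exact congrArg (fun f => f.left) (hq (T := Over.mk (𝟙 SpecC)) (expUnit s)
      (p.map D.inclusion).toOver)
  · refine A1_hom_ext ?_ ?_
    · rw [Category.assoc, Category.assoc]
      exact (D.flow s (p.map D.inclusion)).comp_hom.trans (p.map D.inclusion).comp_hom.symm
    · refine (D.covers (T := Over.mk (𝟙 SpecC)) (expUnit s) (p.map D.inclusion).toOver).trans ?_
      have h0 : coord ((p.map D.inclusion).toOver.left ≫ D.π) = 0 := D.coord_inclusion p
      rw [h0, mul_zero]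
      exact h0.symm

instance : IsClosedImmersion (A1pt 0) :=
  IsClosedImmersion.spec_of_surjective _ fun c => ⟨Polynomial.C c, Polynomial.eval_C⟩

instance : IsClosedImmersion D.inclusion.left :=
  inferInstanceAs (IsClosedImmersion (pullback.fst D.π (A1pt 0)))

/-- Functions on an affine piece of the central fibre extend to the total space, since the inclusion
is a closed immersion. So functions of the total space already detect tangent vectors of the chart.
-/
lemma eq_zero_of_fderiv_inclusion {χ : HolChart D.central n} {w ξ : Fin n → ℂ}
    (hw : w ∈ χ.toHomeo.target)
    (h : ∀ (U : D.totalC.left.Opens) (f : Γ(D.totalC.left, U)),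
      ((χ.toHomeo.symm w).map D.inclusion).pt ∈ U →
      fderiv ℂ (fun w' => evalAt U f ((χ.toHomeo.symm w').map D.inclusion)) w ξ = 0) : ξ = 0 := by
  obtain ⟨V, hV, hwV, -⟩ := exists_isAffineOpen_mem_and_subset
    (U := (⊤ : D.totalC.left.Opens)) (x := ((χ.toHomeo.symm w).map D.inclusion).pt) trivial
  have hVa : IsAffineOpen (D.inclusion.left ⁻¹ᵁ V) := hV.preimage D.inclusion.left
  have hsurj : Function.Surjective (D.inclusion.left.app V) :=
    D.inclusion.left.app_surjective V hV
  have : LocallyOfFiniteType D.central.hom := inferInstance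
  obtain ⟨N, f, hf⟩ := exists_generators hVa
  choose g hg using fun i => hsurj (f i)
  have hwc : w ∈ cdom χ (D.inclusion.left ⁻¹ᵁ V) := ⟨hw, by
    rw [CPoints.map_pt] at hwV; exact hwV⟩
  refine jacobian_mulVec_injective χ hVa hf hwc ξ ?_
  ext i
  rw [← fderiv_pi_apply (differentiableAt_cmap χ f hwc)]
  have hp := hasFDerivAt_pi'.1 (differentiableAt_cmap χ f hwc).hasFDerivAt i
  refine (congrArg (fun L => L ξ) hp.fderiv).symm.trans (Eq.trans ?_ (h V (g i) hwV))
  congr 2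
  ext w'
  by_cases hw' : ((χ.toHomeo.symm w').map D.inclusion).pt ∈ V
  · rw [evalAt_map D.inclusion _ hw', hg]
    rfl
  · rw [evalAt_of_notMem hw']
    exact evalAt_of_notMem (by rw [CPoints.map_pt] at hw'; exact hw') _

end SpecialDegeneration

/-- For a real function, the real and imaginary parts of `∂F/∂z̄_k` are half the derivatives in the
two real directions. -/
lemma fderiv_eq_zero_of_dzbar {n : ℕ} {F : (Fin n → ℂ) → ℝ} {w : Fin n → ℂ}
    (hF : DifferentiableAt ℝ F w) (h : ∀ k, dzbar k (fun w' => (F w' : ℂ)) w = 0) :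
    fderiv ℝ F w = 0 := by
  have hc : ∀ u, fderiv ℝ (fun w' => (F w' : ℂ)) w u = (fderiv ℝ F w u : ℂ) := fun u => by
    have := (Complex.ofRealCLM.hasFDerivAt.comp w hF.hasFDerivAt).fderiv
    exact congrArg (fun L => L u) this
  have hs : ∀ k, fderiv ℝ F w (Pi.single k 1) = 0 ∧ fderiv ℝ F w (Pi.single k Complex.I) = 0 := by
    intro k
    have := h k
    rw [dzbar, hc, hc] at this
    have h1 := congrArg Complex.re this
    have h2 := congrArg Complex.im this
    simp at h1 h2
    exact ⟨h1, h2⟩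
  ext u
  have hu : u = ∑ k, ((u k).re • (Pi.single k 1 : Fin n → ℂ) +
      (u k).im • (Pi.single k Complex.I : Fin n → ℂ)) := by
    conv_lhs => rw [← Finset.univ_sum_single u]
    refine Finset.sum_congr rfl fun k _ => ?_
    rw [← Pi.single_smul, ← Pi.single_smul, ← Pi.single_add]
    congr 1
    simp
  rw [hu, map_sum]
  refine Finset.sum_eq_zero fun k _ => ?_
  rw [map_add, map_smul, map_smul, (hs k).1, (hs k).2]
  simp

namespace SpecialDegeneration

variable {X : CScheme} {n : ℕ} {D : SpecialDegeneration X n}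

/-- The flow fixes the central fibre, so the induced vector is zero, and the Hamiltonian equation
makes `θ` locally constant. The connectedness of the regular part does the rest. -/
theorem Choice.exists_eq_const_of_isTrivial (c : D.Choice) (h : D.IsTrivial) :
    ∃ a, ∀ χ : HolChart D.central n, ∀ w ∈ χ.toHomeo.target, c.θ (χ.toHomeo.symm w) = a := by
  refine exists_eq_const_of_locally_const (D.fano 0).dim c.hamiltonian.continuous
    fun χ w hw => ?_
  have hd : DifferentiableOn ℝ (fun w => c.θ (χ.toHomeo.symm w)) χ.toHomeo.target :=
    (c.hamiltonian.smooth χ).differentiableOn (by simp)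
  have h0 : χ.toHomeo.target.EqOn (fderiv ℝ fun w => c.θ (χ.toHomeo.symm w)) 0 := by
    intro w hw
    refine fderiv_eq_zero_of_dzbar (hd.differentiableAt (χ.toHomeo.open_target.mem_nhds hw))
      fun k => ?_
    obtain ⟨ξ, hξ, he⟩ := c.hamiltonian.eqn χ w hw
    have hξ0 : ξ = 0 := D.eq_zero_of_fderiv_inclusion hw fun U f hU => by
      rw [← hξ U f hU, vectorField]
      simp [flow_eq_of_isTrivial h]
    rw [he k, hξ0]
    simp
  obtain ⟨r, hr, hball⟩ := Metric.isOpen_iff.1 χ.toHomeo.open_target w hw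
  filter_upwards [Metric.ball_mem_nhds w hr] with w' hw'
  exact Metric.isOpen_ball.is_const_of_fderiv_eq_zero (convex_ball w r).isPreconnected
    (hd.mono hball) (h0.mono hball) hw' (Metric.mem_ball_self hr)

end SpecialDegeneration

/-! ## Points with values in algebras -/

/-- The spectrum of a `ℂ`-algebra, as a scheme over `ℂ`. -/
abbrev specOver (C : Type) [CommRing C] [Algebra ℂ C] : CScheme :=
  Over.mk (Spec.map (CommRingCat.ofHom (algebraMap ℂ C)))

section SpecOver

variable {C C' C'' : Type} [CommRing C] [Algebra ℂ C] [CommRing C'] [Algebra ℂ C']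
  [CommRing C''] [Algebra ℂ C'']

/-- The morphism of spectra given by a homomorphism of algebras. -/
def specMap (φ : C →ₐ[ℂ] C') : specOver C' ⟶ specOver C :=
  Over.homMk (Spec.map (CommRingCat.ofHom φ.toRingHom)) (by
    change Spec.map _ ≫ Spec.map _ = Spec.map _
    rw [← Spec.map_comp, ← CommRingCat.ofHom_comp]
    congr 2
    exact φ.comp_algebraMap)

lemma specMap_comp (φ : C →ₐ[ℂ] C') (ψ : C' →ₐ[ℂ] C'') :
    specMap (ψ.comp φ) = specMap ψ ≫ specMap φ := by
  ext : 1
  exact Spec.map_comp (CommRingCat.ofHom φ.toRingHom) (CommRingCat.ofHom ψ.toRingHom)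

lemma specMap_id : specMap (AlgHom.id ℂ C) = 𝟙 _ := by
  ext : 1
  exact Spec.map_id (CommRingCat.of C)

lemma exists_specMap_eq (x : specOver C' ⟶ specOver C) : ∃ φ : C →ₐ[ℂ] C', specMap φ = x := by
  obtain ⟨f, hf⟩ := Spec.map_surjective (R := CommRingCat.of C) (S := CommRingCat.of C') x.left
  refine ⟨{ f.hom with commutes' := fun c => ?_ }, ?_⟩
  · have h := Over.w x
    rw [← hf] at h
    have h' : Spec.map (CommRingCat.ofHom (algebraMap ℂ C) ≫ f) =
        Spec.map (CommRingCat.ofHom (algebraMap ℂ C')) := (Spec.map_comp _ _).trans h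
    exact congr($(Spec.map_injective h').hom c)
  · ext : 1
    exact hf

lemma specMap_injective : Function.Injective (specMap : (C →ₐ[ℂ] C') → _) := by
  intro φ ψ h
  have h' : Spec.map (CommRingCat.ofHom φ.toRingHom) = Spec.map (CommRingCat.ofHom ψ.toRingHom) :=
    congrArg (fun x => x.left) h
  ext c
  exact congr($(Spec.map_injective h').hom c)

/-- A unit of an algebra as a point of the multiplicative group. -/
def gmUnit (u : Cˣ) : (Γ((specOver C).left, ⊤))ˣ :=
  Units.map (Scheme.ΓSpecIso (CommRingCat.of C)).inv.hom.toMonoidHom u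

lemma gmUnit_one : gmUnit (1 : Cˣ) = 1 := map_one _

lemma gmUnit_mul (u v : Cˣ) : gmUnit (u * v) = gmUnit u * gmUnit v := map_mul _ _ _

lemma map_gmUnit (φ : C →ₐ[ℂ] C') (u : Cˣ) :
    Units.map (specMap φ).left.appTop.hom.toMonoidHom (gmUnit u) =
      gmUnit (Units.map φ.toRingHom.toMonoidHom u) := by
  ext
  exact (ConcreteCategory.congr_hom (Scheme.ΓSpecIso_inv_naturality
    (CommRingCat.ofHom φ.toRingHom)) (u : C)).symm

variable {Z : CScheme}

namespace GmAction

variable (α : GmAction Z)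

/-- The action of the units of an algebra on the points with values in it. -/
def smul (u : Cˣ) (x : specOver C ⟶ Z) : specOver C ⟶ Z := α.act (gmUnit u) x

lemma one_smul (x : specOver C ⟶ Z) : α.smul 1 x = x := by
  rw [smul, gmUnit_one, α.one_act]

lemma mul_smul (u v : Cˣ) (x : specOver C ⟶ Z) : α.smul (u * v) x = α.smul u (α.smul v x) := by
  rw [smul, gmUnit_mul, α.mul_act]
  rfl

lemma specMap_smul (φ : C →ₐ[ℂ] C') (u : Cˣ) (x : specOver C ⟶ Z) :
    specMap φ ≫ α.smul u x = α.smul (Units.map φ.toRingHom.toMonoidHom u) (specMap φ ≫ x) := by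
  rw [smul, α.natural, map_gmUnit]
  rfl

end GmAction

/-! ### Affine charts -/

lemma exists_specMap_comp_eq {A : Type} [CommRing A] [Algebra ℂ A] (i : specOver A ⟶ Z)
    [IsOpenImmersion i.left] (x : specOver C ⟶ Z)
    (h : Set.range x.left ⊆ Set.range i.left) : ∃ φ : A →ₐ[ℂ] C, specMap φ ≫ i = x := by
  have hf := IsOpenImmersion.lift_fac i.left x.left h
  let y : specOver C ⟶ specOver A := Over.homMk (IsOpenImmersion.lift i.left x.left h) (by
    rw [← Over.w i, reassoc_of% hf, Over.w x])
  obtain ⟨φ, hφ⟩ := exists_specMap_eq y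
  refine ⟨φ, ?_⟩
  rw [hφ]
  ext : 1
  exact hf

lemma specMap_comp_injective {A : Type} [CommRing A] [Algebra ℂ A] (i : specOver A ⟶ Z)
    [IsOpenImmersion i.left] {φ ψ : A →ₐ[ℂ] C} (h : specMap φ ≫ i = specMap ψ ≫ i) : φ = ψ := by
  refine specMap_injective ?_
  ext : 1
  rw [← cancel_mono i.left]
  exact congrArg (fun x => x.left) h

/-- Every point has arbitrarily small affine neighbourhoods. -/
lemma exists_affine_chart {V : Z.left.Opens} {x : Z.left} (hx : x ∈ V) :
    ∃ (A : Type) (_ : CommRing A) (_ : Algebra ℂ A) (i : specOver A ⟶ Z),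
      IsOpenImmersion i.left ∧ x ∈ Set.range i.left ∧ Set.range i.left ⊆ V := by
  obtain ⟨U, hU, hxU, hUV⟩ := exists_isAffineOpen_mem_and_subset hx
  refine ⟨Γ(Z.left, U), inferInstance, (const Z U).toAlgebra,
    @Over.homMk _ _ _ (@specOver Γ(Z.left, U) _ (const Z U).toAlgebra) Z hU.fromSpec
      (fromSpec_comp_hom hU), ?_, ?_, ?_⟩
  · exact inferInstanceAs (IsOpenImmersion hU.fromSpec)
  · exact hU.range_fromSpec.symm ▸ hxU
  · exact hU.range_fromSpec.trans_subset hUV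

lemma hom_ext_of_affine_charts {T : CScheme} {f g : T ⟶ Z}
    (h : ∀ x : T.left, ∃ (A : Type) (_ : CommRing A) (_ : Algebra ℂ A) (i : specOver A ⟶ T),
      IsOpenImmersion i.left ∧ x ∈ Set.range i.left ∧ i ≫ f = i ≫ g) : f = g := by
  ext : 1
  choose A hA hA' i hi hx he using h
  let 𝒰 : T.left.OpenCover := Scheme.Cover.mkOfCovers T.left (fun x => (specOver (A x)).left)
    (fun x => (i x).left) (fun x => ⟨x, hx x⟩) hi
  exact 𝒰.hom_ext _ _ fun x => congrArg (fun f => f.left) (he x)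

lemma algebra_finiteType_of_chart [LocallyOfFiniteType Z.hom] (i : specOver C ⟶ Z)
    [IsOpenImmersion i.left] : Algebra.FiniteType ℂ C := by
  have h : LocallyOfFiniteType (i.left ≫ Z.hom) := inferInstance
  rw [Over.w i] at h
  have h' := (HasRingHomProperty.Spec_iff (P := @LocallyOfFiniteType)).1 h
  exact RingHom.finiteType_algebraMap.1 h'

lemma isDomain_of_chart [IsIntegral Z.left] (i : specOver C ⟶ Z)
    [IsOpenImmersion i.left] [Nonempty (specOver C).left] : IsDomain C := by
  have : IsIntegral (specOver C).left := isIntegral_of_isOpenImmersion i.left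
  exact (affine_isIntegral_iff (CommRingCat.of C)).1 this

end SpecOver

/-! ### The coordinate of a point of a family over the line -/

section Coordinate

variable {C C' : Type} [CommRing C] [Algebra ℂ C] [CommRing C'] [Algebra ℂ C']
  {S : Scheme.{0}} {π : S ⟶ A1}

/-- The value of the coordinate of the line at a point of the family. -/
def tval (x : specOver C ⟶ totalSpace π) : C :=
  (Scheme.ΓSpecIso (CommRingCat.of C)).hom (coord (x.left ≫ π))

lemma tval_specMap (φ : C →ₐ[ℂ] C') (x : specOver C ⟶ totalSpace π) :
    tval (specMap φ ≫ x) = φ (tval x) := by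
  have h : coord ((specMap φ ≫ x).left ≫ π) =
      (specMap φ).left.appTop (coord (x.left ≫ π)) := by
    rw [← coord_comp]
    rfl
  refine (congrArg (Scheme.ΓSpecIso (CommRingCat.of C')).hom h).trans ?_
  exact ConcreteCategory.congr_hom (Scheme.ΓSpecIso_naturality
    (CommRingCat.ofHom φ.toRingHom)) (coord (x.left ≫ π))

end Coordinate

namespace SpecialDegeneration

variable {X : CScheme} {n : ℕ} (D : SpecialDegeneration X n)
  {C : Type} [CommRing C] [Algebra ℂ C]

lemma tval_smul (u : Cˣ) (x : specOver C ⟶ D.totalC) :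
    tval (D.action.smul u x) = u * tval x := by
  have h := D.covers (gmUnit u) x
  refine (congrArg (Scheme.ΓSpecIso (CommRingCat.of C)).hom h).trans ?_
  refine ((Scheme.ΓSpecIso (CommRingCat.of C)).hom.hom.map_mul _ _).trans ?_
  exact congrArg (fun v => v * tval x)
    (ConcreteCategory.congr_hom (Scheme.ΓSpecIso (CommRingCat.of C)).inv_hom_id (u : C))

end SpecialDegeneration

/-! ## Laurent polynomials -/

open scoped LaurentPolynomial

section Laurent

variable {R C C' : Type} [CommRing R] [Algebra ℂ R] [CommRing C] [Algebra ℂ C]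
  [CommRing C'] [Algebra ℂ C']

/-- Evaluation of Laurent polynomials. -/
def evalL (φ : R →ₐ[ℂ] C) (u : Cˣ) : R[T;T⁻¹] →ₐ[ℂ] C :=
  { LaurentPolynomial.eval₂ φ.toRingHom u with
    commutes' := fun c => by
      change LaurentPolynomial.eval₂ φ.toRingHom u (algebraMap ℂ R[T;T⁻¹] c) = _
      rw [LaurentPolynomial.algebraMap_apply, LaurentPolynomial.eval₂_C]
      exact φ.commutes c }

/-- The constant Laurent polynomials. -/
def constL (R : Type) [CommRing R] [Algebra ℂ R] : R →ₐ[ℂ] R[T;T⁻¹] :=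
  { LaurentPolynomial.C with
    commutes' := fun c => (LaurentPolynomial.algebraMap_apply c).symm }

/-- The variable of the Laurent polynomials. -/
def unitT (R : Type) [CommRing R] : (R[T;T⁻¹])ˣ := (LaurentPolynomial.isUnit_T 1).unit

@[simp]
lemma coe_unitT {R : Type} [CommRing R] : (unitT R : R[T;T⁻¹]) = LaurentPolynomial.T 1 := rfl

lemma evalL_C_mul_T (φ : R →ₐ[ℂ] C) (u : Cˣ) (r : R) (k : ℤ) :
    evalL φ u (LaurentPolynomial.C r * LaurentPolynomial.T k) = φ r * (u ^ k : Cˣ) :=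
  LaurentPolynomial.eval₂_C_mul_T _ _ _ _

@[simp]
lemma evalL_comp_constL (φ : R →ₐ[ℂ] C) (u : Cˣ) : (evalL φ u).comp (constL R) = φ := by
  ext r
  exact LaurentPolynomial.eval₂_C _ _ _

@[simp]
lemma evalL_unitT (φ : R →ₐ[ℂ] C) (u : Cˣ) :
    Units.map (evalL φ u).toRingHom.toMonoidHom (unitT R) = u := by
  ext
  exact (LaurentPolynomial.eval₂_T φ.toRingHom u 1).trans (by rw [zpow_one])

end Laurent

section Universal

variable {Z : CScheme} (α : GmAction Z) {A C : Type} [CommRing A] [Algebra ℂ A]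
  [CommRing C] [Algebra ℂ C]

/-- The universal case of the action on the points of a chart. -/
def GmAction.univ (i : specOver A ⟶ Z) : specOver A[T;T⁻¹] ⟶ Z :=
  α.smul (unitT A) (specMap (constL A) ≫ i)

/-- By naturality every translate of a point in the chart is pulled back from the translate of the
tautological point by the variable. Identities of the action need to be checked for Laurent
polynomials only. -/
lemma GmAction.specMap_univ (i : specOver A ⟶ Z) (φ : A →ₐ[ℂ] C) (u : Cˣ) :
    specMap (evalL φ u) ≫ α.univ i = α.smul u (specMap φ ≫ i) := by
  rw [univ, α.specMap_smul, evalL_unitT, ← Category.assoc, ← specMap_comp, evalL_comp_constL]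

end Universal

/-! ## Orbits of complex points -/

lemma specMap_algebraMap_self : Spec.map (CommRingCat.ofHom (algebraMap ℂ ℂ)) = 𝟙 SpecC :=
  Spec.map_id _

/-- A complex point as a point with values in the algebra `ℂ`. -/
def CPoints.toSpec {Z : CScheme} (p : CPoints Z) : specOver ℂ ⟶ Z :=
  Over.homMk p.hom (p.comp_hom.trans specMap_algebraMap_self.symm)

/-- The complex point given by a point with values in the algebra `ℂ`. -/
def CPoints.ofSpec {Z : CScheme} (x : specOver ℂ ⟶ Z) : CPoints Z :=
  ⟨x.left, (Over.w x).trans specMap_algebraMap_self⟩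

lemma CPoints.map_ofSpec {Z Y : CScheme} (x : specOver ℂ ⟶ Z) (f : Z ⟶ Y) :
    (CPoints.ofSpec x).map f = CPoints.ofSpec (x ≫ f) := rfl

lemma CPoints.map_toSpec {Z Y : CScheme} (p : CPoints Z) (f : Z ⟶ Y) :
    (p.map f).toSpec = p.toSpec ≫ f := rfl

/-- The point `e^s` of the multiplicative group. -/
def expPoint (s : ℂ) : CPoints (specOver ℂ[T;T⁻¹]) :=
  CPoints.ofSpec (specMap (evalL (AlgHom.id ℂ ℂ) (Units.mk0 (Complex.exp s) (Complex.exp_ne_zero s))))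

lemma evalAt_expPoint (s : ℂ) (r : Γ((specOver ℂ[T;T⁻¹]).left, ⊤)) :
    evalAt ⊤ r (expPoint s) =
      evalL (AlgHom.id ℂ ℂ) (Units.mk0 (Complex.exp s) (Complex.exp_ne_zero s))
        ((Scheme.ΓSpecIso (CommRingCat.of ℂ[T;T⁻¹])).hom r) := by
  rw [evalAt_of_mem (U := ⊤) trivial, evalHom_eq_appLE (expPoint s) (U := ⊤) trivial le_top]
  have h : (expPoint s).hom.appLE ⊤ ⊤ le_top = (expPoint s).hom.appTop :=
    Scheme.Hom.appLE_eq_app _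
  rw [h]
  exact ConcreteCategory.congr_hom (Scheme.ΓSpecIso_naturality (CommRingCat.ofHom
    (evalL (AlgHom.id ℂ ℂ) (Units.mk0 (Complex.exp s) (Complex.exp_ne_zero s))).toRingHom)) r

lemma differentiable_evalL_exp (g : ℂ[T;T⁻¹]) : Differentiable ℂ fun s : ℂ =>
    evalL (AlgHom.id ℂ ℂ) (Units.mk0 (Complex.exp s) (Complex.exp_ne_zero s)) g := by
  induction g using LaurentPolynomial.induction_on' with
  | add p q hp hq =>
    simp only [map_add]
    exact hp.fun_add hq
  | C_mul_T k c =>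
    have : (fun s : ℂ => evalL (AlgHom.id ℂ ℂ)
        (Units.mk0 (Complex.exp s) (Complex.exp_ne_zero s))
        (LaurentPolynomial.C c * LaurentPolynomial.T k)) =
        fun s => c * Complex.exp (k * s) := by
      ext s
      rw [evalL_C_mul_T, Units.val_zpow_eq_zpow_val, Complex.exp_int_mul]
      rfl
    rw [this]
    fun_prop

lemma eventually_expPoint {U : (specOver ℂ[T;T⁻¹]).left.Opens} {s : ℂ}
    (hs : (expPoint s).pt ∈ U) (f : Γ((specOver ℂ[T;T⁻¹]).left, U)) :
    (∀ᶠ s' in 𝓝 s, (expPoint s').pt ∈ U) ∧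
      DifferentiableAt ℂ (fun s' => evalAt U f (expPoint s')) s := by
  obtain ⟨r, g, hg, h⟩ := exists_fraction (X := specOver ℂ[T;T⁻¹]) (U := ⊤)
    (isAffineOpen_top (Spec (CommRingCat.of ℂ[T;T⁻¹]))) (p := expPoint s) trivial hs f
  have hd : ∀ r : Γ((specOver ℂ[T;T⁻¹]).left, ⊤),
      Differentiable ℂ fun s' => evalAt ⊤ r (expPoint s') := fun r => by
    simp only [evalAt_expPoint]
    exact differentiable_evalL_exp _
  have hne : ∀ᶠ s' in 𝓝 s, evalAt ⊤ g (expPoint s') ≠ 0 :=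
    (hd g).continuous.continuousAt.eventually_ne hg
  refine ⟨hne.mono fun s' h' => (h _ trivial h').1, ?_⟩
  refine DifferentiableAt.congr_of_eventuallyEq ?_ (hne.mono fun s' h' => (h _ trivial h').2)
  exact (hd r s).fun_div (hd g s) hg

namespace SpecialDegeneration

variable {X : CScheme} {n : ℕ} (D : SpecialDegeneration X n)

lemma flow_eq_smul (s : ℂ) (p : CPoints D.totalC) :
    D.flow s p = CPoints.ofSpec
      (D.action.smul (Units.mk0 (Complex.exp s) (Complex.exp_ne_zero s)) p.toSpec) := by
  -- The flow is defined over the terminal object, the action of units over the spectrum of the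
  -- algebra `ℂ`. The two are isomorphic by the identity, and naturality transports the action.
  let u : Over.mk (𝟙 SpecC) ⟶ specOver ℂ := Over.homMk (𝟙 SpecC)
    ((Category.id_comp _).trans specMap_algebraMap_self)
  have h := D.action.natural u
    (gmUnit (Units.mk0 (Complex.exp s) (Complex.exp_ne_zero s))) p.toSpec
  have h1 : u ≫ p.toSpec = p.toOver := by
    ext : 1
    exact Category.id_comp _
  have h2 : Units.map u.left.appTop.hom.toMonoidHom
      (gmUnit (Units.mk0 (Complex.exp s) (Complex.exp_ne_zero s))) = expUnit s := by
    have : u.left.appTop = 𝟙 _ := Scheme.Hom.id_appTop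
    rw [this]
    rfl
  rw [h1, h2] at h
  have h3 := congrArg (fun f => f.left) h
  refine CPoints.ext ?_
  exact h3.symm.trans (Category.id_comp _)

lemma flow_zero (p : CPoints D.totalC) : D.flow 0 p = p := by
  rw [flow_eq_smul]
  have : Units.mk0 (Complex.exp 0) (Complex.exp_ne_zero 0) = 1 := by
    ext
    simp
  rw [this, D.action.one_smul]
  rfl

lemma flow_add (s s' : ℂ) (p : CPoints D.totalC) :
    D.flow (s + s') p = D.flow s (D.flow s' p) := by
  simp only [flow_eq_smul]
  have : Units.mk0 (Complex.exp (s + s')) (Complex.exp_ne_zero _) =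
      Units.mk0 (Complex.exp s) (Complex.exp_ne_zero s) *
        Units.mk0 (Complex.exp s') (Complex.exp_ne_zero s') := by
    ext
    simp [Complex.exp_add]
  rw [this, D.action.mul_smul]
  rfl

lemma flow_eq_map_univ (s : ℂ) (p : CPoints D.totalC) :
    D.flow s p = (expPoint s).map (D.action.univ p.toSpec) := by
  rw [flow_eq_smul, expPoint, CPoints.map_ofSpec, GmAction.specMap_univ, specMap_id,
    Category.id_comp]

/-- A point with coordinate zero is a point of the central fibre. -/
lemma exists_central_lift {C : Type} [CommRing C] [Algebra ℂ C] {x : specOver C ⟶ D.totalC}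
    (hx : tval x = 0) : ∃ y : specOver C ⟶ D.central, y ≫ D.inclusion = x := by
  have h0 : coord (x.left ≫ D.π) = 0 := by
    have h := congrArg (Scheme.ΓSpecIso (CommRingCat.of C)).inv hx
    rw [map_zero] at h
    exact (ConcreteCategory.congr_hom (Scheme.ΓSpecIso (CommRingCat.of C)).hom_inv_id
      (coord (x.left ≫ D.π))).symm.trans h
  have hA : A1pt 0 ≫ A1hom = 𝟙 SpecC := by
    rw [A1pt, A1hom, ← Spec.map_comp, ← CommRingCat.ofHom_comp]
    have : (Polynomial.evalRingHom (0 : ℂ)).comp Polynomial.C = RingHom.id ℂ := by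
      ext
      simp
    rw [this]
    exact Spec.map_id _
  have h : x.left ≫ D.π = (specOver C).hom ≫ A1pt 0 := by
    refine A1_hom_ext ?_ ?_
    · rw [Category.assoc, Category.assoc, hA, Category.comp_id]
      exact Over.w x
    · rw [h0, coord_comp, coord_A1pt]
      simp
  refine ⟨Over.homMk (pullback.lift x.left (specOver C).hom h) (pullback.lift_snd _ _ _), ?_⟩
  ext : 1
  exact pullback.lift_fst _ _ _

lemma tval_inclusion {C : Type} [CommRing C] [Algebra ℂ C] (y : specOver C ⟶ D.central) :
    tval (y ≫ D.inclusion) = 0 := by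
  have h : (y ≫ D.inclusion).left ≫ D.π = (y.left ≫ pullback.snd D.π (A1pt 0)) ≫ A1pt 0 := by
    change (y.left ≫ pullback.fst D.π (A1pt 0)) ≫ D.π = _
    rw [Category.assoc, pullback.condition, Category.assoc]
  have h' : coord ((y ≫ D.inclusion).left ≫ D.π) = 0 := by
    rw [h, coord_comp, coord_A1pt, map_zero, map_zero]
  exact (congrArg (Scheme.ΓSpecIso (CommRingCat.of C)).hom h').trans (map_zero _)

/-- For small `s` the orbit stays in an affine set and in the regular locus `O`. There the
derivative of every regular function along it vanishes, so the orbit is constant; the group law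
extends this to all `s`. -/
lemma flow_eq_self {O : D.central.left.Opens}
    (hO : ∀ p : CPoints D.central, p.pt ∈ O → ∃ χ : HolChart D.central n, p ∈ χ.toHomeo.source)
    (hv : ∀ χ : HolChart D.central n, ∀ w ∈ χ.toHomeo.target,
      ∀ (U : D.totalC.left.Opens) (f : Γ(D.totalC.left, U)),
      ((χ.toHomeo.symm w).map D.inclusion).pt ∈ U →
        D.vectorField U f ((χ.toHomeo.symm w).map D.inclusion) = 0)
    {p : CPoints D.central} (hp : p.pt ∈ O) (s : ℂ) :
    D.flow s (p.map D.inclusion) = p.map D.inclusion := by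
  set p' := p.map D.inclusion with hp'
  -- The coordinate `t` is multiplied by a unit along the orbit, so the orbit of a point of the
  -- central fibre stays in it.
  obtain ⟨ρ, hρ⟩ := D.exists_central_lift (x := D.action.univ p'.toSpec) (by
    rw [GmAction.univ, tval_smul, tval_specMap, hp', CPoints.map_toSpec, tval_inclusion]
    simp)
  have hflow : ∀ s, D.flow s p' = ((expPoint s).map ρ).map D.inclusion := fun s => by
    rw [flow_eq_map_univ, ← hρ]
    rfl
  obtain ⟨W, hW, hpW, -⟩ := exists_isAffineOpen_mem_and_subset
    (U := (⊤ : D.totalC.left.Opens)) (x := p'.pt) trivial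
  have hdiff : ∀ s, (D.flow s p').pt ∈ W → (∀ᶠ s' in 𝓝 s, (D.flow s' p').pt ∈ W) ∧
      ∀ f, DifferentiableAt ℂ (fun s' => evalAt W f (D.flow s' p')) s := by
    intro s hs
    rw [flow_eq_map_univ, CPoints.map_pt] at hs
    replace hs : (expPoint s).pt ∈ (D.action.univ p'.toSpec).left ⁻¹ᵁ W := hs
    have h1 : ∀ᶠ s' in 𝓝 s, (D.flow s' p').pt ∈ W := by
      refine (eventually_expPoint hs 0).1.mono fun s' h => ?_
      rw [flow_eq_map_univ, CPoints.map_pt]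
      exact h
    refine ⟨h1, fun f => ?_⟩
    refine DifferentiableAt.congr_of_eventuallyEq
      (eventually_expPoint hs ((D.action.univ p'.toSpec).left.app W f)).2 ?_
    filter_upwards [h1] with s' h
    rw [flow_eq_map_univ] at h ⊢
    exact evalAt_map _ _ h f
  have hO' : ∀ᶠ s in 𝓝 (0 : ℂ), ((expPoint s).map ρ).pt ∈ O := by
    have h0 : ((expPoint 0).map ρ).pt ∈ O := by
      have h1 := hflow 0
      rw [flow_zero, hp'] at h1
      have h2 : p.pt = ((expPoint 0).map ρ).pt := by
        refine D.inclusion.left.injective ?_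
        rw [← CPoints.map_pt, ← CPoints.map_pt, h1]
      rw [← h2]
      exact hp
    rw [CPoints.map_pt] at h0
    replace h0 : (expPoint 0).pt ∈ ρ.left ⁻¹ᵁ O := h0
    refine (eventually_expPoint h0 0).1.mono fun s' h => ?_
    rw [CPoints.map_pt]
    exact h
  have hW0 : (D.flow 0 p').pt ∈ W := by rwa [flow_zero]
  obtain ⟨r, hr, hball⟩ := Metric.eventually_nhds_iff_ball.1 (hO'.and (hdiff 0 hW0).1)
  have hfix : ∀ s ∈ Metric.ball (0 : ℂ) r, D.flow s p' = p' := by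
    intro s hs
    refine CPoints.ext_of_evalHom hW (hball s hs).2 hpW fun f => ?_
    -- The derivative at `s` is the derivative at zero of the flow started at the moved point, that
    -- is, the field at that point divided by the nonzero scale.
    have hconst := Metric.isOpen_ball.is_const_of_deriv_eq_zero
      (f := fun s => evalAt W f (D.flow s p')) (convex_ball (0 : ℂ) r).isPreconnected
      (fun s hs => ((hdiff s (hball s hs).2).2 f).differentiableWithinAt) (fun s hs => ?_)
      hs (Metric.mem_ball_self hr)
    · simpa [flow_zero] using hconst
    · obtain ⟨χ, hχ⟩ := hO _ (hball s hs).1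
      have hs2 := (hball s hs).2
      have h1 := hv χ _ (χ.toHomeo.map_source hχ) W f (by
        rw [χ.toHomeo.left_inv hχ, ← hflow]
        exact hs2)
      rw [χ.toHomeo.left_inv hχ, ← hflow, vectorField, mul_eq_zero] at h1
      have h2 := h1.resolve_left (by exact_mod_cast D.scale_ne)
      simp only [← flow_add] at h2
      have h3 := deriv_comp_add_const (f := fun s => evalAt W f (D.flow s p')) (a := s) (x := 0)
      rw [h2, zero_add] at h3
      simpa using h3.symm
  -- `N` steps of size `s / N`, each of them inside the ball.
  obtain ⟨N, hN⟩ := exists_nat_gt (‖s‖ / r)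
  have hN0 : (0 : ℝ) < N := lt_of_le_of_lt (by positivity) hN
  have hmem : s / N ∈ Metric.ball (0 : ℂ) r := by
    rw [mem_ball_zero_iff, norm_div, Complex.norm_natCast, div_lt_iff₀ hN0, mul_comm]
    exact (div_lt_iff₀ hr).1 hN
  have hiter : ∀ k : ℕ, D.flow (k * (s / N)) p' = p' := by
    intro k
    induction k with
    | zero => simp [flow_zero]
    | succ k ih =>
      rw [Nat.cast_succ, add_mul, one_mul, flow_add, hfix _ hmem, ih]
  have := hiter N
  rwa [mul_div_cancel₀ _ (by exact_mod_cast hN0.ne')] at this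

end SpecialDegeneration

open scoped LaurentPolynomial

/-! ## Triviality of the action on the central fibre -/

lemma isAffine_specOver (A : Type) [CommRing A] [Algebra ℂ A] : IsAffine (specOver A).left :=
  inferInstanceAs (IsAffine (Spec (CommRingCat.of A)))

lemma exists_gmUnit_eq {C : Type} [CommRing C] [Algebra ℂ C] (a : (Γ((specOver C).left, ⊤))ˣ) :
    ∃ u : Cˣ, gmUnit u = a := by
  refine ⟨Units.map (Scheme.ΓSpecIso (CommRingCat.of C)).hom.hom.toMonoidHom a, ?_⟩
  ext
  exact ConcreteCategory.congr_hom (Scheme.ΓSpecIso (CommRingCat.of C)).hom_inv_id _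

instance : LocallyOfFiniteType A1hom := by
  rw [A1hom, HasRingHomProperty.Spec_iff (P := @LocallyOfFiniteType)]
  change (algebraMap ℂ (Polynomial ℂ)).FiniteType
  rw [RingHom.finiteType_algebraMap]
  infer_instance

instance : IsSeparated A1hom := by
  rw [A1hom]
  infer_instance

namespace SpecialDegeneration

variable {X : CScheme} {n : ℕ} (D : SpecialDegeneration X n)

instance : IsProper D.π := D.proper

instance : LocallyOfFiniteType D.totalC.hom :=
  inferInstanceAs (LocallyOfFiniteType (D.π ≫ A1hom))

instance : IsSeparated D.totalC.hom :=
  inferInstanceAs (IsSeparated (D.π ≫ A1hom))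

variable {D} in
-- Both morphisms start at a reduced scheme of finite type and end in a separated one, so they need
-- to agree only at the closed points of a dense open set. Over the étale locus these are pairs of a
-- regular point and a nonzero number, and the flow fixes the point.
lemma univ_inclusion (hv : ∀ χ : HolChart D.central n, ∀ w ∈ χ.toHomeo.target,
      ∀ (U : D.totalC.left.Opens) (f : Γ(D.totalC.left, U)),
      ((χ.toHomeo.symm w).map D.inclusion).pt ∈ U →
        D.vectorField U f ((χ.toHomeo.symm w).map D.inclusion) = 0)
    {B : Type} [CommRing B] [Algebra ℂ B] (k : specOver B ⟶ D.central) [IsOpenImmersion k.left]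
    [Nonempty (specOver B).left] :
    D.action.univ (k ≫ D.inclusion) = specMap (constL B) ≫ k ≫ D.inclusion := by
  have hdomB : IsDomain B := isDomain_of_chart k
  have : LocallyOfFiniteType D.central.hom := inferInstance
  have hftB : Algebra.FiniteType ℂ B := algebra_finiteType_of_chart k
  have hdom : IsDomain B[T;T⁻¹] := inferInstance
  let U : D.central.left.Opens := k.left.opensRange
  have hU : IsAffineOpen U := by
    have := isAffine_specOver B
    exact isAffineOpen_opensRange k.left
  have : Nonempty U := ⟨⟨k.left (Nonempty.some inferInstance), ⟨_, rfl⟩⟩⟩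
  obtain ⟨M, hM⟩ := exists_etaleModel (D.fano 0).dim hU
  let O : D.central.left.Opens := D.central.left.basicOpen (polyHom M.U M.y M.ε)
  have hOmem : ∀ p : CPoints D.central, p.pt ∈ O → p.pt ∈ M.U ∧
      MvPolynomial.eval (coordMap M.U M.y p) M.ε ≠ 0 := fun p hp => by
    have h1 : p.pt ∈ M.U := D.central.left.basicOpen_le _ hp
    have h2 := (evalAt_ne_zero_iff h1 _).2 hp
    rw [M.evalAt_polyHom h1] at h2
    exact ⟨h1, h2⟩
  have hO : ∀ p : CPoints D.central, p.pt ∈ O →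
      ∃ χ : HolChart D.central n, p ∈ χ.toHomeo.source := fun p hp => by
    obtain ⟨χ, -, h, -⟩ := M.exists_chart (hOmem p hp).1 (hOmem p hp).2
    exact ⟨χ, h⟩
  ext : 1
  have hred : IsReduced (specOver B[T;T⁻¹]).left :=
    inferInstanceAs (IsReduced (Spec (CommRingCat.of B[T;T⁻¹])))
  have hirr : IrreducibleSpace (specOver B[T;T⁻¹]).left :=
    inferInstanceAs (IrreducibleSpace (PrimeSpectrum B[T;T⁻¹]))
  have hcomp : (D.action.univ (k ≫ D.inclusion)).left ≫ D.totalC.hom =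
    (specOver B[T;T⁻¹]).hom := Over.w _
  have hft : LocallyOfFiniteType
      ((D.action.univ (k ≫ D.inclusion)).left ≫ D.totalC.hom) := by
    rw [hcomp]
    refine (HasRingHomProperty.Spec_iff (P := @LocallyOfFiniteType)).2 ?_
    refine RingHom.finiteType_algebraMap.2 ?_
    have htower : IsScalarTower B (Polynomial B) B[T;T⁻¹] :=
      IsScalarTower.of_algebraMap_eq fun b => (Polynomial.toLaurent_C b).symm
    have h1 : Algebra.FiniteType B B[T;T⁻¹] :=
      Algebra.FiniteType.trans (S := Polynomial B) inferInstance
        (IsLocalization.finiteType_of_monoid_fg (Submonoid.powers (Polynomial.X : Polynomial B)) _)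
    exact Algebra.FiniteType.trans (S := B) inferInstance h1
  let S : (specOver B[T;T⁻¹]).left.Opens := (specMap (constL B) ≫ k).left ⁻¹ᵁ O
  have hSne : (S : Set (specOver B[T;T⁻¹]).left).Nonempty := by
    obtain ⟨p, hp, hε⟩ := M.exists_point_ne
    have hpO : p.pt ∈ O := (evalAt_ne_zero_iff hp _).1 (by rwa [M.evalAt_polyHom hp])
    obtain ⟨φ, hφ⟩ := exists_specMap_comp_eq k p.toSpec (by
      rintro _ ⟨x, rfl⟩
      have : x = IsLocalRing.closedPoint (CommRingCat.of ℂ) :=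
        Subsingleton.elim (α := PrimeSpectrum ℂ) _ _
      rw [this]
      rw [hM] at hp
      exact hp)
    refine ⟨(specMap (evalL φ 1)).left (IsLocalRing.closedPoint (CommRingCat.of ℂ)), ?_⟩
    change (specMap (evalL φ 1) ≫ specMap (constL B) ≫ k).left _ ∈ O
    rw [← Category.assoc, ← specMap_comp, evalL_comp_constL, hφ]
    exact hpO
  refine ext_of_apply_eq D.totalC.hom (S : Set (specOver B[T;T⁻¹]).left)
    S.2.isLocallyClosed (S.2.dense hSne) (fun x hx hxc => ?_)
    ((Over.w (D.action.univ (k ≫ D.inclusion))).trans (Over.w _).symm)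
  have hft' : LocallyOfFiniteType (specOver B[T;T⁻¹]).hom := by rwa [hcomp] at hft
  let P : specOver ℂ ⟶ specOver B[T;T⁻¹] := Over.homMk
    (pointOfClosedPoint (specOver B[T;T⁻¹]).hom x hxc)
    ((pointOfClosedPoint_comp (specOver B[T;T⁻¹]).hom x hxc).trans specMap_algebraMap_self.symm)
  have hPx : P.left (IsLocalRing.closedPoint (CommRingCat.of ℂ)) = x :=
    pointOfClosedPoint_apply (specOver B[T;T⁻¹]).hom x hxc _
  obtain ⟨φ, hφ⟩ := exists_specMap_eq P
  let u : ℂˣ := Units.map φ.toRingHom.toMonoidHom (unitT B)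
  -- Every nonzero number is an exponential, so the flow reaches the whole group.
  obtain ⟨s, hs⟩ : ∃ s, Complex.exp s = u := ⟨Complex.log u, Complex.exp_log u.ne_zero⟩
  have hu : Units.mk0 (Complex.exp s) (Complex.exp_ne_zero s) = u := by
    ext
    exact hs
  let p : CPoints D.central := CPoints.ofSpec (P ≫ specMap (constL B) ≫ k)
  have hp : p.pt ∈ O := by
    change (P ≫ specMap (constL B) ≫ k).left _ ∈ O
    have : (P ≫ specMap (constL B) ≫ k).left (IsLocalRing.closedPoint (CommRingCat.of ℂ)) =
        (specMap (constL B) ≫ k).left x := by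
      rw [← hPx]
      rfl
    rw [this]
    exact hx
  have hfl := D.flow_eq_self hO hv hp s
  rw [flow_eq_smul, hu] at hfl
  have key : P ≫ D.action.univ (k ≫ D.inclusion) = P ≫ specMap (constL B) ≫ k ≫ D.inclusion := by
    have h1 : P ≫ D.action.univ (k ≫ D.inclusion) =
        D.action.smul u (P ≫ specMap (constL B) ≫ k ≫ D.inclusion) := by
      rw [← hφ, GmAction.univ, GmAction.specMap_smul]
    rw [h1]
    ext : 1
    exact congrArg CPoints.hom hfl
  rw [← hPx]
  exact congrArg (fun f => f.left (IsLocalRing.closedPoint (CommRingCat.of ℂ))) key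

variable {D} in
/-- If the vector field vanishes on the regular part of the central fibre, then the action on the
central fibre is trivial. -/
theorem smul_eq_self (hv : ∀ χ : HolChart D.central n, ∀ w ∈ χ.toHomeo.target,
      ∀ (U : D.totalC.left.Opens) (f : Γ(D.totalC.left, U)),
      ((χ.toHomeo.symm w).map D.inclusion).pt ∈ U →
        D.vectorField U f ((χ.toHomeo.symm w).map D.inclusion) = 0)
    {C : Type} [CommRing C] [Algebra ℂ C] {x : specOver C ⟶ D.totalC} (hx : tval x = 0) (u : Cˣ) :
    D.action.smul u x = x := by
  obtain ⟨y, rfl⟩ := D.exists_central_lift hx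
  refine hom_ext_of_affine_charts fun z => ?_
  obtain ⟨B, _, _, k, hk, hzk, -⟩ := exists_affine_chart (Z := D.central) (V := ⊤)
    (x := y.left z) trivial
  obtain ⟨E, _, _, j, hj, hzj, hjV⟩ := exists_affine_chart (Z := specOver C)
    (V := y.left ⁻¹ᵁ k.left.opensRange) (x := z) hzk
  refine ⟨E, inferInstance, inferInstance, j, hj, hzj, ?_⟩
  have : Nonempty (specOver B).left := ⟨hzk.choose⟩
  -- Locally the point lies in a chart of the central fibre, where the universal case can be
  -- specialised.
  obtain ⟨φ, hφ⟩ := exists_specMap_comp_eq k (j ≫ y) (by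
    rintro _ ⟨e, rfl⟩
    exact hjV ⟨e, rfl⟩)
  obtain ⟨v, hv'⟩ := exists_specMap_eq j
  rw [← hv', GmAction.specMap_smul, hv', ← Category.assoc, ← hφ]
  rw [Category.assoc, ← GmAction.specMap_univ, univ_inclusion hv, ← Category.assoc,
    ← specMap_comp, evalL_comp_constL]

end SpecialDegeneration

open scoped LaurentPolynomial

/-! ## The action near the central fibre -/

/-- The base change of Laurent polynomials. -/
def mapL {R R' : Type} [CommRing R] [Algebra ℂ R] [CommRing R'] [Algebra ℂ R'] (φ : R →ₐ[ℂ] R') :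
    R[T;T⁻¹] →ₐ[ℂ] R'[T;T⁻¹] :=
  evalL ((constL R').comp φ) (unitT R')

section Coefficients

variable {R R' : Type} [CommRing R] [Algebra ℂ R] [CommRing R'] [Algebra ℂ R']

lemma coe_unitT_zpow {R : Type} [CommRing R] (j : ℤ) :
    ((unitT R ^ j : (R[T;T⁻¹])ˣ) : R[T;T⁻¹]) = LaurentPolynomial.T j := by
  have h := LaurentPolynomial.eval₂_T (LaurentPolynomial.C : R →+* R[T;T⁻¹]) (unitT R) j
  have h' : LaurentPolynomial.eval₂ (LaurentPolynomial.C : R →+* R[T;T⁻¹]) (unitT R) =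
      RingHom.id _ := by
    refine IsLocalization.ringHom_ext (Submonoid.powers (Polynomial.X : Polynomial R)) ?_
    refine Polynomial.ringHom_ext (fun r => ?_) ?_
    · rw [RingHom.comp_apply, RingHom.comp_apply, LaurentPolynomial.algebraMap_eq_toLaurent,
        Polynomial.toLaurent_C, LaurentPolynomial.eval₂_C, RingHom.id_apply]
    · rw [RingHom.comp_apply, RingHom.comp_apply, LaurentPolynomial.algebraMap_eq_toLaurent,
        Polynomial.toLaurent_X, LaurentPolynomial.eval₂_T, zpow_one, RingHom.id_apply, coe_unitT]
  rw [h'] at h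
  exact h.symm

lemma mapL_C_mul_T (φ : R →ₐ[ℂ] R') (r : R) (j : ℤ) :
    mapL φ (LaurentPolynomial.C r * LaurentPolynomial.T j) =
      LaurentPolynomial.C (φ r) * LaurentPolynomial.T j := by
  rw [mapL, evalL_C_mul_T, coe_unitT_zpow]
  rfl

lemma coeff_C_mul_T {R : Type} [CommRing R] (r : R) (j m : ℤ) :
    (LaurentPolynomial.C r * LaurentPolynomial.T j : R[T;T⁻¹]).coeff m = if j = m then r else 0 := by
  rw [← LaurentPolynomial.smul_eq_C_mul]
  simp

lemma coeff_mapL (φ : R →ₐ[ℂ] R') (g : R[T;T⁻¹]) (m : ℤ) :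
    (mapL φ g).coeff m = φ (g.coeff m) := by
  induction g using LaurentPolynomial.induction_on' with
  | add p q hp hq => simp [map_add, hp, hq]
  | C_mul_T j r =>
    rw [mapL_C_mul_T, coeff_C_mul_T, coeff_C_mul_T]
    split_ifs <;> simp

lemma coeff_C_mul {R : Type} [CommRing R] (r : R) (g : R[T;T⁻¹]) (m : ℤ) :
    (LaurentPolynomial.C r * g).coeff m = r * g.coeff m := by
  induction g using LaurentPolynomial.induction_on' with
  | add p q hp hq => simp [mul_add, hp, hq]
  | C_mul_T j s =>
    rw [← mul_assoc, ← map_mul, coeff_C_mul_T, coeff_C_mul_T]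
    split_ifs <;> simp

lemma coeff_mul_T {R : Type} [CommRing R] (g : R[T;T⁻¹]) (j m : ℤ) :
    (g * LaurentPolynomial.T j).coeff m = g.coeff (m - j) := by
  induction g using LaurentPolynomial.induction_on' with
  | add p q hp hq => simp [add_mul, hp, hq]
  | C_mul_T l s =>
    rw [mul_assoc, ← LaurentPolynomial.T_add, coeff_C_mul_T, coeff_C_mul_T]
    congr 1
    exact propext ⟨fun h => by omega, fun h => by omega⟩

lemma evalL_constL_constL : evalL ((constL R[T;T⁻¹]).comp (constL R))
    (Units.map (constL R[T;T⁻¹]).toRingHom.toMonoidHom (unitT R)) = constL R[T;T⁻¹] := by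
  refine AlgHom.ext fun g => ?_
  induction g using LaurentPolynomial.induction_on' with
  | add p q hp hq => rw [map_add, map_add, hp, hq]
  | C_mul_T l r =>
    rw [evalL_C_mul_T, map_mul, ← coe_unitT_zpow, ← map_zpow]
    rfl

/-- Evaluation at the product of two independent variables sends `r T^l` to `r a^l b^l`; the
coefficient of `a^j` retains only the weight `j`. This is the form in which associativity of the
action enters. -/
lemma coeff_evalL_constL_constL (g : R[T;T⁻¹]) (j : ℤ) :
    (evalL ((constL R[T;T⁻¹]).comp (constL R)) (unitT R[T;T⁻¹] *
      Units.map (constL R[T;T⁻¹]).toRingHom.toMonoidHom (unitT R)) g).coeff j =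
      LaurentPolynomial.C (g.coeff j) * LaurentPolynomial.T j := by
  induction g using LaurentPolynomial.induction_on' with
  | add p q hp hq =>
    rw [map_add, AddMonoidAlgebra.coeff_add, AddMonoidAlgebra.coeff_add, Finsupp.add_apply,
      Finsupp.add_apply, hp, hq, map_add, add_mul]
  | C_mul_T l r =>
    have e : evalL ((constL R[T;T⁻¹]).comp (constL R)) (unitT R[T;T⁻¹] *
        Units.map (constL R[T;T⁻¹]).toRingHom.toMonoidHom (unitT R))
        (LaurentPolynomial.C r * LaurentPolynomial.T l) =
        LaurentPolynomial.C (LaurentPolynomial.C r * LaurentPolynomial.T l) *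
          LaurentPolynomial.T l := by
      rw [evalL_C_mul_T, mul_zpow, Units.val_mul, coe_unitT_zpow, map_mul, ← map_zpow,
        mul_comm (LaurentPolynomial.T l), ← mul_assoc, ← coe_unitT_zpow (R := R)]
      rfl
    rw [e, coeff_C_mul_T, coeff_C_mul_T]
    split_ifs with hlj
    · rw [hlj]
    · rw [map_zero, zero_mul]

end Coefficients

/-- A coaction of the multiplicative group for which `t` has weight one, and which is trivial
modulo `t`, has no negative weights if `t` is nilpotent. -/
theorem coeff_eq_zero_of_coaction {R : Type} [CommRing R] {t : R} {k : ℕ} (ht : t ^ k = 0)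
    {s : R →+* R[T;T⁻¹]} (hst : s t = LaurentPolynomial.C t * LaurentPolynomial.T 1)
    (hco : ∀ f j, s ((s f).coeff j) = LaurentPolynomial.C ((s f).coeff j) * LaurentPolynomial.T j)
    (htriv : ∀ f j, j ≠ 0 → s f = LaurentPolynomial.C f * LaurentPolynomial.T j → t ∣ f)
    (f : R) {j : ℤ} (hj : j < 0) : (s f).coeff j = 0 := by
  -- Descent on the weight: a vector of weight `j < 0` is `t g` by triviality modulo `t`, and
  -- comparison of coefficients replaces `g` by its component of weight `j - 1`, which is negative
  -- again. Hence the vector is divisible by every power of `t`.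
  have key : ∀ m : ℕ, ∀ j < (0 : ℤ), ∀ f, s f = LaurentPolynomial.C f * LaurentPolynomial.T j →
      t ^ m ∣ f := by
    intro m
    induction m with
    | zero => intros; simp
    | succ m ih =>
      intro j hj f hf
      obtain ⟨g, rfl⟩ := htriv f j hj.ne hf
      have h := congrArg (fun p => p.coeff j) hf
      rw [map_mul, hst, mul_assoc, LaurentPolynomial.T_mul, coeff_C_mul, coeff_mul_T,
        coeff_C_mul_T, if_pos rfl] at h
      rw [← h, pow_succ']
      exact mul_dvd_mul_left t (ih (j - 1) (by omega) _ (hco g (j - 1)))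
  have h := key k j hj _ (hco f j)
  rwa [ht, zero_dvd_iff] at h

namespace SpecialDegeneration

variable {X : CScheme} {n : ℕ} (D : SpecialDegeneration X n)

/-- The action of the multiplicative group on the points of the central fibre is trivial. -/
def ActsTrivially : Prop :=
  ∀ {C : Type} [CommRing C] [Algebra ℂ C] {x : specOver C ⟶ D.totalC}, tval x = 0 →
    ∀ u : Cˣ, D.action.smul u x = x

variable {D} {A : Type} [CommRing A] [Algebra ℂ A]
  (i : specOver A ⟶ D.totalC)

/-- On a neighbourhood of the central fibre in `𝔾ₘ × U`, the action maps to `U`. -/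
lemma ActsTrivially.exists_coaction (hD : D.ActsTrivially) [IsOpenImmersion i.left] :
    ∃ (s : A[T;T⁻¹]) (ψ : A →ₐ[ℂ] Localization.Away (1 - LaurentPolynomial.C (tval i) * s)),
      specMap ψ ≫ i = specMap (Algebra.algHom ℂ A[T;T⁻¹] _) ≫ D.action.univ i := by
  set t := tval i with ht
  set ρ := D.action.univ i with hρ
  let V : (specOver A[T;T⁻¹]).left.Opens := ρ.left ⁻¹ᵁ i.left.opensRange
  -- A point with `t = 0` is fixed by the action, so its translate remains in the chart.
  have hVt : ∀ 𝔭 : PrimeSpectrum A[T;T⁻¹], LaurentPolynomial.C t ∈ 𝔭.asIdeal → 𝔭 ∈ V := by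
    intro 𝔭 h𝔭
    let I : Ideal A[T;T⁻¹] := Ideal.span {LaurentPolynomial.C t}
    let mk : A[T;T⁻¹] →ₐ[ℂ] A[T;T⁻¹] ⧸ I := Ideal.Quotient.mkₐ ℂ I
    have h1 : specMap mk ≫ ρ = specMap (mk.comp (constL A)) ≫ i := by
      rw [hρ, GmAction.univ, GmAction.specMap_smul, hD, ← Category.assoc, ← specMap_comp]
      rw [tval_specMap, tval_specMap]
      exact Ideal.Quotient.eq_zero_iff_mem.2 (Ideal.subset_span rfl)
    have h2 : 𝔭 ∈ Set.range (PrimeSpectrum.comap (Ideal.Quotient.mk I)) := by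
      rw [range_comap_of_surjective _ _ Ideal.Quotient.mk_surjective,
        Ideal.mk_ker]
      refine (Ideal.span_le.2 ?_ : I ≤ 𝔭.asIdeal)
      rintro _ rfl
      exact h𝔭
    obtain ⟨𝔮, rfl⟩ := h2
    change ρ.left ((specMap mk).left 𝔮) ∈ Set.range i.left
    have h3 : ρ.left ((specMap mk).left 𝔮) = i.left ((specMap (mk.comp (constL A))).left 𝔮) :=
      congrArg (fun f => f.left 𝔮) h1
    exact ⟨_, h3.symm⟩
  obtain ⟨I, hI⟩ := (PrimeSpectrum.isClosed_iff_zeroLocus_ideal (V.1 : Set (PrimeSpectrum A[T;T⁻¹]))ᶜ).1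
    V.2.isClosed_compl
  -- The points that leave the chart form a closed set disjoint from `t = 0`, so its ideal and `t`
  -- generate the unit ideal. This produces a function `1 - t s` that vanishes wherever the chart is
  -- left.
  have htop : I ⊔ Ideal.span {LaurentPolynomial.C t} = ⊤ := by
    rw [← PrimeSpectrum.zeroLocus_empty_iff_eq_top, PrimeSpectrum.zeroLocus_sup, ← hI,
      PrimeSpectrum.zeroLocus_span, Set.eq_empty_iff_forall_notMem]
    rintro 𝔭 ⟨h1, h2⟩
    exact h1 (hVt 𝔭 (h2 rfl))
  obtain ⟨Q, hQ, b, hb, hQb⟩ := Submodule.mem_sup.1 (htop ▸ Submodule.mem_top : (1 : A[T;T⁻¹]) ∈ _)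
  obtain ⟨s, rfl⟩ := Ideal.mem_span_singleton'.1 hb
  have hQs : Q = 1 - LaurentPolynomial.C t * s := by
    rw [← hQb]
    ring
  subst hQs
  have hsub : ∀ 𝔭 : PrimeSpectrum A[T;T⁻¹], 1 - LaurentPolynomial.C t * s ∉ 𝔭.asIdeal → 𝔭 ∈ V := by
    intro 𝔭 h𝔭
    by_contra hV
    have : 𝔭 ∈ PrimeSpectrum.zeroLocus (I : Set A[T;T⁻¹]) := by
      rw [← hI]
      exact hV
    exact h𝔭 (this hQ)
  obtain ⟨ψ, hψ⟩ := exists_specMap_comp_eq i (specMap (Algebra.algHom ℂ A[T;T⁻¹]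
    (Localization.Away (1 - LaurentPolynomial.C t * s))) ≫ ρ) (by
      rintro _ ⟨𝔮, rfl⟩
      have h := PrimeSpectrum.localization_away_comap_range
        (Localization.Away (1 - LaurentPolynomial.C t * s)) (1 - LaurentPolynomial.C t * s)
      have h𝔮 : PrimeSpectrum.comap (algebraMap A[T;T⁻¹]
          (Localization.Away (1 - LaurentPolynomial.C t * s))) 𝔮 ∈
          (PrimeSpectrum.basicOpen (1 - LaurentPolynomial.C t * s) : Set _) := by
        rw [← h]
        exact ⟨𝔮, rfl⟩
      exact hsub _ h𝔮)
  exact ⟨s, ψ, hψ⟩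

/-- The coaction modulo a power of `t` has no negative weights. -/
lemma ActsTrivially.coeff_eq_zero (hD : D.ActsTrivially) [IsOpenImmersion i.left] (k : ℕ)
    {R : Type} [CommRing R] [Algebra ℂ R] {mk : A →ₐ[ℂ] R} (hmk : Function.Surjective mk)
    (hker : RingHom.ker mk = Ideal.span {tval i ^ k})
    {σ : A →ₐ[ℂ] R[T;T⁻¹]} (hσ : specMap σ ≫ i = D.action.univ (specMap mk ≫ i))
    (f : A) {j : ℤ} (hj : j < 0) : (σ f).coeff j = 0 := by
  set t := tval i with ht
  have htk : mk t ^ k = 0 := by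
    rw [← map_pow]
    exact hker.ge (Ideal.subset_span rfl)
  have hσt : σ t = LaurentPolynomial.C (mk t) * LaurentPolynomial.T 1 := by
    have h := congrArg tval hσ
    rw [tval_specMap, GmAction.univ, tval_smul, tval_specMap, tval_specMap, mul_comm] at h
    exact h
  -- The coaction multiplies `t` by the variable, so it kills `t ^ k` and descends to the quotient,
  -- although no coaction on `A` itself is available.
  let s : R →ₐ[ℂ] R[T;T⁻¹] := AlgHom.liftOfSurjective mk hmk σ (by
    change RingHom.ker mk ≤ RingHom.ker σ
    rw [hker, Ideal.span_le]
    rintro _ rfl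
    change σ (t ^ k) = 0
    rw [map_pow, hσt, mul_pow, ← map_pow, htk]
    simp)
  have hs : ∀ a, s (mk a) = σ a := fun a => AlgHom.liftOfSurjective_apply _ _ _ _ _
  have hsc : s.comp mk = σ := AlgHom.ext hs
  have hstar : ∀ {C : Type} [CommRing C] [Algebra ℂ C] (φ : R →ₐ[ℂ] C) (u : Cˣ),
      D.action.smul u (specMap φ ≫ specMap mk ≫ i) =
        specMap ((evalL φ u).comp s) ≫ specMap mk ≫ i := by
    intro C _ _ φ u
    rw [← GmAction.specMap_univ, ← hσ, ← hsc, specMap_comp, specMap_comp]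
    simp only [Category.assoc]
  have hinj : ∀ {C : Type} [CommRing C] [Algebra ℂ C] {φ φ' : R →ₐ[ℂ] C},
      specMap φ ≫ specMap mk ≫ i = specMap φ' ≫ specMap mk ≫ i → φ = φ' := by
    intro C _ _ φ φ' h
    rw [← Category.assoc, ← Category.assoc, ← specMap_comp, ← specMap_comp] at h
    have h' := specMap_comp_injective i h
    refine AlgHom.ext fun r => ?_
    obtain ⟨a, rfl⟩ := hmk r
    exact DFunLike.congr_fun h' a
  rw [← hs]
  refine coeff_eq_zero_of_coaction (s := s.toRingHom) htk ((hs t).trans hσt) (fun f j => ?_)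
    (fun f j hj0 hf => ?_) (mk f) hj
  -- Associativity of the action, for two independent units.
  · have h := D.action.mul_smul (unitT R[T;T⁻¹])
      (Units.map (constL R[T;T⁻¹]).toRingHom.toMonoidHom (unitT R))
      (specMap ((constL R[T;T⁻¹]).comp (constL R)) ≫ specMap mk ≫ i)
    rw [hstar, hstar, hstar] at h
    have h' := DFunLike.congr_fun (hinj h) f
    rw [evalL_constL_constL] at h'
    have h2 := congrArg (fun p => p.coeff j) h'
    exact (coeff_mapL s (s f) j).symm.trans (h2.symm.trans (coeff_evalL_constL_constL (s f) j))
  -- Modulo `t` the coaction is `f ↦ f`, so a vector of nonzero weight is zero there.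
  · let I : Ideal R := Ideal.span {mk t}
    let θ : R →ₐ[ℂ] R ⧸ I := Ideal.Quotient.mkₐ ℂ I
    have h0 : tval (specMap ((constL _).comp θ) ≫ specMap mk ≫ i) = 0 := by
      rw [tval_specMap, tval_specMap]
      have : θ (mk t) = 0 := Ideal.Quotient.eq_zero_iff_mem.2 (Ideal.subset_span rfl)
      change constL _ (θ (mk t)) = 0
      rw [this, map_zero]
    have h1 := hD h0 (unitT (R ⧸ I))
    rw [hstar] at h1
    have h2 := DFunLike.congr_fun (hinj h1) f
    have h3 : mapL θ (s f) = LaurentPolynomial.C (θ f) := h2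
    have h4 : s f = LaurentPolynomial.C f * LaurentPolynomial.T j := hf
    rw [h4, mapL_C_mul_T] at h3
    have h5 := congrArg (fun p => p.coeff 0) h3
    simp only [coeff_C_mul_T, if_neg hj0] at h5
    have h6 : θ f = 0 := by simpa using h5.symm
    exact Ideal.mem_span_singleton.1 (Ideal.Quotient.eq_zero_iff_mem.1 h6)

end SpecialDegeneration

open scoped LaurentPolynomial PowerSeries

/-! ## Limits of orbits -/

/-- A morphism from the spectrum of a domain to a separated scheme is determined by its restriction
along a dominant morphism. -/
lemma hom_ext_of_injective {Z : CScheme} [IsSeparated Z.hom] {C C' : Type} [CommRing C]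
    [Algebra ℂ C] [IsDomain C] [CommRing C'] [Algebra ℂ C'] {φ : C →ₐ[ℂ] C'}
    (hφ : Function.Injective φ) {x y : specOver C ⟶ Z}
    (h : specMap φ ≫ x = specMap φ ≫ y) : x = y := by
  have hd : IsDominant (specMap φ).left := by
    constructor
    refine (PrimeSpectrum.denseRange_comap_iff_ker_le_nilRadical φ.toRingHom).2 ?_
    rw [(RingHom.injective_iff_ker_eq_bot φ.toRingHom).1 hφ]
    exact bot_le
  have hr : IsReduced (specOver C).left :=
    inferInstanceAs (IsReduced (Spec (CommRingCat.of C)))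
  ext : 1
  exact ext_of_isDominant_of_isSeparated Z.hom ((Over.w x).trans (Over.w y).symm)
    (specMap φ).left (congrArg (fun f => f.left) h)

/-! ### Power series and Laurent series over an algebra -/

section PowerSeries

/-- The power series with the variable inverted. -/
abbrev LSeries (C : Type) [CommRing C] : Type := Localization.Away (PowerSeries.X : C⟦X⟧)

variable {C C' E : Type} [CommRing C] [Algebra ℂ C] [CommRing C'] [Algebra ℂ C']
  [CommRing E] [Algebra ℂ E]

/-- The power series as Laurent series. -/
def toLSeries (C : Type) [CommRing C] [Algebra ℂ C] : C⟦X⟧ →ₐ[ℂ] LSeries C :=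
  IsScalarTower.toAlgHom ℂ C⟦X⟧ (LSeries C)

/-- The constant power series. -/
def constS (C : Type) [CommRing C] [Algebra ℂ C] : C →ₐ[ℂ] C⟦X⟧ :=
  { PowerSeries.C with commutes' := fun _ => PowerSeries.algebraMap_apply.symm }

/-- The constant coefficient. -/
def coeffZero (C : Type) [CommRing C] [Algebra ℂ C] : C⟦X⟧ →ₐ[ℂ] C :=
  { PowerSeries.constantCoeff with
    commutes' := fun c => PowerSeries.constantCoeff_C (algebraMap ℂ C c) }

/-- The variable of the Laurent series. -/
def unitX (C : Type) [CommRing C] : (LSeries C)ˣ :=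
  (IsLocalization.Away.algebraMap_isUnit (S := LSeries C) (PowerSeries.X : C⟦X⟧)).unit

lemma toLSeries_X : toLSeries C PowerSeries.X = unitX C := rfl

/-- The extension of a homomorphism to the Laurent series. -/
def liftLSeries (φ : C⟦X⟧ →ₐ[ℂ] E) (h : IsUnit (φ PowerSeries.X)) : LSeries C →ₐ[ℂ] E :=
  IsLocalization.liftAlgHom (M := Submonoid.powers (PowerSeries.X : C⟦X⟧)) (f := φ) (by
    rintro ⟨_, k, rfl⟩
    change IsUnit (φ (PowerSeries.X ^ k))
    rw [map_pow]
    exact h.pow k)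

lemma liftLSeries_comp (φ : C⟦X⟧ →ₐ[ℂ] E) (h : IsUnit (φ PowerSeries.X)) :
    (liftLSeries φ h).comp (toLSeries C) = φ :=
  AlgHom.ext fun f => IsLocalization.lift_eq _ f

lemma liftLSeries_unitX (φ : C⟦X⟧ →ₐ[ℂ] E) (u : Eˣ) (h : φ PowerSeries.X = u) :
    Units.map (liftLSeries φ (h ▸ u.isUnit)).toRingHom.toMonoidHom (unitX C) = u := by
  ext
  exact (DFunLike.congr_fun (liftLSeries_comp φ (h ▸ u.isUnit)) PowerSeries.X).trans h

lemma toLSeries_injective [IsDomain C] : Function.Injective (toLSeries C) :=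
  IsLocalization.injective (M := Submonoid.powers (PowerSeries.X : C⟦X⟧)) (LSeries C)
    (powers_le_nonZeroDivisors_of_noZeroDivisors PowerSeries.X_ne_zero)

lemma coeffZero_comp_constS : (coeffZero C).comp (constS C) = AlgHom.id ℂ C :=
  AlgHom.ext fun c => PowerSeries.constantCoeff_C c

/-- The base change of power series. -/
def mapS (φ : C →ₐ[ℂ] C') : C⟦X⟧ →ₐ[ℂ] C'⟦X⟧ := PowerSeries.mapAlgHom φ

lemma mapS_X (φ : C →ₐ[ℂ] C') : mapS φ PowerSeries.X = PowerSeries.X :=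
  PowerSeries.map_X φ.toRingHom

lemma mapS_comp_constS (φ : C →ₐ[ℂ] C') : (mapS φ).comp (constS C) = (constS C').comp φ :=
  AlgHom.ext fun c => PowerSeries.map_C φ.toRingHom c

lemma coeffZero_comp_mapS (φ : C →ₐ[ℂ] C') :
    (coeffZero C').comp (mapS φ) = φ.comp (coeffZero C) := by
  refine AlgHom.ext fun f => ?_
  change PowerSeries.constantCoeff (PowerSeries.map φ.toRingHom f) =
    φ (PowerSeries.constantCoeff f)
  rw [← PowerSeries.coeff_zero_eq_constantCoeff_apply, PowerSeries.coeff_map,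
    PowerSeries.coeff_zero_eq_constantCoeff_apply]
  rfl

lemma rescale_C {R : Type} [CommRing R] (c r : R) :
    PowerSeries.rescale c (PowerSeries.C r) = PowerSeries.C r := by
  ext k
  rw [PowerSeries.coeff_rescale, PowerSeries.coeff_C]
  split_ifs with hk
  · rw [hk, pow_zero, one_mul]
  · rw [mul_zero]

/-- The substitution of `c X` for `X`. -/
def scaleS (c : C) : C⟦X⟧ →ₐ[ℂ] C⟦X⟧ :=
  { PowerSeries.rescale c with
    commutes' := fun _ => (congrArg (PowerSeries.rescale c) PowerSeries.algebraMap_apply).trans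
      ((rescale_C _ _).trans PowerSeries.algebraMap_apply.symm) }

end PowerSeries

/-! ### Limits for a → 0 and their functoriality -/

section Limits

variable {Z : CScheme} (α : GmAction Z) {C C' : Type} [CommRing C] [Algebra ℂ C]
  [CommRing C'] [Algebra ℂ C']

/-- The point `z` is the limit of `a · x` for `a → 0`. -/
def GmAction.IsLimit (x z : specOver C ⟶ Z) : Prop :=
  ∃ y : specOver C⟦X⟧ ⟶ Z,
    specMap (toLSeries C) ≫ y =
      α.smul (unitX C) (specMap ((toLSeries C).comp (constS C)) ≫ x) ∧
    specMap (coeffZero C) ≫ y = z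

namespace GmAction.IsLimit

variable {α} {x z z' : specOver C ⟶ Z}

/-- Over a domain the power series embed in the Laurent series, so by separatedness an orbit extends
over `a = 0` in at most one way. -/
lemma unique [IsDomain C] [IsSeparated Z.hom] (h : α.IsLimit x z) (h' : α.IsLimit x z') :
    z = z' := by
  obtain ⟨y, hy, rfl⟩ := h
  obtain ⟨y', hy', rfl⟩ := h'
  rw [hom_ext_of_injective toLSeries_injective (hy.trans hy'.symm)]

lemma specMap (h : α.IsLimit x z) (φ : C →ₐ[ℂ] C') :
    α.IsLimit (specMap φ ≫ x) (HStability.specMap φ ≫ z) := by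
  obtain ⟨y, hy, rfl⟩ := h
  have hX : ((toLSeries C').comp (mapS φ)) PowerSeries.X = unitX C' := by
    rw [AlgHom.comp_apply, mapS_X, toLSeries_X]
  let R := liftLSeries ((toLSeries C').comp (mapS φ)) (hX ▸ (unitX C').isUnit)
  have hR : R.comp (toLSeries C) = (toLSeries C').comp (mapS φ) := liftLSeries_comp _ _
  refine ⟨HStability.specMap (mapS φ) ≫ y, ?_, ?_⟩
  · rw [← Category.assoc, ← specMap_comp, ← hR, specMap_comp, Category.assoc, hy, specMap_smul,
      liftLSeries_unitX _ _ hX, ← Category.assoc, ← specMap_comp, ← Category.assoc, ← specMap_comp]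
    rw [← AlgHom.comp_assoc, hR, AlgHom.comp_assoc, AlgHom.comp_assoc, mapS_comp_constS]
  · rw [← Category.assoc, ← specMap_comp, coeffZero_comp_mapS, specMap_comp, Category.assoc]

/-- Replacing the variable `X` by `u X` moves the starting point along its orbit and does not change
the value at `X = 0`. -/
lemma smul (h : α.IsLimit x z) (u : Cˣ) : α.IsLimit (α.smul u x) z := by
  obtain ⟨y, hy, rfl⟩ := h
  let uX : (LSeries C)ˣ := unitX C *
    Units.map ((toLSeries C).comp (constS C)).toRingHom.toMonoidHom u
  have hX : ((toLSeries C).comp (scaleS (u : C))) PowerSeries.X = uX := by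
    have : scaleS (u : C) PowerSeries.X = PowerSeries.X * constS C u :=
      (PowerSeries.rescale_X (u : C)).trans (mul_comm _ _)
    rw [AlgHom.comp_apply, this, map_mul]
    rfl
  let R := liftLSeries ((toLSeries C).comp (scaleS (u : C))) (hX ▸ uX.isUnit)
  have hR : R.comp (toLSeries C) = (toLSeries C).comp (scaleS (u : C)) := liftLSeries_comp _ _
  have hc : (scaleS (u : C)).comp (constS C) = constS C :=
    AlgHom.ext fun c => rescale_C _ _
  have h0 : (coeffZero C).comp (scaleS (u : C)) = coeffZero C := by
    refine AlgHom.ext fun f => ?_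
    change PowerSeries.constantCoeff (PowerSeries.rescale (u : C) f) = PowerSeries.constantCoeff f
    rw [← PowerSeries.coeff_zero_eq_constantCoeff_apply, PowerSeries.coeff_rescale, pow_zero,
      one_mul, PowerSeries.coeff_zero_eq_constantCoeff_apply]
  refine ⟨HStability.specMap (scaleS (u : C)) ≫ y, ?_, ?_⟩
  · rw [← Category.assoc, ← specMap_comp, ← hR, specMap_comp, Category.assoc, hy, specMap_smul,
      liftLSeries_unitX _ _ hX, ← Category.assoc, ← specMap_comp, specMap_smul, ← mul_smul,
      ← AlgHom.comp_assoc, hR, AlgHom.comp_assoc, hc]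
  · rw [← Category.assoc, ← specMap_comp, h0]

end GmAction.IsLimit

end Limits

namespace SpecialDegeneration

variable {X : CScheme} {n : ℕ} {D : SpecialDegeneration X n} {C : Type} [CommRing C] [Algebra ℂ C]
  {x z : specOver C ⟶ D.totalC}

/-- Along the extended orbit the coordinate is `X` times that of `x`, which vanishes at `X = 0`. -/
lemma tval_eq_zero_of_isLimit [IsDomain C] (h : D.action.IsLimit x z) : tval z = 0 := by
  obtain ⟨y, hy, rfl⟩ := h
  have h := congrArg tval hy
  rw [tval_specMap, tval_smul, tval_specMap, AlgHom.comp_apply, ← toLSeries_X, ← map_mul] at h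
  rw [tval_specMap, toLSeries_injective h, map_mul]
  have : coeffZero C PowerSeries.X = 0 := PowerSeries.constantCoeff_X
  rw [this, zero_mul]

lemma ActsTrivially.isLimit (hD : D.ActsTrivially) (hx : tval x = 0) : D.action.IsLimit x x := by
  refine ⟨specMap (constS C) ≫ x, ?_, ?_⟩
  · rw [← Category.assoc, ← specMap_comp, hD]
    rw [tval_specMap, hx, map_zero]
  · rw [← Category.assoc, ← specMap_comp, coeffZero_comp_constS, specMap_id, Category.id_comp]

end SpecialDegeneration

open scoped LaurentPolynomial PowerSeries

/-! ## Existence of limits near the central fibre -/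

/-- Krull's intersection theorem for the module `S / Q`: the class of `P` is divisible by all powers
of `t`, hence killed by an element of `1 + (t)`. -/
lemma exists_one_sub_mul_mul_eq {S : Type} [CommRing S] [IsNoetherianRing S] {t P Q : S}
    (h : ∀ k : ℕ, ∃ g, t ^ k ∣ P - Q * g) : ∃ s g, (1 - t * s) * P = Q * g := by
  let J : Ideal S := Ideal.span {Q}
  have hmem : (Ideal.Quotient.mk J P) ∈
      (⨅ k : ℕ, Ideal.span {t} ^ k • ⊤ : Submodule S (S ⧸ J)) := by
    rw [Submodule.mem_iInf]
    intro k
    obtain ⟨g, c, hc⟩ := h k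
    have e : Ideal.Quotient.mk J P = t ^ k • Ideal.Quotient.mk J c := by
      rw [Algebra.smul_def]
      change _ = Ideal.Quotient.mk J (t ^ k) * Ideal.Quotient.mk J c
      rw [← map_mul, Ideal.Quotient.eq, ← hc, sub_sub_cancel]
      exact Ideal.mem_span_singleton.2 (dvd_mul_right _ _)
    rw [e]
    exact Submodule.smul_mem_smul (Ideal.pow_mem_pow (Ideal.mem_span_singleton_self t) k) trivial
  obtain ⟨⟨r, hr⟩, hrP⟩ := (Ideal.mem_iInf_smul_pow_eq_bot_iff (Ideal.span {t}) _).1 hmem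
  obtain ⟨s, rfl⟩ := Ideal.mem_span_singleton.1 hr
  have e : Ideal.Quotient.mk J (P - t * s * P) = 0 := by
    rw [map_sub, sub_eq_zero, map_mul _ (t * s)]
    exact hrP.symm
  obtain ⟨g, hg⟩ := Ideal.mem_span_singleton.1 (Ideal.Quotient.eq_zero_iff_mem.1 e)
  exact ⟨s, g, by rw [← hg]; ring⟩

section Laurent

variable {R R' : Type} [CommRing R] [Algebra ℂ R] [CommRing R'] [Algebra ℂ R']

lemma coeff_toLaurent {R : Type} [CommRing R] (p : Polynomial R) (m : ℕ) :
    (Polynomial.toLaurent p).coeff (m : ℤ) = p.coeff m := by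
  induction p using Polynomial.induction_on' with
  | add p q hp hq =>
    rw [map_add, AddMonoidAlgebra.coeff_add, Finsupp.add_apply, hp, hq, Polynomial.coeff_add]
  | monomial j r =>
    rw [Polynomial.toLaurent_C_mul_T, coeff_C_mul_T, Polynomial.coeff_monomial]
    congr 1
    exact propext Nat.cast_inj

lemma mapL_toLaurent (φ : R →ₐ[ℂ] R') (p : Polynomial R) :
    mapL φ (Polynomial.toLaurent p) = Polynomial.toLaurent (p.map φ.toRingHom) := by
  induction p using Polynomial.induction_on' with
  | add p q hp hq => rw [map_add, map_add, hp, hq, Polynomial.map_add, map_add]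
  | monomial j r =>
    rw [Polynomial.toLaurent_C_mul_T, mapL_C_mul_T, Polynomial.map_monomial,
      Polynomial.toLaurent_C_mul_T]
    rfl

lemma exists_toLaurent_eq {R : Type} [CommRing R] {f : R[T;T⁻¹]} (hf : ∀ j < 0, f.coeff j = 0) :
    ∃ p, Polynomial.toLaurent p = f := by
  obtain ⟨m, p, hp⟩ := LaurentPolynomial.exists_T_pow f
  have hd : Polynomial.X ^ m ∣ p := by
    rw [Polynomial.X_pow_dvd_iff]
    intro d hd
    rw [← coeff_toLaurent, hp, coeff_mul_T]
    exact hf _ (by omega)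
  obtain ⟨p', rfl⟩ := hd
  refine ⟨p', ?_⟩
  rw [map_mul, Polynomial.toLaurent_X_pow, LaurentPolynomial.T_mul] at hp
  exact (LaurentPolynomial.isUnit_T (m : ℤ)).mul_right_cancel hp

end Laurent

namespace SpecialDegeneration

variable {X : CScheme} {n : ℕ} {D : SpecialDegeneration X n} {A : Type} [CommRing A] [Algebra ℂ A]
  {i : specOver A ⟶ D.totalC}

/-- The coaction on a function has no pole along `a = 0`, near the central fibre. -/
lemma ActsTrivially.exists_mul_eq_toLaurent (hD : D.ActsTrivially) [IsOpenImmersion i.left]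
    [IsDomain A] [IsNoetherianRing A] (ht : ¬ IsUnit (tval i)) {Q s : A[T;T⁻¹]}
    (hQ : Q = 1 - LaurentPolynomial.C (tval i) * s) {ψ : A →ₐ[ℂ] Localization.Away Q}
    (hψ : specMap ψ ≫ i = specMap (Algebra.algHom ℂ A[T;T⁻¹] _) ≫ D.action.univ i) (f : A) :
    ∃ r g : Polynomial A,
      ψ f * algebraMap A[T;T⁻¹] _ (Polynomial.toLaurent (1 - Polynomial.C (tval i) * r)) =
        algebraMap A[T;T⁻¹] _ (Polynomial.toLaurent g) := by
  set t := tval i with htdef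
  have hQ0 : Q ≠ 0 := by
    intro h0
    have h := congrArg (fun p => p.coeff 0) (sub_eq_zero.1 (hQ.symm.trans h0))
    have h1 : (1 : A[T;T⁻¹]).coeff 0 = 1 := by simp
    rw [coeff_C_mul, h1] at h
    exact ht (IsUnit.of_mul_eq_one (s.coeff 0) h.symm)
  have hinj : Function.Injective (algebraMap A[T;T⁻¹] (Localization.Away Q)) :=
    IsLocalization.injective (M := Submonoid.powers Q) (Localization.Away Q)
      (powers_le_nonZeroDivisors_of_noZeroDivisors hQ0)
  have : IsDomain (Localization.Away Q) :=
    IsLocalization.isDomain_localization (powers_le_nonZeroDivisors_of_noZeroDivisors hQ0)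
  -- Powers of `Q` and of the variable are cleared, to write the coaction of `f` as a quotient of
  -- two polynomials.
  obtain ⟨m, P, hP⟩ := IsLocalization.Away.surj Q (ψ f)
  obtain ⟨a, P', hP'⟩ := LaurentPolynomial.exists_T_pow P
  obtain ⟨b, Q', hQ'⟩ := LaurentPolynomial.exists_T_pow (Q ^ m)
  have hPQ : ψ f * algebraMap A[T;T⁻¹] _ (Polynomial.toLaurent (Q' * Polynomial.X ^ a)) =
      algebraMap A[T;T⁻¹] _ (Polynomial.toLaurent (P' * Polynomial.X ^ b)) := by
    rw [map_mul Polynomial.toLaurent Q', map_mul Polynomial.toLaurent P', hQ', hP',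
      Polynomial.toLaurent_X_pow, Polynomial.toLaurent_X_pow, map_mul, map_mul, map_mul, map_mul,
      map_pow, ← hP]
    ring
  have hQ'0 : Q' * Polynomial.X ^ a ≠ 0 := by
    refine mul_ne_zero (fun h => ?_) (pow_ne_zero _ Polynomial.X_ne_zero)
    rw [h, map_zero] at hQ'
    exact mul_ne_zero (pow_ne_zero m hQ0) (LaurentPolynomial.isUnit_T (b : ℤ)).ne_zero hQ'.symm
  generalize Q' * Polynomial.X ^ a = Q₁ at hPQ hQ'0
  generalize P' * Polynomial.X ^ b = P₁ at hPQ
  -- Modulo `t ^ k` the function `Q = 1 - t s` is a unit, so the coaction takes values in Laurent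
  -- polynomials. They have no negative powers, so the quotient is a polynomial `g` modulo `t ^ k`.
  have hk : ∀ k : ℕ, ∃ g, (Polynomial.C t) ^ k ∣ P₁ - Q₁ * g := by
    intro k
    let I : Ideal A := Ideal.span {t ^ k}
    let mk : A →ₐ[ℂ] A ⧸ I := Ideal.Quotient.mkₐ ℂ I
    have hu : IsUnit (mapL mk Q) := by
      have : mapL mk Q = 1 - mapL mk (LaurentPolynomial.C t * s) := by rw [hQ, map_sub, map_one]
      rw [this]
      refine IsNilpotent.isUnit_one_sub ⟨k, ?_⟩
      have h0 : mapL mk (LaurentPolynomial.C (t ^ k)) = 0 := by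
        have := mapL_C_mul_T mk (t ^ k) 0
        rw [LaurentPolynomial.T_zero, LaurentPolynomial.T_zero, mul_one, mul_one] at this
        rw [this]
        have : mk (t ^ k) = 0 := Ideal.Quotient.eq_zero_iff_mem.2 (Ideal.subset_span rfl)
        rw [this, map_zero]
      rw [← map_pow, mul_pow, ← map_pow, map_mul, h0, zero_mul]
    let κ : Localization.Away Q →ₐ[ℂ] (A ⧸ I)[T;T⁻¹] :=
      IsLocalization.liftAlgHom (M := Submonoid.powers Q) (f := mapL mk) (by
        rintro ⟨_, j, rfl⟩
        change IsUnit (mapL mk (Q ^ j))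
        rw [map_pow]
        exact hu.pow j)
    have hκ : ∀ g, κ (algebraMap _ _ g) = mapL mk g := fun g => IsLocalization.lift_eq _ g
    have hκ' : κ.comp (Algebra.algHom ℂ A[T;T⁻¹] _) = mapL mk := AlgHom.ext hκ
    have hσ : specMap (κ.comp ψ) ≫ i = D.action.univ (specMap mk ≫ i) := by
      rw [specMap_comp, Category.assoc, hψ, ← Category.assoc, ← specMap_comp, hκ', mapL,
        GmAction.specMap_univ, GmAction.univ, specMap_comp, Category.assoc]
    obtain ⟨p, hp⟩ := exists_toLaurent_eq fun j hj => hD.coeff_eq_zero i k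
      Ideal.Quotient.mk_surjective (by exact Ideal.mk_ker) hσ f hj
    obtain ⟨g, rfl⟩ := Polynomial.map_surjective mk.toRingHom Ideal.Quotient.mk_surjective p
    refine ⟨g, ?_⟩
    have h := congrArg κ hPQ
    rw [map_mul, hκ, hκ, mapL_toLaurent, mapL_toLaurent] at h
    have h2 : Polynomial.toLaurent (g.map mk.toRingHom) *
        Polynomial.toLaurent (Q₁.map mk.toRingHom) =
        Polynomial.toLaurent (P₁.map mk.toRingHom) := by
      rw [hp]
      exact h
    rw [← map_mul] at h2
    have h3 := Polynomial.toLaurent_injective h2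
    have h4 : (P₁ - Q₁ * g).map mk.toRingHom = 0 := by
      rw [Polynomial.map_sub, Polynomial.map_mul, ← h3]
      ring
    rw [← map_pow, Polynomial.C_dvd_iff_dvd_coeff]
    intro j
    have h5 := congrArg (fun p => p.coeff j) h4
    simp only [Polynomial.coeff_map, Polynomial.coeff_zero] at h5
    exact Ideal.mem_span_singleton.1 (Ideal.Quotient.eq_zero_iff_mem.1 h5)
  -- The approximations for all `k` combine to one exact quotient, at the price of a denominator `1
  -- - t r`, which is a unit near `t = 0`.
  obtain ⟨r, g, hrg⟩ := exists_one_sub_mul_mul_eq hk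
  refine ⟨r, g, ?_⟩
  have hne : algebraMap A[T;T⁻¹] (Localization.Away Q) (Polynomial.toLaurent Q₁) ≠ 0 := by
    rw [Ne, map_eq_zero_iff _ hinj, map_eq_zero_iff _ Polynomial.toLaurent_injective]
    exact hQ'0
  refine mul_right_cancel₀ hne ?_
  rw [mul_right_comm, hPQ, ← map_mul, ← map_mul, ← map_mul, ← map_mul, mul_comm P₁, hrg, mul_comm]

end SpecialDegeneration

open scoped LaurentPolynomial PowerSeries

/-! ### Laurent polynomials inside fields of power series -/

section PowerSeries

variable {C E : Type} [CommRing C] [Algebra ℂ C] [CommRing E] [Algebra ℂ E]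

lemma liftLSeries_injective {φ : C⟦X⟧ →ₐ[ℂ] E} (h : IsUnit (φ PowerSeries.X))
    (hφ : Function.Injective φ) : Function.Injective (liftLSeries φ h) := by
  rw [injective_iff_map_eq_zero]
  intro a ha
  obtain ⟨m, p, hp⟩ := IsLocalization.Away.surj (PowerSeries.X : C⟦X⟧) a
  have h1 : φ p = 0 := by
    rw [← DFunLike.congr_fun (liftLSeries_comp φ h) p]
    change liftLSeries φ h (algebraMap _ _ p) = 0
    rw [← hp, map_mul, ha, zero_mul]
  rw [(map_eq_zero_iff φ hφ).1 h1, map_zero] at hp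
  exact (((unitX C).isUnit.pow m).mul_left_eq_zero).1 hp

/-- The embedding of the Laurent polynomials in a localisation of the power series. -/
lemma evalL_toLaurent {φ : C⟦X⟧ →ₐ[ℂ] E} {u : Eˣ} (hu : φ PowerSeries.X = u) {A : Type}
    [CommRing A] [Algebra ℂ A] (β : A →ₐ[ℂ] C) (p : Polynomial A) :
    evalL ((φ.comp (constS C)).comp β) u (Polynomial.toLaurent p) =
      φ ((p.map β.toRingHom : Polynomial C) : C⟦X⟧) := by
  induction p using Polynomial.induction_on' with
  | add p q hp hq => rw [map_add, map_add, hp, hq, Polynomial.map_add, Polynomial.coe_add, map_add]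
  | monomial j r =>
    rw [Polynomial.toLaurent_C_mul_T, evalL_C_mul_T, Polynomial.map_monomial,
      ← Polynomial.C_mul_X_pow_eq_monomial, Polynomial.coe_mul, Polynomial.coe_pow,
      Polynomial.coe_X, Polynomial.coe_C, map_mul, map_pow, hu, zpow_natCast, Units.val_pow_eq_pow_val]
    rfl

lemma evalL_injective {φ : C⟦X⟧ →ₐ[ℂ] E} (hφ : Function.Injective φ) {u : Eˣ}
    (hu : φ PowerSeries.X = u) {A : Type} [CommRing A] [Algebra ℂ A] {β : A →ₐ[ℂ] C}
    (hβ : Function.Injective β) :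
    Function.Injective (evalL ((φ.comp (constS C)).comp β) u) := by
  rw [injective_iff_map_eq_zero]
  intro f hf
  obtain ⟨m, p, hp⟩ := LaurentPolynomial.exists_T_pow f
  have h := evalL_toLaurent hu β p
  rw [hp, map_mul, hf, zero_mul] at h
  have h1 := (map_eq_zero_iff φ hφ).1 h.symm
  have h2 : p.map β.toRingHom = 0 := Polynomial.coe_injective C (by rw [h1, Polynomial.coe_zero])
  have h3 : p = 0 := Polynomial.map_injective β.toRingHom hβ (by rw [h2, Polynomial.map_zero])
  rw [h3, map_zero] at hp
  exact ((LaurentPolynomial.isUnit_T (m : ℤ)).mul_left_eq_zero).1 hp.symm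

end PowerSeries

lemma exists_comp_eq_of_range_le {A B K : Type} [CommRing A] [Algebra ℂ A] [CommRing B]
    [Algebra ℂ B] [CommRing K] [Algebra ℂ K] {ι : B →ₐ[ℂ] K} (hι : Function.Injective ι)
    {θ : A →ₐ[ℂ] K} (h : ∀ a, θ a ∈ ι.range) : ∃ σ : A →ₐ[ℂ] B, ι.comp σ = θ := by
  refine ⟨(AlgEquiv.ofInjective ι hι).symm.toAlgHom.comp (θ.codRestrict ι.range h), ?_⟩
  refine AlgHom.ext fun a => ?_
  change ι ((AlgEquiv.ofInjective ι hι).symm (θ.codRestrict ι.range h a)) = θ a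
  exact congrArg Subtype.val ((AlgEquiv.ofInjective ι hι).apply_symm_apply
    (θ.codRestrict ι.range h a))

namespace SpecialDegeneration

variable {X : CScheme} {n : ℕ} {D : SpecialDegeneration X n} {A : Type} [CommRing A] [Algebra ℂ A]
  {i : specOver A ⟶ D.totalC}

/-- The limits exist on a neighbourhood of the central fibre in a chart. -/
theorem ActsTrivially.exists_isLimit (hD : D.ActsTrivially) [IsOpenImmersion i.left]
    [IsDomain A] [Algebra.FiniteType ℂ A] (ht : ¬ IsUnit (tval i)) :
    ∃ s b : A, b = 1 - tval i * s ∧ ∃ z : specOver (Localization.Away b) ⟶ D.totalC,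
      D.action.IsLimit (specMap (IsScalarTower.toAlgHom ℂ A (Localization.Away b)) ≫ i) z := by
  have : IsNoetherianRing A := Algebra.FiniteType.isNoetherianRing ℂ A
  obtain ⟨Q, s, hQ, ψ, hψ⟩ : ∃ Q s : A[T;T⁻¹], Q = 1 - LaurentPolynomial.C (tval i) * s ∧
      ∃ ψ : A →ₐ[ℂ] Localization.Away Q,
        specMap ψ ≫ i = specMap (Algebra.algHom ℂ A[T;T⁻¹] _) ≫ D.action.univ i :=
    let ⟨s, ψ, h⟩ := ActsTrivially.exists_coaction i hD
    ⟨_, s, rfl, ψ, h⟩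
  choose r g hrg using hD.exists_mul_eq_toLaurent ht hQ hψ
  obtain ⟨G, hG⟩ := Algebra.FiniteType.out (R := ℂ) (A := A)
  set t := tval i with htdef
  -- The denominators `1 - t r` are invertible as power series in the group variable as soon as
  -- their constant terms are. Finitely many of them occur, one for each generator of `A`.
  let b : A := ∏ f ∈ G, (1 - t * (r f).coeff 0)
  obtain ⟨s', hs'⟩ : ∃ s', b = 1 - t * s' := by
    refine Finset.prod_induction _ (fun b => ∃ s', b = 1 - t * s') ?_ ⟨0, by ring⟩
      fun f _ => ⟨_, rfl⟩
    rintro _ _ ⟨a, rfl⟩ ⟨c, rfl⟩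
    exact ⟨a + c - t * a * c, by ring⟩
  refine ⟨s', b, hs', ?_⟩
  have hb0 : b ≠ 0 := by
    intro h
    rw [hs', sub_eq_zero] at h
    exact ht (IsUnit.of_mul_eq_one _ h.symm)
  have hle := powers_le_nonZeroDivisors_of_noZeroDivisors hb0
  have : IsDomain (Localization.Away b) := IsLocalization.isDomain_localization hle
  let B := Localization.Away b
  let β : A →ₐ[ℂ] B := IsScalarTower.toAlgHom ℂ A B
  have hβ : Function.Injective β := IsLocalization.injective (M := Submonoid.powers b) B hle
  -- The localized Laurent polynomials and the power series have no map between them in general;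
  -- both are compared in this field.
  let K := FractionRing B⟦X⟧
  let ι : B⟦X⟧ →ₐ[ℂ] K := IsScalarTower.toAlgHom ℂ B⟦X⟧ K
  have hι : Function.Injective ι := IsFractionRing.injective B⟦X⟧ K
  let u : Kˣ := Units.mk0 (ι PowerSeries.X)
    ((map_ne_zero_iff ι hι).2 PowerSeries.X_ne_zero)
  have hu : ι PowerSeries.X = u := rfl
  let l : A[T;T⁻¹] →ₐ[ℂ] K := evalL ((ι.comp (constS B)).comp β) u
  have hl : Function.Injective l := evalL_injective hι hu hβ
  have hlp : ∀ p, l (Polynomial.toLaurent p) = ι ((p.map β.toRingHom : Polynomial B) : B⟦X⟧) :=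
    evalL_toLaurent hu β
  have hQ0 : Q ≠ 0 := by
    intro h0
    have h := congrArg (fun p => p.coeff 0) (sub_eq_zero.1 (hQ.symm.trans h0))
    have h1 : (1 : A[T;T⁻¹]).coeff 0 = 1 := by simp
    rw [coeff_C_mul, h1] at h
    exact ht (IsUnit.of_mul_eq_one (s.coeff 0) h.symm)
  let μ : Localization.Away Q →ₐ[ℂ] K :=
    IsLocalization.liftAlgHom (M := Submonoid.powers Q) (f := l) (by
      rintro ⟨_, j, rfl⟩
      exact ((map_ne_zero_iff l hl).2 (pow_ne_zero j hQ0)).isUnit)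
  have hμ : ∀ p, μ (algebraMap _ _ p) = l p := fun p => IsLocalization.lift_eq _ p
  have hμ' : μ.comp (Algebra.algHom ℂ A[T;T⁻¹] _) = l := AlgHom.ext hμ
  -- The coaction of each generator is a polynomial divided by a unit of the power series ring. The
  -- power series form a subalgebra, so the coaction of all of `A` lies in it.
  have hrange : ∀ a, μ.comp ψ a ∈ ι.range := by
    have hGr : ∀ f ∈ G, μ.comp ψ f ∈ ι.range := by
      intro f hf
      have h := congrArg μ (hrg f)
      rw [map_mul, hμ, hμ, hlp, hlp] at h
      have hunit : IsUnit (((1 - Polynomial.C t * r f).map β.toRingHom : Polynomial B) : B⟦X⟧) := by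
        rw [PowerSeries.isUnit_iff_constantCoeff, ← PowerSeries.coeff_zero_eq_constantCoeff_apply,
          Polynomial.coeff_coe, Polynomial.coeff_map, Polynomial.coeff_sub,
          Polynomial.coeff_one_zero, Polynomial.coeff_C_mul]
        refine isUnit_of_dvd_unit (map_dvd β.toRingHom (Finset.dvd_prod_of_mem
          (fun f => 1 - t * (r f).coeff 0) hf)) ?_
        exact IsLocalization.Away.algebraMap_isUnit b
      obtain ⟨w, hw⟩ := hunit
      rw [← hw] at h
      refine ⟨((g f).map β.toRingHom : Polynomial B) * ↑w⁻¹, ?_⟩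
      change ι _ = μ (ψ f)
      rw [map_mul, ← h, mul_assoc, ← map_mul, Units.mul_inv, map_one, mul_one]
    have hle : (⊤ : Subalgebra ℂ A) ≤ ι.range.comap (μ.comp ψ) := by
      rw [← hG]
      exact Algebra.adjoin_le hGr
    exact fun a => hle trivial
  obtain ⟨σ, hσ⟩ := exists_comp_eq_of_range_le hι hrange
  refine ⟨specMap (coeffZero B) ≫ specMap σ ≫ i, specMap σ ≫ i, ?_, rfl⟩
  have : IsDomain (LSeries B) := IsLocalization.isDomain_localization
    (powers_le_nonZeroDivisors_of_noZeroDivisors PowerSeries.X_ne_zero)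
  -- The extended point agrees with the orbit over the Laurent series, because it does so in the
  -- larger field.
  refine hom_ext_of_injective (liftLSeries_injective (φ := ι) (hu ▸ u.isUnit) hι) ?_
  rw [← Category.assoc, ← specMap_comp, liftLSeries_comp, ← Category.assoc, ← specMap_comp, hσ,
    specMap_comp, Category.assoc, hψ, ← Category.assoc, ← specMap_comp, hμ',
    GmAction.specMap_univ, GmAction.specMap_smul, liftLSeries_unitX ι u hu, ← Category.assoc,
    ← specMap_comp, ← Category.assoc, ← specMap_comp, ← AlgHom.comp_assoc, liftLSeries_comp]

end SpecialDegeneration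

open scoped LaurentPolynomial PowerSeries

/-! ## Existence of limits -/

lemma coord_specMap {C : Type} [CommRing C] [Algebra ℂ C] (φ : Polynomial ℂ →ₐ[ℂ] C) :
    coord (specMap φ).left = (Scheme.ΓSpecIso (CommRingCat.of C)).inv (φ Polynomial.X) :=
  (ConcreteCategory.congr_hom (Scheme.ΓSpecIso_inv_naturality
    (CommRingCat.ofHom φ.toRingHom)) (Polynomial.X : Polynomial ℂ)).symm

lemma specMap_aeval_tval {C : Type} [CommRing C] [Algebra ℂ C] {S : Scheme.{0}} {π : S ⟶ A1}
    (x : specOver C ⟶ totalSpace π) :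
    (specMap (Polynomial.aeval (R := ℂ) (tval x))).left = x.left ≫ π := by
  refine A1_hom_ext ?_ ?_
  · exact (Over.w (specMap (Polynomial.aeval (R := ℂ) (tval x)))).trans (Over.w x).symm
  · rw [coord_specMap, Polynomial.aeval_X]
    exact ConcreteCategory.congr_hom (Scheme.ΓSpecIso (CommRingCat.of C)).hom_inv_id
      (coord (x.left ≫ π))

lemma mem_asIdeal_iff {C : Type} [CommRing C] [Algebra ℂ C] {S : Scheme.{0}} {π : S ⟶ A1}
    (x : specOver C ⟶ totalSpace π) (𝔭 : PrimeSpectrum C) (p : Polynomial ℂ) :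
    p ∈ PrimeSpectrum.asIdeal (π (x.left 𝔭)) ↔ Polynomial.aeval (tval x) p ∈ 𝔭.asIdeal := by
  have h : π (x.left 𝔭) = (specMap (Polynomial.aeval (R := ℂ) (tval x))).left 𝔭 := by
    rw [specMap_aeval_tval]
    rfl
  rw [h]
  rfl

instance isOpenImmersion_specMap_away {A : Type} [CommRing A] [Algebra ℂ A] (b : A) :
    IsOpenImmersion (specMap (IsScalarTower.toAlgHom ℂ A (Localization.Away b))).left :=
  inferInstanceAs (IsOpenImmersion (Spec.map (CommRingCat.ofHom
    (algebraMap A (Localization.Away b)))))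

lemma mem_range_specMap_away {A : Type} [CommRing A] [Algebra ℂ A] {b : A} {𝔭 : PrimeSpectrum A}
    (h : b ∉ 𝔭.asIdeal) :
    𝔭 ∈ Set.range (specMap (IsScalarTower.toAlgHom ℂ A (Localization.Away b))).left :=
  (PrimeSpectrum.localization_away_comap_range (Localization.Away b) b).ge h

/-- An open neighbourhood of the fibre over zero contains almost all fibres. -/
lemma exists_polynomial_of_isClosedMap {S : Scheme.{0}} {π : S ⟶ A1} (hπ : IsClosedMap π)
    {N : Set S} (hN : IsOpen N)
    (h0 : ∀ x, (Polynomial.X : Polynomial ℂ) ∈ PrimeSpectrum.asIdeal (π x) → x ∈ N) :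
    ∃ h : Polynomial ℂ, h ≠ 0 ∧ ∀ x, h ∉ PrimeSpectrum.asIdeal (π x) → x ∈ N := by
  obtain ⟨I, hI⟩ := (PrimeSpectrum.isClosed_iff_zeroLocus_ideal
    (π '' Nᶜ : Set (PrimeSpectrum (Polynomial ℂ)))).1 (hπ _ hN.isClosed_compl)
  let o : PrimeSpectrum (Polynomial ℂ) := ⟨Ideal.span {(Polynomial.X : Polynomial ℂ)},
    (Ideal.span_singleton_prime Polynomial.X_ne_zero).2 Polynomial.prime_X⟩
  have ho : o ∉ PrimeSpectrum.zeroLocus (I : Set (Polynomial ℂ)) := by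
    rw [← hI]
    rintro ⟨x, hx, hxo⟩
    refine hx (h0 x ?_)
    rw [hxo]
    exact Ideal.mem_span_singleton_self _
  obtain ⟨h, hhI, hho⟩ := Set.not_subset.1 ho
  refine ⟨h, fun h0 => hho (h0 ▸ o.asIdeal.zero_mem), fun x hx => ?_⟩
  by_contra hxN
  have : π x ∈ PrimeSpectrum.zeroLocus (I : Set (Polynomial ℂ)) := hI ▸ ⟨x, hxN, rfl⟩
  exact hx (this hhI)

namespace SpecialDegeneration

variable {X : CScheme} {n : ℕ} (D : SpecialDegeneration X n)

instance : IsIntegral D.totalC.left := D.integral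

/-- The point has a neighbourhood on which the limits exist. -/
def HasLimitChart (x : D.total) : Prop :=
  ∃ (A : Type) (_ : CommRing A) (_ : Algebra ℂ A) (i : specOver A ⟶ D.totalC)
    (z : specOver A ⟶ D.central), IsOpenImmersion i.left ∧ x ∈ Set.range i.left ∧
      D.action.IsLimit i (z ≫ D.inclusion)

lemma isOpen_hasLimitChart : IsOpen {x | D.HasLimitChart x} := by
  rw [isOpen_iff_forall_mem_open]
  rintro x ⟨A, _, _, i, z, hi, hx, hz⟩
  exact ⟨Set.range i.left, fun y hy => ⟨A, _, _, i, z, hi, hy, hz⟩,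
    i.left.isOpenEmbedding.isOpen_range, hx⟩

variable {D}

lemma ActsTrivially.hasLimitChart_of_mem (hD : D.ActsTrivially) {x : D.total}
    (hx : (Polynomial.X : Polynomial ℂ) ∈ PrimeSpectrum.asIdeal (D.π x)) : D.HasLimitChart x := by
  obtain ⟨A, _, _, i, hi, ⟨𝔭, rfl⟩, -⟩ := exists_affine_chart (Z := D.totalC) (V := ⊤) (x := x) trivial
  have : Nonempty (specOver A).left := ⟨𝔭⟩
  have : IsDomain A := isDomain_of_chart i
  have : Algebra.FiniteType ℂ A := algebra_finiteType_of_chart i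
  have ht := (mem_asIdeal_iff i 𝔭 _).1 hx
  rw [Polynomial.aeval_X] at ht
  obtain ⟨s, b, hb, z, hz⟩ := hD.exists_isLimit (i := i)
    fun hu => 𝔭.2.ne_top (Ideal.eq_top_of_isUnit_mem _ ht hu)
  have hb𝔭 : b ∉ 𝔭.asIdeal := fun h => 𝔭.2.ne_top ((Ideal.eq_top_iff_one _).2 (by
    have := 𝔭.asIdeal.add_mem h (𝔭.asIdeal.mul_mem_right s ht)
    rwa [hb, sub_add_cancel] at this))
  obtain ⟨𝔮, h𝔮⟩ := mem_range_specMap_away hb𝔭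
  have : Nonempty (specOver (Localization.Away b)).left := ⟨𝔮⟩
  have hop : IsOpenImmersion
      (specMap (IsScalarTower.toAlgHom ℂ A (Localization.Away b)) ≫ i).left :=
    inferInstanceAs (IsOpenImmersion (_ ≫ i.left))
  have : IsDomain (Localization.Away b) :=
    isDomain_of_chart (specMap (IsScalarTower.toAlgHom ℂ A (Localization.Away b)) ≫ i)
  obtain ⟨z', rfl⟩ := D.exists_central_lift (tval_eq_zero_of_isLimit hz)
  exact ⟨_, _, _, _, z', hop, ⟨𝔮, congrArg i.left h𝔮⟩, hz⟩

/-- The set with limits is open and contains the fibre over 0. As `π` is closed it contains the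
fibres over all but finitely many points, and one of these is different from 0. -/
lemma ActsTrivially.exists_fibre (hD : D.ActsTrivially) :
    ∃ c : ℂ, c ≠ 0 ∧ ∀ x : D.total, (Polynomial.X - Polynomial.C c : Polynomial ℂ) ∈
      PrimeSpectrum.asIdeal (D.π x) → D.HasLimitChart x := by
  obtain ⟨h, hh, hN⟩ := exists_polynomial_of_isClosedMap D.π.isClosedMap D.isOpen_hasLimitChart
    fun x => hD.hasLimitChart_of_mem
  obtain ⟨c, hc⟩ := Infinite.exists_notMem_finset (h * Polynomial.X).roots.toFinset
  rw [Multiset.mem_toFinset, Polynomial.mem_roots (mul_ne_zero hh Polynomial.X_ne_zero),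
    Polynomial.IsRoot, Polynomial.eval_mul, Polynomial.eval_X, mul_eq_zero, not_or] at hc
  refine ⟨c, hc.2, fun x hx => hN x fun h1 => ?_⟩
  have h2 : Polynomial.C (h.eval c) ∈ PrimeSpectrum.asIdeal (D.π x) := by
    obtain ⟨g, hg⟩ := Polynomial.X_sub_C_dvd_sub_C_eval (p := h) (a := c)
    have := Ideal.sub_mem _ h1 (Ideal.mul_mem_right g _ hx)
    rwa [← hg, sub_sub_cancel] at this
  exact (PrimeSpectrum.isPrime (D.π x)).ne_top (Ideal.eq_top_of_isUnit_mem _ h2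
    (Polynomial.isUnit_C.2 (isUnit_iff_ne_zero.2 hc.1)))

/-- A point outside the central fibre can be moved into the fibre over `c`, where limits exist;
moving back along the orbit does not change the limit. -/
theorem ActsTrivially.hasLimitChart (hD : D.ActsTrivially) (x : D.total) : D.HasLimitChart x := by
  by_cases hx : (Polynomial.X : Polynomial ℂ) ∈ PrimeSpectrum.asIdeal (D.π x)
  · exact hD.hasLimitChart_of_mem hx
  obtain ⟨c, hc0, hc⟩ := hD.exists_fibre
  let V : D.totalC.left.Opens := D.π ⁻¹ᵁ (PrimeSpectrum.basicOpen (Polynomial.X : Polynomial ℂ))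
  obtain ⟨A, _, _, i, hi, ⟨𝔭, rfl⟩, hiV⟩ := exists_affine_chart (Z := D.totalC) (V := V) (x := x) hx
  have ht : IsUnit (tval i) := by
    by_contra hu
    obtain ⟨𝔪, h𝔪, ht𝔪⟩ := exists_max_ideal_of_mem_nonunits hu
    refine hiV ⟨(⟨𝔪, h𝔪.isPrime⟩ : PrimeSpectrum A), rfl⟩ ?_
    refine (mem_asIdeal_iff i _ _).2 ?_
    rwa [Polynomial.aeval_X]
  obtain ⟨t, ht⟩ := ht
  -- The unit `c / t`, which moves the whole chart into the fibre over `c`.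
  let v : Aˣ := Units.map (algebraMap ℂ A).toMonoidHom (Units.mk0 c hc0) * t⁻¹
  have hw : tval (D.action.smul v i) = algebraMap ℂ A c := by
    rw [tval_smul, ← ht, Units.val_mul, mul_assoc, Units.inv_mul, mul_one]
    rfl
  obtain ⟨A', _, _, i', z', hi', hx', hz'⟩ := hc ((D.action.smul v i).left 𝔭) (by
    refine (mem_asIdeal_iff (D.action.smul v i) 𝔭 _).2 ?_
    rw [map_sub, Polynomial.aeval_X, Polynomial.aeval_C, hw, sub_self]
    exact 𝔭.asIdeal.zero_mem)
  obtain ⟨B, _, _, j, hj, ⟨𝔮, rfl⟩, hjV⟩ := exists_affine_chart (Z := specOver A)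
    (V := (D.action.smul v i).left ⁻¹ᵁ i'.left.opensRange) (x := 𝔭) hx'
  obtain ⟨β, rfl⟩ := exists_specMap_eq j
  obtain ⟨φ, hφ⟩ := exists_specMap_comp_eq i' (specMap β ≫ D.action.smul v i) (by
    rintro _ ⟨𝔯, rfl⟩
    exact hjV ⟨𝔯, rfl⟩)
  have h := hz'.specMap φ
  rw [hφ, GmAction.specMap_smul] at h
  have h2 := h.smul (Units.map β.toRingHom.toMonoidHom v)⁻¹
  rw [← GmAction.mul_smul, inv_mul_cancel, GmAction.one_smul, ← Category.assoc] at h2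
  exact ⟨B, _, _, specMap β ≫ i, specMap φ ≫ z',
    inferInstanceAs (IsOpenImmersion ((specMap β).left ≫ i.left)), ⟨𝔮, rfl⟩, h2⟩

end SpecialDegeneration

open scoped LaurentPolynomial PowerSeries

/-! ## The retraction to the central fibre -/

namespace SpecialDegeneration

variable {X : CScheme} {n : ℕ} {D : SpecialDegeneration X n}

lemma inclusion_cancel {T : CScheme} {x y : T ⟶ D.central}
    (h : x ≫ D.inclusion = y ≫ D.inclusion) : x = y := by
  ext : 1
  rw [← cancel_mono D.inclusion.left]
  exact congrArg (fun f => f.left) h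

/-- `q` maps the points of the total space to their limits. -/
def IsLimitMap (q : D.totalC ⟶ D.central) : Prop :=
  ∀ {T : CScheme} (x : T ⟶ D.totalC) (p : T.left),
    ∃ (C : Type) (_ : CommRing C) (_ : Algebra ℂ C) (j : specOver C ⟶ T),
      IsOpenImmersion j.left ∧ p ∈ Set.range j.left ∧
        D.action.IsLimit (j ≫ x) ((j ≫ x ≫ q) ≫ D.inclusion)

/-- The limits on charts agree on overlaps by uniqueness. Uniqueness needs domains, and the affine
pieces of an integral total space are domains. -/
theorem ActsTrivially.exists_isLimitMap (hD : D.ActsTrivially) :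
    ∃ q : D.totalC ⟶ D.central, IsLimitMap q := by
  choose A hA hA' i z hi hx hz using hD.hasLimitChart
  let 𝒰 : D.total.OpenCover := Scheme.Cover.mkOfCovers D.total (fun x => (specOver (A x)).left)
    (fun x => (i x).left) (fun x => ⟨x, hx x⟩) hi
  have hglue : ∀ x y : D.total, pullback.fst (i x).left (i y).left ≫ (z x).left =
      pullback.snd (i x).left (i y).left ≫ (z y).left := by
    intro x y
    let P : CScheme := Over.mk (pullback.fst (i x).left (i y).left ≫ (specOver (A x)).hom)
    let f : P ⟶ specOver (A x) := Over.homMk (pullback.fst (i x).left (i y).left) rfl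
    let g : P ⟶ specOver (A y) := Over.homMk (pullback.snd (i x).left (i y).left) (by
      change pullback.snd (i x).left (i y).left ≫ (specOver (A y)).hom =
        pullback.fst (i x).left (i y).left ≫ (specOver (A x)).hom
      rw [← Over.w (i x), ← Over.w (i y), ← Category.assoc, ← Category.assoc, pullback.condition])
    have hfg : f ≫ i x = g ≫ i y := by
      ext : 1
      exact pullback.condition
    suffices f ≫ z x = g ≫ z y from congrArg (fun h => h.left) this
    refine hom_ext_of_affine_charts fun p => ?_
    obtain ⟨C, _, _, j, hj, ⟨𝔭, h𝔭⟩, -⟩ := exists_affine_chart (Z := P) (V := ⊤) (x := p) trivial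
    refine ⟨C, _, _, j, hj, ⟨𝔭, h𝔭⟩, ?_⟩
    obtain ⟨φ, hφ⟩ := exists_specMap_eq (j ≫ f)
    obtain ⟨ψ, hψ⟩ := exists_specMap_eq (j ≫ g)
    have hop : IsOpenImmersion (j ≫ f ≫ i x).left :=
      inferInstanceAs (IsOpenImmersion (j.left ≫ pullback.fst (i x).left (i y).left ≫ (i x).left))
    have : Nonempty (specOver C).left := ⟨𝔭⟩
    have : IsDomain C := isDomain_of_chart (j ≫ f ≫ i x)
    have h1 := (hz x).specMap φ
    have h2 := (hz y).specMap ψ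
    rw [hφ, Category.assoc] at h1
    rw [hψ, Category.assoc, ← hfg] at h2
    have h3 := h1.unique h2
    refine inclusion_cancel ?_
    simpa only [Category.assoc] using h3
  let q₀ : D.total ⟶ D.central.left := 𝒰.glueMorphisms (fun x => (z x).left) hglue
  have hq₀ : ∀ x, (i x).left ≫ q₀ = (z x).left := 𝒰.ι_glueMorphisms (fun x => (z x).left) hglue
  let q : D.totalC ⟶ D.central := Over.homMk q₀ (by
    refine 𝒰.hom_ext _ _ fun (x : D.total) => ?_
    change (i x).left ≫ q₀ ≫ D.central.hom = (i x).left ≫ D.totalC.hom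
    rw [← Category.assoc, hq₀, Over.w (z x), Over.w (i x)])
  have hq : ∀ x, i x ≫ q = z x := fun x => by
    ext : 1
    exact hq₀ x
  refine ⟨q, fun {T} x p => ?_⟩
  let y := x.left p
  obtain ⟨C, _, _, j, hj, hp, hjV⟩ := exists_affine_chart (Z := T)
    (V := x.left ⁻¹ᵁ (i y).left.opensRange) (x := p) (hx y)
  refine ⟨C, _, _, j, hj, hp, ?_⟩
  obtain ⟨φ, hφ⟩ := exists_specMap_comp_eq (i y) (j ≫ x) (by
    rintro _ ⟨𝔯, rfl⟩
    exact hjV ⟨𝔯, rfl⟩)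
  have h := (hz y).specMap φ
  rw [← hq, hφ] at h
  rw [← Category.assoc j, ← hφ]
  simpa only [Category.assoc] using hφ ▸ h

variable {q : D.totalC ⟶ D.central}

/-- A fixed point is its own limit. -/
lemma IsLimitMap.inclusion_comp (hq : IsLimitMap q) (hD : D.ActsTrivially) :
    D.inclusion ≫ q = 𝟙 D.central := by
  refine hom_ext_of_affine_charts fun p => ?_
  obtain ⟨C, _, _, j, hj, hp, hlim⟩ := hq D.inclusion p
  refine ⟨C, _, _, j, hj, hp, inclusion_cancel ?_⟩
  obtain ⟨𝔭, h𝔭⟩ := hp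
  have : Nonempty (specOver C).left := ⟨𝔭⟩
  have : IsDomain C := isDomain_of_chart j
  rw [hlim.unique (hD.isLimit (D.tval_inclusion j)), Category.comp_id]

lemma IsLimitMap.comp_inclusion (hq : IsLimitMap q) (hD : D.ActsTrivially) {C : Type} [CommRing C]
    [Algebra ℂ C] {x : specOver C ⟶ D.totalC} (hx : tval x = 0) : (x ≫ q) ≫ D.inclusion = x := by
  obtain ⟨y, rfl⟩ := D.exists_central_lift hx
  rw [Category.assoc y, hq.inclusion_comp hD, Category.comp_id]

lemma IsLimitMap.smul_comp_of_isDomain (hq : IsLimitMap q) {C : Type} [CommRing C] [Algebra ℂ C]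
    [IsDomain C] (x : specOver C ⟶ D.totalC) (u : Cˣ) : D.action.smul u x ≫ q = x ≫ q := by
  refine hom_ext_of_affine_charts fun p => ?_
  obtain ⟨C₁, _, _, j₁, hj₁, ⟨p₁, rfl⟩, h₁⟩ := hq x p
  obtain ⟨C₂, _, _, j₂, hj₂, ⟨p₂, rfl⟩, h₂⟩ := hq (j₁ ≫ D.action.smul u x) p₁
  obtain ⟨φ₁, rfl⟩ := exists_specMap_eq j₁
  obtain ⟨φ₂, rfl⟩ := exists_specMap_eq j₂
  have hop : IsOpenImmersion (specMap φ₂ ≫ specMap φ₁).left :=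
    inferInstanceAs (IsOpenImmersion ((specMap φ₂).left ≫ (specMap φ₁).left))
  refine ⟨C₂, _, _, specMap φ₂ ≫ specMap φ₁, hop, ⟨p₂, rfl⟩, inclusion_cancel ?_⟩
  have : IsIntegral (specOver C).left := inferInstanceAs (IsIntegral (Spec (CommRingCat.of C)))
  have : Nonempty (specOver C₂).left := ⟨p₂⟩
  have : IsDomain C₂ := isDomain_of_chart (specMap φ₂ ≫ specMap φ₁)
  have h₃ := h₁.specMap φ₂
  rw [GmAction.specMap_smul, GmAction.specMap_smul] at h₂
  have h₄ := h₃.smul (Units.map φ₂.toRingHom.toMonoidHom (Units.map φ₁.toRingHom.toMonoidHom u))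
  have h₅ := h₂.unique h₄
  rw [← GmAction.specMap_smul] at h₅
  simpa only [Category.assoc] using h₅

/-- Over an arbitrary base uniqueness of limits is not available. The universal case is: its base is
the spectrum of the Laurent polynomials over a domain, and locally every other case is pulled back
from it. -/
theorem IsLimitMap.act_comp (hq : IsLimitMap q) {T : CScheme} (a : (Γ(T.left, ⊤))ˣ)
    (x : T ⟶ D.totalC) : D.action.act a x ≫ q = x ≫ q := by
  refine hom_ext_of_affine_charts fun p => ?_
  obtain ⟨A, _, _, i, hi, hx, -⟩ := exists_affine_chart (Z := D.totalC) (V := ⊤) (x := x.left p) trivial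
  obtain ⟨C, _, _, j, hj, hp, hjV⟩ := exists_affine_chart (Z := T)
    (V := x.left ⁻¹ᵁ i.left.opensRange) (x := p) hx
  refine ⟨C, _, _, j, hj, hp, ?_⟩
  obtain ⟨φ, hφ⟩ := exists_specMap_comp_eq i (j ≫ x) (by
    rintro _ ⟨𝔯, rfl⟩
    exact hjV ⟨𝔯, rfl⟩)
  obtain ⟨u, hu⟩ := exists_gmUnit_eq (Units.map j.left.appTop.hom.toMonoidHom a)
  obtain ⟨𝔭, -⟩ := hx
  have : Nonempty (specOver A).left := ⟨𝔭⟩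
  have : IsDomain A := isDomain_of_chart i
  have h := hq.smul_comp_of_isDomain (specMap (constL A) ≫ i) (unitT A)
  have h2 := congrArg (fun f => specMap (evalL φ u) ≫ f) h
  rw [← Category.assoc, ← Category.assoc, ← GmAction.univ, GmAction.specMap_univ, ← Category.assoc,
    ← specMap_comp, evalL_comp_constL, hφ] at h2
  rw [← Category.assoc, ← Category.assoc, D.action.natural, ← hu]
  exact h2

end SpecialDegeneration

/-! ## Finite morphisms that are isomorphisms over the zero locus of a function -/

section Nakayama

variable {B M : Type} [CommRing B] [CommRing M]

lemma exists_one_sub_mul_smul_eq_zero {N : Type} [AddCommGroup N] [Module B N] {L : Submodule B N}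
    (hL : L.FG) {t : B} (h : ∀ x ∈ L, ∃ y ∈ L, x = t • y) : ∃ s, ∀ x ∈ L, (1 - t * s) • x = 0 := by
  obtain ⟨r, hr, hr0⟩ := Submodule.exists_sub_one_mem_and_smul_eq_zero_of_fg_of_le_smul
    (Ideal.span {t}) L hL fun x hx => by
      obtain ⟨y, hy, rfl⟩ := h x hx
      exact Submodule.smul_mem_smul (Ideal.mem_span_singleton_self t) hy
  obtain ⟨s, hs⟩ := Ideal.mem_span_singleton.1 hr
  refine ⟨-s, fun x hx => ?_⟩
  have : 1 - t * -s = r := by linear_combination -hs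
  rw [this]
  exact hr0 x hx

/-- Nakayama's lemma for the cokernel and the kernel of `φ`. The cokernel equals `t` times itself by
`hsurj`; an element of the kernel is `t y` by `hinj`, and `y` is again in the kernel because `t` is
regular on `M`. The product of the two annihilating elements serves both. -/
lemma exists_one_sub_mul_mem_range [IsNoetherianRing B] {φ : B →+* M} (hφ : φ.Finite) {t : B}
    (hinj : ∀ b m, φ b = φ t * m → t ∣ b) (hsurj : ∀ m, ∃ b m', m = φ b + φ t * m')
    (hreg : ∀ m, φ t * m = 0 → m = 0) :
    ∃ s w, w = 1 - t * s ∧ (∀ m, ∃ b, φ w * m = φ b) ∧ ∀ b, φ b = 0 → w * b = 0 := by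
  algebraize [φ]
  have : Module.Finite B M := hφ
  let L : Submodule B M := LinearMap.range (Algebra.linearMap B M)
  have hsmul : ∀ (b : B) (m : M), b • m = φ b * m := fun b m => Algebra.smul_def b m
  obtain ⟨s₁, h₁⟩ := exists_one_sub_mul_smul_eq_zero (B := B) (N := M ⧸ L) (L := ⊤) (t := t)
    Module.Finite.fg_top (by
      intro x _
      obtain ⟨m, rfl⟩ := Submodule.Quotient.mk_surjective L x
      obtain ⟨b, m', hm⟩ := hsurj m
      refine ⟨Submodule.Quotient.mk m', trivial, ?_⟩
      rw [← Submodule.Quotient.mk_smul, Submodule.Quotient.eq, hsmul]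
      exact ⟨b, by rw [hm]; exact (add_sub_cancel_right _ _).symm⟩)
  obtain ⟨s₂, h₂⟩ := exists_one_sub_mul_smul_eq_zero (B := B) (N := B) (L := RingHom.ker φ) (t := t)
    (IsNoetherian.noetherian _) (by
      intro x hx
      obtain ⟨y, rfl⟩ := hinj x 0 (by rw [mul_zero]; exact hx)
      refine ⟨y, hreg _ ?_, rfl⟩
      rw [← map_mul]
      exact hx)
  refine ⟨s₁ + s₂ - t * s₁ * s₂, (1 - t * s₁) * (1 - t * s₂), by ring, fun m => ?_, fun b hb => ?_⟩
  · have h := h₁ (Submodule.Quotient.mk m) trivial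
    rw [← Submodule.Quotient.mk_smul, Submodule.Quotient.mk_eq_zero, hsmul] at h
    obtain ⟨b, hb⟩ := h
    refine ⟨b * (1 - t * s₂), ?_⟩
    have hb' : φ b = φ (1 - t * s₁) * m := hb
    rw [map_mul, map_mul, hb']
    ring
  · have h := h₂ b hb
    rw [smul_eq_mul] at h
    rw [mul_assoc, h, mul_zero]

/-- Kernel and cokernel are killed by `w`, which becomes a unit. -/
lemma bijective_localization_map {φ : B →+* M} {w : B} (hsurj : ∀ m, ∃ b, φ w * m = φ b)
    (hinj : ∀ b, φ b = 0 → w * b = 0) :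
    Function.Bijective (IsLocalization.map (M := Submonoid.powers w)
      (S := Localization.Away w) (T := (Submonoid.powers w).map φ)
      (Localization ((Submonoid.powers w).map φ)) φ (Submonoid.le_comap_map _)) := by
  have hw : IsUnit (algebraMap B (Localization.Away w) w) := IsLocalization.Away.algebraMap_isUnit w
  constructor
  · rw [injective_iff_map_eq_zero]
    intro a ha
    obtain ⟨⟨b, v⟩, hb⟩ := IsLocalization.surj (Submonoid.powers w) a
    have h1 : algebraMap M (Localization ((Submonoid.powers w).map φ)) (φ b) = 0 := by
      rw [← IsLocalization.map_eq (S := Localization.Away w) (M := Submonoid.powers w)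
        (Submonoid.le_comap_map _), ← hb, map_mul, ha, zero_mul]
    obtain ⟨⟨_, c, ⟨k, rfl⟩, rfl⟩, hc⟩ :=
      (IsLocalization.map_eq_zero_iff ((Submonoid.powers w).map φ) _ _).1 h1
    have h2 := hinj (w ^ k * b) (by rw [map_mul]; exact hc)
    have h3 : algebraMap B (Localization.Away w) b = 0 := by
      have := congrArg (algebraMap B (Localization.Away w)) h2
      rw [map_mul, map_mul, map_pow, map_zero] at this
      exact ((hw.pow k).mul_right_eq_zero).1 ((hw.mul_right_eq_zero).1 this)
    rw [h3] at hb
    exact ((IsLocalization.map_units (Localization.Away w) v).mul_left_eq_zero).1 hb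
  · intro y
    obtain ⟨⟨m, ⟨_, v, hv, rfl⟩⟩, hm⟩ := IsLocalization.surj ((Submonoid.powers w).map φ) y
    obtain ⟨b, hb⟩ := hsurj m
    have hv' : IsUnit (algebraMap B (Localization.Away w) v) :=
      IsLocalization.map_units (Localization.Away w) (⟨v, hv⟩ : Submonoid.powers w)
    obtain ⟨e, he⟩ := hw.mul hv'
    refine ⟨algebraMap B (Localization.Away w) b * ↑e⁻¹, ?_⟩
    set g := IsLocalization.map (M := Submonoid.powers w)
      (S := Localization.Away w) (T := (Submonoid.powers w).map φ)
      (Localization ((Submonoid.powers w).map φ)) φ (Submonoid.le_comap_map _) with hg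
    have hgb : ∀ b, g (algebraMap B (Localization.Away w) b) = algebraMap M _ (φ b) :=
      fun b => IsLocalization.map_eq (Submonoid.le_comap_map _) b
    have h1 : y * g e = g (algebraMap B (Localization.Away w) b) := by
      rw [he, map_mul, hgb, hgb, hgb, ← hb, map_mul, ← hm]
      ring
    rw [map_mul, ← h1, mul_assoc, ← map_mul, Units.mul_inv, map_one, mul_one]

end Nakayama

/-- The conclusion of Nakayama's lemma: the localised morphism is an isomorphism. -/
lemma exists_isPullback_isIso {B M : Type} [CommRing B] [Algebra ℂ B] [CommRing M] [Algebra ℂ M]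
    (φ : B →ₐ[ℂ] M) {w : B} (hsurj : ∀ m, ∃ b, φ w * m = φ b) (hinj : ∀ b, φ b = 0 → w * b = 0) :
    ∃ (U : Scheme.{0}) (k : U ⟶ (specOver M).left) (f : U ⟶ (specOver (Localization.Away w)).left),
      IsPullback k f (specMap φ).left
        (specMap (IsScalarTower.toAlgHom ℂ B (Localization.Away w))).left ∧ IsIso f := by
  let g : Localization.Away w →+* Localization ((Submonoid.powers w).map φ.toRingHom) :=
    IsLocalization.map (M := Submonoid.powers w) (T := (Submonoid.powers w).map φ.toRingHom)
      (Localization ((Submonoid.powers w).map φ.toRingHom)) φ.toRingHom (Submonoid.le_comap_map _)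
  have hg : Function.Bijective g := bijective_localization_map hsurj hinj
  have hpo := CommRingCat.isPushout_of_isLocalization φ.toRingHom g
    (IsLocalization.map_comp (Submonoid.le_comap_map _)) (Submonoid.powers w)
  refine ⟨_, _, _, isPullback_SpecMap_of_isPushout _ _ _ _ hpo, ?_⟩
  have : IsIso (CommRingCat.ofHom g) :=
    (RingEquiv.ofBijective g hg).toCommRingCatIso.isIso_hom
  infer_instance

open scoped LaurentPolynomial PowerSeries

/-! ## The comparison with the product -/

lemma exists_specOver_isIso (Z : CScheme) [IsAffine Z.left] :
    ∃ (A : Type) (_ : CommRing A) (_ : Algebra ℂ A) (i : specOver A ⟶ Z), IsIso i.left := by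
  refine ⟨Γ(Z.left, ⊤), inferInstance, (const Z ⊤).toAlgebra,
    @Over.homMk _ _ _ (@specOver Γ(Z.left, ⊤) _ (const Z ⊤).toAlgebra) Z
      (isAffineOpen_top Z.left).fromSpec (fromSpec_comp_hom (isAffineOpen_top Z.left)), ?_⟩
  change IsIso (isAffineOpen_top Z.left).fromSpec
  rw [IsAffineOpen.fromSpec_top]
  infer_instance

namespace SpecialDegeneration

variable {X : CScheme} {n : ℕ} (D : SpecialDegeneration X n)

instance : IsProper D.central.hom :=
  inferInstanceAs (IsProper (pullback.snd D.π (A1pt 0)))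

/-- The product of the central fibre and the line. -/
abbrev prodC : CScheme := totalSpace (pullback.snd D.central.hom A1hom)

instance : LocallyOfFiniteType D.prodC.hom :=
  inferInstanceAs (LocallyOfFiniteType (pullback.snd D.central.hom A1hom ≫ A1hom))

/-- The projection to the central fibre. -/
def prodFst : D.prodC ⟶ D.central :=
  Over.homMk (pullback.fst D.central.hom A1hom) pullback.condition

variable {D}

lemma prod_hom_ext {T : CScheme} {x y : T ⟶ D.prodC} (h₁ : x ≫ D.prodFst = y ≫ D.prodFst)
    (h₂ : x.left ≫ pullback.snd D.central.hom A1hom = y.left ≫ pullback.snd D.central.hom A1hom) :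
    x = y := by
  ext : 1
  exact pullback.hom_ext (congrArg (fun f => f.left) h₁) h₂

lemma prod_hom_ext_tval {C : Type} [CommRing C] [Algebra ℂ C] {x y : specOver C ⟶ D.prodC}
    (h₁ : x ≫ D.prodFst = y ≫ D.prodFst) (h₂ : tval x = tval y) : x = y := by
  refine prod_hom_ext h₁ ?_
  rw [← specMap_aeval_tval, ← specMap_aeval_tval, h₂]

/-- The morphism to the product of the central fibre and the line. -/
def toProd (q : D.totalC ⟶ D.central) : D.totalC ⟶ D.prodC :=
  Over.homMk (pullback.lift q.left D.π (Over.w q)) (by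
    change pullback.lift q.left D.π (Over.w q) ≫ pullback.snd D.central.hom A1hom ≫ A1hom = _
    rw [← Category.assoc, pullback.lift_snd]
    rfl)

variable (q : D.totalC ⟶ D.central)

lemma toProd_snd : (toProd q).left ≫ pullback.snd D.central.hom A1hom = D.π :=
  pullback.lift_snd _ _ _

lemma toProd_fst : toProd q ≫ D.prodFst = q := by
  ext : 1
  exact pullback.lift_fst _ _ _

lemma tval_toProd {C : Type} [CommRing C] [Algebra ℂ C] (x : specOver C ⟶ D.totalC) :
    tval (x ≫ toProd q) = tval x := by
  have h : (x ≫ toProd q).left ≫ pullback.snd D.central.hom A1hom = x.left ≫ D.π := by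
    change (x.left ≫ (toProd q).left) ≫ _ = _
    rw [Category.assoc, toProd_snd]
  exact congrArg (fun f => (Scheme.ΓSpecIso (CommRingCat.of C)).hom (coord f)) h

instance : IsProper (toProd q).left := by
  have : IsProper ((toProd q).left ≫ pullback.snd D.central.hom A1hom) := by
    rw [toProd_snd]
    infer_instance
  exact IsProper.of_comp _ (pullback.snd D.central.hom A1hom)

variable {q}

/-- The retraction is the identity on points with values in algebras where `t = 0`; apply this to
the chart modulo `t`. -/
lemma IsLimitMap.inclusion_apply (hq : IsLimitMap q) (hD : D.ActsTrivially) {x : D.total}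
    (hx : (Polynomial.X : Polynomial ℂ) ∈ PrimeSpectrum.asIdeal (D.π x)) :
    D.inclusion.left (q.left x) = x := by
  obtain ⟨A, _, _, i, hi, ⟨𝔭, rfl⟩, -⟩ := exists_affine_chart (Z := D.totalC) (V := ⊤) (x := x) trivial
  have ht := (mem_asIdeal_iff i 𝔭 _).1 hx
  rw [Polynomial.aeval_X] at ht
  let I : Ideal A := Ideal.span {tval i}
  let mk : A →ₐ[ℂ] A ⧸ I := Ideal.Quotient.mkₐ ℂ I
  have h2 : 𝔭 ∈ Set.range (PrimeSpectrum.comap (Ideal.Quotient.mk I)) := by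
    rw [range_comap_of_surjective _ _ Ideal.Quotient.mk_surjective, Ideal.mk_ker]
    refine (Ideal.span_le.2 ?_ : I ≤ 𝔭.asIdeal)
    rintro _ rfl
    exact ht
  obtain ⟨𝔮, rfl⟩ := h2
  have h := hq.comp_inclusion hD (x := specMap mk ≫ i) (by
    rw [tval_specMap]
    exact Ideal.Quotient.eq_zero_iff_mem.2 (Ideal.subset_span rfl))
  exact congrArg (fun f => f.left 𝔮) h

/-- Over `t = 0` a point of the total space is recovered from its limit, so the fibre has at most
one point. -/
lemma IsLimitMap.finite_preimage (hq : IsLimitMap q) (hD : D.ActsTrivially) {y : D.prodC.left}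
    (hy : (Polynomial.X : Polynomial ℂ) ∈
      PrimeSpectrum.asIdeal (pullback.snd D.central.hom A1hom y)) :
    ((toProd q).left ⁻¹' {y}).Finite := by
  refine Set.Subsingleton.finite ?_
  have key : ∀ x, (toProd q).left x = y → x = D.inclusion.left (D.prodFst.left y) := by
    rintro x rfl
    have h1 : pullback.snd D.central.hom A1hom ((toProd q).left x) = D.π x :=
      congrArg (fun f : D.total ⟶ A1 => f x) (toProd_snd q)
    rw [h1] at hy
    have h2 : D.prodFst.left ((toProd q).left x) = q.left x :=
      congrArg (fun f => f.left x) (toProd_fst q)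
    rw [h2, hq.inclusion_apply hD hy]
  exact fun x hx x' hx' => (key x hx).trans (key x' hx').symm

/-- Near the fibre over zero, the comparison morphism is given by a finite algebra. -/
lemma IsLimitMap.exists_finite_chart (hq : IsLimitMap q) (hD : D.ActsTrivially) {y : D.prodC.left}
    (hy : (Polynomial.X : Polynomial ℂ) ∈
      PrimeSpectrum.asIdeal (pullback.snd D.central.hom A1hom y)) :
    ∃ (B : Type) (_ : CommRing B) (_ : Algebra ℂ B) (M : Type) (_ : CommRing M) (_ : Algebra ℂ M)
      (φ : B →ₐ[ℂ] M) (j : specOver B ⟶ D.prodC) (k : specOver M ⟶ D.totalC),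
      IsOpenImmersion j.left ∧ y ∈ Set.range j.left ∧ IsOpenImmersion k.left ∧
        φ.toRingHom.Finite ∧ IsPullback k.left (specMap φ).left (toProd q).left j.left := by
  -- A proper morphism is finite over a neighbourhood of a point with finite fibre.
  obtain ⟨V, hyV, hV⟩ := exists_isFinite_morphismRestrict_of_finite_preimage_singleton
    (toProd q).left y (hq.finite_preimage hD hy)
  obtain ⟨B, _, _, j, hj, hyj, hjV⟩ := exists_affine_chart (Z := D.prodC) hyV
  let j' : (specOver B).left ⟶ V := IsOpenImmersion.lift V.ι j.left
    (hjV.trans V.range_ι.ge)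
  have hj' : j' ≫ V.ι = j.left := IsOpenImmersion.lift_fac _ _ _
  have hpb := (IsPullback.of_hasPullback ((toProd q).left ∣_ V) j').paste_horiz
    (isPullback_morphismRestrict (toProd q).left V).flip
  rw [hj'] at hpb
  have := isAffine_specOver B
  let Q : CScheme := Over.mk (pullback.snd ((toProd q).left ∣_ V) j' ≫ (specOver B).hom)
  have : IsAffine Q.left := isAffine_of_isAffineHom (pullback.snd ((toProd q).left ∣_ V) j')
  obtain ⟨M, _, _, e, he⟩ := exists_specOver_isIso Q
  let f : Q ⟶ specOver B := Over.homMk (pullback.snd ((toProd q).left ∣_ V) j') rfl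
  let g : Q ⟶ D.totalC := Over.homMk (pullback.fst ((toProd q).left ∣_ V) j' ≫
    ((toProd q).left ⁻¹ᵁ V).ι) (by
      rw [← Over.w (toProd q), ← Category.assoc, hpb.w, Category.assoc, Over.w j]
      rfl)
  obtain ⟨φ, hφ⟩ := exists_specMap_eq (e ≫ f)
  have hpb' : IsPullback (e ≫ g).left (specMap φ).left (toProd q).left j.left := by
    rw [hφ]
    exact hpb.of_iso (asIso e.left).symm (Iso.refl _) (Iso.refl _) (Iso.refl _)
      (by simp [g]) (by simp [f]) (by simp) (by simp)
  refine ⟨B, _, _, M, _, _, φ, j, e ≫ g, hj, hyj, ?_, ?_, hpb'⟩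
  · exact MorphismProperty.of_isPullback (P := @IsOpenImmersion) hpb'.flip hj
  · have hfin : IsFinite (specMap φ).left := by
      rw [hφ]
      exact inferInstanceAs (IsFinite (e.left ≫ pullback.snd ((toProd q).left ∣_ V) j'))
    exact (IsFinite.SpecMap_iff _).1 hfin

end SpecialDegeneration

/-! ### The comparison morphism is an isomorphism near the fibre over zero -/

open scoped LaurentPolynomial PowerSeries

/-- The morphism is an isomorphism over a neighbourhood of the point. -/
def IsIsoNear {Y P : Scheme.{0}} (f : Y ⟶ P) (y : P) : Prop :=
  ∃ (U' U : Scheme.{0}) (k : U' ⟶ Y) (g : U' ⟶ U) (j : U ⟶ P),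
    IsOpenImmersion j ∧ y ∈ Set.range j ∧ IsPullback k g f j ∧ IsIso g

lemma isOpen_isIsoNear {Y P : Scheme.{0}} (f : Y ⟶ P) : IsOpen {y | IsIsoNear f y} := by
  rw [isOpen_iff_forall_mem_open]
  rintro x ⟨U', U, k, g, j, hj, hx, h⟩
  exact ⟨Set.range j, fun y hy => ⟨U', U, k, g, j, hj, hy, h⟩,
    j.isOpenEmbedding.isOpen_range, hx⟩

lemma isIso_of_isIsoNear {Y P : Scheme.{0}} {f : Y ⟶ P} (h : ∀ y, IsIsoNear f y) : IsIso f := by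
  choose U' U k g j hj hy hpb hg using h
  let 𝒰 : P.OpenCover := Scheme.Cover.mkOfCovers P U j (fun x => ⟨x, hy x⟩) hj
  refine IsZariskiLocalAtTarget.of_openCover (P := MorphismProperty.isomorphisms Scheme.{0}) 𝒰
    fun y => ?_
  change IsIso (pullback.snd f (j y))
  rw [← (hpb y).isoPullback_inv_snd]
  have := hg y
  infer_instance

lemma IsIsoNear.of_iso {Y P : Scheme.{0}} {f : Y ⟶ P} {a : Y ⟶ Y} {b : P ⟶ P} [IsIso a] [IsIso b]
    (hab : a ≫ f = f ≫ b) {y : P} (h : IsIsoNear f y) : IsIsoNear f (b y) := by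
  obtain ⟨U', U, k, g, j, hj, ⟨u, rfl⟩, hpb, hg⟩ := h
  exact ⟨U', U, k ≫ a, g, j ≫ b, inferInstance, ⟨u, rfl⟩,
    hpb.paste_horiz (IsPullback.of_horiz_isIso ⟨hab⟩), hg⟩

namespace SpecialDegeneration

variable {X : CScheme} {n : ℕ} {D : SpecialDegeneration X n} {q : D.totalC ⟶ D.central}

/-- Flatness over the line makes the coordinate a nonzerodivisor. -/
lemma eq_zero_of_tval_mul {C : Type} [CommRing C] [Algebra ℂ C] (k : specOver C ⟶ D.totalC)
    [IsOpenImmersion k.left] {m : C} (hm : tval k * m = 0) : m = 0 := by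
  have hf : Flat (specMap (Polynomial.aeval (R := ℂ) (tval k))).left := by
    have := D.flat
    rw [specMap_aeval_tval]
    infer_instance
  have hf' : (Polynomial.aeval (R := ℂ) (tval k)).toRingHom.Flat := Flat.SpecMap_iff.1 hf
  algebraize [(Polynomial.aeval (R := ℂ) (tval k)).toRingHom]
  have hreg := Module.Flat.isSMulRegular_of_nonZeroDivisors (M := C)
    (mem_nonZeroDivisors_of_ne_zero (Polynomial.X_ne_zero (R := ℂ)))
  refine hreg ?_
  change (Polynomial.X : Polynomial ℂ) • m = (Polynomial.X : Polynomial ℂ) • (0 : C)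
  rw [smul_zero, Algebra.smul_def]
  change Polynomial.aeval (tval k) Polynomial.X * m = 0
  rw [Polynomial.aeval_X, hm]

/-- Near `y` the comparison is a finite algebra `B → M`. Modulo `t` it has an inverse, given by the
inclusion of the central fibre, and `t` is regular on `M`; so Nakayama's lemma gives an isomorphism
after localization at some `w = 1 - t s`, which is nonzero at `y`. -/
theorem IsLimitMap.isIsoNear_of_mem (hq : IsLimitMap q) (hD : D.ActsTrivially) {y : D.prodC.left}
    (hy : (Polynomial.X : Polynomial ℂ) ∈
      PrimeSpectrum.asIdeal (pullback.snd D.central.hom A1hom y)) :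
    IsIsoNear (toProd q).left y := by
  obtain ⟨B, _, _, M, _, _, φ, j, k, hj, ⟨𝔭, rfl⟩, hk, hφ, hpb⟩ := hq.exists_finite_chart hD hy
  have hkj : k ≫ toProd q = specMap φ ≫ j := by
    ext : 1
    exact hpb.w
  have ht : φ (tval j) = tval k := by
    rw [← tval_specMap, ← hkj, tval_toProd]
  have : Algebra.FiniteType ℂ B := algebra_finiteType_of_chart j
  have : IsNoetherianRing B := Algebra.FiniteType.isNoetherianRing ℂ B
  let I : Ideal B := Ideal.span {tval j}
  let mk : B →ₐ[ℂ] B ⧸ I := Ideal.Quotient.mkₐ ℂ I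
  have hmk : mk (tval j) = 0 := Ideal.Quotient.eq_zero_iff_mem.2 (Ideal.subset_span rfl)
  -- The part of the chart with `t = 0` maps to the central fibre and so lifts to the total space.
  -- By the pull-back property this lift is a homomorphism `θ : M → B / t` with `θ ∘ φ` the
  -- reduction.
  let x : specOver (B ⧸ I) ⟶ D.totalC := ((specMap mk ≫ j) ≫ D.prodFst) ≫ D.inclusion
  have hx : x ≫ toProd q = specMap mk ≫ j := by
    refine prod_hom_ext_tval ?_ ?_
    · rw [Category.assoc, toProd_fst, Category.assoc _ D.inclusion, hq.inclusion_comp hD,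
        Category.comp_id]
    · rw [tval_toProd, tval_inclusion, tval_specMap, hmk]
  have hxl : x.left ≫ (toProd q).left = (specMap mk).left ≫ j.left :=
    congrArg (fun f => f.left) hx
  let θ₀ : specOver (B ⧸ I) ⟶ specOver M := Over.homMk (hpb.lift x.left (specMap mk).left hxl) (by
    rw [← Over.w k, ← Category.assoc, hpb.lift_fst, Over.w x])
  obtain ⟨θ, hθ⟩ := exists_specMap_eq θ₀
  have hθk : specMap θ ≫ k = x := by
    rw [hθ]
    ext : 1
    exact hpb.lift_fst _ _ _
  have hθφ : θ.comp φ = mk := by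
    refine specMap_injective ?_
    rw [specMap_comp, hθ]
    ext : 1
    exact hpb.lift_snd _ _ _
  obtain ⟨s, w, hw, h₁, h₂⟩ := exists_one_sub_mul_mem_range hφ (t := tval j)
    (by
      intro b m hbm
      have h := congrArg θ hbm
      have h1 : θ (φ b) = mk b := DFunLike.congr_fun hθφ b
      have h2 : θ (φ (tval j)) = mk (tval j) := DFunLike.congr_fun hθφ (tval j)
      rw [map_mul] at h
      have h3 : mk b = 0 := h1.symm.trans (h.trans (by
        have : θ (φ.toRingHom (tval j)) = 0 := h2.trans hmk
        rw [this, zero_mul]))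
      exact Ideal.mem_span_singleton.1 (Ideal.Quotient.eq_zero_iff_mem.1 h3))
    (by
      intro m
      -- Conversely `θ` followed by the reduction of `φ` is the reduction of `M`, because the
      -- inclusion after `q` is the identity where `t = 0`. Hence `M` is the image of `B` modulo
      -- `t`.
      let J : Ideal M := Ideal.span {φ (tval j)}
      let mkM : M →ₐ[ℂ] M ⧸ J := Ideal.Quotient.mkₐ ℂ J
      have hmkM : mkM (φ (tval j)) = 0 :=
        Ideal.Quotient.eq_zero_iff_mem.2 (Ideal.subset_span rfl)
      let φ' : B ⧸ I →ₐ[ℂ] M ⧸ J := Ideal.Quotient.liftₐ I (mkM.comp φ) (by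
        intro a ha
        obtain ⟨c, rfl⟩ := Ideal.mem_span_singleton.1 ha
        rw [map_mul]
        change mkM (φ (tval j)) * _ = 0
        rw [hmkM, zero_mul])
      have hφ' : φ'.comp mk = mkM.comp φ := AlgHom.ext fun b => rfl
      have hθ' : φ'.comp θ = mkM := by
        refine specMap_comp_injective k ?_
        have e : specMap mkM ≫ specMap φ ≫ j ≫ D.prodFst = (specMap mkM ≫ k) ≫ q := by
          rw [← Category.assoc (specMap φ), ← hkj, Category.assoc k, toProd_fst, Category.assoc]
        have e' : specMap φ' ≫ (specMap mk ≫ j) ≫ D.prodFst = (specMap mkM ≫ k) ≫ q := by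
          rw [← e, ← Category.assoc, ← Category.assoc, ← specMap_comp, hφ', specMap_comp]
          simp only [Category.assoc]
        rw [specMap_comp, Category.assoc, hθk]
        change specMap φ' ≫ ((specMap mk ≫ j) ≫ D.prodFst) ≫ D.inclusion = _
        rw [← Category.assoc, e']
        refine hq.comp_inclusion hD ?_
        rw [tval_specMap, ← ht, hmkM]
      obtain ⟨b, hb⟩ := Ideal.Quotient.mk_surjective (θ m)
      have h1 : mkM m = mkM (φ b) := by
        rw [← DFunLike.congr_fun hθ' m]
        change φ' (θ m) = _
        rw [← hb]
        rfl
      obtain ⟨m', hm'⟩ := Ideal.mem_span_singleton.1 (Ideal.Quotient.eq.1 h1)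
      exact ⟨b, m', (sub_eq_iff_eq_add'.1 hm')⟩)
    (by
      intro m hm
      refine eq_zero_of_tval_mul k ?_
      rw [← ht]
      exact hm)
  obtain ⟨U, k', f, hpb', hf⟩ := exists_isPullback_isIso φ h₁ h₂
  have ht𝔭 : tval j ∈ 𝔭.asIdeal := by
    have := (mem_asIdeal_iff j 𝔭 _).1 hy
    rwa [Polynomial.aeval_X] at this
  have hw𝔭 : w ∉ 𝔭.asIdeal := fun h => 𝔭.2.ne_top ((Ideal.eq_top_iff_one _).2 (by
    have := 𝔭.asIdeal.add_mem h (𝔭.asIdeal.mul_mem_right s ht𝔭)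
    rwa [hw, sub_add_cancel] at this))
  obtain ⟨𝔮, h𝔮⟩ := mem_range_specMap_away hw𝔭
  exact ⟨U, _, k' ≫ k.left, f,
    (specMap (IsScalarTower.toAlgHom ℂ B (Localization.Away w))).left ≫ j.left, inferInstance,
    ⟨𝔮, congrArg j.left h𝔮⟩, hpb'.paste_horiz hpb, hf⟩

end SpecialDegeneration

open scoped LaurentPolynomial PowerSeries

/-! ## Triviality of the degeneration -/

/-- The multiplication by `b` on the line. -/
def scaleA1 (b : ℂ) : specOver (Polynomial ℂ) ⟶ specOver (Polynomial ℂ) :=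
  specMap (Polynomial.aeval (Polynomial.C b * Polynomial.X))

lemma scaleA1_comp {b c : ℂ} (h : b * c = 1) : scaleA1 b ≫ scaleA1 c = 𝟙 _ := by
  rw [scaleA1, scaleA1, ← specMap_comp, ← specMap_id]
  congr 1
  refine Polynomial.algHom_ext ?_
  rw [AlgHom.comp_apply, Polynomial.aeval_X, map_mul, Polynomial.aeval_X, Polynomial.aeval_C,
    Polynomial.algebraMap_apply, ← mul_assoc, ← map_mul]
  simp [mul_comm c b, h]

lemma coord_comp_scaleA1 {T : Scheme.{0}} (u : T ⟶ A1) (b : ℂ) :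
    coord (u ≫ (scaleA1 b).left) =
      u.appTop ((Scheme.ΓSpecIso (CommRingCat.of (Polynomial ℂ))).inv (Polynomial.C b)) *
        coord u := by
  rw [coord_comp]
  have h := coord_specMap (Polynomial.aeval (R := ℂ) (Polynomial.C b * Polynomial.X))
  rw [Polynomial.aeval_X, map_mul] at h
  refine (congrArg u.appTop h).trans ?_
  rw [map_mul]
  rfl

/-- A nonzero polynomial has a nonzero value at some multiple of a nonzero element of a field. -/
lemma exists_aeval_mul_ne_zero {F : Type} [Field F] [Algebra ℂ F] {h : Polynomial ℂ} (hh : h ≠ 0)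
    {t : F} (ht : t ≠ 0) : ∃ b : ℂ, b ≠ 0 ∧ Polynomial.aeval (algebraMap ℂ F b * t) h ≠ 0 := by
  classical
  have hinj : Function.Injective fun b : ℂ => algebraMap ℂ F b * t := fun b c hbc =>
    (algebraMap ℂ F).injective (mul_right_cancel₀ ht hbc)
  have hne : (h * Polynomial.X).map (algebraMap ℂ F) ≠ 0 :=
    (Polynomial.map_ne_zero_iff (algebraMap ℂ F).injective).2
      (mul_ne_zero hh Polynomial.X_ne_zero)
  obtain ⟨b, hb⟩ := Infinite.exists_notMem_finset
    (((h * Polynomial.X).map (algebraMap ℂ F)).roots.toFinset.preimage _ hinj.injOn)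
  rw [Finset.mem_preimage, Multiset.mem_toFinset, Polynomial.mem_roots hne, Polynomial.IsRoot,
    Polynomial.eval_map_algebraMap, map_mul, Polynomial.aeval_X, mul_eq_zero, not_or] at hb
  refine ⟨b, fun h0 => hb.2 ?_, hb.1⟩
  rw [h0, map_zero, zero_mul]

lemma exists_comp_notMem {h : Polynomial ℂ} (hh : h ≠ 0) {𝔭 : PrimeSpectrum (Polynomial ℂ)}
    (h𝔭 : (Polynomial.X : Polynomial ℂ) ∉ 𝔭.asIdeal) :
    ∃ b : ℂ, b ≠ 0 ∧ Polynomial.aeval (Polynomial.C b * Polynomial.X) h ∉ 𝔭.asIdeal := by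
  let F := FractionRing (Polynomial ℂ ⧸ 𝔭.asIdeal)
  let mk : Polynomial ℂ →ₐ[ℂ] F := (IsScalarTower.toAlgHom ℂ (Polynomial ℂ ⧸ 𝔭.asIdeal) F).comp
    (Ideal.Quotient.mkₐ ℂ 𝔭.asIdeal)
  have hmk : ∀ p, mk p = 0 ↔ p ∈ 𝔭.asIdeal := fun p =>
    (map_eq_zero_iff _ (IsFractionRing.injective (Polynomial ℂ ⧸ 𝔭.asIdeal) F)).trans
      Ideal.Quotient.eq_zero_iff_mem
  obtain ⟨b, hb, hbh⟩ := exists_aeval_mul_ne_zero (F := F) hh (t := mk Polynomial.X)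
    fun h0 => h𝔭 ((hmk _).1 h0)
  refine ⟨b, hb, fun h0 => hbh ?_⟩
  rw [← (hmk _).2 h0, ← Polynomial.aeval_algHom_apply, map_mul]
  congr 3

namespace SpecialDegeneration

variable {X : CScheme} {n : ℕ} (D : SpecialDegeneration X n)

/-- The constant unit `b`. -/
def constUnit {b : ℂ} (hb : b ≠ 0) : (Γ(D.totalC.left, ⊤))ˣ :=
  Units.map (D.π.appTop.hom.comp ((Scheme.ΓSpecIso (CommRingCat.of (Polynomial ℂ))).inv.hom.comp
    Polynomial.C)).toMonoidHom (Units.mk0 b hb)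

/-- The action of a constant on the total space. -/
def translate {b : ℂ} (hb : b ≠ 0) : D.totalC ⟶ D.totalC := D.action.act (D.constUnit hb) (𝟙 _)

lemma translate_π {b : ℂ} (hb : b ≠ 0) :
    (D.translate hb).left ≫ D.π = D.π ≫ (scaleA1 b).left := by
  refine A1_hom_ext ?_ ?_
  · rw [Category.assoc, Category.assoc]
    refine (Over.w (D.translate hb)).trans ?_
    exact congrArg (fun f => D.π ≫ f) (Over.w (scaleA1 b)).symm
  · refine (D.covers (D.constUnit hb) (𝟙 _)).trans ?_
    rw [coord_comp_scaleA1]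
    exact congrArg (fun f => _ * coord f) (Category.id_comp D.π)

lemma map_constUnit {b c : ℂ} (hb : b ≠ 0) (hc : c ≠ 0) :
    Units.map (D.translate hb).left.appTop.hom.toMonoidHom (D.constUnit hc) = D.constUnit hc := by
  ext
  have h := congrArg (fun f => f.appTop ((Scheme.ΓSpecIso (CommRingCat.of (Polynomial ℂ))).inv
    (Polynomial.C c))) (D.translate_π hb)
  have hs : (scaleA1 b).left.appTop ((Scheme.ΓSpecIso (CommRingCat.of (Polynomial ℂ))).inv
      (Polynomial.C c)) = (Scheme.ΓSpecIso (CommRingCat.of (Polynomial ℂ))).inv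
      (Polynomial.C c) := by
    refine (ConcreteCategory.congr_hom (Scheme.ΓSpecIso_inv_naturality (CommRingCat.ofHom
      (Polynomial.aeval (R := ℂ) (Polynomial.C b * Polynomial.X)).toRingHom))
      (Polynomial.C c)).symm.trans ?_
    exact congrArg (Scheme.ΓSpecIso (CommRingCat.of (Polynomial ℂ))).inv
      (Polynomial.aeval_C (Polynomial.C b * Polynomial.X) c)
  simp only [Scheme.Hom.comp_appTop] at h
  exact h.trans (congrArg D.π.appTop hs)

lemma translate_comp {b c : ℂ} (hb : b ≠ 0) (hc : c ≠ 0) (h : b * c = 1) :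
    D.translate hb ≫ D.translate hc = 𝟙 _ := by
  have hu : D.constUnit hc * D.constUnit hb = 1 := by
    rw [constUnit, constUnit, ← map_mul]
    have : Units.mk0 c hc * Units.mk0 b hb = 1 := by
      ext
      exact (mul_comm c b).trans h
    rw [this, map_one]
  have h1 := D.action.natural (D.translate hb) (D.constUnit hc) (𝟙 _)
  rw [map_constUnit, Category.comp_id] at h1
  refine h1.trans ?_
  rw [translate, ← D.action.mul_act, hu, D.action.one_act]

lemma isIso_translate {b : ℂ} (hb : b ≠ 0) : IsIso (D.translate hb).left := by
  have : IsIso (D.translate hb) := ⟨D.translate (inv_ne_zero hb),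
    D.translate_comp hb _ (mul_inv_cancel₀ hb), D.translate_comp _ hb (inv_mul_cancel₀ hb)⟩
  exact inferInstanceAs (IsIso ((Over.forget _).map (D.translate hb)))

/-- The multiplication by `b` on the second factor of the product. -/
def prodScale (b : ℂ) : D.prodC.left ⟶ D.prodC.left :=
  pullback.lift (pullback.fst D.central.hom A1hom)
    (pullback.snd D.central.hom A1hom ≫ (scaleA1 b).left) (by
      rw [Category.assoc, pullback.condition]
      exact congrArg (fun f => pullback.snd D.central.hom A1hom ≫ f) (Over.w (scaleA1 b)).symm)

lemma prodScale_fst (b : ℂ) : D.prodScale b ≫ pullback.fst D.central.hom A1hom =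
    pullback.fst D.central.hom A1hom := pullback.lift_fst _ _ _

lemma prodScale_snd (b : ℂ) : D.prodScale b ≫ pullback.snd D.central.hom A1hom =
    pullback.snd D.central.hom A1hom ≫ (scaleA1 b).left := pullback.lift_snd _ _ _

lemma prodScale_comp {b c : ℂ} (h : b * c = 1) : D.prodScale b ≫ D.prodScale c = 𝟙 _ := by
  refine pullback.hom_ext ?_ ?_
  · rw [Category.assoc, prodScale_fst, prodScale_fst, Category.id_comp]
  · rw [Category.assoc, prodScale_snd, ← Category.assoc, prodScale_snd, Category.assoc,
      Category.id_comp]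
    have h1 : (scaleA1 b).left ≫ (scaleA1 c).left = 𝟙 _ :=
      congrArg (fun f => f.left) (scaleA1_comp h)
    rw [h1]
    exact Category.comp_id _

lemma isIso_prodScale {b : ℂ} (hb : b ≠ 0) : IsIso (D.prodScale b) :=
  ⟨D.prodScale b⁻¹, D.prodScale_comp (mul_inv_cancel₀ hb), D.prodScale_comp (inv_mul_cancel₀ hb)⟩

variable {D} {q : D.totalC ⟶ D.central}

/-- Equivariance of the comparison: the limit is invariant and the coordinate is multiplied by `b`.
-/
lemma IsLimitMap.translate_toProd (hq : IsLimitMap q) {b : ℂ} (hb : b ≠ 0) :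
    (D.translate hb).left ≫ (toProd q).left = (toProd q).left ≫ D.prodScale b := by
  have hfst : (toProd q).left ≫ pullback.fst D.central.hom A1hom = q.left :=
    pullback.lift_fst _ _ _
  refine pullback.hom_ext ?_ ?_
  · rw [Category.assoc, Category.assoc, prodScale_fst, hfst]
    have h := hq.act_comp (D.constUnit hb) (𝟙 _)
    rw [Category.id_comp] at h
    exact congrArg (fun f => f.left) h
  · rw [Category.assoc, Category.assoc, prodScale_snd, toProd_snd, translate_π, ← Category.assoc,
      toProd_snd]

/-- The points near which the comparison is an isomorphism form an open set containing the fibre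
over 0, so it contains everything over the locus `h ≠ 0` of some nonzero polynomial. A point with
nonzero coordinate is moved there by a dilation, and equivariance moves the conclusion back. -/
theorem IsLimitMap.isIso_toProd (hq : IsLimitMap q) (hD : D.ActsTrivially) :
    IsIso (toProd q).left := by
  refine isIso_of_isIsoNear fun y => ?_
  by_cases hy : (Polynomial.X : Polynomial ℂ) ∈
      PrimeSpectrum.asIdeal (pullback.snd D.central.hom A1hom y)
  · exact hq.isIsoNear_of_mem hD hy
  obtain ⟨h, hh, hN⟩ := exists_polynomial_of_isClosedMap
    (pullback.snd D.central.hom A1hom).isClosedMap (isOpen_isIsoNear (toProd q).left)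
    fun x => hq.isIsoNear_of_mem hD
  obtain ⟨b, hb, hbh⟩ := exists_comp_notMem hh hy
  have hnear : IsIsoNear (toProd q).left (D.prodScale b y) := by
    refine hN _ fun h1 => hbh ?_
    have h2 : pullback.snd D.central.hom A1hom (D.prodScale b y) =
        (scaleA1 b).left (pullback.snd D.central.hom A1hom y) :=
      congrArg (fun f : D.prodC.left ⟶ A1 => f y) (D.prodScale_snd b)
    rw [h2] at h1
    exact h1
  have := D.isIso_translate (inv_ne_zero hb)
  have := D.isIso_prodScale (inv_ne_zero hb)
  have h3 := hnear.of_iso (hq.translate_toProd (inv_ne_zero hb))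
  have h4 : D.prodScale b⁻¹ (D.prodScale b y) = y :=
    congrArg (fun f : D.prodC.left ⟶ D.prodC.left => f y) (D.prodScale_comp (mul_inv_cancel₀ hb))
  rwa [h4] at h3

/-- The degeneration is trivial if the action is trivial on the central fibre. -/
theorem ActsTrivially.isTrivial (hD : D.ActsTrivially) : D.IsTrivial := by
  obtain ⟨q, hq⟩ := hD.exists_isLimitMap
  have := hq.isIso_toProd hD
  have hpb : IsPullback q.left D.π D.central.hom A1hom :=
    IsPullback.of_iso_pullback ⟨Over.w q⟩ (asIso (toProd q).left)
      (pullback.lift_fst _ _ _) (pullback.lift_snd _ _ _)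
  obtain ⟨a, -, ⟨e⟩⟩ := D.fibre_iso
  have hA : A1pt a ≫ A1hom = 𝟙 SpecC := by
    rw [A1pt, A1hom, ← Spec.map_comp, ← CommRingCat.ofHom_comp]
    have : (Polynomial.evalRingHom a).comp Polynomial.C = RingHom.id ℂ := by
      ext
      simp
    rw [this]
    exact Spec.map_id _
  have hpb' := (IsPullback.of_hasPullback D.π (A1pt a)).paste_horiz hpb
  rw [hA] at hpb'
  -- The square over the point `a` of the line shows that `q` maps the fibre over `a` isomorphically
  -- to the central fibre, and that fibre is `X`.
  let g : fibre D.π a ⟶ D.central := Over.homMk (pullback.fst D.π (A1pt a) ≫ q.left)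
    (hpb'.w.trans (Category.comp_id _))
  have hg : IsIso g.left := hpb'.isIso_fst_of_isIso
  have hg2 : IsIso ((Over.forget SpecC).map g) := hg
  have hg3 : IsIso g := isIso_of_reflects_iso g (Over.forget SpecC)
  let f : D.central ≅ X := (asIso g).symm ≪≫ e
  refine ⟨q ≫ f.hom, fun a x => ?_, ?_⟩
  · rw [← Category.assoc, hq.act_comp, Category.assoc]
  · exact hpb.of_iso (Iso.refl _) ((Over.forget _).mapIso f) (Iso.refl _) (Iso.refl _)
      (by simp) (by simp) (by simp) (by simp)

end SpecialDegeneration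

/-! ### From a constant Hamiltonian to a trivial degeneration -/

open scoped Matrix

namespace SpecialDegeneration

variable {X : CScheme} {n : ℕ} {D : SpecialDegeneration X n}

/-- The action is trivial on the central fibre if the Hamiltonian is constant. -/
theorem Choice.actsTrivially (c : D.Choice) {a : ℝ} (h : ∀ χ : HolChart D.central n,
    ∀ w ∈ χ.toHomeo.target, c.θ (χ.toHomeo.symm w) = a) : D.ActsTrivially := by
  intro C _ _ x hx u
  refine D.smul_eq_self (fun χ w hw U f hU => ?_) hx u
  obtain ⟨ξ, hξ, he⟩ := c.hamiltonian.eqn χ w hw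
  have hθ : (fun w' => (c.θ (χ.toHomeo.symm w') : ℂ)) =ᶠ[𝓝 w] fun _ => (a : ℂ) := by
    filter_upwards [χ.toHomeo.open_target.mem_nhds hw] with w' hw'
    rw [h χ w' hw']
  -- The Hamiltonian equation with constant `θ` says that the contraction of the curvature with the
  -- induced vector is zero; positivity of the curvature then makes the vector zero.
  have hzero : ξ ᵥ* c.p.curvature χ w = 0 := by
    ext k
    refine (he k).symm.trans ?_
    rw [dzbar, hθ.fderiv_eq]
    simp
  have hdet : IsUnit (c.p.curvature χ w) :=
    (curvature_posDef (D.fano 0).normal (D.fano 0).dim c.p χ hw).isUnit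
  have hξ0 : ξ = 0 := by
    refine Matrix.vecMul_injective_of_isUnit hdet ?_
    simpa using hzero
  rw [hξ U f hU, hξ0, map_zero]

theorem Choice.exists_eq_const_iff_isTrivial (c : D.Choice) :
    (∃ a, ∀ χ : HolChart D.central n, ∀ w ∈ χ.toHomeo.target, c.θ (χ.toHomeo.symm w) = a) ↔
      D.IsTrivial :=
  ⟨fun ⟨_, h⟩ => ActsTrivially.isTrivial (c.actsTrivially h), c.exists_eq_const_of_isTrivial⟩

end SpecialDegeneration

end HStability

end

theorem mainTheorem8 (X : HStability.CScheme) (n : ℕ) (hX : HStability.IsQFano X n)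
    (D : HStability.SpecialDegeneration X n) (c : D.Choice) :
    (0 < c.p.V ∧ IsFiniteMeasure c.p.volume ∧
      Integrable (fun x => c.θ x * Real.exp (c.h x)) c.p.volume ∧
      Integrable c.θ c.p.volume ∧
      Integrable (fun x => Real.exp (c.θ x)) c.p.volume) ∧
    c.DF ≥ c.H ∧ (c.DF = c.H ↔ D.IsTrivial) := by
  obtain ⟨h₁, h₂, h₃⟩ := c.comparison
  exact ⟨h₁, h₂, h₃.trans c.exists_eq_const_iff_isTrivial⟩
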